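/- **Notation.** Let $\omega=e^{2\pi i/3}$, $\kappa_j=e^{\pi i(j-1)/3}$ ($j=1,\dots,6$), $\mathcal Q=\{\kappa_1,\dots,\kappa_6\}$, $\hat{\mathcal Q}=\mathcal Q\cup\{0\}$, let $\partial\mathbb D$ be the unit circle, and let $$\Gamma_1=i[0,1]\cup(-i)[1,\infty),\quad \Gamma_4=(-i)[0,1]\cup i[1,\infty),\quad \hat\Gamma_j=\Gamma_j\cup\partial\mathbb D .$$ For $k\in\mathbb C\setminus\{0\}$ and $j=1,2,3$ put $l_j(k)=i\,\frac{\omega^jk+(\omega^jk)^{-1}}{2\sqrt3}$, $\mathcal L=\mathrm{diag}(l_1,l_2,l_3)$, and $$P(k)=\begin{pmatrix}1&1&1\\ l_1&l_2&l_3\\ l_1^2&l_2^2&l_3^2\end{pmatrix},\qquad D_2=\{\mathrm{Re}\,l_1<\mathrm{Re}\,l_3<\mathrm{Re}\,l_2\},\qquad D_5=\{\mathrm{Re}\,l_2<\mathrm{Re}\,l_3<\mathrm{Re}\,l_1\}.$$ Let $u_0,v_0\in\mathcal S(\mathbb R)$ be real-valued Schwartz functions and set $$\mathsf U(x,k)=P(k)^{-1}\begin{pmatrix}0&0&0\\0&0&0\\-\frac{u_0'(x)}4-\frac{iv_0(x)}{4\sqrt3}&-\frac{u_0(x)}2&0\end{pmatrix}P(k).$$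 With $e^{\hat{\mathcal L}}A=e^{\mathcal L}Ae^{-\mathcal L}$, let $X$ and $X^A$ be the $3\times3$-matrix valued solutions of $$X(x,k)=I-\int_x^\infty e^{(x-x')\widehat{\mathcal L(k)}}(\mathsf UX)(x',k)\,dx',\qquad X^A(x,k)=I+\int_x^\infty e^{-(x-x')\widehat{\mathcal L(k)}}(\mathsf U^TX^A)(x',k)\,dx',$$ understood column by column (each column is defined for the $k$ for which its equation has a solution bounded on right half-lines), and put $$s(k)=I-\int_{\mathbb R}e^{-x\widehat{\mathcal L(k)}}(\mathsf UX)(x,k)\,dx,\qquad s^A(k)=I+\int_{\mathbb R}e^{x\widehat{\mathcal L(k)}}(\mathsf U^TX^A)(x,k)\,dx,$$ $$r_1=\frac{s_{12}}{s_{11}}\ \text{ on }\hat\Gamma_1\setminus\hat{\mathcal Q},\qquad r_2=\frac{s^A_{12}}{s^A_{11}}\ \text{ on }\hat\Gamma_4\setminus\hat{\mathcal Q}.$$ **Assumptions.** (No solitons) $s_{11}(k)\ne0$ for $k\in(\bar D_2\cup\partial\mathbb D)\setminus\hat{\mathcal Q}$ and $s^A_{11}(k)\neq0$ for $k\in(\bar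 D_5\cup\partial\mathbb D)\setminus\hat{\mathcal Q}$. (Generic behavior at $\pm1$) For $k_\star=1$ and $k_\star=-1$, the limits as $k\to k_\star$, $k\in\partial\mathbb D\setminus\mathcal Q$, of $$(k-k_\star)s_{11},\ (k-k_\star)s_{13},\ s_{31},\ s_{33},\ (k-k_\star)s^A_{11},\ (k-k_\star)s^A_{31},\ s^A_{13},\ s^A_{33}$$ exist and are nonzero. **Theorem.** Under these assumptions $r_1$ and $r_2$ are well defined: for $k\in\hat\Gamma_1\setminus\hat{\mathcal Q}$ (resp. $k\in\hat\Gamma_4\setminus\hat{\mathcal Q}$) the first two columns of $X$ (resp. $X^A$) exist and are unique, the integrals defining $s_{11},s_{12}$ (resp. $s^A_{11},s^A_{12}$) converge absolutely, and $s_{11}(k)\ne0$ (resp. $s^A_{11}(k)\neq0$). Moreover $r_1$, $r_2$ admit extensions, denoted by the same letters, such that: (i) $r_1\in C^\infty(\hat\Gamma_1)$ and $r_2\in C^\infty(\hat\Gamma_4\setminus\{\omega^2,-\omega^2\})$, where $C^\infty$ means that the derivatives $\partial_k^n$ along the contour exist to all orders and are continuous on the contour; in particular, at $\pm i$ the derivatives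 along the different branches agree. (ii) $r_1$ is bounded on $\partial\mathbb D$ and $r_1(\kappa_j)\ne0$ for $j=1,\dots,6$. On $\partial\mathbb D$, $r_2$ has simple poles at $\kappa_2,\kappa_5$ and simple zeros at $\kappa_3,\kappa_6$, i.e. near such a point $\kappa$ one has $r_2(k)=(k-\kappa)^{\mp1}g(k)$ with $g$ smooth along $\partial\mathbb D$ at $\kappa$ and $g(\kappa)\neq0$. Furthermore $r_1(1)=r_1(-1)=1$ and $r_2(1)=r_2(-1)=-1$. (iii) For each integer $N\ge0$, $\max_{0\le j\le N}\sup_{k\in\Gamma_1}(1+|k|)^N|\partial_k^jr_1(k)|<\infty$ and $\max_{0\le j\le N}\sup_{k\in\Gamma_4}(1+|k|)^N|\partial_k^jr_2(k)|<\infty$. (iv) For all $k\in\partial\mathbb D\setminus\{-\omega,\omega\}$, $$r_1(\tfrac1{\omega k})+r_2(\omega k)+r_1(\omega^2k)\,r_2(\tfrac1k)=0.\qquad(1)$$ Also $$r_2(k)=\frac{r_1(\omega k)r_1(\omega^2k)-r_1(\frac1k)}{1-r_1(\omega k)r_1(\frac1{\omega k})}\quad(2),\qquad r_1(k)=\frac{r_2(\omega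 k)r_2(\omega^2k)-r_2(\frac1k)}{1-r_2(\omega k)r_2(\frac1{\omega k})}\quad(3),$$ where (2) holds, with nonzero denominator, for $k\in\partial\mathbb D\setminus\{\omega^2,-\omega^2\}$, and (3) holds, with nonzero denominator, for $k\in\partial\mathbb D\setminus\mathcal Q$. In fact, for arbitrary functions $r_1,r_2$, (1) holding on $\partial\mathbb D\setminus\mathcal Q$ is equivalent to (2) holding on $\partial\mathbb D\setminus\mathcal Q$ if the denominators in (2) do not vanish there, and to (3) holding on $\partial\mathbb D\setminus\mathcal Q$ if the denominators in (3) do not vanish there. (v) $r_2(k)=\tilde r(k)\,\overline{r_1(\bar k^{-1})}$ for all $k\in\hat\Gamma_4\setminus\{0,\omega^2,-\omega^2\}$, where $\tilde r(k)=\dfrac{\omega^2-k^2}{1-\omega^2k^2}$. -/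

import Mathlib

open scoped ContDiff

namespace Boussinesq

noncomputable section

/-- The primitive cube root of unity `ω = exp (2πi/3)`. -/
def ω₃ : ℂ := Complex.exp (2 * Real.pi * Complex.I / 3)

/-- The sixth roots of unity `κ_j = exp (πi(j-1)/3)`, used for `j = 1, …, 6`. -/
def κ (j : ℕ) : ℂ := Complex.exp (Real.pi * Complex.I * ((j : ℂ) - 1) / 3)

/-- `𝒬 = {κ_1, …, κ_6}`. -/
def setQ : Set ℂ := κ '' Set.Icc 1 6

/-- `𝒬̂ = 𝒬 ∪ {0}`. -/
def setQhat : Set ℂ := setQ ∪ {0}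

/-- The unit circle `∂𝔻`. -/
def circ : Set ℂ := Metric.sphere (0 : ℂ) 1

/-- `Γ₁ = i[0,1] ∪ (-i)[1,∞)`. -/
def Γ₁ : Set ℂ :=
  {k | ∃ y : ℝ, 0 ≤ y ∧ y ≤ 1 ∧ k = Complex.I * y} ∪ {k | ∃ y : ℝ, 1 ≤ y ∧ k = -Complex.I * y}

/-- `Γ₄ = (-i)[0,1] ∪ i[1,∞)`. -/
def Γ₄ : Set ℂ :=
  {k | ∃ y : ℝ, 0 ≤ y ∧ y ≤ 1 ∧ k = -Complex.I * y} ∪ {k | ∃ y : ℝ, 1 ≤ y ∧ k = Complex.I * y}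

/-- `Γ̂₁ = Γ₁ ∪ ∂𝔻`. -/
def Γhat₁ : Set ℂ := Γ₁ ∪ circ

/-- `Γ̂₄ = Γ₄ ∪ ∂𝔻`. -/
def Γhat₄ : Set ℂ := Γ₄ ∪ circ

/-- `l_j(k) = i (ω^j k + (ω^j k)⁻¹) / (2√3)`. The indices `1, 2, 3` of the mathematical text are
the elements `0, 1, 2` of `Fin 3`. -/
def l (j : Fin 3) (k : ℂ) : ℂ :=
  Complex.I * (ω₃ ^ ((j : ℕ) + 1) * k + (ω₃ ^ ((j : ℕ) + 1) * k)⁻¹) / (2 * (Real.sqrt 3 : ℂ))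

/-- The open set `D₂ = {Re l₁ < Re l₃ < Re l₂}`. -/
def D₂ : Set ℂ := {k | k ≠ 0 ∧ (l 0 k).re < (l 2 k).re ∧ (l 2 k).re < (l 1 k).re}

/-- The open set `D₅ = {Re l₂ < Re l₃ < Re l₁}`. -/
def D₅ : Set ℂ := {k | k ≠ 0 ∧ (l 1 k).re < (l 2 k).re ∧ (l 2 k).re < (l 0 k).re}

/-- The matrix `P(k)` with rows `(1,1,1)`, `(l₁,l₂,l₃)`, `(l₁²,l₂²,l₃²)`. -/
def P (k : ℂ) : Matrix (Fin 3) (Fin 3) ℂ :=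
  Matrix.of fun i j => l j k ^ (i : ℕ)

/-- The matrix conjugated by `P(k)` in the definition of `U(x,k)`. -/
def potential (u v : SchwartzMap ℝ ℝ) (x : ℝ) : Matrix (Fin 3) (Fin 3) ℂ :=
  !![0, 0, 0;
     0, 0, 0;
     -((deriv u x : ℝ) : ℂ) / 4 - Complex.I * ((v x : ℝ) : ℂ) / (4 * (Real.sqrt 3 : ℂ)),
       -((u x : ℝ) : ℂ) / 2, 0]

/-- `U(x,k) = P(k)⁻¹ (potential) P(k)`. -/
def U (u v : SchwartzMap ℝ ℝ) (x : ℝ) (k : ℂ) : Matrix (Fin 3) (Fin 3) ℂ :=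
  (P k)⁻¹ * potential u v x * P k

/-- The integrand `e^{(x-y)(l_i-l_j)} (U φ)_i(y)` of the Volterra equation for the `j`th column
of `X`: it is the `(i,j)` entry of `e^{(x-y) ad 𝓛} (U X)(y)` when `φ` is that column. -/
def volterraX (u v : SchwartzMap ℝ ℝ) (k : ℂ) (j : Fin 3) (φ : ℝ → Fin 3 → ℂ)
    (x : ℝ) (i : Fin 3) (y : ℝ) : ℂ :=
  Complex.exp (((x - y : ℝ) : ℂ) * (l i k - l j k)) * (U u v y k).mulVec (φ y) i

/-- `φ` is the `j`th column of `X(·,k)`: it solves the `j`th column of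
`X(x,k) = I - ∫_x^∞ e^{(x-y) ad 𝓛(k)} (U X)(y,k) dy`, where the integral converges absolutely,
and it is bounded on right half-lines. The columns of `X` are treated separately because
they are defined for different sets of `k`. -/
structure IsColumnX (u v : SchwartzMap ℝ ℝ) (k : ℂ) (j : Fin 3) (φ : ℝ → Fin 3 → ℂ) : Prop where
  bounded : ∀ a : ℝ, ∃ C : ℝ, ∀ x, a ≤ x → ∀ i, ‖φ x i‖ ≤ C
  integrable : ∀ x i, MeasureTheory.IntegrableOn (volterraX u v k j φ x i) (Set.Ioi x)
  equation : ∀ x i, φ x i =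
    (1 : Matrix (Fin 3) (Fin 3) ℂ) i j - ∫ y in Set.Ioi x, volterraX u v k j φ x i y

/-- The integrand `e^{-(x-y)(l_i-l_j)} (Uᵀ φ)_i(y)` for the `j`th column of `X^A`. -/
def volterraXA (u v : SchwartzMap ℝ ℝ) (k : ℂ) (j : Fin 3) (φ : ℝ → Fin 3 → ℂ)
    (x : ℝ) (i : Fin 3) (y : ℝ) : ℂ :=
  Complex.exp (-((x - y : ℝ) : ℂ) * (l i k - l j k)) * (U u v y k).transpose.mulVec (φ y) i

/-- `φ` is the `j`th column of `X^A(·,k)`: it solves the `j`th column of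
`X^A(x,k) = I + ∫_x^∞ e^{-(x-y) ad 𝓛(k)} (Uᵀ X^A)(y,k) dy`. -/
structure IsColumnXA (u v : SchwartzMap ℝ ℝ) (k : ℂ) (j : Fin 3) (φ : ℝ → Fin 3 → ℂ) : Prop where
  bounded : ∀ a : ℝ, ∃ C : ℝ, ∀ x, a ≤ x → ∀ i, ‖φ x i‖ ≤ C
  integrable : ∀ x i, MeasureTheory.IntegrableOn (volterraXA u v k j φ x i) (Set.Ioi x)
  equation : ∀ x i, φ x i =
    (1 : Matrix (Fin 3) (Fin 3) ℂ) i j + ∫ y in Set.Ioi x, volterraXA u v k j φ x i y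

/-- The matrix `X(x,k)`; its `j`th column is the solution of the Volterra equation
whenever such a solution exists. -/
def X (u v : SchwartzMap ℝ ℝ) (x : ℝ) (k : ℂ) : Matrix (Fin 3) (Fin 3) ℂ :=
  Matrix.of fun i j => Classical.epsilon (IsColumnX u v k j) x i

/-- The matrix `X^A(x,k)`. -/
def XA (u v : SchwartzMap ℝ ℝ) (x : ℝ) (k : ℂ) : Matrix (Fin 3) (Fin 3) ℂ :=
  Matrix.of fun i j => Classical.epsilon (IsColumnXA u v k j) x i

/-- The `(i,j)` entry of `e^{-x ad 𝓛(k)} (U X)(x,k)`. -/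
def integrandS (u v : SchwartzMap ℝ ℝ) (k : ℂ) (i j : Fin 3) (x : ℝ) : ℂ :=
  Complex.exp (-(x : ℂ) * (l i k - l j k)) * (U u v x k * X u v x k) i j

/-- The `(i,j)` entry of `e^{x ad 𝓛(k)} (Uᵀ X^A)(x,k)`. -/
def integrandSA (u v : SchwartzMap ℝ ℝ) (k : ℂ) (i j : Fin 3) (x : ℝ) : ℂ :=
  Complex.exp ((x : ℂ) * (l i k - l j k)) * ((U u v x k).transpose * XA u v x k) i j

/-- `s(k) = I - ∫_ℝ e^{-x ad 𝓛(k)} (U X)(x,k) dx`. -/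
def s (u v : SchwartzMap ℝ ℝ) (k : ℂ) : Matrix (Fin 3) (Fin 3) ℂ :=
  Matrix.of fun i j => (1 : Matrix (Fin 3) (Fin 3) ℂ) i j - ∫ x : ℝ, integrandS u v k i j x

/-- `s^A(k) = I + ∫_ℝ e^{x ad 𝓛(k)} (Uᵀ X^A)(x,k) dx`. -/
def sA (u v : SchwartzMap ℝ ℝ) (k : ℂ) : Matrix (Fin 3) (Fin 3) ℂ :=
  Matrix.of fun i j => (1 : Matrix (Fin 3) (Fin 3) ℂ) i j + ∫ x : ℝ, integrandSA u v k i j x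

/-- `r₁ = s₁₂ / s₁₁`, to be considered on `Γ̂₁ \ 𝒬̂`. -/
def r₁ (u v : SchwartzMap ℝ ℝ) (k : ℂ) : ℂ := s u v k 0 1 / s u v k 0 0

/-- `r₂ = s^A₁₂ / s^A₁₁`, to be considered on `Γ̂₄ \ 𝒬̂`. -/
def r₂ (u v : SchwartzMap ℝ ℝ) (k : ℂ) : ℂ := sA u v k 0 1 / sA u v k 0 0

/-- `r₁` is well defined at `k`: the columns of `X` that enter `s₁₁` and `s₁₂` are the unique
solutions of their Volterra equations, the integrals for `s₁₁` and `s₁₂` converge absolutely, and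
the denominator does not vanish. -/
def WellDefined₁ (u v : SchwartzMap ℝ ℝ) (k : ℂ) : Prop :=
  (∃! φ, IsColumnX u v k 0 φ) ∧ (∃! φ, IsColumnX u v k 1 φ) ∧
  MeasureTheory.Integrable (integrandS u v k 0 0) ∧
  MeasureTheory.Integrable (integrandS u v k 0 1) ∧
  s u v k 0 0 ≠ 0

/-- `r₂` is well defined at `k`. -/
def WellDefined₂ (u v : SchwartzMap ℝ ℝ) (k : ℂ) : Prop :=
  (∃! φ, IsColumnXA u v k 0 φ) ∧ (∃! φ, IsColumnXA u v k 1 φ) ∧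
  MeasureTheory.Integrable (integrandSA u v k 0 0) ∧
  MeasureTheory.Integrable (integrandSA u v k 0 1) ∧
  sA u v k 0 0 ≠ 0

/-- Absence of solitons. -/
def NoSolitons (u v : SchwartzMap ℝ ℝ) : Prop :=
  (∀ k ∈ (closure D₂ ∪ circ) \ setQhat, s u v k 0 0 ≠ 0) ∧
  (∀ k ∈ (closure D₅ ∪ circ) \ setQhat, sA u v k 0 0 ≠ 0)

/-- `f` has a nonzero limit as `k → p` along the unit circle (with the points of `𝒬` removed). -/
def HasNonzeroLimit (f : ℂ → ℂ) (p : ℂ) : Prop :=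
  ∃ c : ℂ, c ≠ 0 ∧ Filter.Tendsto f (nhdsWithin p (circ \ setQ)) (nhds c)

/-- Generic behavior at the point `p`. -/
def GenericAt (u v : SchwartzMap ℝ ℝ) (p : ℂ) : Prop :=
  HasNonzeroLimit (fun k => (k - p) * s u v k 0 0) p ∧
  HasNonzeroLimit (fun k => (k - p) * s u v k 0 2) p ∧
  HasNonzeroLimit (fun k => s u v k 2 0) p ∧
  HasNonzeroLimit (fun k => s u v k 2 2) p ∧
  HasNonzeroLimit (fun k => (k - p) * sA u v k 0 0) p ∧
  HasNonzeroLimit (fun k => (k - p) * sA u v k 2 0) p ∧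
  HasNonzeroLimit (fun k => sA u v k 0 2) p ∧
  HasNonzeroLimit (fun k => sA u v k 2 2) p

/-- Smoothness of a function on a contour `S ⊆ ℂ`: all derivatives `∂_k^n f` along the contour
exist and are continuous on `S`. Since derivatives are limits of difference quotients
`(f z - f k) / (z - k)` with `z ∈ S`, at an intersection point all branches of `S`
must give the same values of all derivatives. -/
def SmoothOn (f : ℂ → ℂ) (S : Set ℂ) : Prop := ContDiffOn ℂ ∞ f S

/-- `f`, considered on the unit circle, has a simple pole at `p`. -/
def HasSimplePole (f : ℂ → ℂ) (p : ℂ) : Prop :=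
  ∃ g : ℂ → ℂ, ContDiffWithinAt ℂ ∞ g circ p ∧ g p ≠ 0 ∧
    ∀ᶠ k in nhdsWithin p (circ \ {p}), f k = g k / (k - p)

/-- `f`, considered on the unit circle, has a simple zero at `p`. -/
def HasSimpleZero (f : ℂ → ℂ) (p : ℂ) : Prop :=
  ∃ g : ℂ → ℂ, ContDiffWithinAt ℂ ∞ g circ p ∧ g p ≠ 0 ∧
    ∀ᶠ k in nhdsWithin p circ, f k = (k - p) * g k

/-- Rapid decrease on `S` of `f` and all of its derivatives along `S`. -/
def RapidlyDecreasingOn (f : ℂ → ℂ) (S : Set ℂ) : Prop :=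
  ∀ N : ℕ, ∃ C : ℝ, ∀ j ≤ N, ∀ k ∈ S, (1 + ‖k‖) ^ N * ‖iteratedDerivWithin j f S k‖ ≤ C

/-- The relation `ρ₁(1/(ωk)) + ρ₂(ωk) + ρ₁(ω²k) ρ₂(1/k) = 0`. -/
def CircleRelation (ρ₁ ρ₂ : ℂ → ℂ) (k : ℂ) : Prop :=
  ρ₁ (1 / (ω₃ * k)) + ρ₂ (ω₃ * k) + ρ₁ (ω₃ ^ 2 * k) * ρ₂ (1 / k) = 0

/-- The denominator `1 - ρ(ωk) ρ(1/(ωk))`. -/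
def solvedDenom (ρ : ℂ → ℂ) (k : ℂ) : ℂ := 1 - ρ (ω₃ * k) * ρ (1 / (ω₃ * k))

/-- The relation `σ(k) = (ρ(ωk) ρ(ω²k) - ρ(1/k)) / (1 - ρ(ωk) ρ(1/(ωk)))`, which expresses `σ`
in terms of `ρ`. -/
def SolvedRelation (ρ σ : ℂ → ℂ) (k : ℂ) : Prop :=
  σ k = (ρ (ω₃ * k) * ρ (ω₃ ^ 2 * k) - ρ (1 / k)) / solvedDenom ρ k

/-- `r̃(k) = (ω² - k²) / (1 - ω² k²)`. -/
def rTilde (k : ℂ) : ℂ := (ω₃ ^ 2 - k ^ 2) / (1 - ω₃ ^ 2 * k ^ 2)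

end

end Boussinesq

open scoped ContDiff

namespace Boussinesq

open MeasureTheory Set Filter Topology
open scoped BoundedContinuousFunction

/-! ### Solving f' = a f + g from plus infinity -/

section

/-! Only the last row of the potential is nonzero, so `U` has rank one: `U_im = c_i (q + p l_m)`,
where q, p are the entries of that row and the c_i (`coef`) come from the inverse Vandermonde matrix
(`U_apply`). A column φ of X is therefore governed by one scalar function g = Σ (q + p l_m) φ_m.
With `J a` denoting the inverse of d/dx - a from plus infinity, φ_i = δ_ij + c_i J(l_i - l_j) g and
s_ij = δ_ij - c_i ∫ e^{-x(l_i - l_j)} g dx (`s_eq`). The scalar Volterra equation for g (`IsG`) is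
solved in two forms.

Triangular form: the sums Σ c_i J(l_i - l_j) are divided differences, and the resolvent identity
`J_J` turns them into iterated products of operators `J`. The c_i, singular where two exponents
coincide, disappear, so the solution is smooth through 𝒬 (`isG_triSol`, `contDiffOn_triT`). Hence
s_11/c_1 and -s_12/c_1 extend to smooth functions `regA`, `regB` on the contour without 0, and r_1 =
-regB/regA. Absence of solitons and generic behavior at ±1, spread over the contour and over 𝒬 by
symmetry, give regA ≠ 0 (`regA_ne`). At ±1 one has l_1 = l_2 and regB = -regA, whence r_1(±1) = 1.

Symmetries: k ↦ ωk and k ↦ 1/k permute the exponents and so permute the entries of s (`s_perm`).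
Since u and v are real, p' = q + conj q, and an integration by parts relates X^A at k to X at 1/conj
k: c_i s^A_ij(k) = c_j conj s_ij(1/conj k) (`sA_eq_conj`). As c_2/c_1 is the factor in (v), the
properties of r_2 follow from those of r_1.

Relations: on the circle the exponents are imaginary, and a sesquilinear form built from Σ conj(φ_i)
ψ_i / c_i, corrected by a multiple of p, does not depend on x. So s preserves the form diag(1/c_i)
(`s_hermitian`). Orthogonality of two rows of s is (1), once the entries are written through r_1 by
the symmetries. A 2×2 minor has the same modulus as the complementary entry, which bounds the
denominator of (2) away from zero (`norm_reg_minor`); (2) and (3) are then linear algebra.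

Decay: on the ray -i[1,∞) the coefficients c_i and c_i l_i are bounded, so the diagonal form of the
equation bounds all k-derivatives of s (`sd_s`). A Riccati recursion diagonalizes the system up to
O(k^{-ν}), and Gronwall makes the off-diagonal entries rapidly decreasing (`s_rapid`); interpolation
carries this over to derivatives (`rapid_derivWithin`). Inversion maps the ray to the segment ending
at 0, where rapid decrease becomes flatness (`sd_flat`), and this is smoothness at the origin. -/

/-- Continuous functions which are integrable on right half-lines. -/
structure RightInt (g : ℝ → ℂ) : Prop where
  cont : Continuous g
  int : ∀ x, IntegrableOn g (Ioi x)

/-- The solution operator of `f' = a f + g` with zero data at `+∞`. -/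
noncomputable def J (a : ℂ) (g : ℝ → ℂ) (x : ℝ) : ℂ :=
  -∫ y in Ioi x, Complex.exp (((x - y : ℝ) : ℂ) * a) * g y

theorem norm_exp_mul_le_one {a : ℂ} (ha : 0 ≤ a.re) {t : ℝ} (ht : t ≤ 0) :
    ‖Complex.exp ((t : ℂ) * a)‖ ≤ 1 := by
  rw [Complex.norm_exp, Complex.re_ofReal_mul]
  exact Real.exp_le_one_iff.2 (mul_nonpos_of_nonpos_of_nonneg ht ha)

theorem RightInt.expInt {g : ℝ → ℂ} (hg : RightInt g) {a : ℂ} (ha : 0 ≤ a.re) (x : ℝ) :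
    IntegrableOn (fun y => Complex.exp (((x - y : ℝ) : ℂ) * a) * g y) (Ioi x) := by
  refine (hg.int x).norm.mono' ?_ ?_
  · have := hg.cont
    exact (by fun_prop : Continuous _).aestronglyMeasurable
  · refine (ae_restrict_iff' measurableSet_Ioi).2 (ae_of_all _ fun y hy => ?_)
    rw [norm_mul]
    exact mul_le_of_le_one_left (norm_nonneg _)
      (norm_exp_mul_le_one ha (sub_nonpos.2 (le_of_lt hy)))

theorem norm_J_le {g : ℝ → ℂ} {a : ℂ} (ha : 0 ≤ a.re) {x : ℝ} {B : ℝ → ℝ}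
    (hB : IntegrableOn B (Ioi x)) (h : ∀ y, x < y → ‖g y‖ ≤ B y) :
    ‖J a g x‖ ≤ ∫ y in Ioi x, B y := by
  rw [J, norm_neg]
  refine norm_integral_le_of_norm_le hB ?_
  refine (ae_restrict_iff' measurableSet_Ioi).2 (ae_of_all _ fun y hy => ?_)
  rw [norm_mul]
  exact (mul_le_of_le_one_left (norm_nonneg _)
      (norm_exp_mul_le_one ha (sub_nonpos.2 (le_of_lt hy)))).trans (h y hy)

/-- Integrating factor: e^{(x-y)a} f(y) has derivative e^{(x-y)a} g(y) and tends to 0, because the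
exponential is bounded for y ≥ x when Re a ≥ 0. `J_J` and `J_deriv` follow from this
characterization. -/
theorem eq_J {f g : ℝ → ℂ} (hg : RightInt g) {a : ℂ} (ha : 0 ≤ a.re)
    (hf : ∀ x, HasDerivAt f (a * f x + g x) x) (h0 : Tendsto f atTop (𝓝 0)) (x : ℝ) :
    f x = J a g x := by
  have h1 : ∀ y ∈ Ici x, HasDerivAt (fun y => Complex.exp (((x - y : ℝ) : ℂ) * a) * f y)
      (Complex.exp (((x - y : ℝ) : ℂ) * a) * g y) y := by
    intro y _
    have e : HasDerivAt (fun y : ℝ => Complex.exp (((x - y : ℝ) : ℂ) * a))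
        (Complex.exp (((x - y : ℝ) : ℂ) * a) * (((-1 : ℝ) : ℂ) * a)) y := by
      have := (((hasDerivAt_id y).const_sub x).ofReal_comp.mul_const a).cexp
      simpa using this
    refine (e.mul (hf y)).congr_deriv ?_
    push_cast; ring
  have h2 : Tendsto (fun y => Complex.exp (((x - y : ℝ) : ℂ) * a) * f y) atTop (𝓝 0) := by
    rw [tendsto_zero_iff_norm_tendsto_zero] at h0 ⊢
    refine squeeze_zero' (Eventually.of_forall fun _ => norm_nonneg _) ?_ h0
    filter_upwards [eventually_ge_atTop x] with y hy
    rw [norm_mul]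
    exact mul_le_of_le_one_left (norm_nonneg _) (norm_exp_mul_le_one ha (sub_nonpos.2 hy))
  have := integral_Ioi_of_hasDerivAt_of_tendsto' h1 (hg.expInt ha x) h2
  rw [J, this]; simp

theorem hasDerivAt_integral_Ioi {f : ℝ → ℂ} (hf : RightInt f) (x : ℝ) :
    HasDerivAt (fun x => ∫ y in Ioi x, f y) (-f x) x := by
  have h1 : ∀ z, ∫ y in Ioi z, f y = (∫ y in Ioi 0, f y) - ∫ y in (0:ℝ)..z, f y := by
    intro z
    rw [← intervalIntegral.integral_Ioi_sub_Ioi' (hf.int 0) (hf.int z)]; ring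
  have h2 : HasDerivAt (fun z => ∫ y in (0:ℝ)..z, f y) (f x) x :=
    intervalIntegral.integral_hasDerivAt_right (hf.cont.intervalIntegrable _ _)
      hf.cont.aestronglyMeasurable.stronglyMeasurableAtFilter hf.cont.continuousAt
  exact (h2.const_sub (∫ y in Ioi 0, f y)).congr_of_eventuallyEq (Eventually.of_forall h1)

theorem RightInt.exp_mul {g : ℝ → ℂ} (hg : RightInt g) {a : ℂ} (ha : 0 ≤ a.re) :
    RightInt (fun y => Complex.exp (((-y : ℝ) : ℂ) * a) * g y) := by
  have := hg.cont
  refine ⟨by fun_prop, fun x => ?_⟩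
  have h := (hg.expInt ha x).const_mul (Complex.exp (-(x : ℂ) * a))
  refine h.congr (ae_of_all _ fun y => ?_)
  simp only [← mul_assoc, ← Complex.exp_add]
  congr 2; push_cast; ring

theorem J_eq_exp_mul {g : ℝ → ℂ} (a : ℂ) (x : ℝ) :
    J a g x = -(Complex.exp ((x : ℂ) * a) * ∫ y in Ioi x, Complex.exp (((-y : ℝ) : ℂ) * a) * g y) := by
  rw [J, ← integral_const_mul]
  congr 2; ext y
  rw [← mul_assoc, ← Complex.exp_add]
  congr 2; push_cast; ring

theorem hasDerivAt_J {g : ℝ → ℂ} (hg : RightInt g) {a : ℂ} (ha : 0 ≤ a.re) (x : ℝ) :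
    HasDerivAt (J a g) (a * J a g x + g x) x := by
  have h1 := hasDerivAt_integral_Ioi (hg.exp_mul ha) x
  have e : HasDerivAt (fun y : ℝ => Complex.exp ((y : ℂ) * a)) (Complex.exp ((x : ℂ) * a) * a) x := by
    have := (((hasDerivAt_id x).ofReal_comp).mul_const a).cexp
    simpa using this
  have h2 := (e.mul h1).neg
  have h3 : J a g = -((fun y : ℝ => Complex.exp ((y : ℂ) * a)) *
      fun x => ∫ y in Ioi x, Complex.exp (((-y : ℝ) : ℂ) * a) * g y) := by
    ext y; exact J_eq_exp_mul a y
  rw [h3]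
  refine h2.congr_deriv ?_
  have : Complex.exp ((x:ℂ) * a) * Complex.exp (((-x : ℝ) : ℂ) * a) = 1 := by
    rw [← Complex.exp_add]; simp
  rw [← h3, J_eq_exp_mul]
  linear_combination (g x) * this

theorem tendsto_J {g : ℝ → ℂ} (hg : RightInt g) {a : ℂ} (ha : 0 ≤ a.re) :
    Tendsto (J a g) atTop (𝓝 0) := by
  have h1 : Tendsto (fun x => ∫ y in Ioi x, ‖g y‖) atTop (𝓝 0) :=
    tendsto_integral_Ioi_zero (f := fun y => ‖g y‖) tendsto_id
  exact squeeze_zero_norm (fun x => norm_J_le ha (hg.int x).norm fun _ _ => le_rfl) h1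

theorem continuous_J {g : ℝ → ℂ} (hg : RightInt g) {a : ℂ} (ha : 0 ≤ a.re) : Continuous (J a g) :=
  continuous_iff_continuousAt.2 fun x => (hasDerivAt_J hg ha x).continuousAt

/-- Resolvent identity: the right side solves f' = b f + J a g and vanishes at infinity. -/
theorem J_J {g : ℝ → ℂ} (hg : RightInt g) {a b : ℂ} (ha : 0 ≤ a.re) (hb : 0 ≤ b.re)
    (hab : a ≠ b) (hJ : RightInt (J a g)) (x : ℝ) :
    J b (J a g) x = (J a g x - J b g x) / (a - b) := by
  symm
  have hab' : a - b ≠ 0 := sub_ne_zero.2 hab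
  refine eq_J (f := fun x => (J a g x - J b g x) / (a - b)) hJ hb (fun x => ?_) ?_ x
  · refine (((hasDerivAt_J hg ha x).sub (hasDerivAt_J hg hb x)).div_const (a - b)).congr_deriv ?_
    field_simp; ring
  · simpa using ((tendsto_J hg ha).sub (tendsto_J hg hb)).div_const (a - b)

theorem J_deriv {f f' : ℝ → ℂ} (hf : RightInt f) (hf' : RightInt f') {a : ℂ} (ha : 0 ≤ a.re)
    (hd : ∀ x, HasDerivAt f (f' x) x) (h0 : Tendsto f atTop (𝓝 0)) (x : ℝ) :
    J a f' x = f x + a * J a f x := by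
  symm
  refine eq_J (f := fun x => f x + a * J a f x) hf' ha (fun x => ?_) ?_ x
  · exact ((hd x).add ((hasDerivAt_J hf ha x).const_mul a)).congr_deriv (by ring)
  · simpa using h0.add ((tendsto_J hf ha).const_mul a)

theorem J_add {f g : ℝ → ℂ} (hf : RightInt f) (hg : RightInt g) {a : ℂ} (ha : 0 ≤ a.re) (x : ℝ) :
    J a (fun y => f y + g y) x = J a f x + J a g x := by
  simp only [J, mul_add]
  rw [integral_add (hf.expInt ha x) (hg.expInt ha x)]; ring

theorem J_const_mul (f : ℝ → ℂ) (a c : ℂ) (x : ℝ) :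
    J a (fun y => c * f y) x = c * J a f x := by
  simp only [J, mul_left_comm _ c]
  rw [integral_const_mul]; ring

theorem conj_J (f : ℝ → ℂ) (a : ℂ) (x : ℝ) :
    (starRingEnd ℂ) (J a f x) = J ((starRingEnd ℂ) a) (fun y => (starRingEnd ℂ) (f y)) x := by
  simp only [J, map_neg, ← integral_conj, map_mul, ← Complex.exp_conj, Complex.conj_ofReal]

theorem RightInt.conj {f : ℝ → ℂ} (hf : RightInt f) : RightInt (fun y => (starRingEnd ℂ) (f y)) := by
  refine ⟨Complex.continuous_conj.comp hf.cont, fun x => ?_⟩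
  refine (hf.int x).norm.mono' ((Complex.continuous_conj.comp hf.cont).aestronglyMeasurable) ?_
  exact ae_of_all _ fun y => by simp

theorem RightInt.add {f g : ℝ → ℂ} (hf : RightInt f) (hg : RightInt g) :
    RightInt (fun y => f y + g y) := ⟨hf.cont.add hg.cont, fun x => (hf.int x).add (hg.int x)⟩

theorem RightInt.const_mul {f : ℝ → ℂ} (hf : RightInt f) (c : ℂ) :
    RightInt (fun y => c * f y) := ⟨continuous_const.mul hf.cont, fun x => (hf.int x).const_mul c⟩

theorem rightInt_of_bound {f : ℝ → ℂ} (hf : Continuous f) {C : ℝ}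
    (h : ∀ x, ‖f x‖ ≤ C * (1 + x ^ 2)⁻¹) : RightInt f := by
  refine ⟨hf, fun x => ?_⟩
  exact ((integrable_inv_one_add_sq.const_mul C).mono' hf.aestronglyMeasurable
    (ae_of_all _ h)).integrableOn

/-! ### An arctangent weight and Gronwall uniqueness -/

/-- The exponential of a multiple of the arctangent, used as a weight. -/
noncomputable def bw (L x : ℝ) : ℝ := Real.exp (-L * Real.arctan x)

theorem bw_pos (L x : ℝ) : 0 < bw L x := Real.exp_pos _

theorem bw_neg_mul (L x : ℝ) : bw (-L) x * bw L x = 1 := by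
  rw [bw, bw, ← Real.exp_add]; simp

theorem continuous_bw (L : ℝ) : Continuous (bw L) := by
  unfold bw; fun_prop

theorem bw_le (L x : ℝ) : bw L x ≤ Real.exp (|L| * 2) := by
  refine Real.exp_le_exp.2 ?_
  have h1 := Real.arctan_lt_pi_div_two x
  have h2 := Real.neg_pi_div_two_lt_arctan x
  have h3 := Real.pi_le_four
  have : |Real.arctan x| ≤ 2 := abs_le.2 ⟨by linarith, by linarith⟩
  calc -L * Real.arctan x ≤ |-L * Real.arctan x| := le_abs_self _
    _ = |L| * |Real.arctan x| := by rw [abs_mul, abs_neg]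
    _ ≤ _ := by gcongr

theorem le_bw (L x : ℝ) : Real.exp (-(|L| * 2)) ≤ bw L x := by
  have h := bw_le (-L) x
  have h2 := bw_neg_mul L x
  rw [abs_neg] at h
  rw [Real.exp_neg]
  rw [inv_le_iff_one_le_mul₀ (Real.exp_pos _)]
  nlinarith [bw_pos L x]

theorem hasDerivAt_bw (L x : ℝ) : HasDerivAt (bw L) (-L * ((1 + x ^ 2)⁻¹ * bw L x)) x := by
  unfold bw
  have := ((Real.hasDerivAt_arctan x).const_mul (-L)).exp
  convert this using 1
  simp; ring

theorem integrable_inv_mul_bw (L : ℝ) : Integrable (fun y => (1 + y ^ 2)⁻¹ * bw L y) := by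
  refine integrable_inv_one_add_sq.mul_bdd (c := Real.exp (|L| * 2)) (continuous_bw L).aestronglyMeasurable
    (ae_of_all _ fun x => ?_)
  rw [Real.norm_of_nonneg (bw_pos L x).le]; exact bw_le L x

/-- The integrand is the derivative of -bw/L. Integration against (1 + y²)⁻¹ thus gains the factor
1/L, so a large L turns any Volterra operator with such a kernel into a contraction. -/
theorem integral_inv_mul_bw_le {L : ℝ} (hL : 0 < L) (x : ℝ) :
    ∫ y in Ioi x, (1 + y ^ 2)⁻¹ * bw L y ≤ bw L x / L := by
  have h1 : ∀ y ∈ Ici x, HasDerivAt (fun y => bw L y / (-L)) ((1 + y ^ 2)⁻¹ * bw L y) y := by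
    intro y _
    refine ((hasDerivAt_bw L y).div_const (-L)).congr_deriv ?_
    field_simp
  have h2 : Tendsto (fun y => bw L y / (-L)) atTop (𝓝 (Real.exp (-L * (Real.pi / 2)) / (-L))) := by
    refine Tendsto.div_const ?_ _
    exact (Real.continuous_exp.tendsto _).comp
      ((tendsto_nhds_of_tendsto_nhdsWithin Real.tendsto_arctan_atTop).const_mul (-L))
  rw [integral_Ioi_of_hasDerivAt_of_tendsto' h1 (integrable_inv_mul_bw L).integrableOn h2]
  have : 0 ≤ Real.exp (-L * (Real.pi / 2)) / L := by positivity
  rw [div_neg, div_neg]; linarith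

/-- A Gronwall-type uniqueness principle. -/
theorem eq_zero_of_volterra {D : ℝ → ℝ} {L : ℝ} (hD : ∀ x, 0 ≤ D x)
    (hb : ∀ a, ∃ C, ∀ x, a ≤ x → D x ≤ C)
    (h : ∀ x S, (∀ y, x ≤ y → D y ≤ S * bw L y) → D x ≤ S / 2 * bw L x) (x : ℝ) : D x = 0 := by
  obtain ⟨C, hC⟩ := hb x
  -- Each use of the hypothesis halves the constant; the initial one combines the bound C with the
  -- lower bound for the weight.
  have key : ∀ n : ℕ, ∀ y, x ≤ y → D y ≤ (C * Real.exp (|L| * 2)) / 2 ^ n * bw L y := by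
    intro n
    induction n with
    | zero =>
      intro y hy
      have h1 := le_bw L y
      have hC0 : 0 ≤ C := (hD x).trans (hC x le_rfl)
      calc D y ≤ C := hC y hy
        _ = C * (Real.exp (|L| * 2) * Real.exp (-(|L| * 2))) := by rw [← Real.exp_add]; simp
        _ ≤ C * (Real.exp (|L| * 2) * bw L y) := by gcongr
        _ = _ := by simp; ring
    | succ n ih =>
      intro y hy
      have := h y _ fun z hz => ih z (hy.trans hz)
      rw [pow_succ, ← div_div]; exact this
  have lim : Tendsto (fun n : ℕ => (C * Real.exp (|L| * 2)) / 2 ^ n * bw L x) atTop (𝓝 (0 * bw L x)) := by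
    refine Tendsto.mul_const _ ?_
    exact tendsto_const_nhds.div_atTop (tendsto_pow_atTop_atTop_of_one_lt one_lt_two)
  have := ge_of_tendsto lim (Eventually.of_forall fun n => key n x le_rfl)
  exact le_antisymm (by simpa using this) (hD x)

end

/-! ### Functions with weighted bounds on their derivatives along a set -/

section

section SD
variable {E F G : Type*} [NormedAddCommGroup E] [NormedSpace ℂ E] [NormedAddCommGroup F]
  [NormedSpace ℂ F] [NormedAddCommGroup G] [NormedSpace ℂ G]

/-- `f` is bounded on `S` relative to all weights in `W`. -/
def WBdd (W : Set (ℂ → ℝ)) (S : Set ℂ) (f : ℂ → E) : Prop :=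
  ∀ w ∈ W, ∃ C, ∀ k ∈ S, |w k| * ‖f k‖ ≤ C

/-- `f` has `m` derivatives along `S`, all of them bounded relative to the weights in `W`. -/
def SD (W : Set (ℂ → ℝ)) (S : Set ℂ) : ℕ → (ℂ → E) → Prop
  | 0, f => WBdd W S f
  | m + 1, f => WBdd W S f ∧ ∃ f' : ℂ → E, (∀ k ∈ S, HasDerivWithinAt f (f' k) S k) ∧ SD W S m f'

/-- The weight for plain boundedness. -/
def oneW : Set (ℂ → ℝ) := {fun _ => 1}

/-- The weights for rapid decrease. -/
def rapidW : Set (ℂ → ℝ) := {w | ∃ N : ℕ, w = fun k => ‖k‖ ^ N}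

variable {W : Set (ℂ → ℝ)} {S : Set ℂ}

theorem wBdd_one {f : ℂ → E} : WBdd oneW S f ↔ ∃ C, ∀ k ∈ S, ‖f k‖ ≤ C := by
  simp [WBdd, oneW]

theorem SD.wBdd {m : ℕ} {f : ℂ → E} (h : SD W S m f) : WBdd W S f := by
  cases m with
  | zero => exact h
  | succ m => exact h.1

theorem SD.of_succ {m : ℕ} : ∀ {f : ℂ → E}, SD W S (m + 1) f → SD W S m f := by
  induction m with
  | zero => intro f h; exact h.1
  | succ m ih =>
    rintro f ⟨h, f', hd, h'⟩
    exact ⟨h, f', hd, ih h'⟩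

theorem WBdd.congr {f g : ℂ → E} (h : WBdd W S f) (hfg : EqOn g f S) : WBdd W S g := by
  intro w hw
  obtain ⟨C, hC⟩ := h w hw
  exact ⟨C, fun k hk => by rw [hfg hk]; exact hC k hk⟩

theorem SD.congr {m : ℕ} {f g : ℂ → E} (h : SD W S m f) (hfg : EqOn g f S) : SD W S m g := by
  cases m with
  | zero => exact WBdd.congr h hfg
  | succ m =>
    obtain ⟨h, f', hd, h'⟩ := h
    exact ⟨h.congr hfg, f', fun k hk => (hd k hk).congr hfg (hfg hk), h'⟩

theorem WBdd.add {f g : ℂ → E} (hf : WBdd W S f) (hg : WBdd W S g) :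
    WBdd W S (fun k => f k + g k) := by
  intro w hw
  obtain ⟨C, hC⟩ := hf w hw
  obtain ⟨D, hD⟩ := hg w hw
  refine ⟨C + D, fun k hk => ?_⟩
  calc |w k| * ‖f k + g k‖ ≤ |w k| * (‖f k‖ + ‖g k‖) := by gcongr; exact norm_add_le _ _
    _ ≤ C + D := by rw [mul_add]; exact add_le_add (hC k hk) (hD k hk)

theorem SD.add {m : ℕ} : ∀ {f g : ℂ → E}, SD W S m f → SD W S m g →
    SD W S m (fun k => f k + g k) := by
  induction m with
  | zero => intro f g hf hg; exact WBdd.add hf hg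
  | succ m ih =>
    rintro f g ⟨hf, f', hf', hf''⟩ ⟨hg, g', hg', hg''⟩
    exact ⟨hf.add hg, _, fun k hk => (hf' k hk).add (hg' k hk), ih hf'' hg''⟩

theorem SD.sum {ι : Type*} {m : ℕ} {s : Finset ι} {f : ι → ℂ → E} (h0 : SD W S m (fun _ => (0:E)))
    (h : ∀ i ∈ s, SD W S m (f i)) : SD W S m (fun k => ∑ i ∈ s, f i k) := by
  classical
  induction s using Finset.induction_on with
  | empty => simpa using h0
  | insert a s ha ih =>
    simp only [Finset.sum_insert ha]
    exact (h a (by simp)).add (ih fun i hi => h i (by simp [hi]))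

theorem SD.zero {m : ℕ} : SD W S m (fun _ => (0 : E)) := by
  have h0 : WBdd W S (fun _ => (0 : E)) := fun w _ => ⟨0, fun k _ => by simp⟩
  induction m with
  | zero => exact h0
  | succ m ih => exact ⟨h0, _, fun k _ => hasDerivWithinAt_const _ _ _, ih⟩

theorem SD.const {m : ℕ} (c : E) : SD oneW S m (fun _ => c) := by
  have h0 : WBdd oneW S (fun _ => c) := wBdd_one.2 ⟨‖c‖, fun k _ => le_rfl⟩
  cases m with
  | zero => exact h0
  | succ m => exact ⟨h0, _, fun k _ => hasDerivWithinAt_const _ _ _, SD.zero⟩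

theorem WBdd.bilin (B : E →L[ℂ] F →L[ℂ] G) {f : ℂ → E} {g : ℂ → F} (hf : WBdd oneW S f)
    (hg : WBdd W S g) : WBdd W S (fun k => B (f k) (g k)) := by
  intro w hw
  obtain ⟨C, hC⟩ := wBdd_one.1 hf
  obtain ⟨D, hD⟩ := hg w hw
  refine ⟨‖B‖ * C * D, fun k hk => ?_⟩
  have h1 := B.le_opNorm₂ (f k) (g k)
  have hC0 : 0 ≤ C := (norm_nonneg _).trans (hC k hk)
  calc |w k| * ‖B (f k) (g k)‖ ≤ |w k| * (‖B‖ * ‖f k‖ * ‖g k‖) := by gcongr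
    _ = ‖B‖ * ‖f k‖ * (|w k| * ‖g k‖) := by ring
    _ ≤ ‖B‖ * C * D := by
      gcongr
      · exact hC k hk
      · exact hD k hk

theorem SD.bilin (B : E →L[ℂ] F →L[ℂ] G) {m : ℕ} : ∀ {f : ℂ → E} {g : ℂ → F}, SD oneW S m f →
    SD W S m g → SD W S m (fun k => B (f k) (g k)) := by
  induction m with
  | zero => intro f g hf hg; exact WBdd.bilin B hf hg
  | succ m ih =>
    intro f g hf hg
    have hfm := hf.of_succ
    have hgm := hg.of_succ
    obtain ⟨hf, f', hf', hf''⟩ := hf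
    obtain ⟨hg, g', hg', hg''⟩ := hg
    refine ⟨WBdd.bilin B hf hg, _, fun k hk => ?_, (ih hfm hg'').add (ih hf'' hgm)⟩
    exact B.hasDerivWithinAt_of_bilinear (hf' k hk) (hg' k hk)

theorem SD.clm_apply {m : ℕ} {f : ℂ → (E →L[ℂ] F)} {g : ℂ → E} (hf : SD oneW S m f)
    (hg : SD W S m g) : SD W S m (fun k => f k (g k)) :=
  SD.bilin (ContinuousLinearMap.id ℂ (E →L[ℂ] F)) hf hg

theorem SD.smul {m : ℕ} {f : ℂ → ℂ} {g : ℂ → E} (hf : SD oneW S m f)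
    (hg : SD W S m g) : SD W S m (fun k => f k • g k) :=
  SD.bilin (ContinuousLinearMap.lsmul ℂ ℂ) hf hg

theorem SD.mul {A : Type*} [NormedRing A] [NormedAlgebra ℂ A] {m : ℕ} {f g : ℂ → A}
    (hf : SD oneW S m f) (hg : SD W S m g) : SD W S m (fun k => f k * g k) :=
  SD.bilin (ContinuousLinearMap.mul ℂ A) hf hg

theorem SD.const_smul {m : ℕ} (c : ℂ) {g : ℂ → E} (hg : SD W S m g) :
    SD W S m (fun k => c • g k) := SD.smul (SD.const c) hg

theorem SD.neg {m : ℕ} {g : ℂ → E} (hg : SD W S m g) : SD W S m (fun k => - g k) := by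
  simpa using hg.const_smul (-1)

theorem SD.sub {m : ℕ} {f g : ℂ → E} (hf : SD W S m f) (hg : SD W S m g) :
    SD W S m (fun k => f k - g k) := by
  simpa [sub_eq_add_neg] using hf.add hg.neg

/-- The bound on the inverse is needed only at order zero: the derivative -f⁻¹ f' f⁻¹ is a product
of functions already controlled. -/
theorem SD.inverse {A : Type*} [NormedRing A] [NormedAlgebra ℂ A] [CompleteSpace A] {m : ℕ}
    {f : ℂ → A} (hf : SD oneW S m f) (hu : ∀ k ∈ S, IsUnit (f k))
    (hb : ∃ C, ∀ k ∈ S, ‖Ring.inverse (f k)‖ ≤ C) :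
    SD oneW S m (fun k => Ring.inverse (f k)) := by
  induction m with
  | zero => exact wBdd_one.2 hb
  | succ m ih =>
    have hfm := ih hf.of_succ
    obtain ⟨hf, f', hf', hf''⟩ := hf
    refine ⟨wBdd_one.2 hb, fun k => -(Ring.inverse (f k) * f' k * Ring.inverse (f k)), fun k hk => ?_,
      ((hfm.mul hf'').mul hfm).neg⟩
    obtain ⟨u, huk⟩ := hu k hk
    have h1 := hasFDerivAt_ringInverse (𝕜 := ℂ) u
    rw [huk] at h1
    have h2 := h1.comp_hasDerivWithinAt k (hf' k hk)
    have h3 : ((u⁻¹ : Aˣ) : A) = Ring.inverse (f k) := by rw [← huk, Ring.inverse_unit]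
    exact h2.congr_deriv (by simp [h3, mul_assoc])

theorem SD.inv {m : ℕ} {f : ℂ → ℂ} (hf : SD oneW S m f) {c : ℝ} (hc : 0 < c)
    (hb : ∀ k ∈ S, c ≤ ‖f k‖) : SD oneW S m (fun k => (f k)⁻¹) := by
  have := hf.inverse (fun k hk => isUnit_iff_ne_zero.2 (norm_pos_iff.1 (hc.trans_le (hb k hk))))
    ⟨c⁻¹, fun k hk => by
      rw [Ring.inverse_eq_inv', norm_inv]
      exact inv_anti₀ hc (hb k hk)⟩
  simpa [Ring.inverse_eq_inv'] using this

/-- Composition of a family, in which each member is the derivative of the preceding one, with a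
scalar function. -/
theorem SD.comp_family {Φ : ℕ → ℂ → E} {H : Set ℂ} {M : ℕ} {C : ℝ}
    (hd : ∀ n, n + 2 ≤ M → ∀ z ∈ H, HasDerivWithinAt (Φ n) (Φ (n + 1) z) H z)
    (hb : ∀ n ≤ M, ∀ z ∈ H, ‖Φ n z‖ ≤ C) {a a' : ℂ → ℂ} (ha : MapsTo a S H)
    (had : ∀ k ∈ S, HasDerivWithinAt a (a' k) S k) {m : ℕ} :
    ∀ {n : ℕ}, n + m + 1 ≤ M → SD oneW S m a' → SD oneW S m (fun k => Φ n (a k)) := by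
  induction m with
  | zero => intro n hn _; exact wBdd_one.2 ⟨C, fun k hk => hb n (by omega) _ (ha hk)⟩
  | succ m ih =>
    intro n hn ha'
    refine ⟨wBdd_one.2 ⟨C, fun k hk => hb n (by omega) _ (ha hk)⟩, fun k => a' k • Φ (n + 1) (a k),
      fun k hk => ?_, SD.smul ha'.of_succ (ih (by omega) ha'.of_succ)⟩
    exact (hd n (by omega) _ (ha hk)).scomp k (had k hk) ha

theorem SD.contDiffOn (hS : UniqueDiffOn ℂ S) {m : ℕ} : ∀ {f : ℂ → E}, SD W S (m + 1) f →
    ContDiffOn ℂ m f S := by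
  induction m with
  | zero =>
    rintro f ⟨_, f', hd, _⟩
    exact contDiffOn_zero.2 fun k hk => (hd k hk).continuousWithinAt
  | succ m ih =>
    rintro f ⟨_, f', hd, h'⟩
    rw [show ((m + 1 : ℕ) : WithTop ℕ∞) = (m : WithTop ℕ∞) + 1 by push_cast; rfl,
      contDiffOn_succ_iff_derivWithin hS]
    refine ⟨fun k hk => (hd k hk).differentiableWithinAt, by simp, ?_⟩
    exact (ih h').congr fun k hk => (hd k hk).derivWithin (hS k hk)

theorem SD.iteratedDerivWithin_bound (hS : UniqueDiffOn ℂ S) {j : ℕ} : ∀ {f : ℂ → E},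
    SD W S j f → WBdd W S (iteratedDerivWithin j f S) := by
  induction j with
  | zero => intro f h; rw [iteratedDerivWithin_zero]; exact h
  | succ j ih =>
    rintro f ⟨_, f', hd, h'⟩
    refine (ih h').congr fun k hk => ?_
    rw [iteratedDerivWithin_succ']
    exact iteratedDerivWithin_congr (fun k hk => (hd k hk).derivWithin (hS k hk)) hk

theorem hasDerivWithinAt_of_quadratic {f : ℂ → E} {f' : E} {a : ℂ} {C : ℝ}
    (h : ∀ b ∈ S, ‖f b - f a - (b - a) • f'‖ ≤ C * ‖b - a‖ ^ 2) : HasDerivWithinAt f f' S a := by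
  rw [hasDerivWithinAt_iff_isLittleO]
  have h1 : (fun b => f b - f a - (b - a) • f') =O[𝓝[S] a] fun b => (b - a) ^ 2 := by
    refine Asymptotics.IsBigO.of_bound C ?_
    filter_upwards [self_mem_nhdsWithin] with b hb
    rw [norm_pow]; exact h b hb
  refine h1.trans_isLittleO ?_
  have : (fun b : ℂ => (b - a) ^ 2) =o[𝓝 a] fun b => b - a := by
    have := (Asymptotics.isLittleO_pow_id (𝕜 := ℂ) one_lt_two)
    have h2 : Tendsto (fun b : ℂ => b - a) (𝓝 a) (𝓝 0) := by
      simpa using (continuous_sub_right a).tendsto a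
    exact this.comp_tendsto h2
  exact this.mono nhdsWithin_le_nhds

end SD

/-- Second order remainder estimate for the exponential on a convex set where it is bounded. -/
theorem exp_remainder {H : Set ℂ} (hH : Convex ℝ H) {x : ℝ}
    (hb : ∀ z ∈ H, ‖Complex.exp (-(x : ℂ) * z)‖ ≤ 1) {a b : ℂ} (ha : a ∈ H) (hb' : b ∈ H) :
    ‖Complex.exp (-(x : ℂ) * b) - Complex.exp (-(x : ℂ) * a) -
      (b - a) * (-(x : ℂ) * Complex.exp (-(x : ℂ) * a))‖ ≤ |x| ^ 2 * ‖b - a‖ ^ 2 := by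
  have hd : ∀ z, HasDerivAt (fun z => Complex.exp (-(x : ℂ) * z))
      (-(x : ℂ) * Complex.exp (-(x : ℂ) * z)) z := by
    intro z
    have := ((hasDerivAt_id z).const_mul (-(x : ℂ))).cexp
    refine this.congr_deriv ?_
    simp; ring
  -- The mean value inequality is used twice: here for the exponential, whose derivative is bounded
  -- by |x|, and then for the exponential minus its linear part along the segment.
  have h1 : ∀ z ∈ H, ‖Complex.exp (-(x : ℂ) * z) - Complex.exp (-(x : ℂ) * a)‖ ≤ |x| * ‖z - a‖ := by
    intro z hz
    refine hH.norm_image_sub_le_of_norm_hasDerivWithin_le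
      (f' := fun z => -(x : ℂ) * Complex.exp (-(x : ℂ) * z)) (C := |x|)
      (fun z _ => (hd z).hasDerivWithinAt) (fun z hz => ?_) ha hz
    rw [norm_mul, norm_neg, Complex.norm_real, Real.norm_eq_abs]
    exact mul_le_of_le_one_right (abs_nonneg _) (hb z hz)
  have hseg : segment ℝ a b ⊆ H := hH.segment_subset ha hb'
  have h2 := (convex_segment a b).norm_image_sub_le_of_norm_hasDerivWithin_le
      (f := fun z => Complex.exp (-(x : ℂ) * z) - z * (-(x : ℂ) * Complex.exp (-(x : ℂ) * a)))
      (f' := fun z => -(x : ℂ) * Complex.exp (-(x : ℂ) * z)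
        - 1 * (-(x : ℂ) * Complex.exp (-(x : ℂ) * a))) (C := |x| ^ 2 * ‖b - a‖)
      (fun z _ => ((hd z).sub ((hasDerivAt_id z).mul_const _)).hasDerivWithinAt) (fun z hz => ?_)
      (left_mem_segment ℝ a b) (right_mem_segment ℝ a b)
  · calc _ = _ := by congr 1; ring
      _ ≤ _ := h2
      _ = _ := by ring
  · have h3 : ‖z - a‖ ≤ ‖b - a‖ := norm_sub_le_of_mem_segment hz
    calc _ = ‖-(x : ℂ) * (Complex.exp (-(x : ℂ) * z) - Complex.exp (-(x : ℂ) * a))‖ := by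
          congr 1; ring
      _ = |x| * ‖Complex.exp (-(x : ℂ) * z) - Complex.exp (-(x : ℂ) * a)‖ := by
          rw [norm_mul, norm_neg, Complex.norm_real, Real.norm_eq_abs]
      _ ≤ |x| * (|x| * ‖b - a‖) := by
          gcongr
          exact (h1 z (hseg hz)).trans (by gcongr)
      _ = _ := by ring

end

/-! ### Integral operators depending smoothly on the exponent -/

section

/-- The closed right half-plane. -/
def rightHalf : Set ℂ := {a | 0 ≤ a.re}

/-- The imaginary axis. -/
def imAxis : Set ℂ := {a | a.re = 0}

theorem convex_rightHalf : Convex ℝ rightHalf := convex_halfSpace_re_ge 0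

theorem convex_imAxis : Convex ℝ imAxis := by
  have : imAxis = {a : ℂ | Complex.reLm a = 0} := rfl
  rw [this]; exact convex_hyperplane (Complex.reLm.isLinear) 0

theorem norm_exp_rightHalf {t : ℝ} (ht : 0 ≤ t) {a : ℂ} (ha : a ∈ rightHalf) :
    ‖Complex.exp (-(t : ℂ) * a)‖ ≤ 1 := by
  have := norm_exp_mul_le_one (a := a) ha (neg_nonpos.2 ht)
  simpa using this

theorem norm_exp_imAxis (t : ℝ) {a : ℂ} (ha : a ∈ imAxis) :
    ‖Complex.exp (-(t : ℂ) * a)‖ = 1 := by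
  have h : a.re = 0 := ha
  rw [Complex.norm_exp]
  simp [h]

theorem integral_Ioi_inv_le : ∫ t in Ioi (0:ℝ), (1 + t ^ 2)⁻¹ ≤ 2 := by
  rw [integral_Ioi_inv_one_add_sq]
  have := Real.pi_le_four
  simp; linarith

theorem integral_inv_le : ∫ t : ℝ, (1 + t ^ 2)⁻¹ ≤ 4 := by
  rw [integral_univ_inv_one_add_sq]
  exact Real.pi_le_four

/-- Kernels with decay of order `N + 2`. -/
structure Ker (N : ℕ) where
  toFun : ℝ → ℝ → ℂ
  cont : Continuous (Function.uncurry toFun)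
  bound : ∀ x t, 0 ≤ t → ‖toFun x t‖ ≤ ((1 + t) ^ (N + 2))⁻¹ * (1 + (x + t) ^ 2)⁻¹

open Classical in
/-- The multiplier `(-t)^n e^{-ta}`, cut off outside the admissible range of `n` and `a`. -/
noncomputable def expo (N n : ℕ) (a : ℂ) (t : ℝ) : ℂ :=
  if n ≤ N ∧ 0 ≤ a.re then (-(t : ℂ)) ^ n * Complex.exp (-(t : ℂ) * a) else 0

theorem norm_expo_le (N n : ℕ) (a : ℂ) {t : ℝ} (ht : 0 ≤ t) : ‖expo N n a t‖ ≤ (1 + t) ^ N := by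
  unfold expo
  split_ifs with h
  · rw [norm_mul, norm_pow, norm_neg, Complex.norm_real, Real.norm_of_nonneg ht]
    calc t ^ n * _ ≤ t ^ n * 1 := by gcongr; exact norm_exp_rightHalf ht h.2
      _ ≤ (1 + t) ^ n := by rw [mul_one]; gcongr; linarith
      _ ≤ (1 + t) ^ N := pow_le_pow_right₀ (by linarith) h.1
  · simp; positivity

theorem continuous_expo (N n : ℕ) (a : ℂ) : Continuous (expo N n a) := by
  unfold expo
  split_ifs with h
  · fun_prop
  · exact continuous_const

theorem one_add_sq_inv_le {t : ℝ} (ht : 0 ≤ t) : ((1 + t) ^ 2)⁻¹ ≤ (1 + t ^ 2)⁻¹ :=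
  inv_anti₀ (by positivity) (by nlinarith)

theorem one_add_sq_inv_le_one (t : ℝ) : (1 + t ^ 2)⁻¹ ≤ 1 :=
  inv_le_one_of_one_le₀ (by nlinarith [sq_nonneg t])

namespace Ker
variable {N : ℕ} (κ : Ker N)

/-- Of the N + 2 powers of decay, N absorb the multiplier and two keep the kernel integrable. The
factor in x + t is retained because the arctangent weight needs it. -/
theorem bound_mul {m : ℝ} {x t : ℝ} (ht : 0 ≤ t) (hm : m ≤ (1 + t) ^ N) :
    m * ‖κ.toFun x t‖ ≤ (1 + t ^ 2)⁻¹ * (1 + (x + t) ^ 2)⁻¹ := by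
  calc m * ‖κ.toFun x t‖ ≤ (1 + t) ^ N * (((1 + t) ^ (N + 2))⁻¹ * (1 + (x + t) ^ 2)⁻¹) := by
        gcongr; exact κ.bound x t ht
    _ = ((1 + t) ^ 2)⁻¹ * (1 + (x + t) ^ 2)⁻¹ := by
        have : (1 + t) ≠ 0 := by positivity
        rw [pow_add]; field_simp
    _ ≤ _ := mul_le_mul_of_nonneg_right (one_add_sq_inv_le ht) (by positivity)

theorem bound_mul' {m : ℝ} {x t : ℝ} (ht : 0 ≤ t) (hm : m ≤ (1 + t) ^ N) :
    m * ‖κ.toFun x t‖ ≤ (1 + t ^ 2)⁻¹ :=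
  (κ.bound_mul ht hm).trans (mul_le_of_le_one_right (by positivity) (one_add_sq_inv_le_one _))

theorem norm_integrand_le (n : ℕ) (a : ℂ) (F : ℝ →ᵇ ℂ) (x : ℝ) {t : ℝ} (ht : 0 ≤ t) :
    ‖expo N n a t * κ.toFun x t * F (x + t)‖ ≤ (1 + t ^ 2)⁻¹ * ‖F‖ := by
  rw [norm_mul, norm_mul]
  gcongr
  · exact κ.bound_mul' ht (norm_expo_le N n a ht)
  · exact F.norm_coe_le_norm _

theorem continuous_integrand (n : ℕ) (a : ℂ) (F : ℝ →ᵇ ℂ) :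
    Continuous fun p : ℝ × ℝ => expo N n a p.2 * κ.toFun p.1 p.2 * F (p.1 + p.2) := by
  have h1 : Continuous fun p : ℝ × ℝ => κ.toFun p.1 p.2 := κ.cont
  have h2 := continuous_expo N n a
  fun_prop

theorem integrable_integrand (n : ℕ) (a : ℂ) (F : ℝ →ᵇ ℂ) (x : ℝ) :
    IntegrableOn (fun t => expo N n a t * κ.toFun x t * F (x + t)) (Ioi 0) := by
  refine (integrable_inv_one_add_sq.mul_const ‖F‖).integrableOn.mono'
    (((κ.continuous_integrand n a F).comp (Continuous.prodMk_right x)).aestronglyMeasurable)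
    ((ae_restrict_iff' measurableSet_Ioi).2 (ae_of_all _ fun t ht => ?_))
  exact κ.norm_integrand_le n a F x (le_of_lt ht)

theorem continuous_opFun (n : ℕ) (a : ℂ) (F : ℝ →ᵇ ℂ) :
    Continuous fun x => ∫ t in Ioi (0:ℝ), expo N n a t * κ.toFun x t * F (x + t) := by
  refine MeasureTheory.continuous_of_dominated (bound := fun t => (1 + t ^ 2)⁻¹ * ‖F‖) (fun x => ?_)
    (fun x => ?_) (integrable_inv_one_add_sq.mul_const ‖F‖).integrableOn (ae_of_all _ fun t => ?_)
  · exact (κ.integrable_integrand n a F x).aestronglyMeasurable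
  · exact (ae_restrict_iff' measurableSet_Ioi).2 (ae_of_all _ fun t ht =>
      κ.norm_integrand_le n a F x (le_of_lt ht))
  · have h2 : Continuous fun x : ℝ => κ.toFun x t := κ.cont.comp (Continuous.prodMk_left t)
    exact (continuous_const.mul h2).mul (F.continuous.comp (continuous_add_const t))

theorem norm_opFun_le (n : ℕ) (a : ℂ) (F : ℝ →ᵇ ℂ) (x : ℝ) :
    ‖∫ t in Ioi (0:ℝ), expo N n a t * κ.toFun x t * F (x + t)‖ ≤ 2 * ‖F‖ := by
  refine (norm_integral_le_of_norm_le
    (integrable_inv_one_add_sq.mul_const ‖F‖).integrableOn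
    ((ae_restrict_iff' measurableSet_Ioi).2 (ae_of_all _ fun t ht =>
      κ.norm_integrand_le n a F x (le_of_lt ht)))).trans ?_
  rw [integral_mul_const]
  exact mul_le_mul_of_nonneg_right integral_Ioi_inv_le (norm_nonneg _)

/-- The integral operators with kernel `(-t)^n e^{-ta} κ(x,t)`, as linear maps. -/
noncomputable def opLin (n : ℕ) (a : ℂ) : (ℝ →ᵇ ℂ) →ₗ[ℂ] (ℝ →ᵇ ℂ) where
  toFun F := BoundedContinuousFunction.ofNormedAddCommGroup _ (κ.continuous_opFun n a F)
    (2 * ‖F‖) (κ.norm_opFun_le n a F)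
  map_add' F G := by
    ext x
    change (∫ t in Ioi (0:ℝ), expo N n a t * κ.toFun x t * (F (x + t) + G (x + t))) = _
    simp only [mul_add]
    exact integral_add (κ.integrable_integrand n a F x) (κ.integrable_integrand n a G x)
  map_smul' c F := by
    ext x
    change (∫ t in Ioi (0:ℝ), expo N n a t * κ.toFun x t * (c * F (x + t))) =
      c * ∫ t in Ioi (0:ℝ), expo N n a t * κ.toFun x t * F (x + t)
    rw [← integral_const_mul]
    congr 1; ext t; ring

theorem norm_opLin_le (n : ℕ) (a : ℂ) (F : ℝ →ᵇ ℂ) : ‖κ.opLin n a F‖ ≤ 2 * ‖F‖ :=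
  BoundedContinuousFunction.norm_ofNormedAddCommGroup_le _ (by positivity) (κ.norm_opFun_le n a F)

/-- The integral operators with kernel `(-t)^n e^{-ta} κ(x,t)`. -/
noncomputable def op (n : ℕ) (a : ℂ) : (ℝ →ᵇ ℂ) →L[ℂ] (ℝ →ᵇ ℂ) :=
  LinearMap.mkContinuous (κ.opLin n a) 2 (κ.norm_opLin_le n a)

theorem op_apply (n : ℕ) (a : ℂ) (F : ℝ →ᵇ ℂ) (x : ℝ) :
    κ.op n a F x = ∫ t in Ioi (0:ℝ), expo N n a t * κ.toFun x t * F (x + t) := rfl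

theorem norm_op_le (n : ℕ) (a : ℂ) : ‖κ.op n a‖ ≤ 2 :=
  LinearMap.mkContinuous_norm_le _ (by norm_num) _

/-- The second order remainder of the exponential costs t², hence the requirement of two spare
moments. The estimate is uniform in F and x, which makes it an estimate in operator norm. -/
theorem hasDerivWithinAt_op {n : ℕ} (hn : n + 2 ≤ N) {a : ℂ} (ha : a ∈ rightHalf) :
    HasDerivWithinAt (κ.op n) (κ.op (n + 1) a) rightHalf a := by
  refine hasDerivWithinAt_of_quadratic (E := (ℝ →ᵇ ℂ) →L[ℂ] (ℝ →ᵇ ℂ)) (C := 2) fun b hb => ?_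
  refine ContinuousLinearMap.opNorm_le_bound _ (by positivity) fun F => ?_
  refine (BoundedContinuousFunction.norm_le (by positivity)).2 fun x => ?_
  have e : (κ.op n b - κ.op n a - (b - a) • κ.op (n + 1) a) F x = ∫ t in Ioi (0:ℝ),
      (expo N n b t * κ.toFun x t * F (x + t) - expo N n a t * κ.toFun x t * F (x + t) -
        (b - a) * (expo N (n + 1) a t * κ.toFun x t * F (x + t))) := by
    rw [integral_sub, integral_sub, integral_const_mul]
    · rfl
    · exact κ.integrable_integrand n b F x
    · exact κ.integrable_integrand n a F x
    · exact (κ.integrable_integrand n b F x).sub (κ.integrable_integrand n a F x)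
    · exact (κ.integrable_integrand (n + 1) a F x).const_mul _
  rw [e]
  have hbd : ∀ t : ℝ, 0 ≤ t → ‖expo N n b t * κ.toFun x t * F (x + t) -
      expo N n a t * κ.toFun x t * F (x + t) -
        (b - a) * (expo N (n + 1) a t * κ.toFun x t * F (x + t))‖ ≤
        (1 + t ^ 2)⁻¹ * (‖b - a‖ ^ 2 * ‖F‖) := by
    intro t ht
    have h1 : expo N n b t * κ.toFun x t * F (x + t) -
      expo N n a t * κ.toFun x t * F (x + t) -
        (b - a) * (expo N (n + 1) a t * κ.toFun x t * F (x + t)) =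
        ((-(t : ℂ)) ^ n * (Complex.exp (-(t : ℂ) * b) - Complex.exp (-(t : ℂ) * a) -
      (b - a) * (-(t : ℂ) * Complex.exp (-(t : ℂ) * a)))) * κ.toFun x t * F (x + t) := by
      have ha' : 0 ≤ a.re := ha
      have hb' : 0 ≤ b.re := hb
      simp only [expo, ha', hb', and_true, show n ≤ N by omega, show n + 1 ≤ N by omega, if_true]
      ring
    rw [h1, norm_mul, norm_mul, norm_mul, norm_pow, norm_neg, Complex.norm_real,
      Real.norm_of_nonneg ht]
    have h2 := exp_remainder convex_rightHalf (x := t) (fun z hz => norm_exp_rightHalf ht hz) ha hb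
    rw [abs_of_nonneg ht] at h2
    have h3 : t ^ n * t ^ 2 ≤ (1 + t) ^ N := by
      rw [← pow_add]
      calc t ^ (n + 2) ≤ (1 + t) ^ (n + 2) := by gcongr; linarith
        _ ≤ _ := pow_le_pow_right₀ (by linarith) hn
    have h4 := κ.bound_mul' (x := x) ht h3
    calc _ ≤ t ^ n * (t ^ 2 * ‖b - a‖ ^ 2) * ‖κ.toFun x t‖ * ‖F‖ := by
          gcongr
          exact F.norm_coe_le_norm _
      _ = (t ^ n * t ^ 2 * ‖κ.toFun x t‖) * (‖b - a‖ ^ 2 * ‖F‖) := by ring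
      _ ≤ _ := by gcongr
  refine (norm_integral_le_of_norm_le
    (integrable_inv_one_add_sq.mul_const (‖b - a‖ ^ 2 * ‖F‖)).integrableOn
    ((ae_restrict_iff' measurableSet_Ioi).2 (ae_of_all _ fun t ht => hbd t (le_of_lt ht)))).trans ?_
  rw [integral_mul_const]
  calc _ ≤ 2 * (‖b - a‖ ^ 2 * ‖F‖) := by gcongr; exact integral_Ioi_inv_le
    _ = _ := by ring

/-- The operators are small with respect to an exponential weight. -/
theorem norm_op_weight_le {L : ℝ} (hL : 0 < L) (n : ℕ) (a : ℂ) (F : ℝ →ᵇ ℂ) {C : ℝ}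
    (hF : ∀ x, ‖F x‖ ≤ C * bw L x) (x : ℝ) : ‖κ.op n a F x‖ ≤ C / L * bw L x := by
  have hC : 0 ≤ C := nonneg_of_mul_nonneg_left ((norm_nonneg _).trans (hF 0)) (bw_pos L 0)
  rw [op_apply]
  have hi : IntegrableOn (fun t => C * ((1 + (x + t) ^ 2)⁻¹ * bw L (x + t))) (Ioi 0) := by
    have := ((integrable_inv_mul_bw L).comp_add_left x).const_mul C
    exact this.integrableOn
  refine (norm_integral_le_of_norm_le hi
    ((ae_restrict_iff' measurableSet_Ioi).2 (ae_of_all _ fun t ht => ?_))).trans ?_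
  · have ht : 0 ≤ t := le_of_lt ht
    rw [norm_mul, norm_mul]
    calc _ ≤ ((1 + t ^ 2)⁻¹ * (1 + (x + t) ^ 2)⁻¹) * (C * bw L (x + t)) := by
          exact mul_le_mul (κ.bound_mul ht (norm_expo_le N n a ht)) (hF _) (norm_nonneg _)
            (by positivity)
      _ ≤ (1 * (1 + (x + t) ^ 2)⁻¹) * (C * bw L (x + t)) := by
          have := (bw_pos L (x + t)).le
          gcongr
          exact one_add_sq_inv_le_one t
      _ = _ := by ring
  · rw [integral_const_mul]
    have h1 : ∫ t in Ioi (0:ℝ), (1 + (x + t) ^ 2)⁻¹ * bw L (x + t) =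
        ∫ y in Ioi x, (1 + y ^ 2)⁻¹ * bw L y := by
      have := (measurePreserving_add_left volume x).setIntegral_preimage_emb
        (measurableEmbedding_addLeft x) (fun y => (1 + y ^ 2)⁻¹ * bw L y) (Ioi x)
      simpa using this
    rw [h1]
    calc _ ≤ C * (bw L x / L) := by gcongr; exact integral_inv_mul_bw_le hL x
      _ = _ := by ring

end Ker

theorem integral_Ioi_comp_add (f : ℝ → ℂ) (x : ℝ) :
    ∫ t in Ioi (0:ℝ), f (x + t) = ∫ y in Ioi x, f y := by
  have := (measurePreserving_add_left volume x).setIntegral_preimage_emb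
    (measurableEmbedding_addLeft x) f (Ioi x)
  simpa using this

/-- A continuous function with decay of order `N + 2`. -/
structure Den (N : ℕ) where
  toFun : ℝ → ℂ
  cont : Continuous toFun
  bound : ∀ x, ‖toFun x‖ ≤ ((1 + |x|) ^ (N + 2))⁻¹

open Classical in
/-- The multiplier `(-x)^n e^{-xz}` for imaginary `z`, cut off outside the admissible range. -/
noncomputable def expoI (N n : ℕ) (z : ℂ) (x : ℝ) : ℂ :=
  if n ≤ N ∧ z.re = 0 then (-(x : ℂ)) ^ n * Complex.exp (-(x : ℂ) * z) else 0

theorem norm_expoI_le (N n : ℕ) (z : ℂ) (x : ℝ) : ‖expoI N n z x‖ ≤ (1 + |x|) ^ N := by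
  unfold expoI
  split_ifs with h
  · rw [norm_mul, norm_pow, norm_neg, Complex.norm_real, Real.norm_eq_abs, norm_exp_imAxis x h.2,
      mul_one]
    calc |x| ^ n ≤ (1 + |x|) ^ n := by gcongr; linarith
      _ ≤ (1 + |x|) ^ N := pow_le_pow_right₀ (by linarith [abs_nonneg x]) h.1
  · simp; positivity

theorem continuous_expoI (N n : ℕ) (z : ℂ) : Continuous (expoI N n z) := by
  unfold expoI
  split_ifs with h
  · fun_prop
  · exact continuous_const

namespace Den
variable {N : ℕ} (f : Den N)

theorem bound_mul {m x : ℝ} (hm : m ≤ (1 + |x|) ^ N) : m * ‖f.toFun x‖ ≤ (1 + x ^ 2)⁻¹ := by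
  have hx := abs_nonneg x
  calc m * ‖f.toFun x‖ ≤ (1 + |x|) ^ N * ((1 + |x|) ^ (N + 2))⁻¹ := by
        gcongr; exact f.bound x
    _ = ((1 + |x|) ^ 2)⁻¹ := by
        have : (1 + |x|) ≠ 0 := by positivity
        rw [pow_add]; field_simp
    _ ≤ (1 + |x| ^ 2)⁻¹ := one_add_sq_inv_le hx
    _ = _ := by rw [sq_abs]

theorem norm_integrand_le (n : ℕ) (z : ℂ) (F : ℝ →ᵇ ℂ) (x : ℝ) :
    ‖expoI N n z x * f.toFun x * F x‖ ≤ (1 + x ^ 2)⁻¹ * ‖F‖ := by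
  rw [norm_mul, norm_mul]
  gcongr
  · exact f.bound_mul (norm_expoI_le N n z x)
  · exact F.norm_coe_le_norm _

theorem integrable_integrand (n : ℕ) (z : ℂ) (F : ℝ →ᵇ ℂ) :
    Integrable (fun x => expoI N n z x * f.toFun x * F x) :=
  (integrable_inv_one_add_sq.mul_const ‖F‖).mono'
    (((continuous_expoI N n z).mul f.cont).mul F.continuous).aestronglyMeasurable
    (ae_of_all _ fun x => f.norm_integrand_le n z F x)

/-- The functional `F ↦ ∫ (-x)^n e^{-zx} f(x) F(x) dx`. -/
noncomputable def fn (n : ℕ) (z : ℂ) : (ℝ →ᵇ ℂ) →L[ℂ] ℂ :=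
  LinearMap.mkContinuous
    { toFun := fun F => ∫ x, expoI N n z x * f.toFun x * F x
      map_add' := fun F G => by
        simp only [BoundedContinuousFunction.coe_add, Pi.add_apply, mul_add]
        exact integral_add (f.integrable_integrand n z F) (f.integrable_integrand n z G)
      map_smul' := fun c F => by
        simp only [BoundedContinuousFunction.coe_smul, smul_eq_mul, RingHom.id_apply]
        rw [← integral_const_mul]
        congr 1; ext t; ring }
    4 (fun F => by
      refine (norm_integral_le_of_norm_le (integrable_inv_one_add_sq.mul_const ‖F‖)
        (ae_of_all _ fun x => f.norm_integrand_le n z F x)).trans ?_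
      rw [integral_mul_const]
      gcongr
      exact integral_inv_le)

theorem fn_apply (n : ℕ) (z : ℂ) (F : ℝ →ᵇ ℂ) :
    f.fn n z F = ∫ x, expoI N n z x * f.toFun x * F x := rfl

theorem norm_fn_le (n : ℕ) (z : ℂ) : ‖f.fn n z‖ ≤ 4 :=
  LinearMap.mkContinuous_norm_le _ (by norm_num) _

theorem hasDerivWithinAt_fn {n : ℕ} (hn : n + 2 ≤ N) {a : ℂ} (ha : a ∈ imAxis) :
    HasDerivWithinAt (f.fn n) (f.fn (n + 1) a) imAxis a := by
  refine hasDerivWithinAt_of_quadratic (E := (ℝ →ᵇ ℂ) →L[ℂ] ℂ) (C := 4) fun b hb => ?_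
  refine ContinuousLinearMap.opNorm_le_bound _ (by positivity) fun F => ?_
  have e : (f.fn n b - f.fn n a - (b - a) • f.fn (n + 1) a) F = ∫ t,
      (expoI N n b t * f.toFun t * F t - expoI N n a t * f.toFun t * F t -
        (b - a) * (expoI N (n + 1) a t * f.toFun t * F t)) := by
    rw [integral_sub, integral_sub, integral_const_mul]
    · rfl
    · exact f.integrable_integrand n b F
    · exact f.integrable_integrand n a F
    · exact (f.integrable_integrand n b F).sub (f.integrable_integrand n a F)
    · exact (f.integrable_integrand (n + 1) a F).const_mul _
  rw [e]
  have hbd : ∀ t : ℝ, ‖expoI N n b t * f.toFun t * F t - expoI N n a t * f.toFun t * F t -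
        (b - a) * (expoI N (n + 1) a t * f.toFun t * F t)‖ ≤
        (1 + t ^ 2)⁻¹ * (‖b - a‖ ^ 2 * ‖F‖) := by
    intro t
    have h1 : expoI N n b t * f.toFun t * F t - expoI N n a t * f.toFun t * F t -
        (b - a) * (expoI N (n + 1) a t * f.toFun t * F t) =
        ((-(t : ℂ)) ^ n * (Complex.exp (-(t : ℂ) * b) - Complex.exp (-(t : ℂ) * a) -
      (b - a) * (-(t : ℂ) * Complex.exp (-(t : ℂ) * a)))) * f.toFun t * F t := by
      have ha' : a.re = 0 := ha
      have hb' : b.re = 0 := hb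
      simp only [expoI, ha', hb', and_true, show n ≤ N by omega, show n + 1 ≤ N by omega, if_true]
      ring
    rw [h1, norm_mul, norm_mul, norm_mul, norm_pow, norm_neg, Complex.norm_real,
      Real.norm_eq_abs]
    have h2 := exp_remainder convex_imAxis (x := t) (fun z hz => (norm_exp_imAxis t hz).le) ha hb
    have ht := abs_nonneg t
    have h3 : |t| ^ n * |t| ^ 2 ≤ (1 + |t|) ^ N := by
      rw [← pow_add]
      calc |t| ^ (n + 2) ≤ (1 + |t|) ^ (n + 2) := by gcongr; linarith
        _ ≤ _ := pow_le_pow_right₀ (by linarith) hn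
    have h4 := f.bound_mul h3
    calc _ ≤ |t| ^ n * (|t| ^ 2 * ‖b - a‖ ^ 2) * ‖f.toFun t‖ * ‖F‖ := by
          gcongr
          exact F.norm_coe_le_norm _
      _ = (|t| ^ n * |t| ^ 2 * ‖f.toFun t‖) * (‖b - a‖ ^ 2 * ‖F‖) := by ring
      _ ≤ _ := by gcongr
  refine (norm_integral_le_of_norm_le
    (integrable_inv_one_add_sq.mul_const (‖b - a‖ ^ 2 * ‖F‖)) (ae_of_all _ hbd)).trans ?_
  rw [integral_mul_const]
  calc _ ≤ 4 * (‖b - a‖ ^ 2 * ‖F‖) := by gcongr; exact integral_inv_le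
    _ = _ := by ring

end Den

/-- Multiplication by a bounded continuous function. -/
noncomputable def mulOp (φ : ℝ →ᵇ ℂ) : (ℝ →ᵇ ℂ) →L[ℂ] (ℝ →ᵇ ℂ) :=
  ContinuousLinearMap.mul ℂ (ℝ →ᵇ ℂ) φ

theorem mulOp_apply (φ F : ℝ →ᵇ ℂ) (x : ℝ) : mulOp φ F x = φ x * F x := rfl

/-- Since A and B are mutually inverse, 1 - K = A (1 - BKA) B. -/
theorem conj_inverse {R : Type*} [Ring R] {A B K G : R} (hAB : A * B = 1) (hBA : B * A = 1)
    (h1 : (1 - B * K * A) * G = 1) (h2 : G * (1 - B * K * A) = 1) :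
    (1 - K) * (A * G * B) = 1 ∧ A * G * B * (1 - K) = 1 := by
  have hKK : 1 - K = A * (1 - B * K * A) * B := by
    have : A * (1 - B * K * A) * B = A * B - (A * B) * K * (A * B) := by noncomm_ring
    rw [this, hAB]; simp
  generalize 1 - B * K * A = T at *
  rw [hKK]
  constructor
  · calc _ = A * T * (B * A) * G * B := by noncomm_ring
      _ = A * (T * G) * B := by rw [hBA]; noncomm_ring
      _ = 1 := by rw [h1, mul_one, hAB]
  · calc _ = A * G * (B * A) * T * B := by noncomm_ring
      _ = A * (G * T) * B := by rw [hBA]; noncomm_ring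
      _ = 1 := by rw [h2, mul_one, hAB]

/-- `1 - K` is invertible if `K` is a contraction in a weighted norm. -/
theorem isUnit_one_sub_of_weight {K : (ℝ →ᵇ ℂ) →L[ℂ] (ℝ →ᵇ ℂ)} {L : ℝ}
    (h : ∀ (F : ℝ →ᵇ ℂ) (C : ℝ), (∀ x, ‖F x‖ ≤ C * bw L x) → ∀ x, ‖K F x‖ ≤ C / 2 * bw L x) :
    IsUnit (1 - K) ∧ ‖Ring.inverse (1 - K)‖ ≤ 2 * Real.exp (|L| * 4) := by
  set w : ℝ → ℝ →ᵇ ℂ := fun L => BoundedContinuousFunction.ofNormedAddCommGroup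
    (fun x => (bw L x : ℂ)) (Complex.continuous_ofReal.comp (continuous_bw L)) (Real.exp (|L| * 2))
    (fun x => by
      rw [Complex.norm_real, Real.norm_of_nonneg (bw_pos L x).le]; exact bw_le L x) with hw
  have hwa : ∀ L x, w L x = (bw L x : ℂ) := fun L x => rfl
  have hwn : ∀ L, ‖mulOp (w L)‖ ≤ Real.exp (|L| * 2) := by
    intro L
    refine (ContinuousLinearMap.opNorm_mul_apply_le _ _ _).trans ?_
    exact BoundedContinuousFunction.norm_ofNormedAddCommGroup_le _ (Real.exp_pos _).le _
  have hinv : ∀ L, mulOp (w (-L)) * mulOp (w L) = 1 := by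
    intro L
    ext F x
    have h1 : (mulOp (w (-L)) * mulOp (w L)) F x = (bw (-L) x : ℂ) * ((bw L x : ℂ) * F x) := rfl
    rw [h1, ← mul_assoc, ← Complex.ofReal_mul, bw_neg_mul]; simp
  have hinv' : mulOp (w L) * mulOp (w (-L)) = 1 := by simpa using hinv (-L)
  -- After conjugation by the weight the hypothesis says that the norm is at most 1/2, so the
  -- Neumann series applies; the weight and its inverse enter the bound for the inverse.
  set K' := mulOp (w (-L)) * K * mulOp (w L) with hK'
  have hK'n : ‖K'‖ ≤ 1 / 2 := by
    refine ContinuousLinearMap.opNorm_le_bound _ (by norm_num) fun F => ?_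
    refine (BoundedContinuousFunction.norm_le (by positivity)).2 fun x => ?_
    have h1 := h (mulOp (w L) F) ‖F‖ (fun x => by
      rw [mulOp_apply, norm_mul, hwa, Complex.norm_real, Real.norm_of_nonneg (bw_pos L x).le,
        mul_comm]
      gcongr
      · exact (bw_pos L x).le
      · exact F.norm_coe_le_norm x) x
    have h2 : K' F x = (bw (-L) x : ℂ) * K (mulOp (w L) F) x := rfl
    rw [h2, norm_mul, Complex.norm_real, Real.norm_of_nonneg (bw_pos _ x).le]
    calc _ ≤ bw (-L) x * (‖F‖ / 2 * bw L x) := by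
          gcongr
          exact (bw_pos _ x).le
      _ = ‖F‖ / 2 * (bw (-L) x * bw L x) := by ring
      _ = _ := by rw [bw_neg_mul]; ring
  have hlt : ‖K'‖ < 1 := hK'n.trans_lt (by norm_num)
  have hu' : (1 - K') * (∑' n : ℕ, K' ^ n) = 1 := mul_neg_geom_series K' hlt
  have hu'' : (∑' n : ℕ, K' ^ n) * (1 - K') = 1 := geom_series_mul_neg K' hlt
  set I := mulOp (w L) * (∑' n : ℕ, K' ^ n) * mulOp (w (-L)) with hI
  obtain ⟨hr, hl⟩ := conj_inverse hinv' (hinv L) hu' hu''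
  have hunit : IsUnit (1 - K) := ⟨⟨1 - K, I, hr, hl⟩, rfl⟩
  have hIn : Ring.inverse (1 - K) = I := Ring.inverse_unit ⟨1 - K, I, hr, hl⟩
  refine ⟨hunit, ?_⟩
  rw [hIn]
  have hg : ‖∑' n : ℕ, K' ^ n‖ ≤ 2 := by
    have := tsum_geometric_le_of_norm_lt_one K' hlt
    refine this.trans ?_
    have h1 : ‖(1 : (ℝ →ᵇ ℂ) →L[ℂ] (ℝ →ᵇ ℂ))‖ ≤ 1 := ContinuousLinearMap.norm_id_le
    have h2 : (1 - ‖K'‖)⁻¹ ≤ 2 := by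
      rw [inv_le_comm₀ (by linarith) (by norm_num)]; linarith
    linarith
  calc ‖I‖ ≤ ‖mulOp (w L)‖ * ‖∑' n : ℕ, K' ^ n‖ * ‖mulOp (w (-L))‖ :=
        (norm_mul_le _ _).trans (by gcongr; exact norm_mul_le _ _)
    _ ≤ Real.exp (|L| * 2) * 2 * Real.exp (|-L| * 2) := by gcongr <;> exact hwn _
    _ = _ := by rw [abs_neg, mul_right_comm, ← Real.exp_add]; ring_nf

end

/-! ### A scale of two-sided polynomial weights -/

section

/-- The weight `1 + x⁺`. -/
noncomputable def posp (x : ℝ) : ℝ := 1 + max x 0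

/-- The weight `1 + x⁻`. -/
noncomputable def negp (x : ℝ) : ℝ := 1 + max (-x) 0

theorem one_le_posp (x : ℝ) : 1 ≤ posp x := by unfold posp; linarith [le_max_right x 0]
theorem one_le_negp (x : ℝ) : 1 ≤ negp x := by unfold negp; linarith [le_max_right (-x) 0]
theorem posp_pos (x : ℝ) : 0 < posp x := zero_lt_one.trans_le (one_le_posp x)
theorem negp_pos (x : ℝ) : 0 < negp x := zero_lt_one.trans_le (one_le_negp x)
theorem continuous_posp : Continuous posp := by unfold posp; fun_prop
theorem continuous_negp : Continuous negp := by unfold negp; fun_prop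
theorem posp_le (x : ℝ) : posp x ≤ 1 + |x| := by
  unfold posp; gcongr; exact max_le (le_abs_self x) (abs_nonneg x)
theorem negp_le (x : ℝ) : negp x ≤ 1 + |x| := by
  unfold negp; gcongr; exact max_le (neg_le_abs x) (abs_nonneg x)

/-- Weights with different behaviour at the two ends of the real line. -/
noncomputable def W (r l : ℕ) (x : ℝ) : ℝ := negp x ^ l / posp x ^ r

theorem W_pos (r l : ℕ) (x : ℝ) : 0 < W r l x := div_pos (pow_pos (negp_pos x) _) (pow_pos (posp_pos x) _)

theorem continuous_W (r l : ℕ) : Continuous (W r l) := by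
  unfold W
  exact (continuous_negp.pow _).div (continuous_posp.pow _) fun x => (pow_pos (posp_pos x) _).ne'

theorem W_le (r l : ℕ) (x : ℝ) : W r l x ≤ (1 + |x|) ^ l := by
  unfold W
  refine (div_le_self (pow_nonneg (negp_pos x).le _) (one_le_pow₀ (one_le_posp x))).trans ?_
  exact pow_le_pow_left₀ (negp_pos x).le (negp_le x) _

/-- Two elementary bounds are multiplied: 1 + t ≤ posp(x+t) negp(x), to the power N + 2, and 1 +
(x+t)² ≤ (posp(x+t) negp(x+t))². Together they cost N + 4 powers of decay on the right and of growth
on the left. -/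
theorem W_step (N r l : ℕ) (x : ℝ) {t : ℝ} (ht : 0 ≤ t) :
    W (r + (N + 4)) l (x + t) ≤
      ((1 + t) ^ (N + 2))⁻¹ * (1 + (x + t) ^ 2)⁻¹ * W r (l + (N + 4)) x := by
  have hA := one_le_posp (x + t)
  have hA0 : posp x ≤ posp (x + t) := by unfold posp; gcongr; linarith
  have hB : negp (x + t) ≤ negp x := by unfold negp; gcongr; linarith
  have hB1 := one_le_negp (x + t)
  have h1 : 1 + t ≤ posp (x + t) * negp x := by
    unfold posp negp
    have e1 := le_max_left (x + t) 0
    have e2 := le_max_left (-x) 0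
    have e3 := le_max_right (x + t) 0
    have e4 := le_max_right (-x) 0
    nlinarith [mul_nonneg e3 e4]
  have h2 : 1 + (x + t) ^ 2 ≤ (posp (x + t) * negp (x + t)) ^ 2 := by
    have e : 1 + |x + t| ≤ posp (x + t) * negp (x + t) := by
      unfold posp negp
      rcases le_total 0 (x + t) with h | h
      · rw [abs_of_nonneg h, max_eq_left h, max_eq_right (by linarith)]; linarith
      · rw [abs_of_nonpos h, max_eq_right h, max_eq_left (by linarith)]; linarith
    calc 1 + (x + t) ^ 2 ≤ (1 + |x + t|) ^ 2 := by
          nlinarith [abs_nonneg (x + t), sq_abs (x + t)]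
      _ ≤ _ := by gcongr
  set A := posp (x + t)
  set B := negp (x + t)
  set A0 := posp x
  set B0 := negp x
  have hA0p : 0 < A0 := posp_pos x
  have hB0p : 0 < B0 := negp_pos x
  have hAp : 0 < A := posp_pos _
  have hBp : 0 < B := negp_pos _
  have h3 : (1 + t) ^ (N + 2) * (1 + (x + t) ^ 2) ≤ A ^ (N + 4) * B0 ^ (N + 4) := by
    calc (1 + t) ^ (N + 2) * (1 + (x + t) ^ 2) ≤ (A * B0) ^ (N + 2) * (A * B) ^ 2 := by gcongr
      _ ≤ (A * B0) ^ (N + 2) * (A * B0) ^ 2 := by gcongr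
      _ = _ := by rw [← pow_add, mul_pow]
  unfold W
  change B ^ l / A ^ (r + (N + 4)) ≤ ((1 + t) ^ (N + 2))⁻¹ * (1 + (x + t) ^ 2)⁻¹ * (B0 ^ (l + (N + 4)) / A0 ^ r)
  rw [← mul_inv, inv_mul_eq_div, le_div_iff₀ (by positivity)]
  calc B ^ l / A ^ (r + (N + 4)) * ((1 + t) ^ (N + 2) * (1 + (x + t) ^ 2))
      ≤ B0 ^ l / A ^ (r + (N + 4)) * (A ^ (N + 4) * B0 ^ (N + 4)) := by gcongr
    _ = B0 ^ (l + (N + 4)) / A ^ r := by rw [pow_add, pow_add]; field_simp; ring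
    _ ≤ B0 ^ (l + (N + 4)) / A0 ^ r := by gcongr

/-- The scale of weights used for the Volterra equation. -/
noncomputable def wt (N : ℕ) : ℕ → ℝ → ℝ
  -- The additional factor makes this weight decay at both ends, as integration over the whole line
  -- requires.
  | 0, x => W (3 * (N + 4)) 0 x / (1 + |x|) ^ (N + 4)
  | 1, x => W (2 * (N + 4)) (N + 4) x
  | 2, x => W (N + 4) (2 * (N + 4)) x
  | 3, x => W 0 (3 * (N + 4)) x
  -- Index 4 is used for the inhomogeneity: `wfun N q 4` is q divided by the weight of index 0.
  | _, _ => 1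

theorem wt_pos (N i : ℕ) (x : ℝ) : 0 < wt N i x := by
  unfold wt
  split
  · have := W_pos (3 * (N + 4)) 0 x; positivity
  · exact W_pos _ _ _
  · exact W_pos _ _ _
  · exact W_pos _ _ _
  · exact one_pos

theorem continuous_wt (N i : ℕ) : Continuous (wt N i) := by
  rcases i with _ | _ | _ | _ | i
  · refine (continuous_W _ _).div (by fun_prop) fun x => by positivity
  · exact continuous_W _ _
  · exact continuous_W _ _
  · exact continuous_W _ _
  · exact continuous_const

theorem wt_zero_le' (N : ℕ) (x : ℝ) : wt N 0 x ≤ ((1 + |x|) ^ (N + 4))⁻¹ := by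
  have h := W_le (3 * (N + 4)) 0 x
  simp only [wt, pow_zero] at h ⊢
  rw [inv_eq_one_div]
  gcongr

theorem wt_zero_le (N : ℕ) (x : ℝ) : wt N 0 x ≤ ((1 + |x|) ^ (N + 2))⁻¹ :=
  (wt_zero_le' N x).trans (inv_anti₀ (by positivity)
    (pow_le_pow_right₀ (by linarith [abs_nonneg x]) (by omega)))

theorem wt_le (N i : ℕ) (x : ℝ) : wt N i x ≤ (1 + |x|) ^ (3 * (N + 4)) := by
  have h1 : (1:ℝ) ≤ 1 + |x| := by linarith [abs_nonneg x]
  unfold wt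
  split
  · have h := W_le (3 * (N + 4)) 0 x
    rw [pow_zero] at h
    refine (div_le_self (W_pos _ _ _).le (one_le_pow₀ h1)).trans (h.trans (one_le_pow₀ h1))
  · exact (W_le _ _ _).trans (pow_le_pow_right₀ h1 (by omega))
  · exact (W_le _ _ _).trans (pow_le_pow_right₀ h1 (by omega))
  · exact W_le _ _ _
  · exact one_le_pow₀ h1

theorem inv_wt_zero_le (N : ℕ) (x : ℝ) : (wt N 0 x)⁻¹ ≤ (1 + |x|) ^ (4 * (N + 4)) := by
  simp only [wt, W, pow_zero]
  rw [inv_div, div_div_eq_mul_div, div_one]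
  calc (1 + |x|) ^ (N + 4) * posp x ^ (3 * (N + 4)) ≤ (1 + |x|) ^ (N + 4) * (1 + |x|) ^ (3 * (N + 4)) := by
        have := (posp_pos x).le
        gcongr
        exact posp_le x
    _ = _ := by rw [← pow_add]; congr 1; ring

/-- One application of `J` moves one step along the scale. Three steps suffice because the
triangular operator contains three factors `J`. -/
theorem wt_step (N i : ℕ) (hi : i < 3) (x : ℝ) {t : ℝ} (ht : 0 ≤ t) :
    wt N i (x + t) ≤ ((1 + t) ^ (N + 2))⁻¹ * (1 + (x + t) ^ 2)⁻¹ * wt N (i + 1) x := by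
  interval_cases i
  · have h := W_step N (2 * (N + 4)) 0 x ht
    rw [show 2 * (N + 4) + (N + 4) = 3 * (N + 4) by ring, zero_add] at h
    simp only [wt]
    refine (div_le_self (W_pos _ _ _).le (one_le_pow₀ (by linarith [abs_nonneg (x + t)]))).trans h
  · have h := W_step N (N + 4) (N + 4) x ht
    rw [show (N + 4) + (N + 4) = 2 * (N + 4) by ring] at h
    exact h
  · have h := W_step N 0 (2 * (N + 4)) x ht
    rw [show 2 * (N + 4) + (N + 4) = 3 * (N + 4) by ring, zero_add] at h
    exact h

/-- The kernels of the weighted versions of the operators `J a`. -/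
noncomputable def wker (N : ℕ) (i : Fin 3) : Ker N where
  toFun x t := -((wt N i (x + t) / wt N (i + 1) x : ℝ) : ℂ)
  cont := by
    have h1 := continuous_wt N i
    have h2 := continuous_wt N (i + 1)
    have h3 : ∀ x, wt N (i + 1) x ≠ 0 := fun x => (wt_pos N _ x).ne'
    refine Continuous.neg (Complex.continuous_ofReal.comp ?_)
    exact (h1.comp (continuous_fst.add continuous_snd)).div (h2.comp continuous_fst) fun p => h3 _
  bound x t ht := by
    rw [norm_neg, Complex.norm_real, Real.norm_of_nonneg (div_pos (wt_pos _ _ _) (wt_pos _ _ _)).le,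
      div_le_iff₀ (wt_pos _ _ _)]
    exact wt_step N i i.2 x ht

/-- The density defining the functional that yields the scattering data. -/
noncomputable def wden (N : ℕ) : Den N where
  toFun x := (wt N 0 x : ℂ)
  cont := Complex.continuous_ofReal.comp (continuous_wt N 0)
  bound x := by
    rw [Complex.norm_real, Real.norm_of_nonneg (wt_pos _ _ _).le]
    exact wt_zero_le N x

/-- The weighted function `w_i F`. -/
noncomputable def wmul (N i : ℕ) (F : ℝ →ᵇ ℂ) (x : ℝ) : ℂ := (wt N i x : ℂ) * F x

theorem rightInt_wmul (N : ℕ) (i : ℕ) (hi : i < 3) (F : ℝ →ᵇ ℂ) : RightInt (wmul N i F) := by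
  have hc : Continuous (wmul N i F) :=
    (Complex.continuous_ofReal.comp (continuous_wt N i)).mul F.continuous
  refine ⟨hc, fun x => ?_⟩
  refine (integrable_inv_one_add_sq.mul_const (wt N (i + 1) x * ‖F‖)).integrableOn.mono'
    hc.aestronglyMeasurable ((ae_restrict_iff' measurableSet_Ioi).2 (ae_of_all _ fun y hy => ?_))
  rw [wmul, norm_mul, Complex.norm_real, Real.norm_of_nonneg (wt_pos _ _ _).le]
  have h := wt_step N i hi x (sub_nonneg.2 (le_of_lt hy))
  rw [add_sub_cancel] at h
  have h1 : ((1 + (y - x)) ^ (N + 2))⁻¹ ≤ 1 :=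
    inv_le_one_of_one_le₀ (one_le_pow₀ (by have : x < y := hy; linarith))
  calc wt N i y * ‖F y‖ ≤ (((1 + (y - x)) ^ (N + 2))⁻¹ * (1 + y ^ 2)⁻¹ * wt N (i + 1) x) * ‖F‖ := by
        exact mul_le_mul h (F.norm_coe_le_norm y) (norm_nonneg _) ((wt_pos _ _ _).le.trans h)
    _ ≤ (1 * (1 + y ^ 2)⁻¹ * wt N (i + 1) x) * ‖F‖ := by
        have := (wt_pos N (i + 1) x).le
        gcongr
    _ = _ := by ring

/-- With y = x + t, the operator with kernel `wker` is `J a` conjugated by two consecutive weights.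
-/
theorem wmul_op (N : ℕ) (i : Fin 3) {a : ℂ} (ha : 0 ≤ a.re) (F : ℝ →ᵇ ℂ) :
    wmul N (i + 1) ((wker N i).op 0 a F) = J a (wmul N i F) := by
  ext x
  rw [wmul, Ker.op_apply, ← integral_const_mul, J, ← integral_neg,
    ← integral_Ioi_comp_add (fun y => -(Complex.exp (((x - y : ℝ) : ℂ) * a) * wmul N i F y)) x]
  congr 1; ext t
  have h : (wt N (i + 1) x : ℂ) ≠ 0 := by exact_mod_cast (wt_pos N (i + 1) x).ne'
  simp only [expo, zero_le, ha, and_self, if_true, pow_zero, one_mul, wker, wmul]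
  push_cast
  rw [show (x : ℂ) - (x + t) = -t by ring]
  field_simp

theorem schwartz_bound (f : SchwartzMap ℝ ℂ) (n : ℕ) : ∃ C, ∀ x, (1 + |x|) ^ n * ‖f x‖ ≤ C := by
  obtain ⟨C, -, hC⟩ := f.decay 0 0
  obtain ⟨D, -, hD⟩ := f.decay n 0
  simp only [norm_iteratedFDeriv_zero, pow_zero, one_mul, Real.norm_eq_abs] at hC hD
  refine ⟨2 ^ (n - 1) * (C + D), fun x => ?_⟩
  have h := add_pow_le (zero_le_one (α := ℝ)) (abs_nonneg x) n
  rw [one_pow] at h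
  calc (1 + |x|) ^ n * ‖f x‖ ≤ (2 ^ (n - 1) * (1 + |x| ^ n)) * ‖f x‖ := by gcongr
    _ = 2 ^ (n - 1) * (‖f x‖ + |x| ^ n * ‖f x‖) := by ring
    _ ≤ _ := by gcongr; exacts [hC x, hD x]

end

/-! ### The triangular form of the scalar equation -/

section

/-- The Schwartz decay of f pays for the return from any weight to the one of index 0: 3(N+4) powers
for the former and 4(N+4) for the inverse of the latter. -/
theorem wfun_bound (N : ℕ) (f : SchwartzMap ℝ ℂ) (i : ℕ) :
    ∃ C, ∀ x, ‖f x * ((wt N i x / wt N 0 x : ℝ) : ℂ)‖ ≤ C := by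
  obtain ⟨C, hC⟩ := schwartz_bound f (7 * (N + 4))
  refine ⟨C, fun x => (le_trans ?_ (hC x))⟩
  have h0 : 0 ≤ (wt N 0 x)⁻¹ := inv_nonneg.2 (wt_pos N 0 x).le
  rw [norm_mul, Complex.norm_real, Real.norm_of_nonneg (div_pos (wt_pos _ _ _) (wt_pos _ _ _)).le,
    mul_comm, div_eq_mul_inv]
  calc wt N i x * (wt N 0 x)⁻¹ * ‖f x‖ ≤ (1 + |x|) ^ (3 * (N + 4)) * (1 + |x|) ^ (4 * (N + 4)) * ‖f x‖ := by
        gcongr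
        exacts [wt_le N i x, inv_wt_zero_le N x]
    _ = _ := by rw [← pow_add]; congr 2; ring

/-- The function `f w_i / w_0`. -/
noncomputable def wfun (N : ℕ) (f : SchwartzMap ℝ ℂ) (i : ℕ) : ℝ →ᵇ ℂ :=
  BoundedContinuousFunction.ofNormedAddCommGroup
    (fun x => f x * ((wt N i x / wt N 0 x : ℝ) : ℂ))
    (f.continuous.mul (Complex.continuous_ofReal.comp
      ((continuous_wt N i).div (continuous_wt N 0) fun x => (wt_pos N 0 x).ne')))
    _ (wfun_bound N f i).choose_spec

theorem wt_mul_wfun (N : ℕ) (f : SchwartzMap ℝ ℂ) (i : ℕ) (x : ℝ) :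
    (wt N 0 x : ℂ) * wfun N f i x = f x * wt N i x := by
  have h : (wt N 0 x : ℂ) ≠ 0 := by exact_mod_cast (wt_pos N 0 x).ne'
  change (wt N 0 x : ℂ) * (f x * ((wt N i x / wt N 0 x : ℝ) : ℂ)) = _
  push_cast
  field_simp

section Tri
variable (N : ℕ) (q p : SchwartzMap ℝ ℂ)

/-- The Volterra operator in triangular form. -/
noncomputable def triOp (lam a b : ℂ) : (ℝ →ᵇ ℂ) →L[ℂ] (ℝ →ᵇ ℂ) :=
  (mulOp (wfun N q 3) + lam • mulOp (wfun N p 3)) *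
      ((wker N 2).op 0 0 * ((wker N 1).op 0 b * (wker N 0).op 0 a)) +
    mulOp (wfun N p 2) * ((wker N 1).op 0 b * (wker N 0).op 0 a)

/-- The solution of the Volterra equation in triangular form. -/
noncomputable def triSol (lam a b : ℂ) : ℝ →ᵇ ℂ :=
  Ring.inverse (1 - triOp N q p lam a b) (wfun N q 4 + lam • wfun N p 4)

theorem triOp_apply (lam a b : ℂ) (F : ℝ →ᵇ ℂ) (x : ℝ) :
    triOp N q p lam a b F x = (wfun N q 3 x + lam * wfun N p 3 x) *
      (wker N 2).op 0 0 ((wker N 1).op 0 b ((wker N 0).op 0 a F)) x +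
      wfun N p 2 x * (wker N 1).op 0 b ((wker N 0).op 0 a F) x := by
  simp [triOp, mulOp_apply, add_mul, mul_assoc]

theorem isUnit_triOp (lam a b : ℂ) : IsUnit (1 - triOp N q p lam a b) := by
  set M := ‖wfun N q 3‖ + ‖lam‖ * ‖wfun N p 3‖ + ‖wfun N p 2‖ with hM
  have hM0 : 0 ≤ M := by positivity
  -- With L = 2M + 1, one gain of 1/L gives M/L ≤ 1/2; the gains of the other factors are not
  -- needed.
  have hL : 0 < 2 * M + 1 := by linarith
  refine (isUnit_one_sub_of_weight (L := 2 * M + 1) fun F C hF x => ?_).1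
  have hC : 0 ≤ C := nonneg_of_mul_nonneg_left ((norm_nonneg _).trans (hF 0)) (bw_pos _ 0)
  have hdiv : ∀ D : ℝ, 0 ≤ D → D / (2 * M + 1) ≤ D := fun D hD => div_le_self hD (by linarith)
  have h1 := (wker N 0).norm_op_weight_le hL 0 a F hF
  have h2 := (wker N 1).norm_op_weight_le hL 0 b _ h1
  have h3 := (wker N 2).norm_op_weight_le hL 0 0 _ h2
  have hbw := (bw_pos (2 * M + 1) x).le
  have hC1 : 0 ≤ C / (2 * M + 1) := by positivity
  have h2' : ‖(wker N 1).op 0 b ((wker N 0).op 0 a F) x‖ ≤ C / (2 * M + 1) * bw (2 * M + 1) x :=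
    (h2 x).trans (mul_le_mul_of_nonneg_right (hdiv _ hC1) hbw)
  have h3' : ‖(wker N 2).op 0 0 ((wker N 1).op 0 b ((wker N 0).op 0 a F)) x‖ ≤
      C / (2 * M + 1) * bw (2 * M + 1) x :=
    (h3 x).trans (mul_le_mul_of_nonneg_right ((hdiv _ (by positivity)).trans (hdiv _ hC1)) hbw)
  rw [triOp_apply]
  have e1 : ‖wfun N q 3 x + lam * wfun N p 3 x‖ ≤ ‖wfun N q 3‖ + ‖lam‖ * ‖wfun N p 3‖ := by
    refine (norm_add_le _ _).trans ?_
    rw [norm_mul]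
    gcongr <;> exact BoundedContinuousFunction.norm_coe_le_norm _ _
  have e2 : ‖wfun N p 2 x‖ ≤ ‖wfun N p 2‖ := BoundedContinuousFunction.norm_coe_le_norm _ _
  calc _ ≤ (‖wfun N q 3‖ + ‖lam‖ * ‖wfun N p 3‖) * (C / (2 * M + 1) * bw (2 * M + 1) x) +
        ‖wfun N p 2‖ * (C / (2 * M + 1) * bw (2 * M + 1) x) := by
        refine (norm_add_le _ _).trans ?_
        rw [norm_mul, norm_mul]
        gcongr
    _ = (M / (2 * M + 1)) * C * bw (2 * M + 1) x := by rw [hM]; ring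
    _ ≤ (1 / 2) * C * bw (2 * M + 1) x := by
        have : M / (2 * M + 1) ≤ 1 / 2 := by rw [div_le_div_iff₀ hL (by norm_num)]; linarith
        gcongr
    _ = _ := by ring

/-- The Volterra equation in triangular form, on the level of functions. -/
def TriEq (lam a b : ℂ) (g : ℝ → ℂ) : Prop :=
  ∀ x, g x = q x + p x * lam + (q x + p x * lam) * J 0 (J b (J a g)) x + p x * J b (J a g) x

variable {lam a b : ℂ}

theorem wmul_triOp (ha : 0 ≤ a.re) (hb : 0 ≤ b.re) (F : ℝ →ᵇ ℂ) (x : ℝ) :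
    wmul N 0 (triOp N q p lam a b F) x = (q x + p x * lam) * J 0 (J b (J a (wmul N 0 F))) x +
      p x * J b (J a (wmul N 0 F)) x := by
  have h0 := wmul_op N 0 ha F
  have h1 := wmul_op N 1 hb ((wker N 0).op 0 a F)
  have h2 := wmul_op N 2 (a := 0) le_rfl ((wker N 1).op 0 b ((wker N 0).op 0 a F))
  simp only [Fin.val_zero, Fin.val_one, Fin.val_two, zero_add] at h0 h1 h2
  rw [← h0, ← h1, ← h2]
  simp only [wmul, triOp_apply]
  have e1 := wt_mul_wfun N q 3 x
  have e2 := wt_mul_wfun N p 3 x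
  have e3 := wt_mul_wfun N p 2 x
  linear_combination ((wker N 2).op 0 0 ((wker N 1).op 0 b ((wker N 0).op 0 a F)) x) * e1 +
    lam * ((wker N 2).op 0 0 ((wker N 1).op 0 b ((wker N 0).op 0 a F)) x) * e2 +
    ((wker N 1).op 0 b ((wker N 0).op 0 a F) x) * e3

theorem triSol_eq : triSol N q p lam a b = wfun N q 4 + lam • wfun N p 4 +
    triOp N q p lam a b (triSol N q p lam a b) := by
  have h : ((1 - triOp N q p lam a b) * Ring.inverse (1 - triOp N q p lam a b))
      (wfun N q 4 + lam • wfun N p 4) = wfun N q 4 + lam • wfun N p 4 := by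
    rw [Ring.mul_inverse_cancel _ (isUnit_triOp N q p lam a b)]; rfl
  have h2 : triSol N q p lam a b - triOp N q p lam a b (triSol N q p lam a b) =
    wfun N q 4 + lam • wfun N p 4 := h
  rw [← h2]; abel

theorem wmul_src (x : ℝ) : wmul N 0 (wfun N q 4 + lam • wfun N p 4) x = q x + p x * lam := by
  have e1 := wt_mul_wfun N q 4 x
  have e2 := wt_mul_wfun N p 4 x
  simp only [wt, Complex.ofReal_one, mul_one] at e1 e2
  simp only [wmul, BoundedContinuousFunction.coe_add, BoundedContinuousFunction.coe_smul,
    Pi.add_apply, smul_eq_mul, wt]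
  linear_combination e1 + lam * e2

theorem wmul_add (F G : ℝ →ᵇ ℂ) (x : ℝ) : wmul N 0 (F + G) x = wmul N 0 F x + wmul N 0 G x := by
  simp [wmul, mul_add]

theorem triEq_triSol (ha : 0 ≤ a.re) (hb : 0 ≤ b.re) :
    TriEq q p lam a b (wmul N 0 (triSol N q p lam a b)) := by
  intro x
  conv_lhs => rw [triSol_eq]
  rw [wmul_add, wmul_src, wmul_triOp N q p ha hb]
  ring

theorem wmul_injective {F G : ℝ →ᵇ ℂ} (h : ∀ x, wmul N 0 F x = wmul N 0 G x) : F = G := by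
  ext x
  have h0 : (wt N 0 x : ℂ) ≠ 0 := by exact_mod_cast (wt_pos N 0 x).ne'
  exact mul_left_cancel₀ h0 (h x)

theorem eq_triSol (ha : 0 ≤ a.re) (hb : 0 ≤ b.re) {F : ℝ →ᵇ ℂ}
    (h : TriEq q p lam a b (wmul N 0 F)) : F = triSol N q p lam a b := by
  have h1 : F = wfun N q 4 + lam • wfun N p 4 + triOp N q p lam a b F := by
    refine wmul_injective N fun x => ?_
    rw [wmul_add, wmul_src, wmul_triOp N q p ha hb, h x]; ring
  have h2 : (1 - triOp N q p lam a b) F = wfun N q 4 + lam • wfun N p 4 := by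
    change F - triOp N q p lam a b F = _
    rw [sub_eq_iff_eq_add]; exact h1
  rw [triSol, ← h2]
  have : (Ring.inverse (1 - triOp N q p lam a b) * (1 - triOp N q p lam a b)) F = F := by
    rw [Ring.inverse_mul_cancel _ (isUnit_triOp N q p lam a b)]; rfl
  exact this.symm

/-- The weight of index 0 decreases with N, so the solution for N yields a bounded solution for N =
0, and uniqueness identifies the two. A single function therefore inherits the regularity obtained
for every N. -/
theorem wmul_triSol_eq_zero (ha : 0 ≤ a.re) (hb : 0 ≤ b.re) :
    wmul N 0 (triSol N q p lam a b) = wmul 0 0 (triSol 0 q p lam a b) := by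
  have hle : ∀ x, wt N 0 x / wt 0 0 x ≤ 1 := by
    intro x
    rw [div_le_one (wt_pos _ _ _)]
    have h1 := one_le_posp x
    have h2 : (1:ℝ) ≤ 1 + |x| := by linarith [abs_nonneg x]
    simp only [wt, W, pow_zero]
    gcongr <;> first | assumption | omega
  set G : ℝ →ᵇ ℂ := BoundedContinuousFunction.ofNormedAddCommGroup
    (fun x => ((wt N 0 x / wt 0 0 x : ℝ) : ℂ) * triSol N q p lam a b x)
    ((Complex.continuous_ofReal.comp ((continuous_wt N 0).div (continuous_wt 0 0)
      fun x => (wt_pos 0 0 x).ne')).mul (triSol N q p lam a b).continuous) (‖triSol N q p lam a b‖)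
    (fun x => by
      rw [norm_mul, Complex.norm_real, Real.norm_of_nonneg (div_pos (wt_pos _ _ _) (wt_pos _ _ _)).le]
      exact (mul_le_of_le_one_left (norm_nonneg _) (hle x)).trans
        (BoundedContinuousFunction.norm_coe_le_norm _ _)) with hG
  have hGw : wmul 0 0 G = wmul N 0 (triSol N q p lam a b) := by
    ext x
    have h0 : (wt 0 0 x : ℂ) ≠ 0 := by exact_mod_cast (wt_pos 0 0 x).ne'
    change (wt 0 0 x : ℂ) * (((wt N 0 x / wt 0 0 x : ℝ) : ℂ) * triSol N q p lam a b x) = _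
    rw [wmul]; push_cast; field_simp
  have := eq_triSol 0 q p ha hb (F := G) (by rw [hGw]; exact triEq_triSol N q p ha hb)
  rw [← this, hGw]

/-- The scattering integral `∫ e^{-zx} g(x) dx`. -/
noncomputable def triT (z lam a b : ℂ) : ℂ := (wden N).fn 0 z (triSol N q p lam a b)

theorem fn_wden {z : ℂ} (hz : z.re = 0) (F : ℝ →ᵇ ℂ) :
    (wden N).fn 0 z F = ∫ x : ℝ, Complex.exp (-(x : ℂ) * z) * wmul N 0 F x := by
  rw [Den.fn_apply]
  congr 1; ext x
  simp [expoI, hz, wden, wmul, mul_assoc]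

theorem triT_eq_zero {z : ℂ} (hz : z.re = 0) (ha : 0 ≤ a.re) (hb : 0 ≤ b.re) :
    triT N q p z lam a b = triT 0 q p z lam a b := by
  rw [triT, triT, fn_wden _ hz, fn_wden _ hz, wmul_triSol_eq_zero N q p ha hb]

theorem norm_wmul_zero_le (F : ℝ →ᵇ ℂ) (x : ℝ) : ‖wmul N 0 F x‖ ≤ ‖F‖ * (1 + x ^ 2)⁻¹ := by
  rw [wmul, norm_mul, Complex.norm_real, Real.norm_of_nonneg (wt_pos _ _ _).le, mul_comm]
  have h1 : ((1 + |x|) ^ (N + 4))⁻¹ ≤ ((1 + |x|) ^ 2)⁻¹ := inv_anti₀ (by positivity)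
    (pow_le_pow_right₀ (by linarith [abs_nonneg x]) (by omega))
  have h2 := one_add_sq_inv_le (abs_nonneg x)
  rw [sq_abs] at h2
  exact mul_le_mul (F.norm_coe_le_norm x) (((wt_zero_le' N x).trans h1).trans h2) (wt_pos _ _ _).le
    (norm_nonneg _)

theorem continuous_wmul (i : ℕ) (F : ℝ →ᵇ ℂ) : Continuous (wmul N i F) :=
  (Complex.continuous_ofReal.comp (continuous_wt N i)).mul F.continuous

theorem rightInt_J_wmul (ha : 0 ≤ a.re) (F : ℝ →ᵇ ℂ) : RightInt (J a (wmul N 0 F)) := by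
  have h := wmul_op N 0 ha F
  rw [Fin.val_zero, zero_add] at h
  rw [← h]
  exact rightInt_wmul N 1 (by norm_num) _

theorem J_comm_wmul (ha : 0 ≤ a.re) (hb : 0 ≤ b.re) (F : ℝ →ᵇ ℂ) :
    J b (J a (wmul N 0 F)) = J a (J b (wmul N 0 F)) := by
  by_cases hab : a = b
  · rw [hab]
  ext x
  have h := rightInt_wmul N 0 (by norm_num) F
  rw [J_J h ha hb hab (rightInt_J_wmul N ha F), J_J h hb ha (Ne.symm hab) (rightInt_J_wmul N hb F),
    ← neg_sub b a, div_neg, ← neg_div, neg_sub]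

/-- The equation contains a and b only through the commuting operators J a and J b. -/
theorem triSol_swap (ha : 0 ≤ a.re) (hb : 0 ≤ b.re) :
    triSol N q p lam a b = triSol N q p lam b a := by
  refine eq_triSol N q p hb ha fun x => ?_
  rw [← J_comm_wmul N ha hb]
  exact triEq_triSol N q p ha hb x

theorem triT_swap (z : ℂ) (ha : 0 ≤ a.re) (hb : 0 ≤ b.re) :
    triT N q p z lam a b = triT N q p z lam b a := by
  rw [triT, triT, triSol_swap N q p ha hb]

end Tri

/-- The coefficients `∏_{m ≠ i} (λ_i - λ_m)⁻¹`. -/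
noncomputable def coef (lam : Fin 3 → ℂ) (i : Fin 3) : ℂ :=
  ((lam i - lam (i + 1)) * (lam i - lam (i + 2)))⁻¹

theorem sum_fin_three (j : Fin 3) (f : Fin 3 → ℂ) : ∑ i, f i = f j + f (j + 1) + f (j + 2) := by
  rw [Fin.sum_univ_three]
  fin_cases j
  · rfl
  · change f 0 + f 1 + f 2 = f 1 + f 2 + f 0; ring
  · change f 0 + f 1 + f 2 = f 2 + f 0 + f 1; ring

/-- `g` solves the scalar Volterra equation equivalent to the equation for the `j`th column. -/
structure IsG (q p : ℝ → ℂ) (lam : Fin 3 → ℂ) (j : Fin 3) (g : ℝ → ℂ) : Prop where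
  cont : Continuous g
  bound : ∃ C, ∀ x, ‖g x‖ ≤ C * (1 + x ^ 2)⁻¹
  eq : ∀ x, g x = q x + p x * lam j +
    ∑ i, coef lam i * (q x + p x * lam i) * J (lam i - lam j) g x

theorem IsG.rightInt {q p : ℝ → ℂ} {lam : Fin 3 → ℂ} {j : Fin 3} {g : ℝ → ℂ}
    (h : IsG q p lam j g) : RightInt g := by
  obtain ⟨C, hC⟩ := h.bound
  exact rightInt_of_bound h.cont hC

/-- Write q + p l_i = (q + p l_j) + p (l_i - l_j). With a = l_{j+1} - l_j and b = l_{j+2} - l_j,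
partial fractions give Σ c_i J(l_i - l_j) = J_0 J_b J_a and Σ c_i (l_i - l_j) J(l_i - l_j) = J_b
J_a, so the triangular and the diagonal equations coincide when the exponents are distinct. -/
theorem isG_triSol (N : ℕ) (q p : SchwartzMap ℝ ℂ) {lam : Fin 3 → ℂ} (hlam : Function.Injective lam)
    {j : Fin 3} (hj : ∀ i, 0 ≤ (lam i - lam j).re) :
    IsG q p lam j (wmul N 0 (triSol N q p (lam j) (lam (j + 1) - lam j) (lam (j + 2) - lam j))) := by
  set F := triSol N q p (lam j) (lam (j + 1) - lam j) (lam (j + 2) - lam j) with hF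
  have hne : ∀ i m, i ≠ m → lam i - lam m ≠ 0 := fun i m h => sub_ne_zero.2 (hlam.ne h)
  have d1 : j ≠ j + 1 := by fin_cases j <;> decide
  have d2 : j ≠ j + 2 := by fin_cases j <;> decide
  have d3 : j + 1 ≠ j + 2 := by fin_cases j <;> decide
  have e1 : j + 1 + 1 = j + 2 := by fin_cases j <;> rfl
  have e2 : j + 1 + 2 = j := by fin_cases j <;> rfl
  have e3 : j + 2 + 1 = j := by fin_cases j <;> rfl
  have e4 : j + 2 + 2 = j + 1 := by fin_cases j <;> rfl
  refine ⟨continuous_wmul N 0 _, ⟨_, norm_wmul_zero_le N _⟩, fun x => ?_⟩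
  have ha := hj (j + 1)
  have hb := hj (j + 2)
  have hg := rightInt_wmul N 0 (by norm_num) F
  set g := wmul N 0 F with hgdef
  have hab : lam (j + 1) - lam j ≠ lam (j + 2) - lam j := by
    intro h; exact hne _ _ d3 (by linear_combination h)
  have hJa := rightInt_J_wmul N ha F
  have hJb := rightInt_J_wmul N hb F
  have h1 : ∀ x, J (lam (j + 2) - lam j) (J (lam (j + 1) - lam j) g) x = _ :=
    J_J hg ha hb hab hJa
  have z0 : (0:ℝ) ≤ (0:ℂ).re := le_rfl
  have h2 : J 0 (J (lam (j + 2) - lam j) (J (lam (j + 1) - lam j) g)) x =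
      ((J (lam (j + 1) - lam j) g x - J 0 g x) / (lam (j + 1) - lam j) -
       (J (lam (j + 2) - lam j) g x - J 0 g x) / (lam (j + 2) - lam j)) /
       ((lam (j + 1) - lam j) - (lam (j + 2) - lam j)) := by
    have e : J (lam (j + 2) - lam j) (J (lam (j + 1) - lam j) g) = fun x =>
        ((lam (j + 1) - lam j) - (lam (j + 2) - lam j))⁻¹ * J (lam (j + 1) - lam j) g x +
        (-((lam (j + 1) - lam j) - (lam (j + 2) - lam j))⁻¹) * J (lam (j + 2) - lam j) g x := by
      ext x; rw [h1]; ring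
    rw [e, J_add (hJa.const_mul _) (hJb.const_mul _) z0, J_const_mul, J_const_mul,
      J_J hg ha z0 (hne _ _ d1.symm) hJa, J_J hg hb z0 (hne _ _ d2.symm) hJb]
    ring
  have h3 := triEq_triSol N q p (lam := lam j) ha hb x
  rw [← hF, ← hgdef, h2, h1] at h3
  rw [h3, sum_fin_three j]
  simp only [coef, e1, e2, e3, e4, sub_self]
  have n1 := hne _ _ d1
  have n2 := hne _ _ d2
  have n3 := hne _ _ d3
  have n1' := hne _ _ d1.symm
  have n2' := hne _ _ d2.symm
  have n3' := hne _ _ d3.symm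
  have n4 : (lam (j + 1) - lam j) - (lam (j + 2) - lam j) ≠ 0 := by
    rw [sub_sub_sub_cancel_right]; exact n3
  generalize J (lam (j + 1) - lam j) g x = A
  generalize J (lam (j + 2) - lam j) g x = B
  generalize J 0 g x = C
  generalize lam (j + 1) = u at *
  generalize lam (j + 2) = v at *
  generalize lam j = w at *
  generalize q x = Q
  generalize p x = R
  rw [sub_sub_sub_cancel_right]
  have k1 : w - u = -(u - w) := by ring
  have k2 : w - v = -(v - w) := by ring
  have k3 : v - u = -(u - v) := by ring
  rw [k1, k2, k3]
  field_simp
  ring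

end

/-! ### The diagonal form of the scalar equation -/

section

section Diag
variable (N : ℕ) (q p : SchwartzMap ℝ ℂ) (α β a : Fin 3 → ℂ)

/-- The Volterra operator in diagonal form. -/
noncomputable def diagOp : (ℝ →ᵇ ℂ) →L[ℂ] (ℝ →ᵇ ℂ) :=
  ∑ i, (α i • mulOp (wfun N q 1) + β i • mulOp (wfun N p 1)) * (wker N 0).op 0 (a i)

theorem diagOp_apply (F : ℝ →ᵇ ℂ) (x : ℝ) :
    diagOp N q p α β a F x = ∑ i, (α i * wfun N q 1 x + β i * wfun N p 1 x) *
      (wker N 0).op 0 (a i) F x := by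
  simp [diagOp, mulOp_apply, Fin.sum_univ_three, add_mul, mul_assoc]

/-- The bound depends on the coefficients only through M and not on the exponents; it becomes
uniform along the ray. -/
theorem isUnit_diagOp {M : ℝ} (hM : ∑ i, (‖α i‖ * ‖wfun N q 1‖ + ‖β i‖ * ‖wfun N p 1‖) ≤ M) :
    IsUnit (1 - diagOp N q p α β a) ∧
      ‖Ring.inverse (1 - diagOp N q p α β a)‖ ≤ 2 * Real.exp (|2 * M + 1| * 4) := by
  have hM0 : 0 ≤ M := (Finset.sum_nonneg fun i _ => by positivity).trans hM
  have hL : 0 < 2 * M + 1 := by linarith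
  refine isUnit_one_sub_of_weight fun F C hF x => ?_
  have hC : 0 ≤ C := nonneg_of_mul_nonneg_left ((norm_nonneg _).trans (hF 0)) (bw_pos _ 0)
  have hbw := (bw_pos (2 * M + 1) x).le
  rw [diagOp_apply]
  calc _ ≤ ∑ i, (‖α i‖ * ‖wfun N q 1‖ + ‖β i‖ * ‖wfun N p 1‖) *
        (C / (2 * M + 1) * bw (2 * M + 1) x) := by
        refine (norm_sum_le _ _).trans (Finset.sum_le_sum fun i _ => ?_)
        rw [norm_mul]
        gcongr
        · refine (norm_add_le _ _).trans ?_
          rw [norm_mul, norm_mul]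
          gcongr <;> exact BoundedContinuousFunction.norm_coe_le_norm _ _
        · exact (wker N 0).norm_op_weight_le hL 0 (a i) F hF x
    _ ≤ M * (C / (2 * M + 1) * bw (2 * M + 1) x) := by
        rw [← Finset.sum_mul]; gcongr
    _ = (M / (2 * M + 1)) * C * bw (2 * M + 1) x := by ring
    _ ≤ (1 / 2) * C * bw (2 * M + 1) x := by
        have : M / (2 * M + 1) ≤ 1 / 2 := by rw [div_le_div_iff₀ hL (by norm_num)]; linarith
        gcongr
    _ = _ := by ring

/-- The solution of the Volterra equation in diagonal form with inhomogeneity `γ q + δ p`. -/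
noncomputable def diagSol (γ δ : ℂ) : ℝ →ᵇ ℂ :=
  Ring.inverse (1 - diagOp N q p α β a) (γ • wfun N q 4 + δ • wfun N p 4)

theorem wmul_diagSol (ha : ∀ i, 0 ≤ (a i).re) (γ δ : ℂ) (x : ℝ) :
    wmul N 0 (diagSol N q p α β a γ δ) x = γ * q x + δ * p x +
      ∑ i, (α i * q x + β i * p x) * J (a i) (wmul N 0 (diagSol N q p α β a γ δ)) x := by
  set F := diagSol N q p α β a γ δ with hF
  have hu := (isUnit_diagOp N q p α β a le_rfl).1
  have h : ((1 - diagOp N q p α β a) * Ring.inverse (1 - diagOp N q p α β a))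
      (γ • wfun N q 4 + δ • wfun N p 4) = γ • wfun N q 4 + δ • wfun N p 4 := by
    rw [Ring.mul_inverse_cancel _ hu]; rfl
  have h2 : F - diagOp N q p α β a F = γ • wfun N q 4 + δ • wfun N p 4 := h
  have h3 : F = γ • wfun N q 4 + δ • wfun N p 4 + diagOp N q p α β a F := by rw [← h2]; abel
  have e1 := wt_mul_wfun N q 4 x
  have e2 := wt_mul_wfun N p 4 x
  simp only [wt, Complex.ofReal_one, mul_one] at e1 e2
  have e3 := wt_mul_wfun N q 1 x
  have e4 := wt_mul_wfun N p 1 x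
  have h4 : wmul N 0 F x = (wt N 0 x : ℂ) * (γ * wfun N q 4 x + δ * wfun N p 4 x +
      ∑ i, (α i * wfun N q 1 x + β i * wfun N p 1 x) * (wker N 0).op 0 (a i) F x) := by
    conv_lhs => rw [h3]
    rw [wmul, BoundedContinuousFunction.add_apply, diagOp_apply]
    rfl
  have h5 : ∀ i, J (a i) (wmul N 0 F) x = (wt N 1 x : ℂ) * (wker N 0).op 0 (a i) F x := by
    intro i
    have h := congrFun (wmul_op N 0 (ha i) F) x
    rw [Fin.val_zero, zero_add] at h
    rw [← h]; rfl
  have h6 : (wt N 0 x : ℂ) * ∑ i, (α i * wfun N q 1 x + β i * wfun N p 1 x) *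
      (wker N 0).op 0 (a i) F x = ∑ i, (α i * q x + β i * p x) * J (a i) (wmul N 0 F) x := by
    rw [Finset.mul_sum]
    refine Finset.sum_congr rfl fun i _ => ?_
    rw [h5]
    linear_combination (α i * (wker N 0).op 0 (a i) F x) * e3 +
      (β i * (wker N 0).op 0 (a i) F x) * e4
  rw [h4, mul_add, h6]
  simp only [wt]
  linear_combination γ * e1 + δ * e2

end Diag

/-- The solution of the diagonal equation with inhomogeneity multiplied by `m`, divided by `m`,
solves the equation for the `j`th column. -/
theorem isG_diagSol (N : ℕ) (q p : SchwartzMap ℝ ℂ) {lam : Fin 3 → ℂ}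
    {j : Fin 3} (hj : ∀ i, 0 ≤ (lam i - lam j).re) {m : ℂ} (hm : m ≠ 0) :
    IsG q p lam j (fun x => m⁻¹ * wmul N 0 (diagSol N q p (coef lam) (fun i => coef lam i * lam i)
      (fun i => lam i - lam j) m (m * lam j)) x) := by
  set F := diagSol N q p (coef lam) (fun i => coef lam i * lam i)
      (fun i => lam i - lam j) m (m * lam j) with hF
  refine ⟨continuous_const.mul (continuous_wmul N 0 _), ⟨‖m⁻¹‖ * ‖F‖, fun x => ?_⟩, fun x => ?_⟩
  · rw [norm_mul, mul_assoc]
    exact mul_le_mul_of_nonneg_left (norm_wmul_zero_le N _ x) (norm_nonneg _)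
  · have h := wmul_diagSol N q p (coef lam) (fun i => coef lam i * lam i)
      (fun i => lam i - lam j) hj m (m * lam j) x
    rw [← hF] at h
    rw [h]
    simp only [J_const_mul, Fin.sum_univ_three]
    field_simp

/-- The `j`th column of `X` in terms of the scalar solution. -/
noncomputable def colOf (lam : Fin 3 → ℂ) (j : Fin 3) (g : ℝ → ℂ) (x : ℝ) (i : Fin 3) : ℂ :=
  (1 : Matrix (Fin 3) (Fin 3) ℂ) i j + coef lam i * J (lam i - lam j) g x

/-- These are the second divided differences of 1, λ and λ². -/
theorem coef_sums {lam : Fin 3 → ℂ} (hlam : Function.Injective lam) :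
    (∑ i, coef lam i = 0) ∧ (∑ i, lam i * coef lam i = 0) ∧ ∑ i, lam i ^ 2 * coef lam i = 1 := by
  have h01 : lam 0 - lam 1 ≠ 0 := sub_ne_zero.2 (hlam.ne (by decide))
  have h02 : lam 0 - lam 2 ≠ 0 := sub_ne_zero.2 (hlam.ne (by decide))
  have h12 : lam 1 - lam 2 ≠ 0 := sub_ne_zero.2 (hlam.ne (by decide))
  have c0 : coef lam 0 = ((lam 0 - lam 1) * (lam 0 - lam 2))⁻¹ := rfl
  have c1 : coef lam 1 = -((lam 1 - lam 2) * (lam 0 - lam 1))⁻¹ := by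
    have : coef lam 1 = ((lam 1 - lam 2) * (lam 1 - lam 0))⁻¹ := rfl
    rw [this, ← neg_sub (lam 0), mul_neg, inv_neg]
  have c2 : coef lam 2 = ((lam 0 - lam 2) * (lam 1 - lam 2))⁻¹ := by
    have : coef lam 2 = ((lam 2 - lam 0) * (lam 2 - lam 1))⁻¹ := rfl
    rw [this, ← neg_sub (lam 0), ← neg_sub (lam 1), neg_mul_neg]
  simp only [Fin.sum_univ_three, c0, c1, c2]
  refine ⟨?_, ?_, ?_⟩ <;> (field_simp; ring)

/-- This closes the loop: the column built from g reproduces g as its image under the row q + p l_m,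
so the scalar equation is equivalent to the system. -/
theorem sum_colOf {lam : Fin 3 → ℂ} {j : Fin 3} {q p : ℝ → ℂ} {g : ℝ → ℂ}
    (hg : IsG q p lam j g) (x : ℝ) :
    ∑ m, (q x + p x * lam m) * colOf lam j g x m = g x := by
  rw [hg.eq x]
  simp only [colOf, mul_add, Finset.sum_add_distrib]
  congr 1
  · simp [Matrix.one_apply]
  · exact Finset.sum_congr rfl fun i _ => by ring

end

/-! ### The exponents and the rank one structure of the potential -/

section

/-- `√3` as a complex number. -/
noncomputable def s3 : ℂ := (Real.sqrt 3 : ℂ)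

theorem s3_sq : s3 ^ 2 = 3 := by
  rw [s3, ← Complex.ofReal_pow, Real.sq_sqrt (by norm_num)]; norm_num

theorem s3_ne : s3 ≠ 0 := by
  intro h; have := s3_sq; rw [h] at this; norm_num at this

theorem conj_s3 : (starRingEnd ℂ) s3 = s3 := Complex.conj_ofReal _

theorem omega_eq : ω₃ = (-1 + Complex.I * s3) / 2 := by
  have h : (2 * Real.pi * Complex.I / 3 : ℂ) = ((2 * Real.pi / 3 : ℝ) : ℂ) * Complex.I := by
    push_cast; ring
  have h2 : 2 * Real.pi / 3 = Real.pi - Real.pi / 3 := by ring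
  rw [ω₃, h, Complex.exp_mul_I, ← Complex.ofReal_cos, ← Complex.ofReal_sin, h2, Real.cos_pi_sub,
    Real.sin_pi_sub, Real.cos_pi_div_three, Real.sin_pi_div_three, s3]
  push_cast; ring

theorem omega_cube : ω₃ ^ 3 = 1 := by
  rw [omega_eq]
  linear_combination (-3 / 8 + (1 / 8) * (Complex.I * s3)) * s3 ^ 2 * Complex.I_sq +
    (3/8 - (1/8) * Complex.I * s3) * s3_sq

theorem omega_sum : 1 + ω₃ + ω₃ ^ 2 = 0 := by
  rw [omega_eq]
  linear_combination (1/4) * s3 ^ 2 * Complex.I_sq - (1/4) * s3_sq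

theorem omega_ne : ω₃ ≠ 0 := fun h => by have := omega_cube; rw [h] at this; norm_num at this

theorem conj_omega : (starRingEnd ℂ) ω₃ = ω₃ ^ 2 := by
  have h : ω₃ ^ 2 = -1 - ω₃ := by linear_combination omega_sum
  rw [h, omega_eq]
  simp only [map_div₀, map_add, map_neg, map_one, map_mul, Complex.conj_I, conj_s3, map_ofNat]
  ring

theorem omega_inv : ω₃⁻¹ = ω₃ ^ 2 := by
  refine inv_eq_of_mul_eq_one_right ?_
  linear_combination omega_cube

theorem norm_omega : ‖ω₃‖ = 1 := by
  have h := congrArg norm omega_cube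
  rw [norm_pow, norm_one] at h
  exact (pow_eq_one_iff_of_nonneg (norm_nonneg _) (by norm_num)).1 h

/-- The triple `(l₁, l₂, l₃)`. -/
noncomputable def lam (k : ℂ) (i : Fin 3) : ℂ := l i k

theorem lam_zero (k : ℂ) : lam k 0 = Complex.I * (ω₃ * k + ω₃ ^ 2 * k⁻¹) / (2 * s3) := by
  simp only [lam, l, s3, Fin.val_zero, zero_add, pow_one, mul_inv, omega_inv]

theorem lam_one (k : ℂ) : lam k 1 = Complex.I * (ω₃ ^ 2 * k + ω₃ * k⁻¹) / (2 * s3) := by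
  have : (ω₃ ^ 2)⁻¹ = ω₃ := by rw [← omega_inv, inv_inv]
  simp only [lam, l, s3, Fin.val_one, one_add_one_eq_two, mul_inv, this]

theorem lam_two (k : ℂ) : lam k 2 = Complex.I * (k + k⁻¹) / (2 * s3) := by
  have h : ω₃ ^ (2 + 1) = 1 := omega_cube
  simp only [lam, l, s3, Fin.val_two, h, one_mul]

theorem lam_zero_sub_one (k : ℂ) : lam k 0 - lam k 1 = -(k - k⁻¹) / 2 := by
  have h : ω₃ - ω₃ ^ 2 = Complex.I * s3 := by
    have : ω₃ - ω₃ ^ 2 = 2 * ω₃ + 1 := by linear_combination -omega_sum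
    rw [this, omega_eq]; ring
  have h1 : lam k 0 - lam k 1 = Complex.I * (ω₃ - ω₃ ^ 2) * (k - k⁻¹) / (2 * s3) := by
    rw [lam_zero, lam_one]; ring
  rw [h1, h, div_eq_div_iff (mul_ne_zero two_ne_zero s3_ne) two_ne_zero]
  linear_combination 2 * s3 * (k - k⁻¹) * Complex.I_sq

/-- The constant `i (ω - 1) / (2√3)`. -/
noncomputable def cst : ℂ := Complex.I * (ω₃ - 1) / (2 * s3)

theorem omega_ne_one : ω₃ ≠ 1 := fun h => by
  have := omega_sum; rw [h] at this; norm_num at this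

theorem cst_ne : cst ≠ 0 := div_ne_zero (mul_ne_zero Complex.I_ne_zero (sub_ne_zero.2 omega_ne_one))
  (mul_ne_zero two_ne_zero s3_ne)

theorem lam_zero_sub_two (k : ℂ) : lam k 0 - lam k 2 = cst * (k - ω₃ ^ 2 * k⁻¹) := by
  rw [lam_zero, lam_two, cst]
  linear_combination (Complex.I * k⁻¹ / (2 * s3)) * omega_cube

theorem lam_one_sub_two (k : ℂ) : lam k 1 - lam k 2 = cst * (k⁻¹ - ω₃ ^ 2 * k) := by
  rw [lam_one, lam_two, cst]
  linear_combination (Complex.I * k / (2 * s3)) * omega_cube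

theorem mem_setQ {k : ℂ} : k ∈ setQ ↔ k ^ 6 = 1 := by
  constructor
  · rintro ⟨j, _, rfl⟩
    rw [κ, ← Complex.exp_nat_mul]
    have : ((6 : ℕ) : ℂ) * (Real.pi * Complex.I * ((j : ℂ) - 1) / 3) = ((j : ℤ) - 1 : ℤ) * (2 * Real.pi * Complex.I) := by
      push_cast; ring
    rw [this, Complex.exp_int_mul_two_pi_mul_I]
  · intro h
    obtain ⟨i, hi, rfl⟩ := (Complex.isPrimitiveRoot_exp 6 (by norm_num)).eq_pow_of_pow_eq_one h
    refine ⟨i + 1, ⟨by omega, by omega⟩, ?_⟩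
    rw [κ, ← Complex.exp_nat_mul]
    congr 1; push_cast; ring

/-- The three factors are the conditions for l_1 = l_2, l_1 = l_3 and l_2 = l_3; their union is 𝒬.
-/
theorem six_factor (k : ℂ) : k ^ 6 - 1 = (k ^ 2 - 1) * (k ^ 2 - ω₃ ^ 2) * (k ^ 2 - ω₃) := by
  have h1 := omega_cube
  have h2 := omega_sum
  linear_combination (k ^ 2 - 1) * k ^ 2 * h2 - (k ^ 2 - 1) * h1

theorem lam_injective {k : ℂ} (hk : k ∉ setQhat) : Function.Injective (lam k) := by
  have h0 : k ≠ 0 := fun h => hk (Or.inr h)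
  have h6 : k ^ 6 - 1 ≠ 0 := fun h => hk (Or.inl (mem_setQ.2 (sub_eq_zero.1 h)))
  rw [six_factor] at h6
  have ha : k ^ 2 - 1 ≠ 0 := fun h => h6 (by rw [h]; ring)
  have hb : k ^ 2 - ω₃ ^ 2 ≠ 0 := fun h => h6 (by rw [h]; ring)
  have hc : k ^ 2 - ω₃ ≠ 0 := fun h => h6 (by rw [h]; ring)
  have e01 : lam k 0 - lam k 1 ≠ 0 := by
    rw [lam_zero_sub_one]
    intro h; apply ha; field_simp at h; linear_combination -h
  have e02 : lam k 0 - lam k 2 ≠ 0 := by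
    rw [lam_zero_sub_two]
    refine mul_ne_zero cst_ne fun h => hb ?_
    field_simp at h; linear_combination h
  have e12 : lam k 1 - lam k 2 ≠ 0 := by
    rw [lam_one_sub_two]
    refine mul_ne_zero cst_ne fun h => hc ?_
    field_simp at h
    linear_combination -ω₃ * h + (-k^2) * omega_cube
  have e10 := neg_ne_zero.2 e01
  have e20 := neg_ne_zero.2 e02
  have e21 := neg_ne_zero.2 e12
  rw [neg_sub] at e10 e20 e21
  intro i m h
  have h' := sub_eq_zero.2 h
  fin_cases i <;> fin_cases m <;> first | rfl | (exfalso; revert h'; assumption)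

/-- The lower left entry of the potential matrix, as a Schwartz function. -/
noncomputable def qS (u v : SchwartzMap ℝ ℝ) : SchwartzMap ℝ ℂ :=
  (-1 / 4 : ℂ) • SchwartzMap.postcompCLM (𝕜 := ℝ) Complex.ofRealCLM (SchwartzMap.derivCLM ℝ ℝ u) +
    (-Complex.I / (4 * s3)) • SchwartzMap.postcompCLM (𝕜 := ℝ) Complex.ofRealCLM v

/-- The other nonzero entry of the potential matrix, as a Schwartz function. -/
noncomputable def pS (u : SchwartzMap ℝ ℝ) : SchwartzMap ℝ ℂ :=
  (-1 / 2 : ℂ) • SchwartzMap.postcompCLM (𝕜 := ℝ) Complex.ofRealCLM u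

theorem qS_apply (u v : SchwartzMap ℝ ℝ) (x : ℝ) : qS u v x =
    -((deriv u x : ℝ) : ℂ) / 4 - Complex.I * ((v x : ℝ) : ℂ) / (4 * s3) := by
  have : qS u v x = (-1 / 4 : ℂ) * ((deriv u x : ℝ) : ℂ) + (-Complex.I / (4 * s3)) * (v x : ℂ) := rfl
  rw [this]; ring

theorem pS_apply (u : SchwartzMap ℝ ℝ) (x : ℝ) : pS u x = -((u x : ℝ) : ℂ) / 2 := by
  have : pS u x = (-1 / 2 : ℂ) * (u x : ℂ) := rfl
  rw [this]; ring

theorem det_P (k : ℂ) : (P k).det =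
    (lam k 1 - lam k 0) * (lam k 2 - lam k 0) * (lam k 2 - lam k 1) := by
  have : P k = !![1, 1, 1; lam k 0, lam k 1, lam k 2; lam k 0 ^ 2, lam k 1 ^ 2, lam k 2 ^ 2] := by
    ext i j; fin_cases i <;> fin_cases j <;> simp [P, lam]
  rw [this, Matrix.det_fin_three]
  simp; ring

/-- The potential sees only the last column of P⁻¹, which consists of the numbers c_i by Lagrange
interpolation. -/
theorem U_apply {u v : SchwartzMap ℝ ℝ} {k : ℂ} (hk : k ∉ setQhat) (x : ℝ) (i m : Fin 3) :
    U u v x k i m = coef (lam k) i * (qS u v x + pS u x * lam k m) := by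
  have hinj := lam_injective hk
  have hdet : IsUnit (P k).det := by
    rw [det_P, isUnit_iff_ne_zero]
    exact mul_ne_zero (mul_ne_zero (sub_ne_zero.2 (hinj.ne (by decide)))
      (sub_ne_zero.2 (hinj.ne (by decide)))) (sub_ne_zero.2 (hinj.ne (by decide)))
  set V : Matrix (Fin 3) (Fin 3) ℂ := Matrix.of fun i m =>
    coef (lam k) i * (qS u v x + pS u x * lam k m) with hV
  obtain ⟨c0, c1, c2⟩ := coef_sums hinj
  -- The three rows of this identity are the three moment sums of the c_i.
  have h : P k * V = potential u v x * P k := by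
    rw [Fin.sum_univ_three] at c0 c1 c2
    ext a b
    simp only [Matrix.mul_apply, Fin.sum_univ_three]
    have hP : ∀ i j, P k i j = lam k j ^ (i : ℕ) := fun i j => rfl
    have hq := qS_apply u v x
    have hp := pS_apply u x
    simp only [hP, hV, Matrix.of_apply]
    fin_cases a
    · simp [potential]
      linear_combination (qS u v x + pS u x * lam k b) * c0
    · simp [potential]
      linear_combination (qS u v x + pS u x * lam k b) * c1
    · simp only [potential, Matrix.of_apply, Matrix.cons_val', Matrix.cons_val]
      rw [s3] at hq
      rw [← hq, ← hp]
      simp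
      linear_combination (qS u v x + pS u x * lam k b) * c2
  have : U u v x k = V := by
    rw [U, Matrix.mul_assoc, ← h, ← Matrix.mul_assoc, Matrix.nonsing_inv_mul _ hdet, one_mul]
  rw [this]; rfl

end

/-! ### Columns of X, the scattering matrix and its symmetries -/

section

theorem schwartz_bound_sq (f : SchwartzMap ℝ ℂ) : ∃ C, 0 ≤ C ∧ ∀ x, ‖f x‖ ≤ C * (1 + x ^ 2)⁻¹ := by
  obtain ⟨C, hC⟩ := schwartz_bound f 2
  refine ⟨C, le_trans (by positivity) (hC 0), fun x => ?_⟩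
  rw [← div_eq_mul_inv, le_div_iff₀ (by positivity), mul_comm]
  refine le_trans ?_ (hC x)
  gcongr
  nlinarith [abs_nonneg x, sq_abs x]

/-- Uniqueness for systems of Volterra equations from `+∞`. -/
theorem volterra_unique {V : ℝ → Matrix (Fin 3) (Fin 3) ℂ} {M : ℝ}
    (hV : ∀ y i m, ‖V y i m‖ ≤ M * (1 + y ^ 2)⁻¹) {E : ℝ → Fin 3 → ℝ → ℂ}
    (hE : ∀ x i y, x < y → ‖E x i y‖ ≤ 1) {e : Fin 3 → ℂ} {σ : ℂ} (hσ : ‖σ‖ ≤ 1)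
    {φ φ' : ℝ → Fin 3 → ℂ} (hb : ∀ a : ℝ, ∃ C : ℝ, ∀ x, a ≤ x → ∀ i, ‖φ x i‖ ≤ C)
    (hb' : ∀ a : ℝ, ∃ C : ℝ, ∀ x, a ≤ x → ∀ i, ‖φ' x i‖ ≤ C)
    (hi : ∀ x i, IntegrableOn (fun y => E x i y * (V y).mulVec (φ y) i) (Ioi x))
    (hi' : ∀ x i, IntegrableOn (fun y => E x i y * (V y).mulVec (φ' y) i) (Ioi x))
    (he : ∀ x i, φ x i = e i + σ * ∫ y in Ioi x, E x i y * (V y).mulVec (φ y) i)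
    (he' : ∀ x i, φ' x i = e i + σ * ∫ y in Ioi x, E x i y * (V y).mulVec (φ' y) i) : φ = φ' := by
  have hM : 0 ≤ M := by
    have := (norm_nonneg _).trans (hV 0 0 0)
    simpa using this
  -- Summing over three components gives the factor 3M/L, which is at most 1/2 for L = 6M + 1.
  have key := eq_zero_of_volterra (D := fun x => ∑ i, ‖φ x i - φ' x i‖) (L := 6 * M + 1)
    (fun x => Finset.sum_nonneg fun i _ => norm_nonneg _) (fun a => ?_) (fun x S hS => ?_)
  · ext x i
    have h := (Finset.sum_eq_zero_iff_of_nonneg fun i _ => norm_nonneg _).1 (key x) i (Finset.mem_univ _)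
    exact sub_eq_zero.1 (norm_eq_zero.1 h)
  · obtain ⟨C, hC⟩ := hb a
    obtain ⟨C', hC'⟩ := hb' a
    refine ⟨∑ _i : Fin 3, (C + C'), fun x hx => Finset.sum_le_sum fun i _ => ?_⟩
    exact (norm_sub_le _ _).trans (add_le_add (hC x hx i) (hC' x hx i))
  · have hL : 0 < 6 * M + 1 := by linarith
    have hS0 : 0 ≤ S := nonneg_of_mul_nonneg_left
      ((Finset.sum_nonneg fun i _ => norm_nonneg _).trans (hS x le_rfl)) (bw_pos _ x)
    have hbnd : ∀ i, ‖φ x i - φ' x i‖ ≤ M * S * (bw (6 * M + 1) x / (6 * M + 1)) := by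
      intro i
      have e1 : φ x i - φ' x i = σ * ∫ y in Ioi x, (E x i y * (V y).mulVec (φ y) i -
          E x i y * (V y).mulVec (φ' y) i) := by
        rw [integral_sub (hi x i) (hi' x i), he, he']; ring
      rw [e1, norm_mul]
      refine (mul_le_of_le_one_left (norm_nonneg _) hσ).trans ?_
      refine (norm_integral_le_of_norm_le (((integrable_inv_mul_bw (6 * M + 1)).const_mul
        (M * S)).integrableOn) ((ae_restrict_iff' measurableSet_Ioi).2
          (ae_of_all _ fun y hy => ?_))).trans ?_
      · rw [← mul_sub, norm_mul]
        refine (mul_le_of_le_one_left (norm_nonneg _) (hE x i y hy)).trans ?_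
        have e2 : (V y).mulVec (φ y) i - (V y).mulVec (φ' y) i = ∑ m, V y i m * (φ y m - φ' y m) := by
          simp [Matrix.mulVec, dotProduct, ← Finset.sum_sub_distrib, mul_sub]
        rw [e2]
        calc _ ≤ ∑ m, M * (1 + y ^ 2)⁻¹ * ‖φ y m - φ' y m‖ := by
              refine (norm_sum_le _ _).trans (Finset.sum_le_sum fun m _ => ?_)
              rw [norm_mul]
              exact mul_le_mul_of_nonneg_right (hV y i m) (norm_nonneg _)
          _ ≤ M * (1 + y ^ 2)⁻¹ * (S * bw (6 * M + 1) y) := by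
              rw [← Finset.mul_sum]
              exact mul_le_mul_of_nonneg_left (hS y (le_of_lt hy)) (by positivity)
          _ = _ := by ring
      · rw [integral_const_mul]
        exact mul_le_mul_of_nonneg_left (integral_inv_mul_bw_le hL x) (by positivity)
    calc ∑ i, ‖φ x i - φ' x i‖ ≤ ∑ _i : Fin 3, M * S * (bw (6 * M + 1) x / (6 * M + 1)) :=
          Finset.sum_le_sum fun i _ => hbnd i
      _ = (3 * M / (6 * M + 1)) * S * bw (6 * M + 1) x := by simp; ring
      _ ≤ 1 / 2 * S * bw (6 * M + 1) x := by
          have : 3 * M / (6 * M + 1) ≤ 1 / 2 := by rw [div_le_div_iff₀ hL (by norm_num)]; linarith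
          have := (bw_pos (6 * M + 1) x).le
          gcongr
      _ = _ := by ring

variable {u v : SchwartzMap ℝ ℝ} {k : ℂ}

theorem U_bound (hk : k ∉ setQhat) : ∃ M, ∀ y i m, ‖U u v y k i m‖ ≤ M * (1 + y ^ 2)⁻¹ := by
  obtain ⟨C, hC0, hC⟩ := schwartz_bound_sq (qS u v)
  obtain ⟨D, hD0, hD⟩ := schwartz_bound_sq (pS u)
  refine ⟨∑ i, ∑ m, ‖coef (lam k) i‖ * (C + D * ‖lam k m‖), fun y i m => ?_⟩
  have h1 : ‖U u v y k i m‖ ≤ ‖coef (lam k) i‖ * (C + D * ‖lam k m‖) * (1 + y ^ 2)⁻¹ := by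
    rw [U_apply hk, norm_mul]
    calc _ ≤ ‖coef (lam k) i‖ * (C * (1 + y ^ 2)⁻¹ + D * (1 + y ^ 2)⁻¹ * ‖lam k m‖) := by
          gcongr
          refine (norm_add_le _ _).trans ?_
          rw [norm_mul]
          exact add_le_add (hC y) (mul_le_mul_of_nonneg_right (hD y) (norm_nonneg _))
      _ = _ := by ring
  refine h1.trans (mul_le_mul_of_nonneg_right ?_ (by positivity))
  have h2 : ∀ i, ∀ m, 0 ≤ ‖coef (lam k) i‖ * (C + D * ‖lam k m‖) := fun i m => by positivity
  exact (Finset.single_le_sum (f := fun m => ‖coef (lam k) i‖ * (C + D * ‖lam k m‖))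
    (fun m _ => h2 i m) (Finset.mem_univ m)).trans
    (Finset.single_le_sum (f := fun i => ∑ m, ‖coef (lam k) i‖ * (C + D * ‖lam k m‖))
      (fun i _ => Finset.sum_nonneg fun m _ => h2 i m) (Finset.mem_univ i))

/-- The condition under which the `j`th column of `X` exists. -/
def Adm (k : ℂ) (j : Fin 3) : Prop := ∀ i, 0 ≤ (lam k i - lam k j).re

theorem columnX_unique (hk : k ∉ setQhat) {j : Fin 3} (hj : Adm k j) {φ φ' : ℝ → Fin 3 → ℂ}
    (h : IsColumnX u v k j φ) (h' : IsColumnX u v k j φ') : φ = φ' := by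
  obtain ⟨M, hM⟩ := U_bound (u := u) (v := v) hk
  refine volterra_unique (V := fun y => U u v y k) hM
    (E := fun x i y => Complex.exp (((x - y : ℝ) : ℂ) * (l i k - l j k)))
    (fun x i y hxy => norm_exp_mul_le_one (hj i) (by linarith))
    (e := fun i => (1 : Matrix (Fin 3) (Fin 3) ℂ) i j) (σ := -1) (by simp)
    h.bounded h'.bounded h.integrable h'.integrable (fun x i => ?_) (fun x i => ?_)
  · rw [h.equation]; simp [volterraX, sub_eq_add_neg]
  · rw [h'.equation]; simp [volterraX, sub_eq_add_neg]

theorem U_mulVec_colOf (hk : k ∉ setQhat) {j : Fin 3} {g : ℝ → ℂ}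
    (hg : IsG (qS u v) (pS u) (lam k) j g) (y : ℝ) (i : Fin 3) :
    (U u v y k).mulVec (colOf (lam k) j g y) i = coef (lam k) i * g y := by
  rw [← sum_colOf hg y, Finset.mul_sum]
  simp only [Matrix.mulVec, dotProduct, U_apply hk, mul_assoc]

theorem colOf_bounded {lm : Fin 3 → ℂ} {j : Fin 3} (hj : ∀ i, 0 ≤ (lm i - lm j).re) {q p g : ℝ → ℂ}
    (hg : IsG q p lm j g) : ∃ C, ∀ x i, ‖colOf lm j g x i‖ ≤ C := by
  obtain ⟨C, hC⟩ := hg.bound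
  have hC0 : 0 ≤ C := by simpa using (norm_nonneg _).trans (hC 0)
  have hJ : ∀ x i, ‖J (lm i - lm j) g x‖ ≤ C * 4 := by
    intro x i
    refine (norm_J_le (hj i) (integrable_inv_one_add_sq.const_mul C).integrableOn
      fun y _ => hC y).trans ?_
    rw [integral_const_mul]
    refine mul_le_mul_of_nonneg_left (le_trans ?_ integral_inv_le) hC0
    exact setIntegral_le_integral integrable_inv_one_add_sq (ae_of_all _ fun y => by positivity)
  refine ⟨∑ i, (1 + ‖coef lm i‖ * (C * 4)), fun x i => ?_⟩
  refine le_trans ?_ (Finset.single_le_sum (f := fun i => 1 + ‖coef lm i‖ * (C * 4))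
    (fun i _ => by positivity) (Finset.mem_univ i))
  refine (norm_add_le _ _).trans (add_le_add ?_ ?_)
  · rw [Matrix.one_apply]; split_ifs <;> simp
  · rw [norm_mul]; exact mul_le_mul_of_nonneg_left (hJ x i) (norm_nonneg _)

theorem isColumnX_colOf (hk : k ∉ setQhat) {j : Fin 3} (hj : Adm k j) {g : ℝ → ℂ}
    (hg : IsG (qS u v) (pS u) (lam k) j g) : IsColumnX u v k j (colOf (lam k) j g) := by
  have e : ∀ x i y, volterraX u v k j (colOf (lam k) j g) x i y =
      coef (lam k) i * (Complex.exp (((x - y : ℝ) : ℂ) * (lam k i - lam k j)) * g y) := by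
    intro x i y
    rw [volterraX, U_mulVec_colOf hk hg]; simp only [lam]; ring
  refine ⟨fun a => ?_, fun x i => ?_, fun x i => ?_⟩
  · obtain ⟨C, hC⟩ := colOf_bounded hj hg
    exact ⟨C, fun x _ i => hC x i⟩
  · have := (hg.rightInt.expInt (hj i) x).const_mul (coef (lam k) i)
    exact this.congr (ae_of_all _ fun y => (e x i y).symm)
  · simp only [e]
    rw [integral_const_mul, colOf, J]; ring

theorem existsUnique_columnX (hk : k ∉ setQhat) {j : Fin 3} (hj : Adm k j) :
    ∃! φ, IsColumnX u v k j φ := by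
  have := isG_triSol 0 (qS u v) (pS u) (lam_injective hk) hj
  exact ⟨_, isColumnX_colOf hk hj this, fun φ hφ => columnX_unique hk hj hφ (isColumnX_colOf hk hj this)⟩

/-- Uniqueness lets the chosen column be replaced by the one built from any solution g, so each
later argument may use the more convenient of the two forms. -/
theorem X_eq (hk : k ∉ setQhat) {j : Fin 3} (hj : Adm k j) {g : ℝ → ℂ}
    (hg : IsG (qS u v) (pS u) (lam k) j g) (x : ℝ) (i : Fin 3) :
    X u v x k i j = colOf (lam k) j g x i := by
  have h := Classical.epsilon_spec (existsUnique_columnX (u := u) (v := v) hk hj).exists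
  have := columnX_unique hk hj h (isColumnX_colOf hk hj hg)
  rw [X, Matrix.of_apply, this]

theorem integrandS_eq (hk : k ∉ setQhat) {j : Fin 3} (hj : Adm k j) {g : ℝ → ℂ}
    (hg : IsG (qS u v) (pS u) (lam k) j g) (i : Fin 3) (x : ℝ) :
    integrandS u v k i j x =
      coef (lam k) i * (Complex.exp (-(x : ℂ) * (lam k i - lam k j)) * g x) := by
  have : (U u v x k * X u v x k) i j = (U u v x k).mulVec (colOf (lam k) j g x) i := by
    rw [Matrix.mul_apply]
    simp only [Matrix.mulVec, dotProduct, X_eq hk hj hg]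
  rw [integrandS, this, U_mulVec_colOf hk hg]
  simp only [lam]; ring

theorem s_eq (hk : k ∉ setQhat) {j : Fin 3} (hj : Adm k j) {g : ℝ → ℂ}
    (hg : IsG (qS u v) (pS u) (lam k) j g) (i : Fin 3) :
    s u v k i j = (1 : Matrix (Fin 3) (Fin 3) ℂ) i j -
      coef (lam k) i * ∫ x : ℝ, Complex.exp (-(x : ℂ) * (lam k i - lam k j)) * g x := by
  rw [s, Matrix.of_apply]
  simp only [integrandS_eq hk hj hg]
  rw [integral_const_mul]

theorem integrable_exp_mul {a : ℂ} (ha : a.re = 0) {g : ℝ → ℂ} (hc : Continuous g) {C : ℝ}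
    (hg : ∀ x, ‖g x‖ ≤ C * (1 + x ^ 2)⁻¹) :
    Integrable fun x : ℝ => Complex.exp (-(x : ℂ) * a) * g x := by
  refine (integrable_inv_one_add_sq.const_mul C).mono' (by fun_prop) (ae_of_all _ fun x => ?_)
  rw [norm_mul, norm_exp_imAxis x ha, one_mul]; exact hg x

theorem integrable_integrandS (hk : k ∉ setQhat) {i j : Fin 3} (hj : Adm k j)
    (hij : (lam k i - lam k j).re = 0) : Integrable (integrandS u v k i j) := by
  have hg := isG_triSol 0 (qS u v) (pS u) (lam_injective hk) hj
  obtain ⟨C, hC⟩ := hg.bound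
  have := (integrable_exp_mul hij hg.cont hC).const_mul (coef (lam k) i)
  exact this.congr (ae_of_all _ fun x => (integrandS_eq hk hj hg i x).symm)

/-- The scattering data in terms of the triangular solution. -/
theorem s_eq_triT (hk : k ∉ setQhat) {i j : Fin 3} (hj : Adm k j)
    (hij : (lam k i - lam k j).re = 0) : s u v k i j = (1 : Matrix (Fin 3) (Fin 3) ℂ) i j -
      coef (lam k) i * triT 0 (qS u v) (pS u) (lam k i - lam k j) (lam k j)
        (lam k (j + 1) - lam k j) (lam k (j + 2) - lam k j) := by
  rw [s_eq hk hj (isG_triSol 0 (qS u v) (pS u) (lam_injective hk) hj), triT, fn_wden _ hij]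

/-- The scalar equation is a sum over all indices and so does not see their order. -/
theorem IsG.perm {q p : ℝ → ℂ} {lm lm' : Fin 3 → ℂ} {π : Equiv.Perm (Fin 3)} {j : Fin 3} {g : ℝ → ℂ}
    (hlm : ∀ i, lm' i = lm (π i)) (hc : ∀ i, coef lm' i = coef lm (π i))
    (h : IsG q p lm (π j) g) : IsG q p lm' j g := by
  refine ⟨h.cont, h.bound, fun x => ?_⟩
  rw [h.eq x, hlm j]
  congr 1
  simp only [hc, hlm]
  exact (Equiv.sum_comp π fun i => coef lm i * (q x + p x * lm i) * J (lm i - lm (π j)) g x).symm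

/-- The action of the symmetries on the scattering matrix. -/
theorem s_perm {k' : ℂ} (hk : k ∉ setQhat) (hk' : k' ∉ setQhat) {π : Equiv.Perm (Fin 3)}
    (hlm : ∀ i, lam k' i = lam k (π i)) (hc : ∀ i, coef (lam k') i = coef (lam k) (π i))
    {j : Fin 3} (hj : Adm k (π j)) (i : Fin 3) : s u v k' i j = s u v k (π i) (π j) := by
  have hg := isG_triSol 0 (qS u v) (pS u) (lam_injective hk) hj
  have hj' : Adm k' j := fun i => by rw [hlm, hlm]; exact hj _
  rw [s_eq hk' hj' (hg.perm hlm hc), s_eq hk hj hg, hlm, hlm, hc]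
  simp [Matrix.one_apply]

end

/-! ### Symmetries in k and nonvanishing of s_11 on the contour -/

section

/-- The product over all other indices shows the covariance under permutations that the definition
through i + 1 and i + 2 hides. -/
theorem coef_eq_prod (lm : Fin 3 → ℂ) (i : Fin 3) :
    coef lm i = (∏ m ∈ Finset.univ.erase i, (lm i - lm m))⁻¹ := by
  have h0 : (Finset.univ.erase 0 : Finset (Fin 3)) = {1, 2} := by decide
  have h1 : (Finset.univ.erase 1 : Finset (Fin 3)) = {2, 0} := by decide
  have h2 : (Finset.univ.erase 2 : Finset (Fin 3)) = {0, 1} := by decide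
  fin_cases i
  · simp only [Fin.zero_eta, h0]; rw [Finset.prod_pair (by decide)]; rfl
  · simp only [Fin.mk_one, h1]; rw [Finset.prod_pair (by decide)]; rfl
  · simp only [Fin.reduceFinMk, h2]; rw [Finset.prod_pair (by decide)]; rfl

theorem coef_perm {lm lm' : Fin 3 → ℂ} {π : Equiv.Perm (Fin 3)} (h : ∀ i, lm' i = lm (π i))
    (i : Fin 3) : coef lm' i = coef lm (π i) := by
  rw [coef_eq_prod, coef_eq_prod]
  congr 1
  refine Finset.prod_equiv π (fun m => by simp) fun m _ => by rw [h, h]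

theorem omega_pow_four : ω₃ ^ 4 = ω₃ := by linear_combination ω₃ * omega_cube

/-- The cyclic permutation of the indices. -/
def rot : Equiv.Perm (Fin 3) := Equiv.addRight 1

theorem lam_omega_mul (k : ℂ) (i : Fin 3) : lam (ω₃ * k) i = lam k (rot i) := by
  fin_cases i
  · change lam (ω₃ * k) 0 = lam k 1
    rw [lam_zero, lam_one, mul_inv, omega_inv]
    linear_combination (Complex.I * k⁻¹ / (2 * s3)) * omega_pow_four
  · change lam (ω₃ * k) 1 = lam k 2
    rw [lam_one, lam_two, mul_inv, omega_inv]
    linear_combination (Complex.I * (k + k⁻¹) / (2 * s3)) * omega_cube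
  · change lam (ω₃ * k) 2 = lam k 0
    rw [lam_two, lam_zero, mul_inv, omega_inv]

theorem lam_inv (k : ℂ) (i : Fin 3) : lam k⁻¹ i = lam k (Equiv.swap 0 1 i) := by
  fin_cases i
  · change lam k⁻¹ 0 = lam k 1
    rw [lam_zero, lam_one, inv_inv]; ring
  · change lam k⁻¹ 1 = lam k 0
    rw [lam_zero, lam_one, inv_inv]; ring
  · change lam k⁻¹ 2 = lam k 2
    rw [lam_two, lam_two, inv_inv]; ring

theorem lam_omega_mul_inv (k : ℂ) (i : Fin 3) : lam (ω₃ * k⁻¹) i = lam k (Equiv.swap 1 2 i) := by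
  rw [lam_omega_mul, lam_inv]
  congr 1
  fin_cases i <;> rfl

theorem sum_lam (k : ℂ) : lam k 0 + lam k 1 + lam k 2 = 0 := by
  rw [lam_zero, lam_one, lam_two]
  linear_combination (Complex.I * (k + k⁻¹) / (2 * s3)) * omega_sum

/-- Reflection in the unit circle. -/
noncomputable def refl (k : ℂ) : ℂ := ((starRingEnd ℂ) k)⁻¹

theorem conj_lam (k : ℂ) (i : Fin 3) : (starRingEnd ℂ) (lam k i) = -lam (refl k) i := by
  have h2 : (starRingEnd ℂ) (2 : ℂ) = 2 := map_ofNat _ 2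
  have h4 : (ω₃ ^ 2) ^ 2 = ω₃ := by rw [← pow_mul]; exact omega_pow_four
  fin_cases i
  · change (starRingEnd ℂ) (lam k 0) = -lam (refl k) 0
    rw [lam_zero, lam_zero, refl, inv_inv]
    simp only [map_div₀, map_mul, map_add, map_pow, Complex.conj_I, conj_s3, conj_omega, map_inv₀,
      h2, h4]
    ring
  · change (starRingEnd ℂ) (lam k 1) = -lam (refl k) 1
    rw [lam_one, lam_one, refl, inv_inv]
    simp only [map_div₀, map_mul, map_add, map_pow, Complex.conj_I, conj_s3, conj_omega, map_inv₀,
      h2, h4]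
    ring
  · change (starRingEnd ℂ) (lam k 2) = -lam (refl k) 2
    rw [lam_two, lam_two, refl, inv_inv]
    simp only [map_div₀, map_mul, map_add, Complex.conj_I, conj_s3, map_inv₀, h2]
    ring

theorem mem_circ {k : ℂ} : k ∈ circ ↔ ‖k‖ = 1 := by simp [circ]

theorem ne_zero_of_circ {k : ℂ} (hk : k ∈ circ) : k ≠ 0 := by
  rintro rfl; simp [mem_circ] at hk

theorem conj_of_circ {k : ℂ} (hk : k ∈ circ) : (starRingEnd ℂ) k = k⁻¹ :=
  (Complex.inv_eq_conj (mem_circ.1 hk)).symm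

theorem refl_of_circ {k : ℂ} (hk : k ∈ circ) : refl k = k := by
  rw [refl, conj_of_circ hk, inv_inv]

theorem refl_refl (k : ℂ) : refl (refl k) = k := by simp [refl]

theorem lam_re_of_circ {k : ℂ} (hk : k ∈ circ) (i : Fin 3) : (lam k i).re = 0 := by
  have h := congrArg Complex.re (conj_lam k i)
  rw [refl_of_circ hk, Complex.conj_re, Complex.neg_re] at h
  linarith

theorem adm_of_circ {k : ℂ} (hk : k ∈ circ) (j : Fin 3) : Adm k j := fun i => by
  rw [Complex.sub_re, lam_re_of_circ hk, lam_re_of_circ hk]; simp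

theorem omega_mul_circ {k : ℂ} (hk : k ∈ circ) : ω₃ * k ∈ circ := by
  rw [mem_circ, norm_mul, norm_omega, mem_circ.1 hk, mul_one]

theorem inv_circ {k : ℂ} (hk : k ∈ circ) : k⁻¹ ∈ circ := by
  rw [mem_circ, norm_inv, mem_circ.1 hk, inv_one]

theorem mem_setQhat {k : ℂ} : k ∈ setQhat ↔ k ^ 6 = 1 ∨ k = 0 := by
  rw [setQhat, mem_union, mem_setQ, mem_singleton_iff]

theorem omega_mul_setQhat {k : ℂ} : ω₃ * k ∈ setQhat ↔ k ∈ setQhat := by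
  rw [mem_setQhat, mem_setQhat, mul_pow, show ω₃ ^ 6 = (ω₃ ^ 3) ^ 2 by ring, omega_cube]
  simp [omega_ne]

theorem inv_setQhat {k : ℂ} : k⁻¹ ∈ setQhat ↔ k ∈ setQhat := by
  rw [mem_setQhat, mem_setQhat, inv_pow, inv_eq_one, inv_eq_zero]

theorem refl_setQhat {k : ℂ} : refl k ∈ setQhat ↔ k ∈ setQhat := by
  rw [refl, inv_setQhat, mem_setQhat, mem_setQhat, ← map_pow, map_eq_zero,
    map_eq_one_iff _ (starRingEnd ℂ).injective]

theorem not_mem_setQhat_of_circ {k : ℂ} (hk : k ∈ circ \ setQ) : k ∉ setQhat := by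
  rintro (h | h)
  · exact hk.2 h
  · exact ne_zero_of_circ hk.1 h

/-- For k = iy the exponent l_3 is real and l_1 - l_2 is imaginary; Γ₁ is the part of the axis on
which l_3 is nonnegative, apart from the degenerate value at 0. -/
theorem re_of_Γ₁ {k : ℂ} (hk : k ∈ Γ₁) : (lam k 0 - lam k 1).re = 0 ∧ 0 ≤ (lam k 2).re := by
  have h3 : (0:ℝ) < Real.sqrt 3 := by positivity
  have e2 : ∀ y : ℝ, lam (Complex.I * y) 2 = ((y⁻¹ - y) / (2 * Real.sqrt 3) : ℝ) := by
    intro y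
    rw [lam_two, mul_inv, Complex.inv_I, s3]; push_cast
    linear_combination ((y - (y:ℂ)⁻¹) / (2 * (Real.sqrt 3 : ℂ))) * Complex.I_sq
  have e1 : ∀ y : ℝ, lam (Complex.I * y) 0 - lam (Complex.I * y) 1 =
      Complex.I * ((-(y + y⁻¹) / 2 : ℝ) : ℂ) := by
    intro y
    rw [lam_zero_sub_one, mul_inv, Complex.inv_I]; push_cast; ring
  rcases hk with ⟨y, h0, h1, rfl⟩ | ⟨y, h1, rfl⟩
  · refine ⟨by rw [e1, Complex.re_mul_ofReal]; simp, ?_⟩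
    rw [e2, Complex.ofReal_re]
    rcases h0.eq_or_lt with rfl | h0
    · simp
    · have := (one_le_inv₀ h0).2 h1
      have : 0 ≤ y⁻¹ - y := by linarith
      positivity
  · have : -Complex.I * (y : ℂ) = Complex.I * ((-y : ℝ) : ℂ) := by push_cast; ring
    rw [this]
    refine ⟨by rw [e1, Complex.re_mul_ofReal]; simp, ?_⟩
    rw [e2, Complex.ofReal_re, inv_neg]
    have := inv_le_one_of_one_le₀ h1
    have : 0 ≤ -y⁻¹ - -y := by linarith
    positivity

/-- On Γ₁ the vanishing sum of the exponents gives Re l_1 = Re l_2 = -Re l_3 / 2 ≤ 0 ≤ Re l_3. On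
the circle all exponents are imaginary. -/
theorem adm_of_Γhat₁ {k : ℂ} (hk : k ∈ Γhat₁) : Adm k 0 ∧ Adm k 1 ∧ (lam k 0 - lam k 1).re = 0 := by
  rcases hk with hk | hk
  · obtain ⟨h1, h2⟩ := re_of_Γ₁ hk
    have h3 := congrArg Complex.re (sum_lam k)
    simp only [Complex.add_re, Complex.zero_re, Complex.sub_re] at h1 h3
    refine ⟨fun i => ?_, fun i => ?_, by rw [Complex.sub_re]; exact h1⟩ <;>
    · rw [Complex.sub_re]
      fin_cases i <;> simp <;> linarith
  · refine ⟨adm_of_circ hk 0, adm_of_circ hk 1, ?_⟩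
    rw [Complex.sub_re, lam_re_of_circ hk, lam_re_of_circ hk, sub_zero]

/-- On Γ₁ off the circle, Re l_1 = Re l_2 < Re l_3. A small real displacement of k produces Re l_1 <
Re l_2 < Re l_3, and k ↦ ω/k exchanges l_2 and l_3, which leads into D₂. -/
theorem mem_closure_D₂ {k : ℂ} (hk : k ∈ Γ₁) (h0 : k ≠ 0) (h1 : k ∉ circ) :
    ω₃ * k⁻¹ ∈ closure D₂ := by
  have hcont : ContinuousAt (fun δ : ℝ => k + (δ : ℂ)) 0 := by fun_prop
  have ht0 : Tendsto (fun δ : ℝ => k + (δ : ℂ)) (𝓝 0) (𝓝 k) := by simpa using hcont.tendsto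
  have hlim : Tendsto (fun δ : ℝ => ω₃ * (k + (δ : ℂ))⁻¹) (𝓝 0) (𝓝 (ω₃ * k⁻¹)) :=
    (ht0.inv₀ h0).const_mul ω₃
  have hlamc : ∀ i, ContinuousAt (fun k => lam k i) k := by
    intro i
    have : ContinuousAt (fun k : ℂ => k⁻¹) k := continuousAt_inv₀ h0
    fin_cases i
    · simp only [Fin.zero_eta, lam_zero]; fun_prop
    · simp only [Fin.mk_one, lam_one]; fun_prop
    · simp only [Fin.reduceFinMk, lam_two]; fun_prop
  obtain ⟨hr1, hr2⟩ := re_of_Γ₁ hk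
  have hsum := congrArg Complex.re (sum_lam k)
  simp only [Complex.add_re, Complex.zero_re, Complex.sub_re] at hr1 hsum
  -- reduction to a statement about a one-sided neighbourhood
  have key : ∀ (f : Filter ℝ), f.NeBot → f ≤ 𝓝 0 → 0 < (lam k 2).re →
      (∀ᶠ δ : ℝ in f, (lam (k + δ) 0 - lam (k + δ) 1).re < 0) → ω₃ * k⁻¹ ∈ closure D₂ := by
    intro f _ hf h2 hev
    refine mem_closure_of_tendsto (hlim.mono_left hf) ?_
    have e1 : ∀ᶠ δ : ℝ in f, (lam (k + δ) 1 - lam (k + δ) 2).re < 0 := by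
      have : Tendsto (fun δ : ℝ => (lam (k + δ) 1 - lam (k + δ) 2).re) (𝓝 0)
          (𝓝 (lam k 1 - lam k 2).re) :=
        (Complex.continuous_re.tendsto _).comp
          (((hlamc 1).tendsto.comp ht0).sub ((hlamc 2).tendsto.comp ht0))
      refine (this.mono_left hf).eventually_lt_const ?_
      rw [Complex.sub_re]; linarith
    have e2 : ∀ᶠ δ : ℝ in f, k + (δ : ℂ) ≠ 0 := (ht0.mono_left hf).eventually_ne h0
    filter_upwards [hev, e1, e2] with δ d1 d2 d3
    rw [Complex.sub_re] at d1 d2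
    refine ⟨mul_ne_zero omega_ne (inv_ne_zero d3), ?_, ?_⟩
    · change (lam (ω₃ * (k + δ)⁻¹) 0).re < (lam (ω₃ * (k + δ)⁻¹) 2).re
      rw [lam_omega_mul_inv, lam_omega_mul_inv]
      change (lam (k + δ) 0).re < (lam (k + δ) 1).re
      linarith
    · change (lam (ω₃ * (k + δ)⁻¹) 2).re < (lam (ω₃ * (k + δ)⁻¹) 1).re
      rw [lam_omega_mul_inv, lam_omega_mul_inv]
      change (lam (k + δ) 1).re < (lam (k + δ) 2).re
      linarith
  have h3 : (0:ℝ) < Real.sqrt 3 := by positivity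
  have e2 : ∀ y : ℝ, lam (Complex.I * y) 2 = ((y⁻¹ - y) / (2 * Real.sqrt 3) : ℝ) := by
    intro y
    rw [lam_two, mul_inv, Complex.inv_I, s3]; push_cast
    linear_combination ((y - (y:ℂ)⁻¹) / (2 * (Real.sqrt 3 : ℂ))) * Complex.I_sq
  have e3 : ∀ y δ : ℝ, (lam (Complex.I * y + δ) 0 - lam (Complex.I * y + δ) 1).re =
      -(δ - δ / (δ ^ 2 + y ^ 2)) / 2 := by
    intro y δ
    have hn : Complex.normSq (Complex.I * y + δ) = δ ^ 2 + y ^ 2 := by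
      simp [Complex.normSq_apply]; ring
    have : (lam (Complex.I * y + δ) 0 - lam (Complex.I * y + δ) 1) =
        ((-1 / 2 : ℝ) : ℂ) * ((Complex.I * y + δ) - (Complex.I * y + δ)⁻¹) := by
      rw [lam_zero_sub_one]; push_cast; ring
    rw [this, Complex.re_ofReal_mul, Complex.sub_re, Complex.inv_re, hn]
    simp; ring
  -- Re(l_1 - l_2) at iy + δ has the sign of -δ outside the unit disk and of δ inside, so the
  -- displacement is to the right outside and to the left inside.
  have key2 : ∀ y : ℝ, k = Complex.I * y → y ≠ 0 → (y ^ 2 < 1 ∧ 0 < y ∨ 1 < y ^ 2 ∧ y < 0) →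
      ω₃ * k⁻¹ ∈ closure D₂ := by
    rintro y rfl hy0 (⟨hy, hyp⟩ | ⟨hy, hyn⟩)
    · refine key (𝓝[<] 0) inferInstance nhdsWithin_le_nhds ?_ ?_
      · rw [e2, Complex.ofReal_re]
        have : y < 1 := by nlinarith
        have := (one_lt_inv₀ hyp).2 this
        have : 0 < y⁻¹ - y := by linarith
        positivity
      · have hc : Tendsto (fun δ : ℝ => δ ^ 2 + y ^ 2) (𝓝[<] 0) (𝓝 (y ^ 2)) := by
          have : Continuous (fun δ : ℝ => δ ^ 2 + y ^ 2) := by fun_prop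
          simpa using (this.tendsto 0).mono_left nhdsWithin_le_nhds
        filter_upwards [hc.eventually_lt_const hy, self_mem_nhdsWithin] with δ h1 h2
        rw [e3]
        have h2 : δ < 0 := h2
        have hp : 0 < δ ^ 2 + y ^ 2 := by positivity
        have : δ / (δ ^ 2 + y ^ 2) < δ := by
          rw [div_lt_iff₀ hp]; nlinarith
        linarith
    · refine key (𝓝[>] 0) inferInstance nhdsWithin_le_nhds ?_ ?_
      · rw [e2, Complex.ofReal_re]
        have h5 : y < -1 := by nlinarith
        have : -1 < y⁻¹ := by
          rw [← neg_neg y, inv_neg, neg_lt_neg_iff]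
          exact inv_lt_one_of_one_lt₀ (by linarith)
        have : 0 < y⁻¹ - y := by linarith
        positivity
      · filter_upwards [self_mem_nhdsWithin] with δ h2
        rw [e3]
        have h2 : 0 < δ := h2
        have hp : 1 < δ ^ 2 + y ^ 2 := by nlinarith
        have : δ / (δ ^ 2 + y ^ 2) < δ := by
          rw [div_lt_iff₀ (by linarith)]; nlinarith
        linarith
  rcases hk with ⟨y, hy0, hy1, rfl⟩ | ⟨y, hy1, rfl⟩
  · have hne : y ≠ 0 := by rintro rfl; simp at h0
    have hlt : y ≠ 1 := by rintro rfl; simp [mem_circ] at h1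
    have : y < 1 := lt_of_le_of_ne hy1 hlt
    have : 0 < y := lt_of_le_of_ne hy0 (Ne.symm hne)
    exact key2 y rfl hne (Or.inl ⟨by nlinarith, this⟩)
  · have hlt : y ≠ 1 := by rintro rfl; simp [mem_circ] at h1
    have : 1 < y := lt_of_le_of_ne hy1 (Ne.symm hlt)
    exact key2 (-y) (by push_cast; ring) (by linarith) (Or.inr ⟨by nlinarith, by linarith⟩)

variable {u v : SchwartzMap ℝ ℝ}

theorem s_omega_mul {k : ℂ} (hk : k ∉ setQhat) {j : Fin 3} (hj : Adm k (rot j)) (i : Fin 3) :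
    s u v (ω₃ * k) i j = s u v k (rot i) (rot j) :=
  s_perm hk (fun h => hk (omega_mul_setQhat.1 h)) (lam_omega_mul k) (coef_perm (lam_omega_mul k)) hj i

theorem s_inv {k : ℂ} (hk : k ∉ setQhat) {j : Fin 3} (hj : Adm k (Equiv.swap 0 1 j)) (i : Fin 3) :
    s u v k⁻¹ i j = s u v k (Equiv.swap 0 1 i) (Equiv.swap 0 1 j) :=
  s_perm hk (fun h => hk (inv_setQhat.1 h)) (lam_inv k) (coef_perm (lam_inv k)) hj i

theorem s_omega_mul_inv {k : ℂ} (hk : k ∉ setQhat) {j : Fin 3} (hj : Adm k (Equiv.swap 1 2 j))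
    (i : Fin 3) : s u v (ω₃ * k⁻¹) i j = s u v k (Equiv.swap 1 2 i) (Equiv.swap 1 2 j) :=
  s_perm hk (fun h => hk (inv_setQhat.1 (omega_mul_setQhat.1 h))) (lam_omega_mul_inv k)
    (coef_perm (lam_omega_mul_inv k)) hj i

/-- Off the circle the hypothesis is applied at ω/k, where s_11 has the same value because the
induced transposition fixes the first index. -/
theorem s_zero_zero_ne (hsol : NoSolitons u v) {k : ℂ} (hk : k ∈ Γhat₁ \ setQhat) :
    s u v k 0 0 ≠ 0 := by
  by_cases hc : k ∈ circ
  · exact hsol.1 k ⟨Or.inr hc, hk.2⟩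
  · have hk1 : k ∈ Γ₁ := hk.1.resolve_right hc
    have h0 : k ≠ 0 := fun h => hk.2 (Or.inr h)
    have h := s_omega_mul_inv (u := u) (v := v) hk.2 (j := 0) (adm_of_Γhat₁ hk.1).1 0
    have h' : s u v (ω₃ * k⁻¹) 0 0 = s u v k 0 0 := h
    rw [← h']
    exact hsol.1 _ ⟨Or.inl (mem_closure_D₂ hk1 h0 hc),
      fun h => hk.2 (inv_setQhat.1 (omega_mul_setQhat.1 h))⟩

theorem wellDefined₁ (hsol : NoSolitons u v) {k : ℂ} (hk : k ∈ Γhat₁ \ setQhat) :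
    WellDefined₁ u v k := by
  obtain ⟨h0, h1, h2⟩ := adm_of_Γhat₁ hk.1
  exact ⟨existsUnique_columnX hk.2 h0, existsUnique_columnX hk.2 h1,
    integrable_integrandS hk.2 h0 (by simp), integrable_integrandS hk.2 h1 h2,
    s_zero_zero_ne hsol hk⟩

end

/-! ### The adjoint problem and its relation to X at the reflected point -/

section

/-- The sum of the entries of a column. -/
noncomputable def colSum (lm : Fin 3 → ℂ) (j : Fin 3) (g : ℝ → ℂ) (x : ℝ) : ℂ :=
  ∑ i, colOf lm j g x i

/-- The derivative of `colSum`. -/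
noncomputable def colSum' (lm : Fin 3 → ℂ) (j : Fin 3) (g : ℝ → ℂ) (x : ℝ) : ℂ :=
  ∑ i, coef lm i * ((lm i - lm j) * J (lm i - lm j) g x)

section ColSum
variable {lm : Fin 3 → ℂ} {j : Fin 3} {q p g : ℝ → ℂ}

theorem colSum_eq (x : ℝ) : colSum lm j g x = 1 + ∑ i, coef lm i * J (lm i - lm j) g x := by
  simp only [colSum, colOf, Finset.sum_add_distrib]
  congr 1
  simp [Matrix.one_apply]

/-- The terms c_i g of the individual derivatives cancel since Σ c_i = 0. -/
theorem hasDerivAt_colSum (hinj : Function.Injective lm) (hj : ∀ i, 0 ≤ (lm i - lm j).re)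
    (hg : RightInt g) (x : ℝ) : HasDerivAt (colSum lm j g) (colSum' lm j g x) x := by
  have h : HasDerivAt (fun x => 1 + ∑ i, coef lm i * J (lm i - lm j) g x)
      (∑ i, coef lm i * ((lm i - lm j) * J (lm i - lm j) g x + g x)) x :=
    (HasDerivAt.fun_sum fun i _ => (hasDerivAt_J hg (hj i) x).const_mul (coef lm i)).const_add 1
  have e : colSum lm j g = fun x => 1 + ∑ i, coef lm i * J (lm i - lm j) g x := funext colSum_eq
  rw [e]
  refine h.congr_deriv ?_
  have h0 := (coef_sums hinj).1
  simp only [mul_add, Finset.sum_add_distrib, ← Finset.sum_mul, h0, colSum']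
  ring

theorem sum_lam_colOf (x : ℝ) :
    ∑ m, lm m * colOf lm j g x m = colSum' lm j g x + lm j * colSum lm j g x := by
  rw [colSum_eq]
  simp only [colOf, colSum', mul_add, Finset.sum_add_distrib, Finset.mul_sum]
  have : ∑ m, lm m * (1 : Matrix (Fin 3) (Fin 3) ℂ) m j = lm j * 1 := by simp [Matrix.one_apply]
  rw [this, add_left_comm, ← Finset.sum_add_distrib]
  congr 1
  exact Finset.sum_congr rfl fun i _ => by ring

/-- In terms of the sum Y of the entries of the column, g = q Y + p (Y' + l_j Y). This form can be
compared with its complex conjugate. -/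
theorem IsG.eq_colSum (hg : IsG q p lm j g) (x : ℝ) :
    g x = q x * colSum lm j g x + p x * (colSum' lm j g x + lm j * colSum lm j g x) := by
  rw [← sum_lam_colOf, ← sum_colOf hg x, colSum, Finset.mul_sum, Finset.mul_sum,
    ← Finset.sum_add_distrib]
  exact Finset.sum_congr rfl fun i _ => by ring

theorem continuous_colSum (hj : ∀ i, 0 ≤ (lm i - lm j).re) (hg : RightInt g) :
    Continuous (colSum lm j g) := by
  have e : colSum lm j g = fun x => 1 + ∑ i, coef lm i * J (lm i - lm j) g x := funext colSum_eq
  rw [e]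
  exact continuous_const.add (continuous_finsetSum _ fun i _ =>
    continuous_const.mul (continuous_J hg (hj i)))

theorem continuous_colSum' (hj : ∀ i, 0 ≤ (lm i - lm j).re) (hg : RightInt g) :
    Continuous (colSum' lm j g) :=
  continuous_finsetSum _ fun i _ => continuous_const.mul (continuous_const.mul
    (continuous_J hg (hj i)))

theorem colSum_bounded (hj : ∀ i, 0 ≤ (lm i - lm j).re) (hg : IsG q p lm j g) :
    ∃ C, ∀ x, ‖colSum lm j g x‖ ≤ C ∧ ‖colSum' lm j g x‖ ≤ C := by
  obtain ⟨C, hC⟩ := colOf_bounded hj hg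
  refine ⟨max (∑ _i : Fin 3, C) (∑ i, ‖lm i‖ * C + ‖lm j‖ * ∑ _i : Fin 3, C), fun x => ?_⟩
  have h1 : ‖colSum lm j g x‖ ≤ ∑ _i : Fin 3, C :=
    (norm_sum_le _ _).trans (Finset.sum_le_sum fun i _ => hC x i)
  refine ⟨h1.trans (le_max_left _ _), le_trans ?_ (le_max_right _ _)⟩
  rw [show colSum' lm j g x = (∑ m, lm m * colOf lm j g x m) - lm j * colSum lm j g x by
    rw [sum_lam_colOf]; ring]
  refine (norm_sub_le _ _).trans (add_le_add ((norm_sum_le _ _).trans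
    (Finset.sum_le_sum fun i _ => ?_)) ?_)
  · rw [norm_mul]; exact mul_le_mul_of_nonneg_left (hC x i) (norm_nonneg _)
  · rw [norm_mul]; exact mul_le_mul_of_nonneg_left h1 (norm_nonneg _)

end ColSum

variable {u v : SchwartzMap ℝ ℝ} {k : ℂ}

theorem conj_pS (x : ℝ) : (starRingEnd ℂ) (pS u x) = pS u x := by
  rw [pS_apply]; simp [map_ofNat]

/-- The derivative of `pS`. -/
noncomputable def pS' (u : SchwartzMap ℝ ℝ) : SchwartzMap ℝ ℂ := SchwartzMap.derivCLM ℂ ℂ (pS u)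

theorem hasDerivAt_pS (x : ℝ) : HasDerivAt (pS u) (pS' u x) x :=
  (pS u).differentiable.differentiableAt.hasDerivAt

/-- Both sides are -u'/2. This is where the reality of u and v enters the duality and the
conservation law. -/
theorem pS'_eq (x : ℝ) : pS' u x = qS u v x + (starRingEnd ℂ) (qS u v x) := by
  have h1 : HasDerivAt (fun x : ℝ => -((u x : ℝ) : ℂ) / 2) (-((deriv u x : ℝ) : ℂ) / 2) x :=
    ((u.differentiable.differentiableAt (x := x)).hasDerivAt.ofReal_comp.neg).div_const 2
  have h2 : (pS u : ℝ → ℂ) = fun x : ℝ => -((u x : ℝ) : ℂ) / 2 := funext (pS_apply u)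
  have h3 := hasDerivAt_pS (u := u) x
  rw [h2] at h3
  rw [h3.unique h1, qS_apply]
  simp only [map_sub, map_div₀, map_neg, map_mul, Complex.conj_I, conj_s3, Complex.conj_ofReal,
    map_ofNat]
  ring

theorem conj_lam_refl (k : ℂ) (i : Fin 3) : (starRingEnd ℂ) (lam (refl k) i) = -lam k i := by
  rw [conj_lam, refl_refl]

theorem conj_coef_refl (k : ℂ) (i : Fin 3) :
    (starRingEnd ℂ) (coef (lam (refl k)) i) = coef (lam k) i := by
  simp only [coef, map_inv₀, map_mul, map_sub, conj_lam_refl]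
  congr 1; ring

/-- The conjugate of `colSum` at the reflected point. -/
noncomputable def conjSum (k : ℂ) (j : Fin 3) (g : ℝ → ℂ) (x : ℝ) : ℂ :=
  (starRingEnd ℂ) (colSum (lam (refl k)) j g x)

/-- The derivative of `conjSum`. -/
noncomputable def conjSum' (k : ℂ) (j : Fin 3) (g : ℝ → ℂ) (x : ℝ) : ℂ :=
  (starRingEnd ℂ) (colSum' (lam (refl k)) j g x)

section Dual
variable {j : Fin 3} {g : ℝ → ℂ}

theorem hasDerivAt_pS_conjSum (hk : k ∉ setQhat) (hj : Adm (refl k) j) (hg : RightInt g) (x : ℝ) :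
    HasDerivAt (fun x => pS u x * conjSum k j g x)
      (pS' u x * conjSum k j g x + pS u x * conjSum' k j g x) x :=
  (hasDerivAt_pS x).mul (hasDerivAt_colSum
    (lam_injective fun h => hk (refl_setQhat.1 h)) hj hg x).star

/-- Conjugate `IsG.eq_colSum` and eliminate conj q by `pS'_eq`. What remains, up to conj g, is the
derivative of p times the conjugate sum, shifted by l_i - l_j, and such a term integrates
explicitly. -/
theorem dual_identity (hg : IsG (qS u v) (pS u) (lam (refl k)) j g) (i : Fin 3) (x : ℝ) :
    (qS u v x + pS u x * lam k i) * conjSum k j g x =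
      (pS' u x * conjSum k j g x + pS u x * conjSum' k j g x +
        (lam k i - lam k j) * (pS u x * conjSum k j g x)) - (starRingEnd ℂ) (g x) := by
  have h := congrArg (starRingEnd ℂ) (hg.eq_colSum x)
  simp only [map_add, map_mul, conj_pS, conj_lam_refl] at h
  rw [h, pS'_eq (v := v)]
  change _ = _ - ((starRingEnd ℂ) (qS u v x) * conjSum k j g x +
    pS u x * (conjSum' k j g x + -lam k j * conjSum k j g x))
  ring

theorem conjSum_bounded (hj : Adm (refl k) j) (hg : IsG (qS u v) (pS u) (lam (refl k)) j g) :
    ∃ C, 0 ≤ C ∧ ∀ x, ‖conjSum k j g x‖ ≤ C ∧ ‖conjSum' k j g x‖ ≤ C := by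
  obtain ⟨C, hC⟩ := colSum_bounded hj hg
  refine ⟨C, (norm_nonneg _).trans (hC 0).1, fun x => ?_⟩
  simpa [conjSum, conjSum'] using hC x

theorem continuous_conjSum (hj : Adm (refl k) j) (hg : RightInt g) :
    Continuous (conjSum k j g) ∧ Continuous (conjSum' k j g) :=
  ⟨Complex.continuous_conj.comp (continuous_colSum hj hg),
    Complex.continuous_conj.comp (continuous_colSum' hj hg)⟩

theorem schwartz_mul_bound (f : SchwartzMap ℝ ℂ) {F : ℝ → ℂ} {C : ℝ} (hC : ∀ x, ‖F x‖ ≤ C) :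
    ∃ D, ∀ x, ‖f x * F x‖ ≤ D * (1 + x ^ 2)⁻¹ := by
  obtain ⟨D, hD0, hD⟩ := schwartz_bound_sq f
  refine ⟨D * C, fun x => ?_⟩
  rw [norm_mul]
  calc _ ≤ D * (1 + x ^ 2)⁻¹ * C := mul_le_mul (hD x) (hC x) (norm_nonneg _) (by positivity)
    _ = _ := by ring

theorem rightInt_schwartz_mul (f : SchwartzMap ℝ ℂ) {F : ℝ → ℂ} {C : ℝ} (hc : Continuous F)
    (hC : ∀ x, ‖F x‖ ≤ C) : RightInt (fun x => f x * F x) := by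
  obtain ⟨D, hD⟩ := schwartz_mul_bound f hC
  exact rightInt_of_bound (f.continuous.mul hc) hD

/-- The `j`th column of `X^A`. -/
noncomputable def colA (u v : SchwartzMap ℝ ℝ) (k : ℂ) (j : Fin 3) (g : ℝ → ℂ) (x : ℝ)
    (i : Fin 3) : ℂ :=
  (1 : Matrix (Fin 3) (Fin 3) ℂ) i j - coef (lam k) j *
    J (-(lam k i - lam k j)) (fun y => (qS u v y + pS u y * lam k i) * conjSum k j g y) x

theorem adm_refl (hj : Adm (refl k) j) (i : Fin 3) : 0 ≤ (-(lam k i - lam k j)).re := by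
  have h1 := congrArg Complex.re (conj_lam_refl k i)
  have h2 := congrArg Complex.re (conj_lam_refl k j)
  have h3 := hj i
  simp only [Complex.conj_re, Complex.neg_re, Complex.sub_re] at *
  linarith

theorem rightInt_dual (hj : Adm (refl k) j) (hg : IsG (qS u v) (pS u) (lam (refl k)) j g)
    (i : Fin 3) : RightInt (fun y => (qS u v y + pS u y * lam k i) * conjSum k j g y) := by
  obtain ⟨C, hC0, hC⟩ := conjSum_bounded hj hg
  have := rightInt_schwartz_mul (qS u v + lam k i • pS u)
    (continuous_conjSum hj hg.rightInt).1 (fun x => (hC x).1)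
  refine cast ?_ this
  congr 1; ext x
  change (qS u v x + lam k i * pS u x) * _ = _
  ring

theorem J_dual (hk : k ∉ setQhat) (hj : Adm (refl k) j)
    (hg : IsG (qS u v) (pS u) (lam (refl k)) j g) (i : Fin 3) (x : ℝ) :
    J (-(lam k i - lam k j)) (fun y => (qS u v y + pS u y * lam k i) * conjSum k j g y) x =
      pS u x * conjSum k j g x -
        J (-(lam k i - lam k j)) (fun y => (starRingEnd ℂ) (g y)) x := by
  obtain ⟨C, hC0, hC⟩ := conjSum_bounded hj hg
  obtain ⟨hc, hc'⟩ := continuous_conjSum hj hg.rightInt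
  have ha := adm_refl hj i
  have r0 := rightInt_schwartz_mul (pS u) hc (fun x => (hC x).1)
  have r1 := (rightInt_schwartz_mul (pS' u) hc (fun x => (hC x).1)).add
    (rightInt_schwartz_mul (pS u) hc' (fun x => (hC x).2))
  have hlim : Tendsto (fun x => pS u x * conjSum k j g x) atTop (𝓝 0) := by
    obtain ⟨D, hD⟩ := schwartz_mul_bound (pS u) (fun x => (hC x).1)
    refine squeeze_zero_norm hD ?_
    have h1 : Tendsto (fun x : ℝ => 1 + x ^ 2) atTop atTop :=
      tendsto_atTop_add_const_left _ _ (tendsto_pow_atTop (by norm_num))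
    simpa using (tendsto_inv_atTop_zero.comp h1).const_mul D
  have h1 := J_deriv r0 r1 ha (hasDerivAt_pS_conjSum hk hj hg.rightInt) hlim x
  have e : (fun y => (qS u v y + pS u y * lam k i) * conjSum k j g y) = fun y =>
      ((pS' u y * conjSum k j g y + pS u y * conjSum' k j g y) +
        (lam k i - lam k j) * (pS u y * conjSum k j g y)) + (-1) * (starRingEnd ℂ) (g y) := by
    ext y; rw [dual_identity hg]; ring
  rw [e, J_add (r1.add (r0.const_mul _)) (hg.rightInt.conj.const_mul _) ha,
    J_add r1 (r0.const_mul _) ha, J_const_mul, J_const_mul, h1]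
  ring

/-- The boundary term p · conj Y in `J_dual` does not depend on i and is annihilated by Σ c_i = 0;
the rest is the conjugate of `colSum_eq`. -/
theorem sum_coef_colA (hk : k ∉ setQhat) (hj : Adm (refl k) j)
    (hg : IsG (qS u v) (pS u) (lam (refl k)) j g) (x : ℝ) :
    ∑ i, coef (lam k) i * colA u v k j g x i = coef (lam k) j * conjSum k j g x := by
  have h0 := (coef_sums (lam_injective hk)).1
  have e1 : conjSum k j g x = 1 + ∑ i, coef (lam k) i *
      J (-(lam k i - lam k j)) (fun y => (starRingEnd ℂ) (g y)) x := by
    rw [conjSum, colSum_eq]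
    simp only [map_add, map_one, map_sum, map_mul, conj_coef_refl, conj_J, map_sub, conj_lam_refl]
    congr 1
    refine Finset.sum_congr rfl fun i _ => ?_
    congr 2; ring
  have e2 : ∑ i, coef (lam k) i * (1 : Matrix (Fin 3) (Fin 3) ℂ) i j = coef (lam k) j := by
    simp [Matrix.one_apply]
  simp only [colA, J_dual hk hj hg, mul_sub, Finset.sum_sub_distrib, e2]
  have e3 : ∑ i, coef (lam k) i * (coef (lam k) j * (pS u x * conjSum k j g x)) = 0 := by
    rw [← Finset.sum_mul, h0, zero_mul]
  rw [e3]
  have e4 := congrArg (fun z => coef (lam k) j * z) e1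
  simp only [mul_add, Finset.mul_sum] at e4
  rw [e4, zero_sub, sub_neg_eq_add, mul_one]
  congr 1
  exact Finset.sum_congr rfl fun i _ => by ring

/-- The transpose has rank one as well, so a column of X^A enters only through Σ c_m φ_m. -/
theorem U_transpose_mulVec (hk : k ∉ setQhat) (φ : Fin 3 → ℂ) (y : ℝ) (i : Fin 3) :
    (U u v y k).transpose.mulVec φ i =
      (qS u v y + pS u y * lam k i) * ∑ m, coef (lam k) m * φ m := by
  simp only [Matrix.mulVec, dotProduct, Matrix.transpose_apply, U_apply hk, Finset.mul_sum]
  exact Finset.sum_congr rfl fun m _ => by ring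

theorem isColumnXA_colA (hk : k ∉ setQhat) (hj : Adm (refl k) j)
    (hg : IsG (qS u v) (pS u) (lam (refl k)) j g) : IsColumnXA u v k j (colA u v k j g) := by
  have e : ∀ x i y, volterraXA u v k j (colA u v k j g) x i y = coef (lam k) j *
      (Complex.exp (((x - y : ℝ) : ℂ) * -(lam k i - lam k j)) *
        ((qS u v y + pS u y * lam k i) * conjSum k j g y)) := by
    intro x i y
    rw [volterraXA, U_transpose_mulVec hk, sum_coef_colA hk hj hg]
    simp only [lam, mul_neg, neg_mul]; ring
  have hint := fun x i => (rightInt_dual hj hg i).expInt (adm_refl hj i) x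
  refine ⟨fun a => ?_, fun x i => ?_, fun x i => ?_⟩
  · obtain ⟨C, hC0, hC⟩ := conjSum_bounded hj hg
    have hb : ∀ i, ∃ D, ∀ x, ‖colA u v k j g x i‖ ≤ D := by
      intro i
      obtain ⟨D, hD⟩ := schwartz_mul_bound (qS u v + lam k i • pS u) (fun x => (hC x).1)
      have hD0 : 0 ≤ D := by simpa using (norm_nonneg _).trans (hD 0)
      have hJ : ∀ x, ‖J (-(lam k i - lam k j))
          (fun y => (qS u v y + pS u y * lam k i) * conjSum k j g y) x‖ ≤ D * 4 := by
        intro x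
        refine (norm_J_le (adm_refl hj i) (integrable_inv_one_add_sq.const_mul D).integrableOn
          fun y _ => ?_).trans ?_
        · have := hD y
          change ‖(qS u v y + lam k i * pS u y) * _‖ ≤ _ at this
          rwa [mul_comm (lam k i)] at this
        · rw [integral_const_mul]
          refine mul_le_mul_of_nonneg_left (le_trans ?_ integral_inv_le) hD0
          exact setIntegral_le_integral integrable_inv_one_add_sq
            (ae_of_all _ fun y => by positivity)
      refine ⟨1 + ‖coef (lam k) j‖ * (D * 4), fun x => ?_⟩
      refine (norm_sub_le _ _).trans (add_le_add ?_ ?_)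
      · rw [Matrix.one_apply]; split_ifs <;> simp
      · rw [norm_mul]; exact mul_le_mul_of_nonneg_left (hJ x) (norm_nonneg _)
    choose D hD using hb
    refine ⟨∑ i, |D i|, fun x _ i => (hD i x).trans ((le_abs_self _).trans ?_)⟩
    exact Finset.single_le_sum (f := fun i => |D i|) (fun i _ => abs_nonneg _) (Finset.mem_univ i)
  · exact ((hint x i).const_mul (coef (lam k) j)).congr (ae_of_all _ fun y => (e x i y).symm)
  · simp only [e]
    rw [integral_const_mul, colA, J]; ring

theorem columnXA_unique (hk : k ∉ setQhat) (hj : Adm (refl k) j) {φ φ' : ℝ → Fin 3 → ℂ}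
    (h : IsColumnXA u v k j φ) (h' : IsColumnXA u v k j φ') : φ = φ' := by
  obtain ⟨M, hM⟩ := U_bound (u := u) (v := v) hk
  refine volterra_unique (V := fun y => (U u v y k).transpose) (fun y i m => hM y m i)
    (E := fun x i y => Complex.exp (-((x - y : ℝ) : ℂ) * (l i k - l j k)))
    (fun x i y hxy => ?_)
    (e := fun i => (1 : Matrix (Fin 3) (Fin 3) ℂ) i j) (σ := 1) (by simp)
    h.bounded h'.bounded h.integrable h'.integrable (fun x i => ?_) (fun x i => ?_)
  · rw [neg_mul, ← mul_neg]
    exact norm_exp_mul_le_one (adm_refl hj i) (by linarith)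
  · rw [h.equation]; simp [volterraXA]
  · rw [h'.equation]; simp [volterraXA]

theorem existsUnique_columnXA (hk : k ∉ setQhat) (hj : Adm (refl k) j) :
    ∃! φ, IsColumnXA u v k j φ := by
  have := isG_triSol 0 (qS u v) (pS u) (lam_injective fun h => hk (refl_setQhat.1 h)) hj
  exact ⟨_, isColumnXA_colA hk hj this,
    fun φ hφ => columnXA_unique hk hj hφ (isColumnXA_colA hk hj this)⟩

theorem integrandSA_eq (hk : k ∉ setQhat) (hj : Adm (refl k) j)
    (hg : IsG (qS u v) (pS u) (lam (refl k)) j g) (i : Fin 3) (x : ℝ) :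
    integrandSA u v k i j x = coef (lam k) j * (Complex.exp ((x : ℂ) * (lam k i - lam k j)) *
      ((qS u v x + pS u x * lam k i) * conjSum k j g x)) := by
  have h := Classical.epsilon_spec (existsUnique_columnXA (u := u) (v := v) hk hj).exists
  have h1 := columnXA_unique hk hj h (isColumnXA_colA hk hj hg)
  have : ((U u v x k).transpose * XA u v x k) i j =
      (U u v x k).transpose.mulVec (colA u v k j g x) i := by
    rw [Matrix.mul_apply]
    simp only [Matrix.mulVec, dotProduct, XA, Matrix.of_apply, h1]
  rw [integrandSA, this, U_transpose_mulVec hk, sum_coef_colA hk hj hg]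
  simp only [lam]; ring

theorem integrable_dual {a : ℂ} (ha : a.re = 0) (f : SchwartzMap ℝ ℂ)
    {F : ℝ → ℂ} {C : ℝ} (hF : Continuous F) (hC : ∀ x, ‖F x‖ ≤ C) :
    Integrable fun x : ℝ => Complex.exp ((x : ℂ) * a) * (f x * F x) := by
  obtain ⟨D, hD⟩ := schwartz_mul_bound f hC
  have := integrable_exp_mul (a := -a) (by simp [ha]) (f.continuous.mul hF) hD
  simpa using this

theorem integrable_integrandSA (hk : k ∉ setQhat) {i : Fin 3} (hj : Adm (refl k) j)
    (hij : (lam k i - lam k j).re = 0) : Integrable (integrandSA u v k i j) := by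
  have hg := isG_triSol 0 (qS u v) (pS u) (lam_injective fun h => hk (refl_setQhat.1 h)) hj
  obtain ⟨C, hC0, hC⟩ := conjSum_bounded hj hg
  have := (integrable_dual hij (qS u v + lam k i • pS u)
    (continuous_conjSum hj hg.rightInt).1 (fun x => (hC x).1)).const_mul (coef (lam k) j)
  refine this.congr (ae_of_all _ fun x => ?_)
  rw [integrandSA_eq hk hj hg]
  change _ * (_ * ((qS u v x + lam k i * pS u x) * _)) = _
  rw [mul_comm (lam k i)]

/-- By `dual_identity` the integrand is an exact derivative minus the conjugate of the integrand for
s at the reflected point, and the derivative of an integrable function has integral zero. -/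
theorem sA_eq (hk : k ∉ setQhat) {i : Fin 3} (hj : Adm (refl k) j)
    (hij : (lam k i - lam k j).re = 0) (hg : IsG (qS u v) (pS u) (lam (refl k)) j g) :
    sA u v k i j = (1 : Matrix (Fin 3) (Fin 3) ℂ) i j - coef (lam k) j * (starRingEnd ℂ)
      (∫ x : ℝ, Complex.exp (-(x : ℂ) * (lam (refl k) i - lam (refl k) j)) * g x) := by
  obtain ⟨C, hC0, hC⟩ := conjSum_bounded hj hg
  obtain ⟨hc, hc'⟩ := continuous_conjSum hj hg.rightInt
  rw [sA, Matrix.of_apply]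
  simp only [integrandSA_eq hk hj hg]
  rw [integral_const_mul, ← integral_conj]
  set a := lam k i - lam k j with ha
  have e1 : ∀ x : ℝ, (starRingEnd ℂ)
      (Complex.exp (-(x : ℂ) * (lam (refl k) i - lam (refl k) j)) * g x) =
      Complex.exp ((x : ℂ) * a) * (starRingEnd ℂ) (g x) := by
    intro x
    rw [map_mul, ← Complex.exp_conj, map_mul, map_neg, Complex.conj_ofReal, map_sub,
      conj_lam_refl, conj_lam_refl]
    congr 2; rw [ha]; ring
  simp only [e1]
  have hd : ∀ x : ℝ, HasDerivAt (fun x : ℝ => Complex.exp ((x : ℂ) * a) * (pS u x * conjSum k j g x))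
      (Complex.exp ((x : ℂ) * a) * (pS' u x * conjSum k j g x) + Complex.exp ((x : ℂ) * a) *
        (pS u x * conjSum' k j g x) + a * (Complex.exp ((x : ℂ) * a) * (pS u x * conjSum k j g x))) x := by
    intro x
    have e : HasDerivAt (fun y : ℝ => Complex.exp ((y : ℂ) * a)) (Complex.exp ((x : ℂ) * a) * a) x := by
      have := (((hasDerivAt_id x).ofReal_comp).mul_const a).cexp
      simpa using this
    exact (e.mul (hasDerivAt_pS_conjSum hk hj hg.rightInt x)).congr_deriv (by ring)
  have i0 := integrable_dual hij (pS u) hc (fun x => (hC x).1)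
  have i1 := integrable_dual hij (pS' u) hc (fun x => (hC x).1)
  have i2 := integrable_dual hij (pS u) hc' (fun x => (hC x).2)
  have hz := integral_eq_zero_of_hasDerivAt_of_integrable hd ((i1.add i2).add (i0.const_mul a)) i0
  obtain ⟨D, hD⟩ := hg.bound
  have i3 : Integrable fun x : ℝ => Complex.exp ((x : ℂ) * a) * (starRingEnd ℂ) (g x) := by
    have := integrable_exp_mul (a := -a) (by rw [Complex.neg_re, hij, neg_zero]) (g := fun x => (starRingEnd ℂ) (g x))
      (Complex.continuous_conj.comp hg.cont) (C := D) (fun x => by simpa using hD x)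
    simpa using this
  have e2 : ∀ x : ℝ, Complex.exp ((x : ℂ) * a) *
      ((qS u v x + pS u x * lam k i) * conjSum k j g x) =
      (Complex.exp ((x : ℂ) * a) * (pS' u x * conjSum k j g x) + Complex.exp ((x : ℂ) * a) *
        (pS u x * conjSum' k j g x) + a * (Complex.exp ((x : ℂ) * a) * (pS u x * conjSum k j g x))) -
      Complex.exp ((x : ℂ) * a) * (starRingEnd ℂ) (g x) := by
    intro x; rw [dual_identity hg, ha]; ring
  simp only [e2]
  have i4 : Integrable fun x : ℝ => Complex.exp ((x : ℂ) * a) * (pS' u x * conjSum k j g x) +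
      Complex.exp ((x : ℂ) * a) * (pS u x * conjSum' k j g x) +
      a * (Complex.exp ((x : ℂ) * a) * (pS u x * conjSum k j g x)) :=
    (i1.add i2).add (i0.const_mul a)
  rw [integral_sub i4 i3, hz]
  ring

end Dual

theorem sA_eq_conj (hk : k ∉ setQhat) {i j : Fin 3} (hj : Adm (refl k) j)
    (hij : (lam k i - lam k j).re = 0) :
    coef (lam k) i * sA u v k i j = coef (lam k) j * (starRingEnd ℂ) (s u v (refl k) i j) := by
  have hk' : refl k ∉ setQhat := fun h => hk (refl_setQhat.1 h)
  have hg := isG_triSol 0 (qS u v) (pS u) (lam_injective hk') hj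
  rw [sA_eq hk hj hij hg, s_eq hk' hj hg]
  simp only [map_sub, map_mul, conj_coef_refl]
  have : coef (lam k) i * (1 : Matrix (Fin 3) (Fin 3) ℂ) i j =
      coef (lam k) j * (starRingEnd ℂ) ((1 : Matrix (Fin 3) (Fin 3) ℂ) i j) := by
    rw [Matrix.one_apply]
    split_ifs with h
    · simp [h]
    · simp
  linear_combination this

theorem coef_ne (hk : k ∉ setQhat) (i : Fin 3) : coef (lam k) i ≠ 0 := by
  have h := lam_injective hk
  refine inv_ne_zero (mul_ne_zero (sub_ne_zero.2 (h.ne ?_)) (sub_ne_zero.2 (h.ne ?_))) <;>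
    fin_cases i <;> decide

theorem sA_self (hk : k ∉ setQhat) {j : Fin 3} (hj : Adm (refl k) j) :
    sA u v k j j = (starRingEnd ℂ) (s u v (refl k) j j) :=
  mul_left_cancel₀ (coef_ne hk j) (sA_eq_conj hk hj (by simp))

theorem refl_mem_Γhat₁ (hk : k ∈ Γhat₄) (h0 : k ≠ 0) : refl k ∈ Γhat₁ := by
  rcases hk with (⟨y, hy0, hy1, rfl⟩ | ⟨y, hy1, rfl⟩) | hk
  · have hy : 0 < y := lt_of_le_of_ne hy0 fun h => h0 (by simp [← h])
    refine Or.inl (Or.inr ⟨y⁻¹, (one_le_inv₀ hy).2 hy1, ?_⟩)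
    simp [refl, mul_comm]
  · refine Or.inl (Or.inl ⟨y⁻¹, by positivity, inv_le_one_of_one_le₀ hy1, ?_⟩)
    simp [refl, mul_comm]
  · rw [refl_of_circ hk]; exact Or.inr hk

theorem re_of_Γhat₄ (hk : k ∈ Γhat₄) (h0 : k ≠ 0) : (lam k 0 - lam k 1).re = 0 := by
  have h := (adm_of_Γhat₁ (refl_mem_Γhat₁ hk h0)).2.2
  have h1 := congrArg Complex.re (conj_lam_refl k 0)
  have h2 := congrArg Complex.re (conj_lam_refl k 1)
  simp only [Complex.conj_re, Complex.neg_re, Complex.sub_re] at *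
  linarith

theorem wellDefined₂ (hsol : NoSolitons u v) (hk : k ∈ Γhat₄ \ setQhat) : WellDefined₂ u v k := by
  have hz : k ≠ 0 := fun h => hk.2 (Or.inr h)
  have hr := refl_mem_Γhat₁ hk.1 hz
  obtain ⟨h0, h1, h2⟩ := adm_of_Γhat₁ hr
  refine ⟨existsUnique_columnXA hk.2 h0, existsUnique_columnXA hk.2 h1,
    integrable_integrandSA hk.2 h0 (by simp), integrable_integrandSA hk.2 h1 (re_of_Γhat₄ hk.1 hz), ?_⟩
  rw [sA_self hk.2 h0]
  exact (map_ne_zero _).2 (s_zero_zero_ne hsol ⟨hr, fun h => hk.2 (refl_setQhat.1 h)⟩)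

theorem rTilde_eq (hk : k ≠ 0) : rTilde k = -(lam k 0 - lam k 2) / (lam k 1 - lam k 2) := by
  rw [lam_zero_sub_two, lam_one_sub_two, ← mul_neg, mul_div_mul_left _ _ cst_ne, rTilde]
  have e1 : -(k - ω₃ ^ 2 * k⁻¹) = (ω₃ ^ 2 - k ^ 2) * k⁻¹ := by field_simp; ring
  have e2 : k⁻¹ - ω₃ ^ 2 * k = (1 - ω₃ ^ 2 * k ^ 2) * k⁻¹ := by field_simp
  rw [e1, e2, mul_div_mul_right _ _ (inv_ne_zero hk)]

/-- This identifies the factor in (v) with the ratio c_2/c_1 that `sA_eq_conj` produces for the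
entry s^A_12. -/
theorem rTilde_eq_coef (hk : k ∉ setQhat) : rTilde k * coef (lam k) 0 = coef (lam k) 1 := by
  have hz : k ≠ 0 := fun h => hk (Or.inr h)
  have h := lam_injective hk
  have h01 : lam k 0 - lam k 1 ≠ 0 := sub_ne_zero.2 (h.ne (by decide))
  have h02 : lam k 0 - lam k 2 ≠ 0 := sub_ne_zero.2 (h.ne (by decide))
  have h12 : lam k 1 - lam k 2 ≠ 0 := sub_ne_zero.2 (h.ne (by decide))
  have c0 : coef (lam k) 0 = ((lam k 0 - lam k 1) * (lam k 0 - lam k 2))⁻¹ := rfl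
  have c1 : coef (lam k) 1 = -((lam k 1 - lam k 2) * (lam k 0 - lam k 1))⁻¹ := by
    have : coef (lam k) 1 = ((lam k 1 - lam k 2) * (lam k 1 - lam k 0))⁻¹ := rfl
    rw [this, ← neg_sub (lam k 0), mul_neg, inv_neg]
  rw [rTilde_eq hz, c0, c1]
  field_simp

theorem r₂_eq (hk : k ∈ Γhat₄ \ setQhat) :
    r₂ u v k = rTilde k * (starRingEnd ℂ) (r₁ u v (refl k)) := by
  have hz : k ≠ 0 := fun h => hk.2 (Or.inr h)
  obtain ⟨h0, h1, h2⟩ := adm_of_Γhat₁ (refl_mem_Γhat₁ hk.1 hz)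
  have e := sA_eq_conj (u := u) (v := v) hk.2 h1 (re_of_Γhat₄ hk.1 hz)
  rw [← rTilde_eq_coef hk.2, mul_comm (rTilde k), mul_assoc] at e
  rw [r₂, r₁, mul_left_cancel₀ (coef_ne hk.2 0) e, sA_self hk.2 h0, map_div₀, mul_div_assoc]

end

/-! ### Algebra of the relations on the circle -/

section

section Relations
variable {ρ₁ ρ₂ : ℂ → ℂ}

theorem omega_pow_mul_inv {k : ℂ} : (ω₃ * k)⁻¹ = ω₃ ^ 2 * k⁻¹ := by rw [mul_inv, omega_inv]

theorem omega_sq_circ {k : ℂ} (hk : k ∈ circ) : ω₃ ^ 2 * k ∈ circ := by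
  rw [pow_two, mul_assoc]; exact omega_mul_circ (omega_mul_circ hk)

theorem omega_mul_setQ {k : ℂ} : ω₃ * k ∈ setQ ↔ k ∈ setQ := by
  rw [mem_setQ, mem_setQ, mul_pow, show ω₃ ^ 6 = (ω₃ ^ 3) ^ 2 by ring, omega_cube]
  simp

theorem omega_mul_circ_diff {k : ℂ} (hk : k ∈ circ \ setQ) : ω₃ * k ∈ circ \ setQ :=
  ⟨omega_mul_circ hk.1, fun h => hk.2 (omega_mul_setQ.1 h)⟩

theorem omega_sq_circ_diff {k : ℂ} (hk : k ∈ circ \ setQ) : ω₃ ^ 2 * k ∈ circ \ setQ := by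
  rw [pow_two, mul_assoc]; exact omega_mul_circ_diff (omega_mul_circ_diff hk)

theorem inv_circ_diff {k : ℂ} (hk : k ∈ circ \ setQ) : k⁻¹ ∈ circ \ setQ :=
  ⟨inv_circ hk.1, fun h => hk.2 (by rw [mem_setQ] at h ⊢; rwa [inv_pow, inv_eq_one] at h)⟩

/-- The form of the circle relation in which `ρ₁` and `ρ₂` play symmetric roles. -/
def SymmRelation (ρ₁ ρ₂ : ℂ → ℂ) (k : ℂ) : Prop :=
  ρ₁ k⁻¹ + ρ₂ k + ρ₁ (ω₃ * k) * ρ₂ (ω₃ * k⁻¹) = 0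

theorem circleRelation_omega_sq (k : ℂ) :
    CircleRelation ρ₁ ρ₂ (ω₃ ^ 2 * k) ↔ SymmRelation ρ₁ ρ₂ k := by
  have e1 : 1 / (ω₃ * (ω₃ ^ 2 * k)) = k⁻¹ := by
    rw [one_div, ← mul_assoc, ← pow_succ', omega_cube, one_mul]
  have e2 : ω₃ * (ω₃ ^ 2 * k) = k := by rw [← mul_assoc, ← pow_succ', omega_cube, one_mul]
  have e3 : ω₃ ^ 2 * (ω₃ ^ 2 * k) = ω₃ * k := by linear_combination ω₃ * k * omega_cube
  have e4 : 1 / (ω₃ ^ 2 * k) = ω₃ * k⁻¹ := by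
    rw [one_div, mul_inv, ← omega_inv, inv_inv]
  rw [CircleRelation, e1, e2, e3, e4, SymmRelation]

theorem circleRelation_iff : (∀ k ∈ circ \ setQ, CircleRelation ρ₁ ρ₂ k) ↔
    ∀ k ∈ circ \ setQ, SymmRelation ρ₁ ρ₂ k := by
  refine ⟨fun h k hk => (circleRelation_omega_sq k).1 (h _ (omega_sq_circ_diff hk)), fun h k hk => ?_⟩
  have := (circleRelation_omega_sq (ρ₁ := ρ₁) (ρ₂ := ρ₂) (ω₃ * k)).2 (h _ (omega_mul_circ_diff hk))
  rwa [← mul_assoc, ← pow_succ, omega_cube, one_mul] at this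

/-- Replacing k by 1/k exchanges the roles of the two functions. -/
theorem symmRelation_swap (h : ∀ k ∈ circ \ setQ, SymmRelation ρ₁ ρ₂ k) :
    ∀ k ∈ circ \ setQ, SymmRelation ρ₂ ρ₁ k := by
  intro k hk
  have := h _ (inv_circ_diff hk)
  rw [SymmRelation, inv_inv] at this
  rw [SymmRelation]; linear_combination this

theorem solvedDenom_eq (k : ℂ) : solvedDenom ρ₁ k = 1 - ρ₁ (ω₃ * k) * ρ₁ (ω₃ ^ 2 * k⁻¹) := by
  rw [solvedDenom, one_div, omega_pow_mul_inv]

/-- The relation at k and at ω/k gives two linear equations for ρ₂(k) and ρ₂(ω/k), whose determinant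
is the denominator; the second unknown is eliminated. -/
theorem solvedRelation_of_symm {k : ℂ} (hd : solvedDenom ρ₁ k ≠ 0) (h : SymmRelation ρ₁ ρ₂ k)
    (h' : SymmRelation ρ₁ ρ₂ (ω₃ * k⁻¹)) : SolvedRelation ρ₁ ρ₂ k := by
  rw [SolvedRelation, eq_div_iff hd, solvedDenom_eq, one_div]
  rw [SymmRelation] at h h'
  have e1 : (ω₃ * k⁻¹)⁻¹ = ω₃ ^ 2 * k := by rw [omega_pow_mul_inv, inv_inv]
  have e2 : ω₃ * (ω₃ * k⁻¹) = ω₃ ^ 2 * k⁻¹ := by ring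
  have e3 : ω₃ * (ω₃ ^ 2 * k) = k := by rw [← mul_assoc, ← pow_succ', omega_cube, one_mul]
  rw [e1, e2, e3] at h'
  linear_combination h - ρ₁ (ω₃ * k) * h'

theorem symm_of_solvedRelation {k : ℂ} (hd : solvedDenom ρ₁ k ≠ 0) (h : SolvedRelation ρ₁ ρ₂ k)
    (h' : SolvedRelation ρ₁ ρ₂ (ω₃ * k⁻¹)) : SymmRelation ρ₁ ρ₂ k := by
  have e1 : (ω₃ * k⁻¹)⁻¹ = ω₃ ^ 2 * k := by rw [omega_pow_mul_inv, inv_inv]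
  have e2 : ω₃ * (ω₃ * k⁻¹) = ω₃ ^ 2 * k⁻¹ := by ring
  have e3 : ω₃ ^ 2 * (ω₃ ^ 2 * k) = ω₃ * k := by linear_combination ω₃ * k * omega_cube
  have e4 : ω₃ ^ 2 * (ω₃ * k⁻¹) = k⁻¹ := by linear_combination k⁻¹ * omega_cube
  -- The denominators at k and ω/k agree, so one nonvanishing hypothesis serves for both.
  have hd' : solvedDenom ρ₁ (ω₃ * k⁻¹) = solvedDenom ρ₁ k := by
    rw [solvedDenom_eq, solvedDenom_eq, e1, e2, e3, mul_comm (ρ₁ (ω₃ * k))]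
  rw [SolvedRelation, hd', eq_div_iff hd, one_div, e1, e2, e4] at h'
  rw [SolvedRelation, eq_div_iff hd, one_div] at h
  rw [SymmRelation]
  refine mul_right_cancel₀ hd ?_
  rw [zero_mul]
  have e5 := solvedDenom_eq (ρ₁ := ρ₁) k
  linear_combination h + ρ₁ (ω₃ * k) * h' + ρ₁ k⁻¹ * e5

theorem omega_mul_inv_circ_diff {k : ℂ} (hk : k ∈ circ \ setQ) : ω₃ * k⁻¹ ∈ circ \ setQ :=
  omega_mul_circ_diff (inv_circ_diff hk)

theorem circleRelation_iff_solved (hd : ∀ k ∈ circ \ setQ, solvedDenom ρ₁ k ≠ 0) :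
    (∀ k ∈ circ \ setQ, CircleRelation ρ₁ ρ₂ k) ↔ ∀ k ∈ circ \ setQ, SolvedRelation ρ₁ ρ₂ k := by
  rw [circleRelation_iff]
  exact ⟨fun h k hk => solvedRelation_of_symm (hd k hk) (h k hk) (h _ (omega_mul_inv_circ_diff hk)),
    fun h k hk => symm_of_solvedRelation (hd k hk) (h k hk) (h _ (omega_mul_inv_circ_diff hk))⟩

theorem circleRelation_iff_solved' (hd : ∀ k ∈ circ \ setQ, solvedDenom ρ₂ k ≠ 0) :
    (∀ k ∈ circ \ setQ, CircleRelation ρ₁ ρ₂ k) ↔ ∀ k ∈ circ \ setQ, SolvedRelation ρ₂ ρ₁ k := by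
  rw [← circleRelation_iff_solved hd, circleRelation_iff, circleRelation_iff]
  exact ⟨symmRelation_swap, symmRelation_swap⟩

end Relations

/-! ### The conserved sesquilinear form and the circle relation -/

variable {u v : SchwartzMap ℝ ℝ} {k : ℂ}

/-- The columns of `X` in the interaction picture. -/
noncomputable def intCol (lm : Fin 3 → ℂ) (j : Fin 3) (g : ℝ → ℂ) (i : Fin 3) (x : ℝ) : ℂ :=
  (1 : Matrix (Fin 3) (Fin 3) ℂ) i j -
    coef lm i * ∫ y in Ioi x, Complex.exp (((-y : ℝ) : ℂ) * (lm i - lm j)) * g y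

section Hermitian
variable {lm : Fin 3 → ℂ} {j : Fin 3} {g : ℝ → ℂ}

theorem intCol_eq (i : Fin 3) (x : ℝ) :
    intCol lm j g i x = Complex.exp (((-x : ℝ) : ℂ) * (lm i - lm j)) * colOf lm j g x i := by
  rw [intCol, colOf, J_eq_exp_mul]
  have h1 : Complex.exp (((-x : ℝ) : ℂ) * (lm i - lm j)) * Complex.exp ((x:ℂ) * (lm i - lm j)) = 1 := by
    rw [← Complex.exp_add]; simp
  have h2 : Complex.exp (((-x : ℝ) : ℂ) * (lm i - lm j)) * (1 : Matrix (Fin 3) (Fin 3) ℂ) i j =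
      (1 : Matrix (Fin 3) (Fin 3) ℂ) i j := by
    rw [Matrix.one_apply]
    split_ifs with h
    · simp [h]
    · simp
  linear_combination -h2 + coef lm i * (∫ y in Ioi x, Complex.exp (((-y : ℝ) : ℂ) * (lm i - lm j)) * g y) * h1

theorem hasDerivAt_intCol (hg : RightInt g) (i : Fin 3) (hi : 0 ≤ (lm i - lm j).re) (x : ℝ) :
    HasDerivAt (intCol lm j g i)
      (coef lm i * (Complex.exp (((-x : ℝ) : ℂ) * (lm i - lm j)) * g x)) x := by
  have := ((hasDerivAt_integral_Ioi (hg.exp_mul hi) x).const_mul (coef lm i)).const_sub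
    ((1 : Matrix (Fin 3) (Fin 3) ℂ) i j)
  exact this.congr_deriv (by ring)

theorem tendsto_intCol_atTop (i : Fin 3) :
    Tendsto (intCol lm j g i) atTop (𝓝 ((1 : Matrix (Fin 3) (Fin 3) ℂ) i j)) := by
  have h := tendsto_integral_Ioi_zero (f := fun y => Complex.exp (((-y : ℝ) : ℂ) * (lm i - lm j)) * g y)
    (μ := volume) (tendsto_id (α := ℝ) (x := atTop))
  have h2 := (h.const_mul (coef lm i)).const_sub ((1 : Matrix (Fin 3) (Fin 3) ℂ) i j)
  rw [mul_zero, sub_zero] at h2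
  exact h2

theorem tendsto_integral_Ioi_atBot {f : ℝ → ℂ} (hf : Integrable f) :
    Tendsto (fun x => ∫ y in Ioi x, f y) atBot (𝓝 (∫ y, f y)) := by
  have := (aecover_Ioi (μ := volume) (tendsto_id (α := ℝ) (x := atBot))).integral_tendsto_of_countably_generated hf
  simpa using this

theorem tendsto_intCol_atBot (hg : IsG (qS u v) (pS u) (lam k) j g) (hk : k ∈ circ \ setQ) (i : Fin 3) :
    Tendsto (intCol (lam k) j g i) atBot (𝓝 (s u v k i j)) := by
  have hre : (lam k i - lam k j).re = 0 := by
    rw [Complex.sub_re, lam_re_of_circ hk.1, lam_re_of_circ hk.1, sub_zero]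
  obtain ⟨C, hC⟩ := hg.bound
  have hint := integrable_exp_mul hre hg.cont hC
  rw [s_eq (not_mem_setQhat_of_circ hk) (adm_of_circ hk.1 j) hg i]
  have := ((tendsto_integral_Ioi_atBot hint).const_mul (coef (lam k) i)).const_sub
    ((1 : Matrix (Fin 3) (Fin 3) ℂ) i j)
  exact this.congr fun x => by simp [intCol]

/-- The conserved sesquilinear form. -/
theorem s_hermitian (hk : k ∈ circ \ setQ) (a b : Fin 3) :
    ∑ i, (starRingEnd ℂ) (s u v k i a) * s u v k i b / coef (lam k) i =
      ∑ i, (1 : Matrix (Fin 3) (Fin 3) ℂ) i a * (1 : Matrix (Fin 3) (Fin 3) ℂ) i b /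
        coef (lam k) i := by
  have hq := not_mem_setQhat_of_circ hk
  have hinj := lam_injective hq
  have ha := adm_of_circ hk.1 a
  have hb := adm_of_circ hk.1 b
  have hga := isG_triSol 0 (qS u v) (pS u) hinj ha
  have hgb := isG_triSol 0 (qS u v) (pS u) hinj hb
  generalize wmul 0 0 (triSol 0 (qS u v) (pS u) (lam k a) (lam k (a + 1) - lam k a)
    (lam k (a + 2) - lam k a)) = ga at hga
  generalize wmul 0 0 (triSol 0 (qS u v) (pS u) (lam k b) (lam k (b + 1) - lam k b)
    (lam k (b + 2) - lam k b)) = gb at hgb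
  have hcl : ∀ i, (starRingEnd ℂ) (lam k i) = -lam k i := fun i => by
    rw [conj_lam, refl_of_circ hk.1]
  have hcc : ∀ i, (starRingEnd ℂ) (coef (lam k) i) = coef (lam k) i := fun i => by
    have := conj_coef_refl k i
    rwa [refl_of_circ hk.1] at this
  set H : ℝ → ℂ := fun x => ∑ i, (starRingEnd ℂ) (intCol (lam k) a ga i x) *
    intCol (lam k) b gb i x / coef (lam k) i with hH
  -- H' is e^{x(l_b - l_a)} (conj(g_a) Y_b + conj(Y_a) g_b), with Y the column sums. By
  -- `IsG.eq_colSum` and p' = q + conj q this is the derivative of K, and K vanishes at both ends of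
  -- the line.
  set K : ℝ → ℂ := fun x => Complex.exp ((x : ℂ) * (lam k b - lam k a)) * (pS u x *
    ((starRingEnd ℂ) (colSum (lam k) a ga x) * colSum (lam k) b gb x)) with hK
  have hd : ∀ x, HasDerivAt (fun x => H x - K x) 0 x := by
    intro x
    have h1 : HasDerivAt H (∑ i, ((starRingEnd ℂ) (coef (lam k) i *
        (Complex.exp (((-x : ℝ) : ℂ) * (lam k i - lam k a)) * ga x)) * intCol (lam k) b gb i x +
        (starRingEnd ℂ) (intCol (lam k) a ga i x) * (coef (lam k) i *
        (Complex.exp (((-x : ℝ) : ℂ) * (lam k i - lam k b)) * gb x))) / coef (lam k) i) x :=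
      HasDerivAt.fun_sum fun i _ => (((hasDerivAt_intCol hga.rightInt i (ha i) x).star).mul
        (hasDerivAt_intCol hgb.rightInt i (hb i) x)).div_const _
    have e : HasDerivAt (fun y : ℝ => Complex.exp ((y : ℂ) * (lam k b - lam k a)))
        (Complex.exp ((x : ℂ) * (lam k b - lam k a)) * (lam k b - lam k a)) x := by
      have := (((hasDerivAt_id x).ofReal_comp).mul_const (lam k b - lam k a)).cexp
      simpa using this
    have h2 : HasDerivAt K _ x := e.mul ((hasDerivAt_pS x).mul
      (((hasDerivAt_colSum hinj ha hga.rightInt x).star).mul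
        (hasDerivAt_colSum hinj hb hgb.rightInt x)))
    refine (h1.sub h2).congr_deriv ?_
    have e1 : ∀ i, ((starRingEnd ℂ) (coef (lam k) i *
        (Complex.exp (((-x : ℝ) : ℂ) * (lam k i - lam k a)) * ga x)) * intCol (lam k) b gb i x +
        (starRingEnd ℂ) (intCol (lam k) a ga i x) * (coef (lam k) i *
        (Complex.exp (((-x : ℝ) : ℂ) * (lam k i - lam k b)) * gb x))) / coef (lam k) i =
        Complex.exp ((x : ℂ) * (lam k b - lam k a)) * ((starRingEnd ℂ) (ga x) *
          colOf (lam k) b gb x i + (starRingEnd ℂ) (colOf (lam k) a ga x i) * gb x) := by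
      intro i
      rw [intCol_eq, intCol_eq]
      simp only [map_mul, hcc, ← Complex.exp_conj, Complex.conj_ofReal, map_sub, hcl]
      have x1 : Complex.exp (((-x : ℝ) : ℂ) * (-lam k i - -lam k a)) *
          Complex.exp (((-x : ℝ) : ℂ) * (lam k i - lam k b)) =
          Complex.exp ((x : ℂ) * (lam k b - lam k a)) := by
        rw [← Complex.exp_add]; congr 1; push_cast; ring
      rw [← x1]
      field_simp [coef_ne hq i]
    simp only [e1, ← Finset.mul_sum, Finset.sum_add_distrib, ← Finset.sum_mul, ← map_sum]
    change Complex.exp ((x : ℂ) * (lam k b - lam k a)) * ((starRingEnd ℂ) (ga x) *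
      colSum (lam k) b gb x + (starRingEnd ℂ) (colSum (lam k) a ga x) * gb x) -
      (_ + _ * (_ + _ * ((starRingEnd ℂ) (colSum' (lam k) a ga x) * _ + _))) = 0
    have g1 := congrArg (starRingEnd ℂ) (hga.eq_colSum x)
    simp only [map_add, map_mul, conj_pS, hcl] at g1
    have g2 := hgb.eq_colSum x
    rw [g1, g2, pS'_eq (v := v)]
    change _ - (_ + _ * (_ + _ * (_ + (starRingEnd ℂ) (colSum (lam k) a ga x) * _))) = 0
    change _ - (_ * (pS u x * ((starRingEnd ℂ) (colSum (lam k) a ga x) * colSum (lam k) b gb x)) +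
      _ * ((qS u v x + (starRingEnd ℂ) (qS u v x)) *
        ((starRingEnd ℂ) (colSum (lam k) a ga x) * colSum (lam k) b gb x) + _)) = 0
    ring
  have hconst : ∀ x y, H x - K x = H y - K y := fun x y =>
    is_const_of_deriv_eq_zero (fun x => (hd x).differentiableAt) (fun x => (hd x).deriv) x y
  obtain ⟨C, hC⟩ := colSum_bounded ha hga
  obtain ⟨D, hD⟩ := colSum_bounded hb hgb
  have hbd : ∃ E, ∀ x, ‖K x‖ ≤ E * (1 + x ^ 2)⁻¹ := by
    have hC0 : 0 ≤ C := (norm_nonneg _).trans (hC 0).1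
    obtain ⟨E, hE⟩ := schwartz_mul_bound (pS u) (F := fun x =>
      (starRingEnd ℂ) (colSum (lam k) a ga x) * colSum (lam k) b gb x) (C := C * D) (fun x => by
        rw [norm_mul, RCLike.norm_conj]
        exact mul_le_mul (hC x).1 (hD x).1 (norm_nonneg _) hC0)
    refine ⟨E, fun x => ?_⟩
    have hre : (-(lam k b - lam k a)).re = 0 := by
      rw [Complex.neg_re, Complex.sub_re, lam_re_of_circ hk.1, lam_re_of_circ hk.1]; simp
    have := norm_exp_imAxis x hre
    rw [neg_mul_neg] at this
    rw [hK]
    simp only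
    rw [norm_mul, this, one_mul]
    exact hE x
  obtain ⟨E, hE⟩ := hbd
  have hq2 : Tendsto (fun x : ℝ => E * (1 + x ^ 2)⁻¹) atTop (𝓝 0) := by
    have h1 : Tendsto (fun x : ℝ => 1 + x ^ 2) atTop atTop :=
      tendsto_atTop_add_const_left _ _ (tendsto_pow_atTop (by norm_num))
    simpa using (tendsto_inv_atTop_zero.comp h1).const_mul E
  have hK1 : Tendsto K atTop (𝓝 0) := squeeze_zero_norm hE hq2
  have hK2 : Tendsto K atBot (𝓝 0) := by
    refine squeeze_zero_norm hE ?_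
    have := hq2.comp tendsto_neg_atBot_atTop
    simpa [Function.comp_def] using this
  have hH1 : Tendsto H atTop (𝓝 (∑ i, (starRingEnd ℂ) ((1 : Matrix (Fin 3) (Fin 3) ℂ) i a) *
      (1 : Matrix (Fin 3) (Fin 3) ℂ) i b / coef (lam k) i)) :=
    tendsto_finsetSum _ fun i _ => (((Complex.continuous_conj.tendsto _).comp
      (tendsto_intCol_atTop i)).mul (tendsto_intCol_atTop i)).div_const _
  have hH2 : Tendsto H atBot (𝓝 (∑ i, (starRingEnd ℂ) (s u v k i a) * s u v k i b /
      coef (lam k) i)) :=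
    tendsto_finsetSum _ fun i _ => (((Complex.continuous_conj.tendsto _).comp
      (tendsto_intCol_atBot hga hk i)).mul (tendsto_intCol_atBot hgb hk i)).div_const _
  have t1 := hH1.sub hK1
  have t2 := hH2.sub hK2
  have c1 : (fun x => H x - K x) = fun _ => H 0 - K 0 := funext fun x => hconst x 0
  rw [c1] at t1 t2
  have f1 := tendsto_nhds_unique t1 tendsto_const_nhds
  have f2 := tendsto_nhds_unique t2 tendsto_const_nhds
  rw [sub_zero] at f1 f2
  rw [f2, ← f1]
  refine Finset.sum_congr rfl fun i _ => ?_
  congr 2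
  rw [Matrix.one_apply]
  split_ifs <;> simp

/-- The two-sided inverse of the scattering matrix on the circle. -/
theorem s_mul_inverse (hk : k ∈ circ \ setQ) :
    s u v k * Matrix.of (fun i j => coef (lam k) i * (starRingEnd ℂ) (s u v k j i) /
      coef (lam k) j) = 1 := by
  have hq := not_mem_setQhat_of_circ hk
  rw [mul_eq_one_comm]
  ext a b
  rw [Matrix.mul_apply]
  have h := s_hermitian (u := u) (v := v) hk a b
  have e : ∑ i, (1 : Matrix (Fin 3) (Fin 3) ℂ) i a * (1 : Matrix (Fin 3) (Fin 3) ℂ) i b /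
      coef (lam k) i = (1 : Matrix (Fin 3) (Fin 3) ℂ) a b / coef (lam k) a := by
    simp only [Matrix.one_apply, ite_mul, one_mul, zero_mul, ite_div, zero_div,
      Finset.sum_ite_eq', Finset.mem_univ, if_true]
  rw [e, eq_div_iff (coef_ne hq a), Finset.sum_mul] at h
  rw [← h]
  refine Finset.sum_congr rfl fun i _ => ?_
  rw [Matrix.of_apply]; ring

/-- The product is taken in the order s times inverse, so this relates rows of s, whereas
`s_hermitian` relates columns. -/
theorem s_orthogonal (hk : k ∈ circ \ setQ) :
    coef (lam k) 0 * (starRingEnd ℂ) (s u v k 1 0) * s u v k 2 0 +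
    coef (lam k) 1 * (starRingEnd ℂ) (s u v k 1 1) * s u v k 2 1 +
    coef (lam k) 2 * (starRingEnd ℂ) (s u v k 1 2) * s u v k 2 2 = 0 := by
  have h := congrFun (congrFun (s_mul_inverse (u := u) (v := v) hk) 2) 1
  rw [Matrix.mul_apply, Fin.sum_univ_three] at h
  simp only [Matrix.of_apply] at h
  have hc := coef_ne (not_mem_setQhat_of_circ hk) 1
  have e : (1 : Matrix (Fin 3) (Fin 3) ℂ) 2 1 = 0 := Matrix.one_apply_ne (by decide)
  rw [e] at h
  field_simp at h
  linear_combination h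

/-- The inverse of s is its adjoint conjugated by a diagonal matrix, which leaves the determinant
unchanged. -/
theorem norm_det_s (hk : k ∈ circ \ setQ) : ‖(s u v k).det‖ = 1 := by
  have hq := not_mem_setQhat_of_circ hk
  have h := congrArg Matrix.det (s_mul_inverse (u := u) (v := v) hk)
  rw [Matrix.det_mul, Matrix.det_one] at h
  have e : (Matrix.of (fun i j => coef (lam k) i * (starRingEnd ℂ) (s u v k j i) /
      coef (lam k) j)).det = (starRingEnd ℂ) (s u v k).det := by
    rw [Matrix.det_fin_three, Matrix.det_fin_three]
    simp only [Matrix.of_apply, map_sub, map_add, map_mul]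
    have h0 := coef_ne hq 0
    have h1 := coef_ne hq 1
    have h2 := coef_ne hq 2
    field_simp
    ring
  rw [e, Complex.mul_conj'] at h
  have : ‖(s u v k).det‖ ^ 2 = 1 := by exact_mod_cast h
  exact (pow_eq_one_iff_of_nonneg (norm_nonneg _) (by norm_num)).1 this

/-- The minor is an entry of the adjugate, that is, of det s times the inverse; in the diagonal
entry of the inverse the factors c cancel. -/
theorem norm_minor (hk : k ∈ circ \ setQ) :
    ‖s u v k 0 0 * s u v k 1 1 - s u v k 0 1 * s u v k 1 0‖ = ‖s u v k 2 2‖ := by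
  have hq := not_mem_setQhat_of_circ hk
  have h := s_mul_inverse (u := u) (v := v) hk
  set B := Matrix.of (fun i j => coef (lam k) i * (starRingEnd ℂ) (s u v k j i) /
      coef (lam k) j) with hB
  have h1 : (s u v k).adjugate = (s u v k).det • B := by
    calc (s u v k).adjugate = (s u v k).adjugate * (s u v k * B) := by rw [h, mul_one]
      _ = _ := by rw [← mul_assoc, Matrix.adjugate_mul, Matrix.smul_mul, one_mul]
  have h2 := congrFun (congrFun h1 2) 2
  have h3 : (s u v k).adjugate 2 2 =
      s u v k 0 0 * s u v k 1 1 - s u v k 0 1 * s u v k 1 0 := by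
    rw [Matrix.adjugate_fin_three]; simp
  rw [← h3, h2, Matrix.smul_apply, smul_eq_mul, norm_mul, norm_det_s hk, one_mul, hB,
    Matrix.of_apply, norm_div, norm_mul, RCLike.norm_conj,
    mul_div_cancel_left₀ _ (norm_ne_zero_iff.2 (coef_ne hq 2))]

theorem s_one_one (hk : k ∈ circ \ setQ) : s u v k 1 1 = s u v (ω₃ * k) 0 0 :=
  (s_omega_mul (not_mem_setQhat_of_circ hk) (j := 0) (adm_of_circ hk.1 _) 0).symm

theorem s_two_two (hk : k ∈ circ \ setQ) : s u v k 2 2 = s u v (ω₃ ^ 2 * k) 0 0 := by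
  rw [pow_two, mul_assoc, ← s_one_one (omega_mul_circ_diff hk)]
  exact (s_omega_mul (not_mem_setQhat_of_circ hk) (j := 1) (adm_of_circ hk.1 _) 1).symm

/-- Here and in the next three lemmas the symmetries turn values of r_1 at related points into
quotients of entries from the second or third row of s at the single point k. -/
theorem r₁_inv (hk : k ∈ circ \ setQ) : r₁ u v k⁻¹ = s u v k 1 0 / s u v k 1 1 := by
  have h := not_mem_setQhat_of_circ hk
  rw [r₁, s_inv h (adm_of_circ hk.1 _), s_inv h (adm_of_circ hk.1 _)]
  rfl

theorem r₁_omega_mul (hk : k ∈ circ \ setQ) : r₁ u v (ω₃ * k) = s u v k 1 2 / s u v k 1 1 := by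
  have h := not_mem_setQhat_of_circ hk
  rw [r₁, s_omega_mul h (adm_of_circ hk.1 _), s_omega_mul h (adm_of_circ hk.1 _)]
  rfl

theorem r₁_omega_sq_mul (hk : k ∈ circ \ setQ) :
    r₁ u v (ω₃ ^ 2 * k) = s u v k 2 0 / s u v k 2 2 := by
  have h := not_mem_setQhat_of_circ hk
  have h' := omega_mul_circ_diff hk
  have h'' := not_mem_setQhat_of_circ h'
  rw [pow_two, mul_assoc, r₁, s_omega_mul h'' (adm_of_circ h'.1 _),
    s_omega_mul h'' (adm_of_circ h'.1 _), s_omega_mul h (adm_of_circ hk.1 _),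
    s_omega_mul h (adm_of_circ hk.1 _)]
  rfl

theorem r₁_inv_omega_mul (hk : k ∈ circ \ setQ) :
    r₁ u v (ω₃ * k)⁻¹ = s u v k 2 1 / s u v k 2 2 := by
  have h := not_mem_setQhat_of_circ hk
  rw [r₁_inv (omega_mul_circ_diff hk), s_omega_mul h (adm_of_circ hk.1 _),
    s_omega_mul h (adm_of_circ hk.1 _)]
  rfl

theorem circ_subset_Γhat₄ : circ ⊆ Γhat₄ := subset_union_right

theorem r₂_eq_circ (hk : k ∈ circ \ setQ) :
    r₂ u v k = rTilde k * (starRingEnd ℂ) (r₁ u v k) := by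
  rw [r₂_eq ⟨circ_subset_Γhat₄ hk.1, not_mem_setQhat_of_circ hk⟩, refl_of_circ hk.1]

theorem rTilde_eq_coef_div (hk : k ∉ setQhat) : rTilde k = coef (lam k) 1 / coef (lam k) 0 := by
  rw [eq_div_iff (coef_ne hk 0), rTilde_eq_coef hk]

/-- After substitution of these quotients, and of c_3/c_2 and c_1/c_2 for the factors in r_2(ωk) and
r_2(1/k), clearing denominators leaves `s_orthogonal`. -/
theorem circleRelation_r (hsol : NoSolitons u v) (hk : k ∈ circ \ setQ) :
    CircleRelation (r₁ u v) (r₂ u v) k := by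
  have h := not_mem_setQhat_of_circ hk
  have h' := omega_mul_circ_diff hk
  have hi := inv_circ_diff hk
  have e1 : rTilde (ω₃ * k) = coef (lam k) 2 / coef (lam k) 1 := by
    rw [rTilde_eq_coef_div (not_mem_setQhat_of_circ h'), coef_perm (lam_omega_mul k),
      coef_perm (lam_omega_mul k)]
    rfl
  have e2 : rTilde k⁻¹ = coef (lam k) 0 / coef (lam k) 1 := by
    rw [rTilde_eq_coef_div (not_mem_setQhat_of_circ hi), coef_perm (lam_inv k),
      coef_perm (lam_inv k)]
    rfl
  have n1 : s u v k 1 1 ≠ 0 := by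
    rw [s_one_one hk]
    exact hsol.1 _ ⟨Or.inr h'.1, not_mem_setQhat_of_circ h'⟩
  have n2 : s u v k 2 2 ≠ 0 := by
    have h'' := omega_sq_circ_diff hk
    rw [s_two_two hk]
    exact hsol.1 _ ⟨Or.inr h''.1, not_mem_setQhat_of_circ h''⟩
  have n1' : (starRingEnd ℂ) (s u v k 1 1) ≠ 0 := (map_ne_zero _).2 n1
  have o := s_orthogonal (u := u) (v := v) hk
  rw [CircleRelation, one_div, one_div, r₁_inv_omega_mul hk, r₂_eq_circ h', r₂_eq_circ hi, e1, e2,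
    r₁_inv hk, r₁_omega_mul hk, r₁_omega_sq_mul hk, map_div₀, map_div₀]
  have c1 := coef_ne h 1
  field_simp
  linear_combination o

end Hermitian

end

/-! ### Contours, conjugation and smooth dependence on k -/

section

theorem accPt_of_preconnected {S T : Set ℂ} (hT : IsPreconnected T) (hn : T.Nontrivial) (hTS : T ⊆ S)
    {x : ℂ} (hx : x ∈ T) : AccPt x (𝓟 S) :=
  (hT.preperfect_of_nontrivial hn x hx).mono (principal_mono.2 hTS)

/-- Over ℂ the tangent space is one-dimensional, so unique differentiability only requires every
point to be an accumulation point. -/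
theorem uniqueDiffOn_of_preconnected {T : Set ℂ} (hT : IsPreconnected T) (hn : T.Nontrivial) :
    UniqueDiffOn ℂ T := fun _ hx =>
  uniqueDiffWithinAt_iff_accPt.2 (accPt_of_preconnected hT hn Subset.rfl hx)

theorem uniqueDiffOn_rightHalf : UniqueDiffOn ℂ rightHalf :=
  uniqueDiffOn_of_preconnected convex_rightHalf.isPreconnected
    ⟨0, by simp [rightHalf], 1, by simp [rightHalf], by simp⟩

theorem uniqueDiffOn_imAxis : UniqueDiffOn ℂ imAxis :=
  uniqueDiffOn_of_preconnected convex_imAxis.isPreconnected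
    ⟨0, by simp [imAxis], Complex.I, by simp [imAxis], Complex.I_ne_zero.symm⟩

/-- The segment from `0` to `c`. -/
def seg (c : ℂ) : Set ℂ := (fun y : ℝ => c * y) '' Icc 0 1

/-- The ray from `c` to infinity. -/
def ray (c : ℂ) : Set ℂ := (fun y : ℝ => c * y) '' Ici 1

theorem Γ₁_eq : Γ₁ = seg Complex.I ∪ ray (-Complex.I) := by
  ext k
  simp only [Γ₁, seg, ray, mem_union, mem_ofPred_eq, mem_image, mem_Icc, mem_Ici]
  constructor
  · rintro (⟨y, h0, h1, rfl⟩ | ⟨y, h1, rfl⟩)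
    exacts [Or.inl ⟨y, ⟨h0, h1⟩, rfl⟩, Or.inr ⟨y, h1, rfl⟩]
  · rintro (⟨y, ⟨h0, h1⟩, rfl⟩ | ⟨y, h1, rfl⟩)
    exacts [Or.inl ⟨y, h0, h1, rfl⟩, Or.inr ⟨y, h1, rfl⟩]

theorem Γ₄_eq : Γ₄ = seg (-Complex.I) ∪ ray Complex.I := by
  ext k
  simp only [Γ₄, seg, ray, mem_union, mem_ofPred_eq, mem_image, mem_Icc, mem_Ici]
  constructor
  · rintro (⟨y, h0, h1, rfl⟩ | ⟨y, h1, rfl⟩)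
    exacts [Or.inl ⟨y, ⟨h0, h1⟩, rfl⟩, Or.inr ⟨y, h1, rfl⟩]
  · rintro (⟨y, ⟨h0, h1⟩, rfl⟩ | ⟨y, h1, rfl⟩)
    exacts [Or.inl ⟨y, h0, h1, rfl⟩, Or.inr ⟨y, h1, rfl⟩]

theorem isPreconnected_seg (c : ℂ) : IsPreconnected (seg c) :=
  (convex_Icc (0:ℝ) 1).isPreconnected.image _ (by fun_prop)

theorem isPreconnected_ray (c : ℂ) : IsPreconnected (ray c) :=
  (convex_Ici (1:ℝ)).isPreconnected.image _ (by fun_prop)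

theorem nontrivial_seg {c : ℂ} (hc : c ≠ 0) : (seg c).Nontrivial :=
  ⟨0, ⟨0, by simp, by simp⟩, c, ⟨1, by simp, by simp⟩, hc.symm⟩

theorem nontrivial_ray {c : ℂ} (hc : c ≠ 0) : (ray c).Nontrivial :=
  ⟨c, ⟨1, by simp, by simp⟩, c * 2, ⟨2, by simp, by simp⟩, by
    intro h; apply hc; linear_combination -h⟩

theorem isPreconnected_circ : IsPreconnected circ :=
  isPreconnected_sphere (by rw [Complex.rank_real_complex]; exact Nat.one_lt_ofNat) _ _

theorem nontrivial_circ : circ.Nontrivial :=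
  ⟨1, by simp [mem_circ], -1, by simp [mem_circ], by norm_num⟩

theorem isClosed_seg (c : ℂ) : IsClosed (seg c) :=
  (isCompact_Icc.image (by fun_prop)).isClosed

theorem isClosed_ray (c : ℂ) (hc : c ≠ 0) : IsClosed (ray c) := by
  have : ray c = {k | ∃ y : ℝ, 1 ≤ y ∧ k / c = y} := by
    ext k
    constructor
    · rintro ⟨y, hy, rfl⟩
      exact ⟨y, hy, by simp only; field_simp⟩
    · rintro ⟨y, hy, h⟩
      exact ⟨y, hy, by simp only; rw [← h]; field_simp⟩
  have h2 : ray c = (fun k : ℂ => k / c) ⁻¹' {z | 1 ≤ z.re ∧ z.im = 0} := by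
    rw [this]; ext k
    constructor
    · rintro ⟨y, hy, h⟩
      simp [h, hy]
    · rintro ⟨h1, h2⟩
      exact ⟨(k / c).re, h1, by apply Complex.ext <;> simp [h2]⟩
  rw [h2]
  refine IsClosed.preimage (by fun_prop) ?_
  exact (isClosed_le continuous_const Complex.continuous_re).inter
    (isClosed_eq Complex.continuous_im continuous_const)

theorem isCompact_circ : IsCompact circ := isCompact_sphere _ _

theorem uniqueDiffOn_contour {c d : ℂ} (hc : c ≠ 0) (hd : d ≠ 0) {T : Set ℂ}
    (hT : T = ∅ ∨ T = circ) : UniqueDiffOn ℂ (seg c ∪ ray d ∪ T) := by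
  intro x hx
  rw [uniqueDiffWithinAt_iff_accPt]
  rcases hx with (hx | hx) | hx
  · exact accPt_of_preconnected (isPreconnected_seg c) (nontrivial_seg hc)
      (subset_union_left.trans subset_union_left) hx
  · exact accPt_of_preconnected (isPreconnected_ray d) (nontrivial_ray hd)
      (subset_union_right.trans subset_union_left) hx
  · rcases hT with rfl | rfl
    · exact hx.elim
    · exact accPt_of_preconnected isPreconnected_circ nontrivial_circ subset_union_right hx

theorem uniqueDiffOn_Γ₁ : UniqueDiffOn ℂ Γ₁ := by
  rw [Γ₁_eq, ← union_empty (seg _ ∪ _)]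
  exact uniqueDiffOn_contour Complex.I_ne_zero (neg_ne_zero.2 Complex.I_ne_zero) (Or.inl rfl)

theorem uniqueDiffOn_Γ₄ : UniqueDiffOn ℂ Γ₄ := by
  rw [Γ₄_eq, ← union_empty (seg _ ∪ _)]
  exact uniqueDiffOn_contour (neg_ne_zero.2 Complex.I_ne_zero) Complex.I_ne_zero (Or.inl rfl)

theorem uniqueDiffOn_Γhat₁ : UniqueDiffOn ℂ Γhat₁ := by
  rw [Γhat₁, Γ₁_eq]
  exact uniqueDiffOn_contour Complex.I_ne_zero (neg_ne_zero.2 Complex.I_ne_zero) (Or.inr rfl)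

theorem uniqueDiffOn_Γhat₄ : UniqueDiffOn ℂ Γhat₄ := by
  rw [Γhat₄, Γ₄_eq]
  exact uniqueDiffOn_contour (neg_ne_zero.2 Complex.I_ne_zero) Complex.I_ne_zero (Or.inr rfl)

theorem uniqueDiffOn_diff_zero {S : Set ℂ} (h : UniqueDiffOn ℂ S) : UniqueDiffOn ℂ (S \ {0}) := by
  rw [sdiff_eq]; exact h.inter isOpen_compl_singleton

theorem finite_setQ : setQ.Finite := (Set.finite_Icc 1 6).image _

theorem neBot_circ_diff {k : ℂ} (hk : k ∈ circ) : (𝓝[circ \ setQ] k).NeBot := by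
  have h : AccPt k (𝓟 circ) :=
    accPt_of_preconnected isPreconnected_circ nontrivial_circ Subset.rfl hk
  have h1 : (𝓝[circ \ {k}] k).NeBot := by
    rw [accPt_principal_iff_nhdsWithin] at h; exact h
  have h2 : ((setQ \ {k})ᶜ : Set ℂ) ∈ 𝓝 k :=
    (finite_setQ.subset sdiff_subset).isClosed.isOpen_compl.mem_nhds (by simp)
  have h3 : (𝓝[(circ \ {k}) ∩ (setQ \ {k})ᶜ] k).NeBot := by
    rwa [nhdsWithin_inter_of_mem' (mem_nhdsWithin_of_mem_nhds h2)]
  refine h3.mono (nhdsWithin_mono _ ?_)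
  rintro z ⟨⟨hz1, hz2⟩, hz3⟩
  exact ⟨hz1, fun h => hz3 ⟨h, hz2⟩⟩

/-- An identity between functions which are continuous at a point of the circle extends to
this point. -/
theorem eq_of_eqOn_circ {E : Type*} [TopologicalSpace E] [T2Space E] {f g : ℂ → E} {k : ℂ} (hk : k ∈ circ) (hf : ContinuousWithinAt f circ k)
    (hg : ContinuousWithinAt g circ k) (h : ∀ z ∈ circ \ setQ, f z = g z) : f k = g k := by
  have := neBot_circ_diff hk
  have hs : circ \ setQ ⊆ circ := fun z hz => hz.1
  refine tendsto_nhds_unique (hf.mono hs) ((hg.mono hs).tendsto.congr' ?_)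
  filter_upwards [self_mem_nhdsWithin] with z hz
  exact (h z hz).symm

section Conj

theorem conj_continuousWithin {S T : Set ℂ} (hST : ∀ z ∈ S, (starRingEnd ℂ) z ∈ T) (k : ℂ) :
    Tendsto (starRingEnd ℂ) (𝓝[S] k) (𝓝[T] ((starRingEnd ℂ) k)) :=
  tendsto_nhdsWithin_of_tendsto_nhds_of_eventually_within _
    ((Complex.continuous_conj.tendsto k).mono_left nhdsWithin_le_nhds)
    (by filter_upwards [self_mem_nhdsWithin] with z hz using hST z hz)

theorem hasDerivWithinAt_conj {f : ℂ → ℂ} {f' k : ℂ} {S T : Set ℂ}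
    (hST : ∀ z ∈ S, (starRingEnd ℂ) z ∈ T) (h : HasDerivWithinAt f f' T ((starRingEnd ℂ) k)) :
    HasDerivWithinAt (fun z => (starRingEnd ℂ) (f ((starRingEnd ℂ) z))) ((starRingEnd ℂ) f') S k := by
  rw [hasDerivWithinAt_iff_isLittleO] at h ⊢
  have h1 := (h.comp_tendsto (conj_continuousWithin hST k)).norm_norm
  refine Asymptotics.IsLittleO.of_norm_norm (h1.congr (fun z => ?_) fun z => ?_)
  · simp only [Function.comp_apply, smul_eq_mul]
    rw [← RCLike.norm_conj]
    simp only [map_sub, map_mul, Complex.conj_conj]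
  · simp only [Function.comp_apply]
    rw [← map_sub, RCLike.norm_conj]

/-- The two conjugations together preserve complex difference quotients: the derivative is the
conjugate of f' at the conjugate point, which permits induction. -/
theorem contDiffOn_conj {S T : Set ℂ} (hS : UniqueDiffOn ℂ S) (hT : UniqueDiffOn ℂ T)
    (hST : ∀ z ∈ S, (starRingEnd ℂ) z ∈ T) {m : ℕ} : ∀ {f : ℂ → ℂ}, ContDiffOn ℂ m f T →
    ContDiffOn ℂ m (fun z => (starRingEnd ℂ) (f ((starRingEnd ℂ) z))) S := by
  induction m with
  | zero =>
    intro f h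
    have := contDiffOn_zero.1 h
    exact contDiffOn_zero.2 (Complex.continuous_conj.comp_continuousOn
      (this.comp Complex.continuous_conj.continuousOn hST))
  | succ m ih =>
    intro f h
    rw [show ((m + 1 : ℕ) : WithTop ℕ∞) = (m : WithTop ℕ∞) + 1 by push_cast; rfl] at h ⊢
    rw [contDiffOn_succ_iff_derivWithin hT] at h
    rw [contDiffOn_succ_iff_derivWithin hS]
    have hd : ∀ z ∈ S, HasDerivWithinAt (fun z => (starRingEnd ℂ) (f ((starRingEnd ℂ) z)))
        ((starRingEnd ℂ) (derivWithin f T ((starRingEnd ℂ) z))) S z := fun z hz =>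
      hasDerivWithinAt_conj hST (h.1 _ (hST z hz)).hasDerivWithinAt
    refine ⟨fun z hz => (hd z hz).differentiableWithinAt, by simp, ?_⟩
    exact (ih h.2.2).congr fun z hz => (hd z hz).derivWithin (hS z hz)

theorem SD.conj {V : Set (ℂ → ℝ)} (hV : ∀ w ∈ V, ∀ z, w ((starRingEnd ℂ) z) = w z) {S T : Set ℂ}
    (hST : ∀ z ∈ S, (starRingEnd ℂ) z ∈ T) {m : ℕ} : ∀ {f : ℂ → ℂ}, SD V T m f →
    SD V S m (fun z => (starRingEnd ℂ) (f ((starRingEnd ℂ) z))) := by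
  have hb : ∀ {f : ℂ → ℂ}, WBdd V T f → WBdd V S
      (fun z => (starRingEnd ℂ) (f ((starRingEnd ℂ) z))) := by
    intro f h w hw
    obtain ⟨C, hC⟩ := h w hw
    refine ⟨C, fun z hz => ?_⟩
    have := hC _ (hST z hz)
    rwa [hV w hw, ← RCLike.norm_conj] at this
  induction m with
  | zero => exact hb
  | succ m ih =>
    rintro f ⟨h, f', hd, h'⟩
    exact ⟨hb h, _, fun z hz => hasDerivWithinAt_conj hST (hd _ (hST z hz)), ih h'⟩

end Conj

section Smooth
variable {E : Type*} [NormedAddCommGroup E] [NormedSpace ℂ E]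

theorem contDiffOn_family {Φ : ℕ → ℂ → E} {H : Set ℂ} (hH : UniqueDiffOn ℂ H) {M : ℕ}
    (hd : ∀ n, n + 2 ≤ M → ∀ z ∈ H, HasDerivWithinAt (Φ n) (Φ (n + 1) z) H z) {m : ℕ} :
    ∀ {n : ℕ}, n + m + 2 ≤ M → ContDiffOn ℂ m (Φ n) H := by
  induction m with
  | zero => intro n hn; exact contDiffOn_zero.2 fun z hz => (hd n hn z hz).continuousWithinAt
  | succ m ih =>
    intro n hn
    rw [show ((m + 1 : ℕ) : WithTop ℕ∞) = (m : WithTop ℕ∞) + 1 by push_cast; rfl,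
      contDiffOn_succ_iff_derivWithin hH]
    refine ⟨fun z hz => (hd n (by omega) z hz).differentiableWithinAt, by simp, ?_⟩
    exact (ih (n := n + 1) (by omega)).congr fun z hz =>
      (hd n (by omega) z hz).derivWithin (hH z hz)

theorem contDiffOn_op (m : ℕ) (i : Fin 3) :
    ContDiffOn ℂ m ((wker (m + 2) i).op 0) rightHalf :=
  contDiffOn_family uniqueDiffOn_rightHalf (M := m + 2)
    (fun _ hn _ hz => (wker (m + 2) i).hasDerivWithinAt_op hn hz) (by omega)

theorem contDiffOn_fn (m : ℕ) : ContDiffOn ℂ m ((wden (m + 2)).fn 0) imAxis :=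
  contDiffOn_family uniqueDiffOn_imAxis (M := m + 2)
    (fun _ hn _ hz => (wden (m + 2)).hasDerivWithinAt_fn hn hz) (by omega)

theorem contDiffWithinAt_ringInverse {A : Type*} [NormedRing A] [NormedAlgebra ℂ A]
    [CompleteSpace A] {f : ℂ → A} {S : Set ℂ} {k : ℂ} {n : WithTop ℕ∞}
    (hf : ContDiffWithinAt ℂ n f S k) (hu : IsUnit (f k)) :
    ContDiffWithinAt ℂ n (fun k => Ring.inverse (f k)) S k := by
  obtain ⟨w, hw⟩ := hu
  have h1 := contDiffAt_ringInverse ℂ w (n := n)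
  rw [hw] at h1
  exact h1.comp_contDiffWithinAt k hf

/-- For C^m regularity the weights with N = m + 2 are used; the value does not depend on N, so all
finite orders hold for the same function. -/
theorem contDiffOn_triT (q p : SchwartzMap ℝ ℂ) {S : Set ℂ} {z lm a b : ℂ → ℂ}
    (hz : ContDiffOn ℂ ∞ z S) (hlm : ContDiffOn ℂ ∞ lm S) (ha : ContDiffOn ℂ ∞ a S)
    (hb : ContDiffOn ℂ ∞ b S) (hz' : ∀ k ∈ S, (z k).re = 0) (ha' : ∀ k ∈ S, 0 ≤ (a k).re)
    (hb' : ∀ k ∈ S, 0 ≤ (b k).re) :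
    ContDiffOn ℂ ∞ (fun k => triT 0 q p (z k) (lm k) (a k) (b k)) S := by
  have key : ∀ m : ℕ, ContDiffOn ℂ m (fun k => triT 0 q p (z k) (lm k) (a k) (b k)) S := by
    intro m
    have hm : (m : WithTop ℕ∞) ≤ ∞ := by exact_mod_cast le_top
    have hz := hz.of_le hm
    have hlm := hlm.of_le hm
    have ha := ha.of_le hm
    have hb := hb.of_le hm
    have oa := (contDiffOn_op m 0).comp ha ha'
    have ob := (contDiffOn_op m 1).comp hb hb'
    have oz := (contDiffOn_fn m).comp hz hz'
    have hprod := ob.clm_comp oa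
    have hop : ContDiffOn ℂ m (fun k => 1 - triOp (m + 2) q p (lm k) (a k) (b k)) S :=
      contDiffOn_const.sub (((contDiffOn_const.add (hlm.smul contDiffOn_const)).clm_comp
        (contDiffOn_const.clm_comp hprod)).add (contDiffOn_const.clm_comp hprod))
    have hinv : ContDiffOn ℂ m (fun k => Ring.inverse (1 - triOp (m + 2) q p (lm k) (a k) (b k))) S := by
      intro k hk
      exact contDiffWithinAt_ringInverse
        (f := fun k => 1 - triOp (m + 2) q p (lm k) (a k) (b k)) (hop k hk) (isUnit_triOp (m + 2) q p (lm k) (a k) (b k))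
    have hsol : ContDiffOn ℂ m (fun k => triSol (m + 2) q p (lm k) (a k) (b k)) S :=
      hinv.clm_apply (contDiffOn_const.add (hlm.smul contDiffOn_const))
    exact (oz.clm_apply hsol).congr fun k hk =>
      (triT_eq_zero (m + 2) q p (hz' k hk) (ha' k hk) (hb' k hk)).symm
  exact contDiffOn_infty.2 key

end Smooth

end

/-! ### Regularization at 𝒬 and the generic assumption -/

section

/-- 𝒬 is the orbit of ±1 under multiplication by ω, so information at ±1 together with the
symmetries reaches all of 𝒬. -/
theorem setQ_cases {k : ℂ} (hk : k ∈ setQ) :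
    ∃ p : ℂ, (p = 1 ∨ p = -1) ∧ (k = p ∨ k = ω₃ * p ∨ k = ω₃ ^ 2 * p) := by
  have h : k ^ 6 - 1 = 0 := sub_eq_zero.2 (mem_setQ.1 hk)
  rw [six_factor, mul_eq_zero, mul_eq_zero] at h
  have hsq : ∀ c : ℂ, k ^ 2 = c ^ 2 → k = c * 1 ∨ k = c * -1 := by
    intro c hc
    rcases sq_eq_sq_iff_eq_or_eq_neg.1 hc with h | h
    exacts [Or.inl (by rw [h, mul_one]), Or.inr (by rw [h, mul_neg, mul_one])]
  rcases h with (h | h) | h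
  · rcases hsq 1 (by linear_combination h) with h | h <;> rw [one_mul] at h
    exacts [⟨1, by simp, by simp [h]⟩, ⟨-1, by simp, by simp [h]⟩]
  · rcases hsq ω₃ (by linear_combination h) with h | h
    exacts [⟨1, by simp, Or.inr (Or.inl h)⟩, ⟨-1, by simp, Or.inr (Or.inl h)⟩]
  · rcases hsq (ω₃ ^ 2) (by linear_combination h - ω₃ * omega_cube) with h | h
    exacts [⟨1, by simp, Or.inr (Or.inr h)⟩, ⟨-1, by simp, Or.inr (Or.inr h)⟩]

theorem pm_one_circ {p : ℂ} (hp : p = 1 ∨ p = -1) : p ∈ circ := by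
  rcases hp with rfl | rfl <;> simp [mem_circ]

theorem pm_one_inv {p : ℂ} (hp : p = 1 ∨ p = -1) : p⁻¹ = p := by
  rcases hp with rfl | rfl <;> simp

/-- The regularized numerator of `s₁₁`. -/
noncomputable def regA (u v : SchwartzMap ℝ ℝ) (k : ℂ) : ℂ :=
  (lam k 0 - lam k 1) * (lam k 0 - lam k 2) -
    triT 0 (qS u v) (pS u) 0 (lam k 0) (lam k 1 - lam k 0) (lam k 2 - lam k 0)

/-- The regularized numerator of `-s₁₂`. -/
noncomputable def regB (u v : SchwartzMap ℝ ℝ) (k : ℂ) : ℂ :=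
  triT 0 (qS u v) (pS u) (lam k 0 - lam k 1) (lam k 1) (lam k 2 - lam k 1) (lam k 0 - lam k 1)

variable {u v : SchwartzMap ℝ ℝ} {k : ℂ}

theorem s_eq_regA (hk : k ∉ setQhat) (h : Adm k 0) :
    s u v k 0 0 = coef (lam k) 0 * regA u v k := by
  have hinj := lam_injective hk
  have h01 : lam k 0 - lam k 1 ≠ 0 := sub_ne_zero.2 (hinj.ne (by decide))
  have h02 : lam k 0 - lam k 2 ≠ 0 := sub_ne_zero.2 (hinj.ne (by decide))
  rw [s_eq_triT hk h (by simp), sub_self]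
  have c0 : coef (lam k) 0 = ((lam k 0 - lam k 1) * (lam k 0 - lam k 2))⁻¹ := rfl
  change 1 - _ = coef (lam k) 0 * (_ - _)
  rw [mul_sub, c0, inv_mul_cancel₀ (mul_ne_zero h01 h02)]
  rfl

theorem s_eq_regB (hk : k ∉ setQhat) (h : Adm k 1) (h' : (lam k 0 - lam k 1).re = 0) :
    s u v k 0 1 = -(coef (lam k) 0 * regB u v k) := by
  rw [s_eq_triT hk h h', Matrix.one_apply_ne (by decide), zero_sub]
  rfl

theorem contDiffOn_lam (i : Fin 3) : ContDiffOn ℂ ∞ (fun k => lam k i) {0}ᶜ := by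
  have h : ContDiffOn ℂ ∞ (fun k : ℂ => k⁻¹) {0}ᶜ := contDiffOn_id.inv fun k hk => hk
  have e : ∀ c d : ℂ, ContDiffOn ℂ ∞ (fun k : ℂ => Complex.I * (c * k + d * k⁻¹) / (2 * s3)) {0}ᶜ :=
    fun c d => (contDiffOn_const.mul ((contDiffOn_const.mul contDiffOn_id).add
      (contDiffOn_const.mul h))).div_const _
  fin_cases i
  · exact (e ω₃ (ω₃ ^ 2)).congr fun k _ => lam_zero k
  · exact (e (ω₃ ^ 2) ω₃).congr fun k _ => lam_one k
  · exact (e 1 1).congr fun k _ => by simpa using lam_two k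

theorem contDiffOn_regA : ContDiffOn ℂ ∞ (regA u v) (Γhat₁ \ {0}) := by
  have hl := fun i => (contDiffOn_lam i).mono (fun k (hk : k ∈ Γhat₁ \ {0}) => hk.2)
  refine (((hl 0).sub (hl 1)).mul ((hl 0).sub (hl 2))).sub
    (contDiffOn_triT _ _ contDiffOn_const (hl 0) ((hl 1).sub (hl 0)) ((hl 2).sub (hl 0))
      (fun k _ => by simp) (fun k hk => (adm_of_Γhat₁ hk.1).1 1) fun k hk => (adm_of_Γhat₁ hk.1).1 2)

theorem contDiffOn_regB : ContDiffOn ℂ ∞ (regB u v) (Γhat₁ \ {0}) := by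
  have hl := fun i => (contDiffOn_lam i).mono (fun k (hk : k ∈ Γhat₁ \ {0}) => hk.2)
  exact contDiffOn_triT _ _ ((hl 0).sub (hl 1)) (hl 1) ((hl 2).sub (hl 1)) ((hl 0).sub (hl 1))
    (fun k hk => (adm_of_Γhat₁ hk.1).2.2) (fun k hk => (adm_of_Γhat₁ hk.1).2.1 2)
    fun k hk => (adm_of_Γhat₁ hk.1).2.1 0

theorem circ_subset : circ ⊆ Γhat₁ \ {0} := fun _ hk => ⟨Or.inr hk, ne_zero_of_circ hk⟩

theorem continuousOn_regA : ContinuousOn (regA u v) circ :=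
  contDiffOn_regA.continuousOn.mono circ_subset

theorem continuousOn_regB : ContinuousOn (regB u v) circ :=
  contDiffOn_regB.continuousOn.mono circ_subset

/-- The point ω/k exchanges l_2 and l_3, in which regA is symmetric by `triT_swap`. -/
theorem regA_omega_mul_inv (hk : Adm k 0) : regA u v (ω₃ * k⁻¹) = regA u v k := by
  rw [regA, regA, lam_omega_mul_inv, lam_omega_mul_inv, lam_omega_mul_inv]
  change (lam k 0 - lam k 2) * (lam k 0 - lam k 1) - triT 0 (qS u v) (pS u) 0 (lam k 0)
    (lam k 2 - lam k 0) (lam k 1 - lam k 0) = _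
  rw [triT_swap _ _ _ _ (hk 2) (hk 1), mul_comm (lam k 0 - lam k 2)]

/-- By continuity h(p) is the limit of f m, that is, the product of two nonzero numbers. -/
theorem ne_zero_of_hasNonzeroLimit {f m h : ℂ → ℂ} {p : ℂ} (hp : p ∈ circ)
    (hf : HasNonzeroLimit f p) (hm : ContinuousWithinAt m circ p) (hm0 : m p ≠ 0)
    (hh : ContinuousWithinAt h circ p) (e : ∀ k ∈ circ \ setQ, f k * m k = h k) : h p ≠ 0 := by
  obtain ⟨c, hc, hlim⟩ := hf
  have := neBot_circ_diff hp
  have hs : circ \ setQ ⊆ circ := fun z hz => hz.1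
  have h1 := (hlim.mul (hm.mono hs).tendsto).congr'
    (by filter_upwards [self_mem_nhdsWithin] with z hz using e z hz)
  rw [tendsto_nhds_unique (hh.mono hs) h1]
  exact mul_ne_zero hc hm0

theorem omega_sq_ne_one : ω₃ ^ 2 ≠ 1 := fun h => omega_ne_one (by
  linear_combination omega_cube - ω₃ * h)

theorem continuousOn_lam (i : Fin 3) : ContinuousOn (fun k => lam k i) circ :=
  (contDiffOn_lam i).continuousOn.mono fun _ hk => ne_zero_of_circ hk

theorem lam_sub_ne {p : ℂ} (hp : p = 1 ∨ p = -1) :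
    lam p 0 - lam p 2 ≠ 0 ∧ lam p 1 - lam p 2 ≠ 0 := by
  have h1 : (1 : ℂ) - ω₃ ^ 2 ≠ 0 := sub_ne_zero.2 omega_sq_ne_one.symm
  have hp0 := ne_zero_of_circ (pm_one_circ hp)
  rw [lam_zero_sub_two, lam_one_sub_two, pm_one_inv hp]
  have : p - ω₃ ^ 2 * p = (1 - ω₃ ^ 2) * p := by ring
  rw [this]
  exact ⟨mul_ne_zero cst_ne (mul_ne_zero h1 hp0), mul_ne_zero cst_ne (mul_ne_zero h1 hp0)⟩

/-- The regular factor of `s₁₁` at `p = ±1`. -/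
theorem sub_mul_coef {p : ℂ} (hp : p = 1 ∨ p = -1) (hk : k ∉ setQhat) :
    (k - p) * coef (lam k) 0 * (-(k + p) / (2 * k) * (lam k 0 - lam k 2)) = 1 := by
  have hinj := lam_injective hk
  have h01 : lam k 0 - lam k 1 ≠ 0 := sub_ne_zero.2 (hinj.ne (by decide))
  have h02 : lam k 0 - lam k 2 ≠ 0 := sub_ne_zero.2 (hinj.ne (by decide))
  have c0 : coef (lam k) 0 = ((lam k 0 - lam k 1) * (lam k 0 - lam k 2))⁻¹ := rfl
  have h0 : k ≠ 0 := fun h => hk (Or.inr h)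
  have e : lam k 0 - lam k 1 = -((k - p) * (k + p)) / (2 * k) := by
    rw [lam_zero_sub_one]
    rcases hp with rfl | rfl <;> (field_simp; ring)
  rw [e] at h01
  have : (k - p) * (k + p) ≠ 0 := fun h => h01 (by rw [h]; simp)
  rw [c0, e]
  have h2 : k - p ≠ 0 := left_ne_zero_of_mul this
  have h3 : k + p ≠ 0 := right_ne_zero_of_mul this
  field_simp

theorem continuous_factor {p : ℂ} (hp : p = 1 ∨ p = -1) :
    ContinuousWithinAt (fun k => -(k + p) / (2 * k) * (lam k 0 - lam k 2)) circ p ∧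
      -(p + p) / (2 * p) * (lam p 0 - lam p 2) ≠ 0 := by
  have hp0 := ne_zero_of_circ (pm_one_circ hp)
  have hc := pm_one_circ hp
  refine ⟨ContinuousWithinAt.mul (ContinuousAt.continuousWithinAt ?_)
    ((continuousOn_lam 0 p hc).sub (continuousOn_lam 2 p hc)), mul_ne_zero ?_ (lam_sub_ne hp).1⟩
  · exact (by fun_prop : ContinuousAt (fun k => -(k + p)) p).div (by fun_prop) (by simpa using hp0)
  · rw [← two_mul, neg_div, div_self (by simpa using hp0)]; simp

theorem coef_omega_sq (hk : k ∉ setQhat) : coef (lam (ω₃ ^ 2 * k)) 0 *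
    ((lam k 2 - lam k 0) * (lam k 2 - lam k 1)) = 1 := by
  have hinj := lam_injective hk
  rw [pow_two, mul_assoc, coef_perm (lam_omega_mul _), coef_perm (lam_omega_mul k)]
  change ((lam k 2 - lam k 0) * (lam k 2 - lam k 1))⁻¹ * _ = 1
  exact inv_mul_cancel₀ (mul_ne_zero (sub_ne_zero.2 (hinj.ne (by decide)))
    (sub_ne_zero.2 (hinj.ne (by decide))))

theorem continuous_factor' {p : ℂ} (hp : p = 1 ∨ p = -1) :
    ContinuousWithinAt (fun k => (lam k 2 - lam k 0) * (lam k 2 - lam k 1)) circ p ∧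
      (lam p 2 - lam p 0) * (lam p 2 - lam p 1) ≠ 0 := by
  have hc := pm_one_circ hp
  refine ⟨((continuousOn_lam 2 p hc).sub (continuousOn_lam 0 p hc)).mul
    ((continuousOn_lam 2 p hc).sub (continuousOn_lam 1 p hc)), ?_⟩
  rw [← neg_sub (lam p 0), ← neg_sub (lam p 1), neg_mul_neg]
  exact mul_ne_zero (lam_sub_ne hp).1 (lam_sub_ne hp).2

/-- Up to factors that are continuous and nonzero at p, and signs, the generic quantities s_11,
s_33, s_13, s_31 are regA at k, regA at ω²k, regB at ω/k and regB at ω²k. The remaining value, regA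
at ωp, equals regA at p by `regA_omega_mul_inv`. -/
theorem regA_ne_pm_one {p : ℂ} (hp : p = 1 ∨ p = -1) (hgen : GenericAt u v p) :
    regA u v p ≠ 0 ∧ regA u v (ω₃ * p) ≠ 0 ∧ regA u v (ω₃ ^ 2 * p) ≠ 0 ∧
      regB u v (ω₃ * p) ≠ 0 ∧ regB u v (ω₃ ^ 2 * p) ≠ 0 := by
  obtain ⟨g1, g2, g3, g4, -⟩ := hgen
  have hc := pm_one_circ hp
  have hp0 := ne_zero_of_circ hc
  have cinv : ContinuousWithinAt (fun k : ℂ => ω₃ * k⁻¹) circ p :=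
    (continuousWithinAt_const.mul (continuousAt_inv₀ hp0).continuousWithinAt)
  have minv : MapsTo (fun k : ℂ => ω₃ * k⁻¹) circ circ := fun k hk => omega_mul_circ (inv_circ hk)
  have csq : ContinuousWithinAt (fun k : ℂ => ω₃ ^ 2 * k) circ p := by fun_prop
  have msq : MapsTo (fun k : ℂ => ω₃ ^ 2 * k) circ circ := fun k hk => omega_sq_circ hk
  have h1 : regA u v p ≠ 0 := by
    refine ne_zero_of_hasNonzeroLimit hc g1 (continuous_factor hp).1 (continuous_factor hp).2
      (continuousOn_regA p hc) fun k hk => ?_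
    have hq := not_mem_setQhat_of_circ hk
    rw [s_eq_regA hq (adm_of_circ hk.1 0)]
    linear_combination regA u v k * sub_mul_coef hp hq
  refine ⟨h1, ?_, ?_, ?_, ?_⟩
  · have := regA_omega_mul_inv (u := u) (v := v) (adm_of_circ hc 0)
    rw [pm_one_inv hp] at this
    rwa [this]
  · refine ne_zero_of_hasNonzeroLimit (h := fun k => regA u v (ω₃ ^ 2 * k)) hc g4
      (continuous_factor' hp).1 (continuous_factor' hp).2
      (ContinuousWithinAt.comp (continuousOn_regA _ (omega_sq_circ hc)) csq msq) fun k hk => ?_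
    have hq := not_mem_setQhat_of_circ hk
    have hk' := omega_sq_circ_diff hk
    rw [s_two_two hk, s_eq_regA (not_mem_setQhat_of_circ hk') (adm_of_circ hk'.1 0)]
    linear_combination regA u v (ω₃ ^ 2 * k) * coef_omega_sq hq
  · have := ne_zero_of_hasNonzeroLimit (h := fun k => -regB u v (ω₃ * k⁻¹)) hc g2
      (continuous_factor hp).1 (continuous_factor hp).2
      (ContinuousWithinAt.comp (g := regB u v) (f := fun k : ℂ => ω₃ * k⁻¹)
        (continuousOn_regB _ (omega_mul_circ (inv_circ hc))) cinv minv).neg fun k hk => ?_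
    · simpa [pm_one_inv hp] using this
    have hq := not_mem_setQhat_of_circ hk
    have hk' := omega_mul_inv_circ_diff hk
    have e : s u v k 0 2 = s u v (ω₃ * k⁻¹) 0 1 :=
      (s_omega_mul_inv hq (j := 1) (adm_of_circ hk.1 _) 0).symm
    have e2 : coef (lam (ω₃ * k⁻¹)) 0 = coef (lam k) 0 := coef_perm (lam_omega_mul_inv k) 0
    rw [e, s_eq_regB (not_mem_setQhat_of_circ hk') (adm_of_circ hk'.1 1)
      (by simpa using (adm_of_Γhat₁ (Or.inr hk'.1)).2.2), e2]
    linear_combination -regB u v (ω₃ * k⁻¹) * sub_mul_coef hp hq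
  · have := ne_zero_of_hasNonzeroLimit (h := fun k => -regB u v (ω₃ ^ 2 * k)) hc g3
      (continuous_factor' hp).1 (continuous_factor' hp).2
      (ContinuousWithinAt.comp (g := regB u v)
        (continuousOn_regB _ (omega_sq_circ hc)) csq msq).neg fun k hk => ?_
    · simpa using this
    have hq := not_mem_setQhat_of_circ hk
    have hk' := omega_sq_circ_diff hk
    have hk1 := omega_mul_circ_diff hk
    have e : s u v k 2 0 = s u v (ω₃ ^ 2 * k) 0 1 := by
      rw [pow_two, mul_assoc, s_omega_mul (not_mem_setQhat_of_circ hk1) (adm_of_circ hk1.1 _),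
        s_omega_mul hq (adm_of_circ hk.1 _)]
      rfl
    rw [e, s_eq_regB (not_mem_setQhat_of_circ hk') (adm_of_circ hk'.1 1)
      (adm_of_Γhat₁ (Or.inr hk'.1)).2.2]
    linear_combination -regB u v (ω₃ ^ 2 * k) * coef_omega_sq hq

/-- The hypotheses on the potentials. -/
structure Generic (u v : SchwartzMap ℝ ℝ) : Prop where
  sol : NoSolitons u v
  one : GenericAt u v 1
  neg_one : GenericAt u v (-1)

theorem Generic.at {p : ℂ} (h : Generic u v) (hp : p = 1 ∨ p = -1) : GenericAt u v p := by
  rcases hp with rfl | rfl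
  exacts [h.one, h.neg_one]

theorem mem_circ_of_setQ (hk : k ∈ setQ) : k ∈ circ := by
  rw [mem_circ]
  have h := congrArg norm (mem_setQ.1 hk)
  rw [norm_pow, norm_one] at h
  exact (pow_eq_one_iff_of_nonneg (norm_nonneg _) (by norm_num)).1 h

theorem regA_ne (h : Generic u v) (hk : k ∈ Γhat₁ \ {0}) : regA u v k ≠ 0 := by
  by_cases hq : k ∈ setQ
  · obtain ⟨p, hp, rfl | rfl | rfl⟩ := setQ_cases hq
    · exact (regA_ne_pm_one hp (h.at hp)).1
    · exact (regA_ne_pm_one hp (h.at hp)).2.1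
    · exact (regA_ne_pm_one hp (h.at hp)).2.2.1
  · have hq' : k ∉ setQhat := fun h' => h'.elim hq hk.2
    have := s_zero_zero_ne h.sol ⟨hk.1, hq'⟩
    rw [s_eq_regA hq' (adm_of_Γhat₁ hk.1).1] at this
    exact right_ne_zero_of_mul this

/-- At ±1 one has l_1 = l_2: the product in regA vanishes and both integrals become the same, after
exchanging a and b. -/
theorem regB_pm_one {p : ℂ} (hp : p = 1 ∨ p = -1) : regB u v p = -regA u v p := by
  have e : lam p 0 - lam p 1 = 0 := by rw [lam_zero_sub_one, pm_one_inv hp]; simp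
  have e' : lam p 1 = lam p 0 := (sub_eq_zero.1 e).symm
  have hc := adm_of_circ (pm_one_circ hp)
  rw [regB, regA, e', sub_self, zero_mul, zero_sub, neg_neg,
    triT_swap _ _ _ _ (hc 0 2) (by simp)]

theorem regB_ne (h : Generic u v) (hk : k ∈ setQ) : regB u v k ≠ 0 := by
  obtain ⟨p, hp, rfl | rfl | rfl⟩ := setQ_cases hk
  · rw [regB_pm_one hp]
    exact neg_ne_zero.2 (regA_ne_pm_one hp (h.at hp)).1
  · exact (regA_ne_pm_one hp (h.at hp)).2.2.2.1
  · exact (regA_ne_pm_one hp (h.at hp)).2.2.2.2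

/-- This is `norm_minor` written with regA and regB. The moduli of l_1 - l_3 and l_2 - l_3 cancel,
and only |l_1 - l_2|² survives. -/
theorem norm_reg_minor_aux (hk : k ∈ circ \ setQ) :
    ‖regA u v k * regA u v k⁻¹ - regB u v k * regB u v k⁻¹‖ =
      ‖lam k 0 - lam k 1‖ ^ 2 * ‖regA u v (ω₃ ^ 2 * k)‖ := by
  have hq := not_mem_setQhat_of_circ hk
  have hi := inv_circ_diff hk
  have hi' := not_mem_setQhat_of_circ hi
  have hk' := omega_sq_circ_diff hk
  have hinj := lam_injective hq
  have n01 : ‖lam k 0 - lam k 1‖ ≠ 0 := norm_ne_zero_iff.2 (sub_ne_zero.2 (hinj.ne (by decide)))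
  have n02 : ‖lam k 0 - lam k 2‖ ≠ 0 := norm_ne_zero_iff.2 (sub_ne_zero.2 (hinj.ne (by decide)))
  have n12 : ‖lam k 1 - lam k 2‖ ≠ 0 := norm_ne_zero_iff.2 (sub_ne_zero.2 (hinj.ne (by decide)))
  have e1 : s u v k 1 1 = s u v k⁻¹ 0 0 := (s_inv hq (j := 0) (adm_of_circ hk.1 _) 0).symm
  have e2 : s u v k 1 0 = s u v k⁻¹ 0 1 := (s_inv hq (j := 1) (adm_of_circ hk.1 _) 0).symm
  have c1 : coef (lam k⁻¹) 0 = coef (lam k) 1 := coef_perm (lam_inv k) 0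
  have h := norm_minor (u := u) (v := v) hk
  rw [e1, e2, s_two_two hk, s_eq_regA hq (adm_of_circ hk.1 0), s_eq_regA hi' (adm_of_circ hi.1 0),
    s_eq_regB hq (adm_of_circ hk.1 1) (adm_of_Γhat₁ (Or.inr hk.1)).2.2,
    s_eq_regB hi' (adm_of_circ hi.1 1) (adm_of_Γhat₁ (Or.inr hi.1)).2.2,
    s_eq_regA (not_mem_setQhat_of_circ hk') (adm_of_circ hk'.1 0), c1] at h
  have e3 : coef (lam k) 0 * regA u v k * (coef (lam k) 1 * regA u v k⁻¹) -
      -(coef (lam k) 0 * regB u v k) * -(coef (lam k) 1 * regB u v k⁻¹) =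
      coef (lam k) 0 * coef (lam k) 1 *
        (regA u v k * regA u v k⁻¹ - regB u v k * regB u v k⁻¹) := by ring
  have f0 : ‖coef (lam k) 0‖ = (‖lam k 0 - lam k 1‖ * ‖lam k 0 - lam k 2‖)⁻¹ := by
    rw [← norm_mul, ← norm_inv]; rfl
  have f1 : ‖coef (lam k) 1‖ = (‖lam k 1 - lam k 2‖ * ‖lam k 0 - lam k 1‖)⁻¹ := by
    rw [norm_sub_rev (lam k 0), ← norm_mul, ← norm_inv]; rfl
  have f2 : ‖coef (lam (ω₃ ^ 2 * k)) 0‖ = (‖lam k 0 - lam k 2‖ * ‖lam k 1 - lam k 2‖)⁻¹ := by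
    rw [eq_inv_of_mul_eq_one_left (coef_omega_sq hq), norm_inv, norm_mul,
      norm_sub_rev (lam k 0), norm_sub_rev (lam k 1)]
  rw [e3, norm_mul, norm_mul, norm_mul, f0, f1, f2] at h
  generalize ‖regA u v k * regA u v k⁻¹ - regB u v k * regB u v k⁻¹‖ = x at h ⊢
  generalize ‖regA u v (ω₃ ^ 2 * k)‖ = y at h ⊢
  field_simp at h
  linarith

theorem norm_reg_minor (hk : k ∈ circ) :
    ‖regA u v k * regA u v k⁻¹ - regB u v k * regB u v k⁻¹‖ =
      ‖lam k 0 - lam k 1‖ ^ 2 * ‖regA u v (ω₃ ^ 2 * k)‖ := by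
  have ci : ContinuousOn (fun k : ℂ => k⁻¹) circ := fun k hk =>
    (continuousAt_inv₀ (ne_zero_of_circ hk)).continuousWithinAt
  have mi : MapsTo (fun k : ℂ => k⁻¹) circ circ := fun k hk => inv_circ hk
  have msq : MapsTo (fun k : ℂ => ω₃ ^ 2 * k) circ circ := fun k hk => omega_sq_circ hk
  have hA := continuousOn_regA (u := u) (v := v)
  have hB := continuousOn_regB (u := u) (v := v)
  exact eq_of_eqOn_circ
    (f := fun k => ‖regA u v k * regA u v k⁻¹ - regB u v k * regB u v k⁻¹‖)
    (g := fun k => ‖lam k 0 - lam k 1‖ ^ 2 * ‖regA u v (ω₃ ^ 2 * k)‖) hk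
    (((hA.mul (hA.comp ci mi)).sub (hB.mul (hB.comp ci mi))).norm k hk)
    (((((continuousOn_lam 0).sub (continuousOn_lam 1)).norm.pow 2).mul
      (hA.comp (by fun_prop) msq).norm) k hk) fun z hz => norm_reg_minor_aux hz

end

/-! ### The extensions and their properties on the circle -/

section

open Classical in
/-- The extension of `r₁`. -/
noncomputable def extR₁ (u v : SchwartzMap ℝ ℝ) (k : ℂ) : ℂ :=
  if k = 0 then 0 else -regB u v k / regA u v k

/-- The reflected function, which is smooth along the reflected contour. -/
noncomputable def reflR₁ (u v : SchwartzMap ℝ ℝ) (k : ℂ) : ℂ := (starRingEnd ℂ) (extR₁ u v (refl k))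

/-- The extension of `r₂`. -/
noncomputable def extR₂ (u v : SchwartzMap ℝ ℝ) (k : ℂ) : ℂ := rTilde k * reflR₁ u v k

variable {u v : SchwartzMap ℝ ℝ} {k : ℂ}

theorem extR₁_of_ne (hk : k ≠ 0) : extR₁ u v k = -regB u v k / regA u v k := if_neg hk

theorem extR₁_eq (hk : k ∈ Γhat₁ \ setQhat) : extR₁ u v k = r₁ u v k := by
  obtain ⟨h0, h1, h2⟩ := adm_of_Γhat₁ hk.1
  rw [extR₁_of_ne (fun h => hk.2 (Or.inr h)), r₁, s_eq_regA hk.2 h0, s_eq_regB hk.2 h1 h2, ← mul_neg,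
    mul_div_mul_left _ _ (coef_ne hk.2 0)]

theorem extR₂_eq (hk : k ∈ Γhat₄ \ setQhat) : extR₂ u v k = r₂ u v k := by
  have hz : k ≠ 0 := fun h => hk.2 (Or.inr h)
  rw [extR₂, reflR₁, r₂_eq hk, extR₁_eq ⟨refl_mem_Γhat₁ hk.1 hz, fun h => hk.2 (refl_setQhat.1 h)⟩]

theorem contDiffOn_extR₁ (h : Generic u v) : ContDiffOn ℂ ∞ (extR₁ u v) (Γhat₁ \ {0}) :=
  (contDiffOn_regB.neg.div contDiffOn_regA fun _ hk => regA_ne h hk).congr fun _ hk =>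
    extR₁_of_ne hk.2

theorem conj_mem_Γhat₁ (hk : k ∈ Γhat₄) : (starRingEnd ℂ) k ∈ Γhat₁ := by
  rcases hk with (⟨y, hy0, hy1, rfl⟩ | ⟨y, hy1, rfl⟩) | hk
  · exact Or.inl (Or.inl ⟨y, hy0, hy1, by simp⟩)
  · exact Or.inl (Or.inr ⟨y, hy1, by simp⟩)
  · rw [conj_of_circ hk]; exact Or.inr (inv_circ hk)

theorem inv_mem_Γhat₁ (hk : k ∈ Γhat₁) (h0 : k ≠ 0) : k⁻¹ ∈ Γhat₁ := by
  rcases hk with (⟨y, hy0, hy1, rfl⟩ | ⟨y, hy1, rfl⟩) | hk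
  · have hy : 0 < y := lt_of_le_of_ne hy0 fun h => h0 (by simp [← h])
    refine Or.inl (Or.inr ⟨y⁻¹, (one_le_inv₀ hy).2 hy1, ?_⟩)
    simp [mul_comm]
  · refine Or.inl (Or.inl ⟨y⁻¹, by positivity, inv_le_one_of_one_le₀ hy1, ?_⟩)
    simp [mul_comm]
  · exact Or.inr (inv_circ hk)

theorem contDiffOn_inv : ContDiffOn ℂ ∞ (fun k : ℂ => k⁻¹) {0}ᶜ := contDiffOn_id.inv fun _ hk => hk

theorem contDiffOn_reflR₁ (h : Generic u v) : ContDiffOn ℂ ∞ (reflR₁ u v) (Γhat₄ \ {0}) := by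
  have h1 : ContDiffOn ℂ ∞ (fun k => extR₁ u v k⁻¹) (Γhat₁ \ {0}) :=
    (contDiffOn_extR₁ h).comp (contDiffOn_inv.mono fun k hk => hk.2) fun k hk =>
      ⟨inv_mem_Γhat₁ hk.1 hk.2, inv_ne_zero hk.2⟩
  rw [contDiffOn_infty] at h1 ⊢
  intro m
  exact contDiffOn_conj (uniqueDiffOn_diff_zero uniqueDiffOn_Γhat₄)
    (uniqueDiffOn_diff_zero uniqueDiffOn_Γhat₁)
    (fun z hz => ⟨conj_mem_Γhat₁ hz.1, (map_ne_zero _).2 hz.2⟩) (h1 m)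

theorem rTilde_denom (k : ℂ) : 1 - ω₃ ^ 2 * k ^ 2 = -ω₃ ^ 2 * ((k - ω₃ ^ 2) * (k + ω₃ ^ 2)) := by
  linear_combination -(ω₃ ^ 3 + 1) * omega_cube

theorem rTilde_denom_ne (hk : k ∉ ({ω₃ ^ 2, -ω₃ ^ 2} : Set ℂ)) : 1 - ω₃ ^ 2 * k ^ 2 ≠ 0 := by
  rw [mem_insert_iff, mem_singleton_iff, not_or] at hk
  rw [rTilde_denom]
  refine mul_ne_zero (neg_ne_zero.2 (pow_ne_zero 2 omega_ne)) (mul_ne_zero (sub_ne_zero.2 hk.1) ?_)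
  intro h; exact hk.2 (eq_neg_of_add_eq_zero_left h)

theorem contDiffOn_rTilde : ContDiffOn ℂ ∞ rTilde {ω₃ ^ 2, -ω₃ ^ 2}ᶜ :=
  ContDiffOn.div (by fun_prop) (by fun_prop) fun _ hk => rTilde_denom_ne hk

theorem continuousOn_extR₁ (h : Generic u v) : ContinuousOn (extR₁ u v) circ :=
  (contDiffOn_extR₁ h).continuousOn.mono circ_subset

theorem extR₁_bounded (h : Generic u v) : ∃ C : ℝ, ∀ k ∈ circ, ‖extR₁ u v k‖ ≤ C :=
  isCompact_circ.exists_bound_of_continuousOn (continuousOn_extR₁ h)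

theorem extR₁_ne (h : Generic u v) (hk : k ∈ setQ) : extR₁ u v k ≠ 0 := by
  have hc := mem_circ_of_setQ hk
  rw [extR₁_of_ne (ne_zero_of_circ hc)]
  exact div_ne_zero (neg_ne_zero.2 (regB_ne h hk)) (regA_ne h (circ_subset hc))

theorem extR₁_pm_one (h : Generic u v) {p : ℂ} (hp : p = 1 ∨ p = -1) : extR₁ u v p = 1 := by
  have hc := pm_one_circ hp
  rw [extR₁_of_ne (ne_zero_of_circ hc), regB_pm_one hp, neg_neg,
    div_self (regA_ne h (circ_subset hc))]

theorem extR₂_pm_one (h : Generic u v) {p : ℂ} (hp : p = 1 ∨ p = -1) : extR₂ u v p = -1 := by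
  have hc := pm_one_circ hp
  have hp2 : p ^ 2 = 1 := by rcases hp with rfl | rfl <;> norm_num
  rw [extR₂, reflR₁, refl_of_circ hc, extR₁_pm_one h hp, rTilde, hp2, map_one, mul_one, mul_one,
    ← neg_sub 1 (ω₃ ^ 2), neg_div, div_self (sub_ne_zero.2 omega_sq_ne_one.symm)]

theorem circ_subset' : circ ⊆ Γhat₄ \ {0} := fun _ hk => ⟨Or.inr hk, ne_zero_of_circ hk⟩

theorem reflR₁_ne (h : Generic u v) (hk : k ∈ setQ) : reflR₁ u v k ≠ 0 := by
  rw [reflR₁, refl_of_circ (mem_circ_of_setQ hk)]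
  exact (map_ne_zero _).2 (extR₁_ne h hk)

theorem pm_omega_mem {p : ℂ} (hp : p = ω₃ ∨ p = -ω₃) : p ∈ setQ := by
  rw [mem_setQ]
  have : ω₃ ^ 6 = 1 := by rw [show ω₃ ^ 6 = (ω₃ ^ 3) ^ 2 by ring, omega_cube]; norm_num
  rcases hp with rfl | rfl
  · exact this
  · rw [← this]; ring

theorem pm_omega_sq_mem {p : ℂ} (hp : p = ω₃ ^ 2 ∨ p = -ω₃ ^ 2) : p ∈ setQ := by
  rw [mem_setQ]
  have : ω₃ ^ 12 = 1 := by rw [show ω₃ ^ 12 = (ω₃ ^ 3) ^ 4 by ring, omega_cube]; norm_num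
  rcases hp with rfl | rfl
  · rw [← this]; ring
  · rw [← this]; ring

/-- The pole comes from one linear factor in the denominator of the explicit quotient; the reflected
r_1 is smooth and nonzero there. -/
theorem hasSimplePole_extR₂ (h : Generic u v) {p : ℂ} (hp : p = ω₃ ^ 2 ∨ p = -ω₃ ^ 2) :
    HasSimplePole (extR₂ u v) p := by
  have hq := pm_omega_sq_mem hp
  have hc := mem_circ_of_setQ hq
  have hp0 := ne_zero_of_circ hc
  have hpp : p + p ≠ 0 := by rw [← two_mul]; exact mul_ne_zero two_ne_zero hp0
  have hw : -ω₃ ^ 2 ≠ 0 := neg_ne_zero.2 (pow_ne_zero 2 omega_ne)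
  have hden : ∀ k, 1 - ω₃ ^ 2 * k ^ 2 = -ω₃ ^ 2 * ((k - p) * (k + p)) := by
    intro k; rw [rTilde_denom]; rcases hp with rfl | rfl <;> ring
  refine ⟨fun k => (ω₃ ^ 2 - k ^ 2) / (-ω₃ ^ 2 * (k + p)) * reflR₁ u v k, ?_, ?_, ?_⟩
  · refine ContDiffWithinAt.mul (ContDiffWithinAt.div ?_ ?_ (mul_ne_zero hw hpp))
      (((contDiffOn_reflR₁ h).mono circ_subset') p hc)
    · exact ContDiff.contDiffWithinAt (by fun_prop)
    · exact ContDiff.contDiffWithinAt (by fun_prop)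
  · refine mul_ne_zero (div_ne_zero ?_ (mul_ne_zero hw hpp)) (reflR₁_ne h hq)
    have hp2 : p ^ 2 = ω₃ := by
      rcases hp with rfl | rfl <;> linear_combination ω₃ * omega_cube
    rw [hp2]
    intro h2
    apply omega_ne_one
    refine mul_left_cancel₀ omega_ne ?_
    linear_combination h2
  · filter_upwards [self_mem_nhdsWithin] with k hk
    have h1 : k - p ≠ 0 := sub_ne_zero.2 hk.2
    rw [extR₂, rTilde, hden, div_mul_eq_mul_div, div_mul_eq_mul_div, div_div]
    congr 1; ring

theorem hasSimpleZero_extR₂ (h : Generic u v) {p : ℂ} (hp : p = ω₃ ∨ p = -ω₃) :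
    HasSimpleZero (extR₂ u v) p := by
  have hq := pm_omega_mem hp
  have hc := mem_circ_of_setQ hq
  have hp0 := ne_zero_of_circ hc
  have hpp : p + p ≠ 0 := by rw [← two_mul]; exact mul_ne_zero two_ne_zero hp0
  have hp2 : p ^ 2 = ω₃ ^ 2 := by rcases hp with rfl | rfl <;> ring
  have hd : 1 - ω₃ ^ 2 * p ^ 2 ≠ 0 := by
    rw [hp2]
    intro h2
    exact omega_ne_one (by linear_combination -h2 - ω₃ * omega_cube)
  refine ⟨fun k => -(k + p) / (1 - ω₃ ^ 2 * k ^ 2) * reflR₁ u v k, ?_, ?_, ?_⟩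
  · refine ContDiffWithinAt.mul (ContDiffWithinAt.div ?_ ?_ hd)
      (((contDiffOn_reflR₁ h).mono circ_subset') p hc)
    · exact ContDiff.contDiffWithinAt (by fun_prop)
    · exact ContDiff.contDiffWithinAt (by fun_prop)
  · exact mul_ne_zero (div_ne_zero (neg_ne_zero.2 hpp) hd) (reflR₁_ne h hq)
  · filter_upwards with k
    rw [extR₂, rTilde, ← hp2]; ring

theorem circleRelation_ext_aux (h : Generic u v) (hk : k ∈ circ \ setQ) :
    CircleRelation (extR₁ u v) (extR₂ u v) k := by
  have e1 : ∀ z ∈ circ \ setQ, extR₁ u v z = r₁ u v z := fun z hz =>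
    extR₁_eq ⟨Or.inr hz.1, not_mem_setQhat_of_circ hz⟩
  have e2 : ∀ z ∈ circ \ setQ, extR₂ u v z = r₂ u v z := fun z hz =>
    extR₂_eq ⟨Or.inr hz.1, not_mem_setQhat_of_circ hz⟩
  have := circleRelation_r h.sol hk
  have hk1 := omega_mul_circ_diff hk
  rw [CircleRelation, one_div, one_div] at this ⊢
  rwa [e1 _ (inv_circ_diff hk1), e2 _ hk1, e1 _ (omega_sq_circ_diff hk), e2 _ (inv_circ_diff hk)]

theorem continuousWithinAt_extR₂ (h : Generic u v) (hk : k ∈ circ)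
    (hk' : k ∉ ({ω₃ ^ 2, -ω₃ ^ 2} : Set ℂ)) : ContinuousWithinAt (extR₂ u v) circ k := by
  have h1 : ContinuousWithinAt (reflR₁ u v) circ k :=
    ((contDiffOn_reflR₁ h).continuousOn.mono circ_subset') k hk
  have h2 : ContinuousAt rTilde k := by
    refine (contDiffOn_rTilde.continuousOn k hk').continuousAt ?_
    exact (Set.toFinite _).isClosed.isOpen_compl.mem_nhds hk'
  exact h2.continuousWithinAt.mul h1

/-- The identity extends by continuity from circ \ setQ. The excluded points are those where ωk or
1/k is a pole of r_2. -/
theorem circleRelation_ext (h : Generic u v) (hk : k ∈ circ) (hk' : k ∉ ({-ω₃, ω₃} : Set ℂ)) :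
    CircleRelation (extR₁ u v) (extR₂ u v) k := by
  have hk0 := ne_zero_of_circ hk
  rw [mem_insert_iff, mem_singleton_iff, not_or] at hk'
  have n1 : ω₃ * k ∉ ({ω₃ ^ 2, -ω₃ ^ 2} : Set ℂ) := by
    rw [mem_insert_iff, mem_singleton_iff, not_or]
    refine ⟨fun e => hk'.2 (mul_left_cancel₀ omega_ne ?_), fun e => hk'.1 (mul_left_cancel₀ omega_ne ?_)⟩
    · rw [e]; ring
    · rw [e]; ring
  have n2 : k⁻¹ ∉ ({ω₃ ^ 2, -ω₃ ^ 2} : Set ℂ) := by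
    rw [mem_insert_iff, mem_singleton_iff, not_or]
    refine ⟨fun e => hk'.2 ?_, fun e => hk'.1 ?_⟩
    · rw [← inv_inv k, e, ← omega_inv, inv_inv]
    · rw [← inv_inv k, e, ← omega_inv, inv_neg, inv_inv]
  have h1 := continuousOn_extR₁ h
  have ci : ContinuousWithinAt (fun k : ℂ => k⁻¹) circ k := (continuousAt_inv₀ hk0).continuousWithinAt
  have cm : ContinuousWithinAt (fun k : ℂ => ω₃ * k) circ k := by fun_prop
  have cmi : ContinuousWithinAt (fun k : ℂ => (ω₃ * k)⁻¹) circ k :=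
    (ContinuousAt.inv₀ (by fun_prop) (mul_ne_zero omega_ne hk0)).continuousWithinAt
  have csq : ContinuousWithinAt (fun k : ℂ => ω₃ ^ 2 * k) circ k := by fun_prop
  have c1 : ContinuousWithinAt (fun k => extR₁ u v (ω₃ * k)⁻¹) circ k :=
    ContinuousWithinAt.comp (g := extR₁ u v) (f := fun k : ℂ => (ω₃ * k)⁻¹)
      (h1 _ (inv_circ (omega_mul_circ hk))) cmi
      fun z hz => inv_circ (omega_mul_circ hz)
  have c2 : ContinuousWithinAt (fun k => extR₂ u v (ω₃ * k)) circ k :=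
    ContinuousWithinAt.comp (g := extR₂ u v) (f := fun k : ℂ => ω₃ * k)
      (continuousWithinAt_extR₂ h (omega_mul_circ hk) n1) cm
      fun z hz => omega_mul_circ hz
  have c3 : ContinuousWithinAt (fun k => extR₁ u v (ω₃ ^ 2 * k)) circ k :=
    ContinuousWithinAt.comp (g := extR₁ u v) (f := fun k : ℂ => ω₃ ^ 2 * k)
      (h1 _ (omega_sq_circ hk)) csq fun z hz => omega_sq_circ hz
  have c4 : ContinuousWithinAt (fun k => extR₂ u v k⁻¹) circ k :=
    ContinuousWithinAt.comp (g := extR₂ u v) (f := fun k : ℂ => k⁻¹)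
      (continuousWithinAt_extR₂ h (inv_circ hk) n2) ci fun z hz => inv_circ hz
  have := eq_of_eqOn_circ hk ((c1.add c2).add (c3.mul c4)) (g := fun _ => 0)
    continuousWithinAt_const fun z hz => by
      have := circleRelation_ext_aux h hz
      rwa [CircleRelation, one_div, one_div] at this
  rw [CircleRelation, one_div, one_div]
  exact this

/-- Apply `norm_reg_minor` at ωk: the denominator times two nonzero values of regA has modulus |l_1
- l_2|² |regA|, and l_1 = l_2 at ωk only for k = ±ω². -/
theorem solvedDenom_extR₁ (h : Generic u v) (hk : k ∈ circ) (hk' : k ∉ ({ω₃ ^ 2, -ω₃ ^ 2} : Set ℂ)) :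
    solvedDenom (extR₁ u v) k ≠ 0 := by
  have hm := omega_mul_circ hk
  have hi := inv_circ hm
  have nA := regA_ne h (circ_subset hm)
  have nA' := regA_ne h (circ_subset hi)
  have n := norm_reg_minor (u := u) (v := v) hm
  have nA'' := regA_ne h (circ_subset (omega_sq_circ hm))
  have hm0 := ne_zero_of_circ hm
  have hl : lam (ω₃ * k) 0 - lam (ω₃ * k) 1 ≠ 0 := by
    rw [lam_zero_sub_one]
    intro e
    rw [mem_insert_iff, mem_singleton_iff, not_or] at hk'
    have e2 : (ω₃ * k) ^ 2 = 1 ^ 2 := by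
      have := mul_inv_cancel₀ hm0
      linear_combination -2 * (ω₃ * k) * e + this
    have e3 : k = ω₃ ^ 2 * (ω₃ * k) := by linear_combination -k * omega_cube
    rcases sq_eq_sq_iff_eq_or_eq_neg.1 e2 with e4 | e4
    · exact hk'.1 (by rw [e3, e4, mul_one])
    · exact hk'.2 (by rw [e3, e4]; ring)
  have n1 : regA u v (ω₃ * k) * regA u v (ω₃ * k)⁻¹ - regB u v (ω₃ * k) * regB u v (ω₃ * k)⁻¹ ≠ 0 := by
    rw [← norm_ne_zero_iff, n]
    exact mul_ne_zero (pow_ne_zero 2 (norm_ne_zero_iff.2 hl)) (norm_ne_zero_iff.2 nA'')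
  rw [solvedDenom, one_div, extR₁_of_ne hm0, extR₁_of_ne (inv_ne_zero hm0)]
  generalize regA u v (ω₃ * k) = a, regA u v (ω₃ * k)⁻¹ = a', regB u v (ω₃ * k) = b,
    regB u v (ω₃ * k)⁻¹ = b' at *
  intro e
  apply n1
  field_simp at e
  linear_combination e

theorem symmRelation_ext (h : Generic u v) (hk : k ∈ circ) (hk' : k ∉ ({ω₃ ^ 2, -ω₃ ^ 2} : Set ℂ)) :
    SymmRelation (extR₁ u v) (extR₂ u v) k := by
  refine (circleRelation_omega_sq k).1 (circleRelation_ext h (omega_sq_circ hk) ?_)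
  rw [mem_insert_iff, mem_singleton_iff, not_or] at hk' ⊢
  have e3 : k = ω₃ * (ω₃ ^ 2 * k) := by linear_combination -k * omega_cube
  refine ⟨fun e => hk'.2 ?_, fun e => hk'.1 ?_⟩
  · rw [e3, e]; ring
  · rw [e3, e]; ring

theorem solvedRelation_ext (h : Generic u v) (hk : k ∈ circ)
    (hk' : k ∉ ({ω₃ ^ 2, -ω₃ ^ 2} : Set ℂ)) : SolvedRelation (extR₁ u v) (extR₂ u v) k := by
  refine solvedRelation_of_symm (solvedDenom_extR₁ h hk hk') (symmRelation_ext h hk hk')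
    (symmRelation_ext h (omega_mul_circ (inv_circ hk)) ?_)
  have hk0 := ne_zero_of_circ hk
  rw [mem_insert_iff, mem_singleton_iff, not_or] at hk' ⊢
  have e3 : ω₃ ^ 2 * k⁻¹ = (ω₃ * k)⁻¹ := omega_pow_mul_inv.symm
  refine ⟨fun e => hk'.1 ?_, fun e => hk'.2 ?_⟩
  · have e4 : k⁻¹ = ω₃ := mul_left_cancel₀ omega_ne (by rw [e]; ring)
    rw [← inv_inv k, e4, omega_inv]
  · have e4 : k⁻¹ = -ω₃ := mul_left_cancel₀ omega_ne (by rw [e]; ring)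
    rw [← inv_inv k, e4, inv_neg, omega_inv]

theorem rTilde_mul_inv (hk : k ∈ circ \ setQ) : rTilde k * rTilde k⁻¹ = 1 := by
  have h := not_mem_setQhat_of_circ hk
  have hi := not_mem_setQhat_of_circ (inv_circ_diff hk)
  have c1 : coef (lam k⁻¹) 0 = coef (lam k) 1 := coef_perm (lam_inv k) 0
  have c2 : coef (lam k⁻¹) 1 = coef (lam k) 0 := coef_perm (lam_inv k) 1
  rw [rTilde_eq_coef_div h, rTilde_eq_coef_div hi, c1, c2]
  have h0 := coef_ne h 0
  have h1 := coef_ne h 1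
  field_simp

theorem solvedDenom_extR₂ (h : Generic u v) (hk : k ∈ circ \ setQ) :
    solvedDenom (extR₂ u v) k ≠ 0 := by
  have hm := omega_mul_circ_diff hk
  -- The explicit factors at ωk and at its inverse multiply to 1, so the two denominators are
  -- complex conjugates of each other.
  have h1 : solvedDenom (extR₂ u v) k = (starRingEnd ℂ) (solvedDenom (extR₁ u v) k) := by
    rw [solvedDenom, solvedDenom, one_div, extR₂, extR₂, reflR₁, reflR₁, refl_of_circ hm.1,
      refl_of_circ (inv_circ hm.1), map_sub, map_mul, map_one]
    linear_combination -(starRingEnd ℂ) (extR₁ u v (ω₃ * k)) *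
      (starRingEnd ℂ) (extR₁ u v (ω₃ * k)⁻¹) * rTilde_mul_inv hm
  rw [h1]
  refine (map_ne_zero _).2 (solvedDenom_extR₁ h hk.1 fun h' => hk.2 (pm_omega_sq_mem ?_))
  simpa using h'

theorem solvedRelation_ext' (h : Generic u v) (hk : k ∈ circ \ setQ) :
    SolvedRelation (extR₂ u v) (extR₁ u v) k :=
  (circleRelation_iff_solved' (fun _ hz => solvedDenom_extR₂ h hz)).1
    (fun _ hz => circleRelation_ext_aux h hz) k hk

theorem kappa_mem {j : ℕ} (hj : j ∈ Icc 1 6) : κ j ∈ setQ := ⟨j, hj, rfl⟩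

theorem kappa_add_three (j : ℕ) : κ (j + 3) = -κ j := by
  have : (Real.pi * Complex.I * (((j + 3 : ℕ) : ℂ) - 1) / 3) =
      Real.pi * Complex.I * ((j : ℂ) - 1) / 3 + Real.pi * Complex.I := by push_cast; ring
  rw [κ, this, Complex.exp_add, Complex.exp_pi_mul_I, κ]; ring

theorem kappa_three : κ 3 = ω₃ := by
  rw [κ, ω₃]; congr 1; push_cast; ring

theorem kappa_six : κ 6 = -ω₃ := by rw [kappa_add_three 3, kappa_three]

theorem kappa_five : κ 5 = ω₃ ^ 2 := by
  rw [κ, ω₃, ← Complex.exp_nat_mul]; congr 1; push_cast; ring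

theorem kappa_two : κ 2 = -ω₃ ^ 2 := by
  rw [← kappa_five, kappa_add_three 2, neg_neg]

end

/-! ### Uniform estimates along the ray -i[1,∞) -/

section

theorem ray_norm {c k : ℂ} (hc : ‖c‖ = 1) (hk : k ∈ ray c) : 1 ≤ ‖k‖ := by
  obtain ⟨y, hy, rfl⟩ := hk
  have hy : 1 ≤ y := hy
  simp only
  rw [norm_mul, hc, one_mul, Complex.norm_real, Real.norm_of_nonneg (by linarith)]
  exact hy

theorem sd_inv_ray {c : ℂ} (hc : ‖c‖ = 1) (m : ℕ) : SD oneW (ray c) m (fun k : ℂ => k⁻¹) := by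
  have hb : WBdd oneW (ray c) (fun k : ℂ => k⁻¹) := wBdd_one.2 ⟨1, fun k hk => by
    rw [norm_inv]; exact inv_le_one_of_one_le₀ (ray_norm hc hk)⟩
  induction m with
  | zero => exact hb
  | succ m ih =>
    refine ⟨hb, fun k => -(k⁻¹ * k⁻¹), fun k hk => ?_, (ih.mul ih).neg⟩
    have h0 : k ≠ 0 := norm_pos_iff.1 (zero_lt_one.trans_le (ray_norm hc hk))
    exact ((hasDerivAt_inv h0).hasDerivWithinAt).congr_deriv (by rw [pow_two, mul_inv])

/-- The ray `-i[1,∞)`. -/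
def rayS : Set ℂ := ray (-Complex.I)

theorem norm_neg_I : ‖-Complex.I‖ = 1 := by simp

theorem rayS_norm {k : ℂ} (hk : k ∈ rayS) : 1 ≤ ‖k‖ := ray_norm norm_neg_I hk

theorem rayS_ne {k : ℂ} (hk : k ∈ rayS) : k ≠ 0 :=
  norm_pos_iff.1 (zero_lt_one.trans_le (rayS_norm hk))

theorem rayS_subset : rayS ⊆ Γhat₁ := fun k hk => Or.inl (by rw [Γ₁_eq]; exact Or.inr hk)

theorem rayS_not_mem {k : ℂ} (hk : k ∈ rayS) : k ∉ setQhat := by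
  have h0 := rayS_ne hk
  obtain ⟨y, hy, rfl⟩ := hk
  rw [mem_setQhat, not_or]
  refine ⟨fun h => ?_, h0⟩
  have h1 : (-Complex.I * (y : ℂ)) ^ 6 = -((y ^ 6 : ℝ) : ℂ) := by
    have : Complex.I ^ 6 = -1 := by
      rw [show Complex.I ^ 6 = (Complex.I ^ 2) ^ 3 by ring, Complex.I_sq]; norm_num
    push_cast
    linear_combination (y : ℂ) ^ 6 * this
  simp only at h
  rw [h1] at h
  have h2 : -(y ^ 6) = (1 : ℝ) := by exact_mod_cast h
  have : 0 ≤ y ^ 6 := by positivity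
  linarith

theorem rayS_inv_sq {k : ℂ} (hk : k ∈ rayS) : ∃ t : ℝ, 0 ≤ t ∧ t ≤ 1 ∧ k⁻¹ * k⁻¹ = -(t : ℂ) := by
  obtain ⟨y, hy, rfl⟩ := hk
  have hy : 1 ≤ y := hy
  have h1 := inv_le_one_of_one_le₀ hy
  have h0 : 0 ≤ y⁻¹ := by positivity
  refine ⟨y⁻¹ * y⁻¹, by positivity, by nlinarith, ?_⟩
  simp only [mul_inv, inv_neg, Complex.inv_I, Complex.ofReal_mul, Complex.ofReal_inv]
  linear_combination ((y : ℂ)⁻¹ * (y : ℂ)⁻¹) * Complex.I_sq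

theorem omega_re : ω₃.re = -1 / 2 := by
  rw [omega_eq, s3]; simp

theorem omega_sq_re : (ω₃ ^ 2).re = -1 / 2 := by
  rw [← conj_omega, Complex.conj_re, omega_re]

theorem half_le_norm {w : ℂ} (hw : w.re = -1 / 2) {t : ℝ} (h1 : t ≤ 1) :
    1 / 2 ≤ ‖1 + w * t‖ := by
  refine le_trans ?_ (Complex.abs_re_le_norm _)
  rw [Complex.add_re, Complex.one_re, Complex.re_mul_ofReal, hw]
  exact le_trans (by linarith) (le_abs_self _)

/-- The difference quotients of the exponents. -/
noncomputable def lamq (i j : Fin 3) (k : ℂ) : ℂ := (lam k i - lam k j) * k⁻¹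

/-- Along the ray k⁻² = -t with 0 ≤ t ≤ 1. Up to constants of fixed modulus the quotients are 1 + t,
1 + ω² t and 1 + ω t, whose real parts are at least 1/2. -/
theorem lamq_bound : ∃ c > 0, ∀ i j : Fin 3, i ≠ j → ∀ k ∈ rayS, c ≤ ‖lamq i j k‖ := by
  have hc := norm_pos_iff.2 cst_ne
  refine ⟨min (1 / 2) (‖cst‖ * (1 / 2)), by positivity, ?_⟩
  have key : ∀ k ∈ rayS, 1 / 2 ≤ ‖lamq 0 1 k‖ ∧ ‖cst‖ * (1 / 2) ≤ ‖lamq 0 2 k‖ ∧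
      ‖cst‖ * (1 / 2) ≤ ‖lamq 1 2 k‖ := by
    intro k hk
    have hk0 := rayS_ne hk
    obtain ⟨t, h0, h1, ht⟩ := rayS_inv_sq hk
    have hkk := mul_inv_cancel₀ hk0
    refine ⟨?_, ?_, ?_⟩
    · have : lamq 0 1 k = ((-(1 + t) / 2 : ℝ) : ℂ) := by
        rw [lamq, lam_zero_sub_one]; push_cast
        linear_combination (1 / 2) * ht - (1 / 2) * hkk
      rw [this, Complex.norm_real, Real.norm_eq_abs]
      exact le_trans (by linarith) (neg_le_abs _)
    · have : lamq 0 2 k = cst * (1 + ω₃ ^ 2 * t) := by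
        rw [lamq, lam_zero_sub_two]
        linear_combination cst * hkk - cst * ω₃ ^ 2 * ht
      rw [this, norm_mul]
      exact mul_le_mul_of_nonneg_left (half_le_norm omega_sq_re h1) hc.le
    · have : lamq 1 2 k = cst * (-(ω₃ ^ 2) * (1 + ω₃ * t)) := by
        rw [lamq, lam_one_sub_two]
        linear_combination cst * ht - cst * ω₃ ^ 2 * hkk + cst * t * omega_cube
      rw [this, norm_mul, norm_mul, norm_neg, norm_pow, norm_omega, one_pow, one_mul]
      exact mul_le_mul_of_nonneg_left (half_le_norm omega_re h1) hc.le
  have hsymm : ∀ i j k, ‖lamq i j k‖ = ‖lamq j i k‖ := fun i j k => by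
    rw [lamq, lamq, norm_mul, norm_mul, norm_sub_rev]
  intro i j hij k hk
  obtain ⟨k1, k2, k3⟩ := key k hk
  fin_cases i <;> fin_cases j
  · exact absurd rfl hij
  · exact (min_le_left _ _).trans k1
  · exact (min_le_right _ _).trans k2
  · rw [hsymm]; exact (min_le_left _ _).trans k1
  · exact absurd rfl hij
  · exact (min_le_right _ _).trans k3
  · rw [hsymm]; exact (min_le_right _ _).trans k2
  · rw [hsymm]; exact (min_le_right _ _).trans k3
  · exact absurd rfl hij

theorem lam_form (i : Fin 3) : ∃ α β : ℂ, ∀ k, lam k i = α * k + β * k⁻¹ := by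
  fin_cases i
  · exact ⟨Complex.I * ω₃ / (2 * s3), Complex.I * ω₃ ^ 2 / (2 * s3), fun k => by
      simp only [Fin.zero_eta, lam_zero]; ring⟩
  · exact ⟨Complex.I * ω₃ ^ 2 / (2 * s3), Complex.I * ω₃ / (2 * s3), fun k => by
      simp only [Fin.mk_one, lam_one]; ring⟩
  · exact ⟨Complex.I / (2 * s3), Complex.I / (2 * s3), fun k => by
      simp only [Fin.reduceFinMk, lam_two]; ring⟩

variable (m : ℕ)

theorem sd_inv : SD oneW rayS m (fun k : ℂ => k⁻¹) := sd_inv_ray norm_neg_I m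

theorem sd_lam_mul_inv (i : Fin 3) : SD oneW rayS m (fun k => lam k i * k⁻¹) := by
  obtain ⟨α, β, h⟩ := lam_form i
  refine ((SD.const α).add ((SD.const β).mul ((sd_inv m).mul (sd_inv m)))).congr fun k hk => ?_
  have := mul_inv_cancel₀ (rayS_ne hk)
  simp only [h]
  linear_combination α * this

theorem sd_lamq (i j : Fin 3) : SD oneW rayS m (lamq i j) :=
  ((sd_lam_mul_inv m i).sub (sd_lam_mul_inv m j)).congr fun k _ => by simp only [lamq]; ring

/-- The derivative of `lam k i - lam k j`. -/
theorem sd_lam_deriv (i j : Fin 3) : ∃ f : ℂ → ℂ,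
    (∀ k ∈ rayS, HasDerivWithinAt (fun k => lam k i - lam k j) (f k) rayS k) ∧
      ∀ m, SD oneW rayS m f := by
  obtain ⟨α, β, h⟩ := lam_form i
  obtain ⟨γ, δ, h'⟩ := lam_form j
  refine ⟨fun k => (α - γ) + (δ - β) * (k⁻¹ * k⁻¹), fun k hk => ?_, fun m =>
    (SD.const (α - γ)).add ((SD.const (δ - β)).mul ((sd_inv m).mul (sd_inv m)))⟩
  have h0 := rayS_ne hk
  have e : (fun k => lam k i - lam k j) = fun k => (α - γ) * k + (β - δ) * k⁻¹ := by
    ext k; rw [h, h']; ring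
  rw [e]
  refine ((((hasDerivAt_id k).const_mul (α - γ)).add
    ((hasDerivAt_inv h0).const_mul (β - δ))).hasDerivWithinAt).congr_deriv ?_
  rw [pow_two, mul_inv]; ring

theorem sd_lamq_inv {i j : Fin 3} (hij : i ≠ j) : SD oneW rayS m (fun k => (lamq i j k)⁻¹) := by
  obtain ⟨c, hc, hb⟩ := lamq_bound
  exact (sd_lamq m i j).inv hc (hb i j hij)

/-- The coefficients multiplied by `k ^ 2`. -/
theorem sd_coef_mul_sq (i : Fin 3) : SD oneW rayS m (fun k => coef (lam k) i * (k * k)) := by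
  have h1 : i ≠ i + 1 := by fin_cases i <;> decide
  have h2 : i ≠ i + 2 := by fin_cases i <;> decide
  refine ((sd_lamq_inv m h1).mul (sd_lamq_inv m h2)).congr fun k hk => ?_
  have h0 := rayS_ne hk
  simp only [coef, lamq, mul_inv, inv_inv]
  ring

theorem sd_coef_mul (i : Fin 3) : SD oneW rayS m (fun k => coef (lam k) i * k) :=
  ((sd_coef_mul_sq m i).mul (sd_inv m)).congr fun k hk => by
    have := mul_inv_cancel₀ (rayS_ne hk)
    linear_combination -(coef (lam k) i * k) * this

theorem sd_coef (i : Fin 3) : SD oneW rayS m (fun k => coef (lam k) i) :=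
  ((sd_coef_mul m i).mul (sd_inv m)).congr fun k hk => by
    have := mul_inv_cancel₀ (rayS_ne hk)
    linear_combination -(coef (lam k) i) * this

theorem sd_coef_lam_mul (i j : Fin 3) : SD oneW rayS m (fun k => coef (lam k) i * lam k j * k) :=
  ((sd_coef_mul_sq m i).mul (sd_lam_mul_inv m j)).congr fun k hk => by
    have := mul_inv_cancel₀ (rayS_ne hk)
    linear_combination -(coef (lam k) i * k * lam k j) * this

theorem sd_coef_lam (i j : Fin 3) : SD oneW rayS m (fun k => coef (lam k) i * lam k j) :=
  ((sd_coef_lam_mul m i j).mul (sd_inv m)).congr fun k hk => by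
    have := mul_inv_cancel₀ (rayS_ne hk)
    linear_combination -(coef (lam k) i * lam k j) * this

section DiagSmooth
variable (N : ℕ) (q p : SchwartzMap ℝ ℂ)

/-- The diagonal solution for the `j`th column, normalized by `coef (lam k) i`. -/
noncomputable def diagF (N : ℕ) (i j : Fin 3) (k : ℂ) : ℝ →ᵇ ℂ :=
  diagSol N q p (coef (lam k)) (fun n => coef (lam k) n * lam k n) (fun n => lam k n - lam k j)
    (coef (lam k) i) (coef (lam k) i * lam k j)

theorem diag_bound : ∃ C, ∀ (j : Fin 3), ∀ k ∈ rayS,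
    ‖Ring.inverse (1 - diagOp N q p (coef (lam k)) (fun n => coef (lam k) n * lam k n)
      (fun n => lam k n - lam k j))‖ ≤ C := by
  have h1 : ∀ n, ∃ C, ∀ k ∈ rayS, ‖coef (lam k) n‖ ≤ C := fun n => wBdd_one.1 (sd_coef 0 n).wBdd
  have h2 : ∀ n, ∃ C, ∀ k ∈ rayS, ‖coef (lam k) n * lam k n‖ ≤ C :=
    fun n => wBdd_one.1 (sd_coef_lam 0 n n).wBdd
  choose C hC using h1
  choose D hD using h2
  refine ⟨_, fun j k hk => (isUnit_diagOp N q p (coef (lam k)) (fun n => coef (lam k) n * lam k n)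
    (fun n => lam k n - lam k j) (M := ∑ n, (C n * ‖wfun N q 1‖ + D n * ‖wfun N p 1‖)) ?_).2⟩
  gcongr with n
  · exact hC n k hk
  · exact hD n k hk

/-- The choice N = m + 1 supplies the operator family with the m derivatives needed for m controlled
derivatives of the solution, the last of which need only be bounded. -/
theorem sd_diagF {i j : Fin 3} (hj : ∀ k ∈ rayS, Adm k j) :
    SD oneW rayS m (diagF q p (m + 1) i j) := by
  obtain ⟨C, hC⟩ := diag_bound (m + 1) q p
  have hop : ∀ n, SD oneW rayS m (fun k => (wker (m + 1) 0).op 0 (lam k n - lam k j)) := by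
    intro n
    obtain ⟨f, hf, hf'⟩ := sd_lam_deriv n j
    exact SD.comp_family (Φ := (wker (m + 1) 0).op) (H := rightHalf) (M := m + 1) (C := 2)
      (fun n hn z hz => (wker (m + 1) 0).hasDerivWithinAt_op hn hz)
      (fun n _ z _ => (wker (m + 1) 0).norm_op_le n z) (fun k hk => hj k hk n) hf (by omega) (hf' m)
  have hdiag : SD oneW rayS m (fun k => 1 - diagOp (m + 1) q p (coef (lam k))
      (fun n => coef (lam k) n * lam k n) (fun n => lam k n - lam k j)) := by
    refine (SD.const 1).sub (SD.sum SD.zero fun n _ => SD.mul (A := (ℝ →ᵇ ℂ) →L[ℂ] (ℝ →ᵇ ℂ))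
      (f := fun k => coef (lam k) n • mulOp (wfun (m + 1) q 1) +
        (coef (lam k) n * lam k n) • mulOp (wfun (m + 1) p 1))
      (SD.add ?_ ?_) (hop n))
    · exact SD.smul (sd_coef m n) (SD.const _)
    · exact SD.smul (sd_coef_lam m n n) (SD.const _)
  have hinv := SD.inverse (A := (ℝ →ᵇ ℂ) →L[ℂ] (ℝ →ᵇ ℂ)) (f := fun k => 1 - diagOp (m + 1) q p
      (coef (lam k)) (fun n => coef (lam k) n * lam k n) (fun n => lam k n - lam k j)) hdiag (fun k _ => (isUnit_diagOp (m + 1) q p (coef (lam k))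
    (fun n => coef (lam k) n * lam k n) (fun n => lam k n - lam k j) le_rfl).1)
    ⟨C, fun k hk => hC j k hk⟩
  exact hinv.clm_apply ((SD.smul (sd_coef m i) (SD.const _)).add
    (SD.smul (sd_coef_lam m i j) (SD.const _)))

/-- The inhomogeneity c_i q + c_i l_j p is O(1/k) and the inverse operators are uniformly bounded.
-/
theorem norm_diagF_le (i j : Fin 3) : ∃ C, ∀ k ∈ rayS, ‖k‖ * ‖diagF q p N i j k‖ ≤ C := by
  obtain ⟨C, hC⟩ := diag_bound N q p
  obtain ⟨D, hD⟩ := wBdd_one.1 (sd_coef_mul 0 i).wBdd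
  obtain ⟨E, hE⟩ := wBdd_one.1 (sd_coef_lam_mul 0 i j).wBdd
  refine ⟨C * (D * ‖wfun N q 4‖ + E * ‖wfun N p 4‖), fun k hk => ?_⟩
  have hC0 := (norm_nonneg _).trans (hC j k hk)
  have h1 : ‖diagF q p N i j k‖ ≤ C * (‖coef (lam k) i‖ * ‖wfun N q 4‖ +
      ‖coef (lam k) i * lam k j‖ * ‖wfun N p 4‖) := by
    refine (ContinuousLinearMap.le_opNorm _ _).trans ?_
    refine mul_le_mul (hC j k hk) ?_ (norm_nonneg _) hC0
    refine (norm_add_le _ _).trans ?_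
    rw [norm_smul, norm_smul]
  have h2 := hD k hk
  have h3 := hE k hk
  rw [norm_mul] at h2 h3
  calc _ ≤ ‖k‖ * (C * (‖coef (lam k) i‖ * ‖wfun N q 4‖ +
      ‖coef (lam k) i * lam k j‖ * ‖wfun N p 4‖)) := by gcongr
    _ = C * (‖coef (lam k) i‖ * ‖k‖ * ‖wfun N q 4‖ +
      ‖coef (lam k) i * lam k j‖ * ‖k‖ * ‖wfun N p 4‖) := by ring
    _ ≤ _ := by gcongr

end DiagSmooth

variable {u v : SchwartzMap ℝ ℝ}

theorem isG_diagF (N : ℕ) {i j : Fin 3} {k : ℂ} (hk : k ∈ rayS) (hj : Adm k j) :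
    IsG (qS u v) (pS u) (lam k) j
      (fun x => (coef (lam k) i)⁻¹ * wmul N 0 (diagF (qS u v) (pS u) N i j k) x) :=
  isG_diagSol N (qS u v) (pS u) hj (coef_ne (rayS_not_mem hk) i)

/-- The normalization by c_i absorbs the prefactor of the scattering integral, so no further power
of k is lost. -/
theorem s_eq_diagF (N : ℕ) {i j : Fin 3} {k : ℂ} (hk : k ∈ rayS) (hj : Adm k j)
    (hij : (lam k i - lam k j).re = 0) : s u v k i j = (1 : Matrix (Fin 3) (Fin 3) ℂ) i j -
      (wden N).fn 0 (lam k i - lam k j) (diagF (qS u v) (pS u) N i j k) := by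
  rw [s_eq (rayS_not_mem hk) hj (isG_diagF N (i := i) hk hj) i, fn_wden N hij, ← integral_const_mul]
  congr 2
  ext x
  have := coef_ne (rayS_not_mem hk) i
  field_simp

theorem sd_s {i j : Fin 3} (hj : ∀ k ∈ rayS, Adm k j)
    (hij : ∀ k ∈ rayS, (lam k i - lam k j).re = 0) : SD oneW rayS m (fun k => s u v k i j) := by
  obtain ⟨f, hf, hf'⟩ := sd_lam_deriv i j
  have hfn : SD oneW rayS m (fun k => (wden (m + 1)).fn 0 (lam k i - lam k j)) :=
    SD.comp_family (Φ := (wden (m + 1)).fn) (H := imAxis) (M := m + 1) (C := 4)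
      (fun n hn z hz => (wden (m + 1)).hasDerivWithinAt_fn hn hz)
      (fun n _ z _ => (wden (m + 1)).norm_fn_le n z) hij hf (by omega) (hf' m)
  exact ((SD.const _).sub (hfn.clm_apply (sd_diagF m _ _ hj))).congr fun k hk =>
    s_eq_diagF (m + 1) hk (hj k hk) (hij k hk)

theorem norm_s_self_sub_one {j : Fin 3} (hj : ∀ k ∈ rayS, Adm k j) :
    ∃ C, ∀ k ∈ rayS, ‖k‖ * ‖s u v k j j - 1‖ ≤ C := by
  obtain ⟨C, hC⟩ := norm_diagF_le 0 (qS u v) (pS u) j j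
  refine ⟨4 * C, fun k hk => ?_⟩
  rw [s_eq_diagF 0 hk (hj k hk) (by simp), Matrix.one_apply_eq, sub_sub_cancel_left, norm_neg]
  calc _ ≤ ‖k‖ * (4 * ‖diagF (qS u v) (pS u) 0 j j k‖) := by
        refine mul_le_mul_of_nonneg_left ?_ (norm_nonneg _)
        refine (ContinuousLinearMap.le_opNorm _ _).trans ?_
        exact mul_le_mul_of_nonneg_right ((wden 0).norm_fn_le 0 _) (norm_nonneg _)
    _ = 4 * (‖k‖ * ‖diagF (qS u v) (pS u) 0 j j k‖) := by ring
    _ ≤ _ := by gcongr; exact hC k hk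

/-- As s_jj - 1 = O(1/k), the entry is at least 1/2 in modulus far out on the ray; the rest of the
ray is compact and the entry does not vanish on it. -/
theorem s_self_lower_bound {j : Fin 3} (hj : ∀ k ∈ rayS, Adm k j) (hne : ∀ k ∈ rayS, s u v k j j ≠ 0) :
    ∃ c > 0, ∀ k ∈ rayS, c ≤ ‖s u v k j j‖ := by
  obtain ⟨C, hC⟩ := norm_s_self_sub_one (u := u) (v := v) hj
  have hcont : ContinuousOn (fun k => s u v k j j) rayS := by
    obtain ⟨-, f, hf, -⟩ := sd_s (u := u) (v := v) 1 hj (i := j) (fun k _ => by simp)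
    exact fun k hk => (hf k hk).continuousWithinAt
  set K := rayS ∩ Metric.closedBall 0 (2 * C) with hK
  have hcomp : IsCompact K := (isCompact_closedBall _ _).inter_left
    (isClosed_ray _ (neg_ne_zero.2 Complex.I_ne_zero))
  have h1 : ∃ c > 0, ∀ k ∈ K, c ≤ ‖s u v k j j‖ := by
    rcases K.eq_empty_or_nonempty with h | h
    · exact ⟨1, one_pos, fun k hk => by rw [h] at hk; exact hk.elim⟩
    · obtain ⟨k₀, hk₀, hmin⟩ := hcomp.exists_isMinOn h
        ((hcont.mono inter_subset_left).norm)
      exact ⟨_, norm_pos_iff.2 (hne k₀ hk₀.1), fun k hk => hmin hk⟩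
  obtain ⟨c, hc, hck⟩ := h1
  refine ⟨min c (1 / 2), by positivity, fun k hk => ?_⟩
  by_cases hkK : ‖k‖ ≤ 2 * C
  · exact (min_le_left _ _).trans (hck k ⟨hk, by simpa using hkK⟩)
  · refine (min_le_right _ _).trans ?_
    push Not at hkK
    have h2 := hC k hk
    have hk1 := rayS_norm hk
    have h3 : ‖s u v k j j - 1‖ ≤ 1 / 2 := by
      by_contra hcon
      push Not at hcon
      nlinarith
    have h4 : ‖(1 : ℂ)‖ ≤ ‖s u v k j j‖ + ‖s u v k j j - 1‖ := by
      have := norm_sub_le (s u v k j j) (s u v k j j - 1)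
      rwa [sub_sub_cancel] at this
    rw [norm_one] at h4
    linarith

end

/-! ### Approximate diagonalization by a Riccati recursion -/

section

/-- Symbols which are `O(k⁻ⁿ)` along the ray and integrable in `x`. -/
def XBdd (n : ℕ) (w : ℂ → ℝ → ℂ) : Prop :=
  ∃ C, ∀ k ∈ rayS, ∀ x, ‖k‖ ^ n * ‖w k x‖ ≤ C * (1 + x ^ 2)⁻¹

/-- Symbols of order `-n` with `m` controlled derivatives in `x`. -/
def SX : ℕ → ℕ → (ℂ → ℝ → ℂ) → Prop
  | 0, n, w => XBdd n w
  | m + 1, n, w => XBdd n w ∧ (∀ k ∈ rayS, Differentiable ℝ (w k)) ∧ SX m n fun k => deriv (w k)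

section SX
variable {m n n' : ℕ} {w w' : ℂ → ℝ → ℂ}

theorem XBdd.congr (h : XBdd n w) (e : ∀ k ∈ rayS, w' k = w k) : XBdd n w' := by
  obtain ⟨C, hC⟩ := h
  exact ⟨C, fun k hk x => by rw [e k hk]; exact hC k hk x⟩

theorem SX.congr (h : SX m n w) (e : ∀ k ∈ rayS, w' k = w k) : SX m n w' := by
  induction m generalizing w w' with
  | zero => exact XBdd.congr h e
  | succ m ih =>
    obtain ⟨h1, h2, h3⟩ := h
    exact ⟨h1.congr e, fun k hk => by rw [e k hk]; exact h2 k hk, ih h3 fun k hk => by rw [e k hk]⟩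

theorem SX.bdd (h : SX m n w) : XBdd n w := by
  cases m with
  | zero => exact h
  | succ m => exact h.1

theorem SX.of_succ (h : SX (m + 1) n w) : SX m n w := by
  induction m generalizing w with
  | zero => exact h.1
  | succ m ih => exact ⟨h.1, h.2.1, ih h.2.2⟩

theorem XBdd.mono (hn : n ≤ n') (h : XBdd n' w) : XBdd n w := by
  obtain ⟨C, hC⟩ := h
  refine ⟨C, fun k hk x => le_trans ?_ (hC k hk x)⟩
  exact mul_le_mul_of_nonneg_right (pow_le_pow_right₀ (rayS_norm hk) hn) (norm_nonneg _)

theorem SX.mono (hn : n ≤ n') (h : SX m n' w) : SX m n w := by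
  induction m generalizing w with
  | zero => exact XBdd.mono hn h
  | succ m ih => exact ⟨h.1.mono hn, h.2.1, ih h.2.2⟩

theorem XBdd.add (h : XBdd n w) (h' : XBdd n w') : XBdd n fun k x => w k x + w' k x := by
  obtain ⟨C, hC⟩ := h
  obtain ⟨D, hD⟩ := h'
  refine ⟨C + D, fun k hk x => ?_⟩
  calc _ ≤ ‖k‖ ^ n * (‖w k x‖ + ‖w' k x‖) := by gcongr; exact norm_add_le _ _
    _ ≤ _ := by rw [mul_add, add_mul]; exact add_le_add (hC k hk x) (hD k hk x)

theorem SX.add (h : SX m n w) (h' : SX m n w') : SX m n fun k x => w k x + w' k x := by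
  induction m generalizing w w' with
  | zero => exact XBdd.add h h'
  | succ m ih =>
    obtain ⟨h1, h2, h3⟩ := h
    obtain ⟨h1', h2', h3'⟩ := h'
    exact ⟨h1.add h1', fun k hk => (h2 k hk).add (h2' k hk), (ih h3 h3').congr fun k hk => by
      ext x; exact deriv_fun_add (h2 k hk x) (h2' k hk x)⟩

theorem SX.zero : SX m n fun _ _ => 0 := by
  induction m with
  | zero => exact ⟨0, fun k _ x => by simp⟩
  | succ m ih =>
    exact ⟨⟨0, fun k _ x => by simp⟩, fun k _ => differentiable_const 0, ih.congr fun k _ => by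
      ext x; simp⟩

theorem SX.sum {ι : Type*} (s : Finset ι) {w : ι → ℂ → ℝ → ℂ} (h : ∀ i ∈ s, SX m n (w i)) :
    SX m n fun k x => ∑ i ∈ s, w i k x := by
  classical
  induction s using Finset.induction_on with
  | empty => simpa using SX.zero
  | insert a s ha ih =>
    simp only [Finset.sum_insert ha]
    exact (h a (by simp)).add (ih fun i hi => h i (by simp [hi]))

theorem XBdd.smul {ρ : ℂ → ℂ} {r : ℕ} (hρ : ∃ C, ∀ k ∈ rayS, ‖k‖ ^ r * ‖ρ k‖ ≤ C) (h : XBdd n w) :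
    XBdd (n + r) fun k x => ρ k * w k x := by
  obtain ⟨C, hC⟩ := hρ
  obtain ⟨D, hD⟩ := h
  refine ⟨C * D, fun k hk x => ?_⟩
  have hC0 : 0 ≤ C := le_trans (by positivity) (hC k hk)
  calc _ = (‖k‖ ^ r * ‖ρ k‖) * (‖k‖ ^ n * ‖w k x‖) := by rw [norm_mul]; ring
    _ ≤ C * (D * (1 + x ^ 2)⁻¹) :=
      mul_le_mul (hC k hk) (hD k hk x) (by positivity) hC0
    _ = _ := by ring

theorem SX.smul {ρ : ℂ → ℂ} {r : ℕ} (hρ : ∃ C, ∀ k ∈ rayS, ‖k‖ ^ r * ‖ρ k‖ ≤ C) (h : SX m n w) :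
    SX m (n + r) fun k x => ρ k * w k x := by
  induction m generalizing w with
  | zero => exact XBdd.smul hρ h
  | succ m ih =>
    obtain ⟨h1, h2, h3⟩ := h
    exact ⟨h1.smul hρ, fun k hk => (h2 k hk).const_mul _, (ih h3).congr fun k hk => by
      ext x; exact deriv_const_mul _ (h2 k hk x)⟩

theorem SX.neg (h : SX m n w) : SX m n fun k x => -w k x := by
  have := SX.smul (r := 0) (ρ := fun _ => -1) ⟨1, fun k _ => by simp⟩ h
  simpa using this

theorem SX.sub (h : SX m n w) (h' : SX m n w') : SX m n fun k x => w k x - w' k x := by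
  simpa [sub_eq_add_neg] using h.add h'.neg

theorem XBdd.mul (h : XBdd n w) (h' : XBdd n' w') : XBdd (n + n') fun k x => w k x * w' k x := by
  obtain ⟨C, hC⟩ := h
  obtain ⟨D, hD⟩ := h'
  refine ⟨C * D, fun k hk x => ?_⟩
  have h0 : 0 < (1 + x ^ 2)⁻¹ := by positivity
  have hC0 : 0 ≤ C := nonneg_of_mul_nonneg_left (le_trans (by positivity) (hC k hk x)) h0
  have hD0 : 0 ≤ D := nonneg_of_mul_nonneg_left (le_trans (by positivity) (hD k hk x)) h0
  calc _ = (‖k‖ ^ n * ‖w k x‖) * (‖k‖ ^ n' * ‖w' k x‖) := by rw [norm_mul]; ring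
    _ ≤ (C * (1 + x ^ 2)⁻¹) * (D * (1 + x ^ 2)⁻¹) :=
      mul_le_mul (hC k hk x) (hD k hk x) (by positivity) (by positivity)
    _ = C * D * (1 + x ^ 2)⁻¹ * (1 + x ^ 2)⁻¹ := by ring
    _ ≤ _ := mul_le_of_le_one_right (by positivity) (one_add_sq_inv_le_one x)

theorem SX.mul (h : SX m n w) (h' : SX m n' w') : SX m (n + n') fun k x => w k x * w' k x := by
  induction m generalizing w w' with
  | zero => exact XBdd.mul h h'
  | succ m ih =>
    have g := h.of_succ
    have g' := h'.of_succ
    obtain ⟨h1, h2, h3⟩ := h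
    obtain ⟨h1', h2', h3'⟩ := h'
    exact ⟨h1.mul h1', fun k hk => (h2 k hk).mul (h2' k hk), ((ih h3 g').add (ih g h3')).congr
      fun k hk => by ext x; exact deriv_fun_mul (h2 k hk x) (h2' k hk x)⟩

theorem SX.schwartz (f : SchwartzMap ℝ ℂ) : SX m 0 fun _ x => f x := by
  induction m generalizing f with
  | zero =>
    obtain ⟨C, _, hC⟩ := schwartz_bound_sq f
    exact ⟨C, fun k _ x => by simpa using hC x⟩
  | succ m ih =>
    obtain ⟨C, _, hC⟩ := schwartz_bound_sq f
    exact ⟨⟨C, fun k _ x => by simpa using hC x⟩, fun k _ => f.differentiable,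
      ih (SchwartzMap.derivCLM ℂ ℂ f)⟩

end SX

section Riccati
variable (q p : SchwartzMap ℝ ℂ) (i : Fin 3)

/-- The entries of the potential. -/
noncomputable def entry (a b : Fin 3) (k : ℂ) (x : ℝ) : ℂ := coef (lam k) a * (q x + p x * lam k b)

theorem sx_entry (m : ℕ) (a b : Fin 3) : SX m 0 (entry q p a b) := by
  have h1 := SX.smul (m := m) (r := 0) (ρ := fun k => coef (lam k) a) (by
    simpa using wBdd_one.1 (sd_coef 0 a).wBdd) (SX.schwartz q)
  have h2 := SX.smul (m := m) (r := 0) (ρ := fun k => coef (lam k) a * lam k b) (by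
    simpa only [pow_zero, one_mul] using wBdd_one.1 (sd_coef_lam 0 a b).wBdd) (SX.schwartz p)
  exact (h1.add h2).congr fun k _ => by ext x; simp only [entry]; ring

/-- The sum `∑ ω_m c_m (q + p l_b)`, where `ω = e_i + w`. -/
noncomputable def wsum (w : Fin 3 → ℂ → ℝ → ℂ) (b : Fin 3) (k : ℂ) (x : ℝ) : ℂ :=
  entry q p i b k x + ∑ a, w a k x * entry q p a b k x

/-- One step of the diagonalization. -/
noncomputable def ricStep (w : Fin 3 → ℂ → ℝ → ℂ) (b : Fin 3) (k : ℂ) (x : ℝ) : ℂ :=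
  -(lam k b - lam k i)⁻¹ *
    (deriv (w b k) x + wsum q p i w b k x - wsum q p i w i k x * w b k x)

/-- The approximate diagonalizers. -/
noncomputable def ricIter : ℕ → Fin 3 → ℂ → ℝ → ℂ
  | 0 => fun _ _ _ => 0
  | ν + 1 => ricStep q p i (ricIter ν)

theorem inv_bound (b : Fin 3) :
    ∃ C, ∀ k ∈ rayS, ‖k‖ ^ 1 * ‖-(lam k b - lam k i)⁻¹‖ ≤ C := by
  -- For b = i the inverse of zero is zero by convention; this keeps the i-th component of w equal
  -- to zero.
  by_cases h : b = i
  · exact ⟨0, fun k _ => by simp [h]⟩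
  · obtain ⟨C, hC⟩ := wBdd_one.1 (sd_lamq_inv 0 h).wBdd
    refine ⟨C, fun k hk => le_trans (le_of_eq ?_) (hC k hk)⟩
    rw [lamq, mul_inv, inv_inv, norm_mul, norm_neg, pow_one, mul_comm]

theorem sx_wsum {m : ℕ} {w : Fin 3 → ℂ → ℝ → ℂ} (h : ∀ b, SX m 0 (w b)) (b : Fin 3) :
    SX m 0 (wsum q p i w b) :=
  (sx_entry q p m i b).add (SX.sum _ fun a _ => (h a).mul (sx_entry q p m a b))

theorem sx_ricIter (ν : ℕ) : ∀ m b, SX m 0 (ricIter q p i ν b) := by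
  induction ν with
  | zero => exact fun m b => SX.zero
  | succ ν ih =>
    intro m b
    have h1 := ((ih (m + 1) b).2.2.add (sx_wsum q p i (ih m) b)).sub
      ((sx_wsum q p i (ih m) i).mul (ih m b))
    exact (h1.smul (inv_bound i b)).mono (Nat.zero_le _)

/-- The step map is a polynomial in w plus an x-derivative, times (l_b - l_i)⁻¹ = O(1/k). The
difference of two consecutive iterates therefore gains one order in k at each step, at the cost of
an x-derivative, and arbitrarily many of those are controlled. -/
theorem sx_ricIter_sub (ν : ℕ) : ∀ m b,
    SX m (ν + 1) fun k x => ricIter q p i (ν + 1) b k x - ricIter q p i ν b k x := by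
  induction ν with
  | zero =>
    intro m b
    refine ((sx_entry q p m i b).smul (inv_bound i b)).congr fun k _ => ?_
    ext x
    simp only [ricIter, ricStep, wsum, zero_mul, Finset.sum_const_zero, mul_zero]
    simp
  | succ ν ih =>
    intro m b
    set δ : Fin 3 → ℂ → ℝ → ℂ := fun b k x => ricIter q p i (ν + 1) b k x - ricIter q p i ν b k x
      with hδ
    have h1 := (ih (m + 1) b).2.2
    have h2 : SX m (ν + 1 + 0) fun k x => ∑ a, δ a k x * entry q p a b k x :=
      SX.sum _ fun a _ => (ih m a).mul (sx_entry q p m a b)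
    have h3 : SX m (0 + (ν + 1)) fun k x => wsum q p i (ricIter q p i (ν + 1)) i k x * δ b k x :=
      (sx_wsum q p i (sx_ricIter q p i (ν + 1) m) i).mul (ih m b)
    have h4 : SX m (ν + 1 + 0 + 0) fun k x =>
        (∑ a, δ a k x * entry q p a i k x) * ricIter q p i ν b k x :=
      (SX.sum _ fun a _ => (ih m a).mul (sx_entry q p m a i)).mul (sx_ricIter q p i ν m b)
    rw [zero_add] at h3
    refine ((((h1.add h2).sub (h3.add h4))).smul (inv_bound i b)).congr fun k hk => ?_
    ext x
    have d1 := (sx_ricIter q p i (ν + 1) 1 b).2.1 k hk x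
    have d2 := (sx_ricIter q p i ν 1 b).2.1 k hk x
    have e1 : deriv (δ b k) x = deriv (ricIter q p i (ν + 1) b k) x - deriv (ricIter q p i ν b k) x :=
      deriv_fun_sub d1 d2
    have e2 : ricIter q p i (ν + 1 + 1) b k x = ricStep q p i (ricIter q p i (ν + 1)) b k x := rfl
    have e3 : ricIter q p i (ν + 1) b k x = ricStep q p i (ricIter q p i ν) b k x := rfl
    change _ = _ * (deriv (δ b k) x + _ - _)
    have e4 : ∀ c, ∑ a, δ a k x * entry q p a c k x = wsum q p i (ricIter q p i (ν + 1)) c k x -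
        wsum q p i (ricIter q p i ν) c k x := by
      intro c
      simp only [wsum, hδ, sub_mul, Finset.sum_sub_distrib]; ring
    rw [e1, e2, e4, e4]
    conv_lhs => rw [e3]
    simp only [ricStep, hδ]
    ring

theorem ricIter_self (ν : ℕ) (k : ℂ) (x : ℝ) : ricIter q p i ν i k x = 0 := by
  cases ν with
  | zero => rfl
  | succ ν => simp [ricIter, ricStep]

/-- The remainder of the approximate diagonalization. -/
noncomputable def ricRem (ν : ℕ) (b : Fin 3) (k : ℂ) (x : ℝ) : ℂ :=
  deriv (ricIter q p i ν b k) x + (lam k b - lam k i) * ricIter q p i ν b k x +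
    wsum q p i (ricIter q p i ν) b k x - wsum q p i (ricIter q p i ν) i k x *
      ((1 : Matrix (Fin 3) (Fin 3) ℂ) i b + ricIter q p i ν b k x)

/-- The recursion solves the Riccati equation for the term containing l_b - l_i, so the defect of an
iterate is that factor times the next increment. -/
theorem ricRem_eq (ν : ℕ) (b : Fin 3) {k : ℂ} (hk : k ∈ rayS) (x : ℝ) : ricRem q p i ν b k x =
    -(lam k b - lam k i) * (ricIter q p i (ν + 1) b k x - ricIter q p i ν b k x) := by
  by_cases h : b = i
  · subst h
    have : ricIter q p b ν b k = fun _ => 0 := funext fun x => ricIter_self q p b ν k x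
    simp [ricRem, this]
  · have hne : lam k b - lam k i ≠ 0 := sub_ne_zero.2 ((lam_injective (rayS_not_mem hk)).ne h)
    rw [ricRem, Matrix.one_apply_ne (Ne.symm h), zero_add]
    change _ = -(lam k b - lam k i) * (ricStep q p i (ricIter q p i ν) b k x - _)
    rw [ricStep]
    field_simp
    ring

theorem ricRem_bdd (ν : ℕ) (b : Fin 3) : XBdd ν (ricRem q p i ν b) := by
  obtain ⟨C, hC⟩ := (sx_ricIter_sub q p i ν 0 b).bdd
  obtain ⟨D, hD⟩ := wBdd_one.1 (sd_lamq 0 b i).wBdd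
  refine ⟨D * C, fun k hk x => ?_⟩
  have hD0 := (norm_nonneg _).trans (hD k hk)
  have h1 : ‖lam k b - lam k i‖ ≤ D * ‖k‖ := by
    have := hD k hk
    rw [lamq, norm_mul, norm_inv] at this
    have hp : 0 < ‖k‖ := norm_pos_iff.2 (rayS_ne hk)
    rwa [← div_eq_mul_inv, div_le_iff₀ hp] at this
  rw [ricRem_eq q p i ν b hk, norm_mul, norm_neg]
  calc _ ≤ ‖k‖ ^ ν * ((D * ‖k‖) *
        ‖ricIter q p i (ν + 1) b k x - ricIter q p i ν b k x‖) := by gcongr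
    _ = D * (‖k‖ ^ (ν + 1) * ‖ricIter q p i (ν + 1) b k x - ricIter q p i ν b k x‖) := by ring
    _ ≤ D * (C * (1 + x ^ 2)⁻¹) := mul_le_mul_of_nonneg_left (hC k hk x) hD0
    _ = _ := by ring

end Riccati

/-- A Gronwall estimate on the line with data at `+∞`. -/
theorem norm_le_of_linear_ode {f μ ρ : ℝ → ℂ} {K ε : ℝ} (hμc : Continuous μ)
    (hρc : Continuous ρ) (hμ : ∀ x, ‖μ x‖ ≤ K * (1 + x ^ 2)⁻¹)
    (hρ : ∀ x, ‖ρ x‖ ≤ ε * (1 + x ^ 2)⁻¹) (hf : ∀ x, HasDerivAt f (μ x * f x + ρ x) x)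
    (h0 : Tendsto f atTop (𝓝 0)) (x : ℝ) : ‖f x‖ ≤ Real.exp (8 * K) * 4 * ε := by
  have hr := rightInt_of_bound hμc hμ
  have hK : 0 ≤ K := by simpa using (norm_nonneg _).trans (hμ 0)
  have hε : 0 ≤ ε := by simpa using (norm_nonneg _).trans (hρ 0)
  have hint : ∀ (C : ℝ) (x : ℝ), 0 ≤ C → ∫ y in Ioi x, C * (1 + y ^ 2)⁻¹ ≤ 4 * C := by
    intro C x hC
    rw [integral_const_mul, mul_comm]
    refine mul_le_mul_of_nonneg_right (le_trans ?_ integral_inv_le) hC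
    exact setIntegral_le_integral integrable_inv_one_add_sq (ae_of_all _ fun y => by positivity)
  have hb : ∀ (C : ℝ) (x : ℝ), IntegrableOn (fun y : ℝ => C * (1 + y ^ 2)⁻¹) (Ioi x) := fun C x =>
    (integrable_inv_one_add_sq.const_mul C).integrableOn
  -- Λ is the primitive of μ vanishing at plus infinity. It is bounded by 4K, so the integrating
  -- factor and its inverse are bounded by e^{4K}.
  set Λ := J 0 μ with hΛ
  have hΛb : ∀ x, ‖Λ x‖ ≤ 4 * K := fun x =>
    (norm_J_le le_rfl (hb K x) fun y _ => hμ y).trans (hint K x hK)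
  have hΛd : ∀ x, HasDerivAt Λ (μ x) x := fun x => (hasDerivAt_J hr le_rfl x).congr_deriv (by simp)
  have hexp : ∀ z : ℂ, ‖z‖ ≤ 4 * K → ‖Complex.exp z‖ ≤ Real.exp (4 * K) := fun z hz => by
    rw [Complex.norm_exp]
    exact Real.exp_le_exp.2 ((Complex.re_le_norm z).trans hz)
  have hE : ∀ x, ‖Complex.exp (-Λ x)‖ ≤ Real.exp (4 * K) := fun x => hexp _ (by
    rw [norm_neg]; exact hΛb x)
  have hΛc : Continuous Λ := continuous_J hr le_rfl
  have hgc : Continuous fun x => Complex.exp (-Λ x) * ρ x := by fun_prop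
  have hgb : ∀ x, ‖Complex.exp (-Λ x) * ρ x‖ ≤ (Real.exp (4 * K) * ε) * (1 + x ^ 2)⁻¹ := by
    intro x
    rw [norm_mul, mul_assoc]
    exact mul_le_mul (hE x) (hρ x) (norm_nonneg _) (Real.exp_pos _).le
  have hlim : Tendsto (fun x => Complex.exp (-Λ x) * f x) atTop (𝓝 0) := by
    rw [tendsto_zero_iff_norm_tendsto_zero] at h0 ⊢
    have := h0.const_mul (Real.exp (4 * K))
    rw [mul_zero] at this
    refine squeeze_zero (fun _ => norm_nonneg _) (fun x => ?_) this
    rw [norm_mul]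
    exact mul_le_mul_of_nonneg_right (hE x) (norm_nonneg _)
  have h1 := eq_J (f := fun x => Complex.exp (-Λ x) * f x) (rightInt_of_bound hgc hgb)
    (a := 0) le_rfl (fun x => by
      refine (((hΛd x).fun_neg.cexp).mul (hf x)).congr_deriv ?_
      ring) hlim x
  have h2 : f x = Complex.exp (Λ x) * J 0 (fun x => Complex.exp (-Λ x) * ρ x) x := by
    rw [← h1, ← mul_assoc, ← Complex.exp_add]; simp
  rw [h2, norm_mul]
  calc _ ≤ Real.exp (4 * K) * (4 * (Real.exp (4 * K) * ε)) := by
        refine mul_le_mul (hexp _ (hΛb x)) ?_ (norm_nonneg _) (Real.exp_pos _).le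
        exact (norm_J_le le_rfl (hb _ x) fun y _ => hgb y).trans (hint _ x (by positivity))
    _ = (Real.exp (4 * K) * Real.exp (4 * K)) * 4 * ε := by ring
    _ = _ := by rw [← Real.exp_add]; ring_nf

end

/-! ### Rapid decrease of the off-diagonal scattering data -/

section

/-- Each c_n is of exact order k⁻² along the ray, so the ratios stay bounded. -/
theorem coef_ratio_bound (n j : Fin 3) :
    ∃ C, ∀ k ∈ rayS, ‖coef (lam k) n * (coef (lam k) j)⁻¹‖ ≤ C := by
  have h : SD oneW rayS 0 fun k => coef (lam k) n * (coef (lam k) j)⁻¹ :=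
    ((sd_coef_mul_sq 0 n).mul ((sd_lamq 0 j (j + 1)).mul (sd_lamq 0 j (j + 2)))).congr
      fun k hk => by
        have h0 := mul_inv_cancel₀ (rayS_ne hk)
        simp only [lamq]
        rw [coef, coef, inv_inv]
        linear_combination -(((lam k n - lam k (n + 1)) * (lam k n - lam k (n + 2)))⁻¹ *
          (lam k j - lam k (j + 1)) * (lam k j - lam k (j + 2))) * (k * k⁻¹ + 1) * h0
  exact wBdd_one.1 h.wBdd

theorem hasDerivAt_colOf {lm : Fin 3 → ℂ} {j : Fin 3} {g : ℝ → ℂ} (hg : RightInt g) (n : Fin 3)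
    (hn : 0 ≤ (lm n - lm j).re) (x : ℝ) :
    HasDerivAt (fun x => colOf lm j g x n) ((lm n - lm j) * colOf lm j g x n + coef lm n * g x) x := by
  have h := ((hasDerivAt_J hg hn x).const_mul (coef lm n)).const_add
    ((1 : Matrix (Fin 3) (Fin 3) ℂ) n j)
  refine h.congr_deriv ?_
  rw [colOf]
  by_cases h : n = j
  · subst h; simp
  · rw [Matrix.one_apply_ne h]; ring

variable {u v : SchwartzMap ℝ ℝ}

/-- The scalar g carries c_j⁻¹, but the columns contain only c_n g, and c_n / c_j is bounded; hence
the columns are bounded uniformly in k. -/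
theorem exists_isG_colOf_bound (u v : SchwartzMap ℝ ℝ) (j : Fin 3) (hj : ∀ k ∈ rayS, Adm k j) :
    ∃ B, ∀ k ∈ rayS, ∃ g, IsG (qS u v) (pS u) (lam k) j g ∧
      ∀ x n, ‖colOf (lam k) j g x n‖ ≤ B := by
  obtain ⟨C, hC⟩ := norm_diagF_le 0 (qS u v) (pS u) j j
  have hD := fun n => coef_ratio_bound n j
  choose D hD using hD
  refine ⟨1 + (∑ n, |D n|) * (4 * C), fun k hk => ⟨_, isG_diagF 0 (i := j) hk (hj k hk), ?_⟩⟩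
  intro x n
  set F := diagF (qS u v) (pS u) 0 j j k with hF
  have hFC : ‖F‖ ≤ C := by
    refine le_trans ?_ (hC k hk)
    exact le_mul_of_one_le_left (norm_nonneg _) (rayS_norm hk)
  have hC0 := (norm_nonneg _).trans hFC
  set c := (coef (lam k) j)⁻¹ with hc
  have hJ : ‖J (lam k n - lam k j) (fun x => c * wmul 0 0 F x) x‖ ≤ ‖c‖ * (4 * C) := by
    refine (norm_J_le (hj k hk n) (B := fun y => (‖c‖ * C) * (1 + y ^ 2)⁻¹)
      (integrable_inv_one_add_sq.const_mul _).integrableOn fun y _ => ?_).trans ?_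
    · rw [norm_mul, mul_assoc]
      refine mul_le_mul_of_nonneg_left ((norm_wmul_zero_le 0 F y).trans ?_) (norm_nonneg _)
      gcongr
    · rw [integral_const_mul]
      have : ∫ y in Ioi x, (1 + y ^ 2)⁻¹ ≤ 4 :=
        le_trans (setIntegral_le_integral integrable_inv_one_add_sq
          (ae_of_all _ fun y => by positivity)) integral_inv_le
      calc _ ≤ ‖c‖ * C * 4 := by gcongr
        _ = _ := by ring
  rw [colOf]
  refine (norm_add_le _ _).trans (add_le_add ?_ ?_)
  · rw [Matrix.one_apply]; split_ifs <;> simp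
  · rw [norm_mul]
    calc _ ≤ ‖coef (lam k) n‖ * (‖c‖ * (4 * C)) := by gcongr
      _ = ‖coef (lam k) n * c‖ * (4 * C) := by rw [norm_mul]; ring
      _ ≤ _ := by
        gcongr
        refine ((hD n k hk).trans (le_abs_self _)).trans ?_
        exact Finset.single_le_sum (f := fun n => |D n|) (fun n _ => abs_nonneg _) (Finset.mem_univ n)

theorem tendsto_intCol_s {k : ℂ} {j : Fin 3} {g : ℝ → ℂ} (hg : IsG (qS u v) (pS u) (lam k) j g)
    (hk : k ∉ setQhat) (hj : Adm k j) {i : Fin 3} (hre : (lam k i - lam k j).re = 0) :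
    Tendsto (intCol (lam k) j g i) atBot (𝓝 (s u v k i j)) := by
  obtain ⟨C, hC⟩ := hg.bound
  have hint := integrable_exp_mul hre hg.cont hC
  rw [s_eq hk hj hg i]
  have := ((tendsto_integral_Ioi_atBot hint).const_mul (coef (lam k) i)).const_sub
    ((1 : Matrix (Fin 3) (Fin 3) ℂ) i j)
  exact this.congr fun x => by simp [intCol]

theorem tendsto_zero_of_le_inv_sq {l : Filter ℝ} (hl : Tendsto (fun x : ℝ => x ^ 2) l atTop)
    {f : ℝ → ℂ} {C : ℝ} (h : ∀ x, ‖f x‖ ≤ C * (1 + x ^ 2)⁻¹) : Tendsto f l (𝓝 0) := by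
  have h1 : Tendsto (fun x : ℝ => C * (1 + x ^ 2)⁻¹) l (𝓝 (C * 0)) :=
    ((tendsto_inv_atTop_zero.comp (tendsto_atTop_add_const_left l 1 hl))).const_mul C
  rw [mul_zero] at h1
  exact squeeze_zero_norm h h1

/-- The off-diagonal entries decay rapidly along the ray. -/
theorem s_rapid {i j : Fin 3} (hij : i ≠ j) (hj : ∀ k ∈ rayS, Adm k j)
    (hre : ∀ k ∈ rayS, (lam k i - lam k j).re = 0) (ν : ℕ) :
    ∃ C, ∀ k ∈ rayS, ‖k‖ ^ ν * ‖s u v k i j‖ ≤ C := by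
  obtain ⟨B, hB⟩ := exists_isG_colOf_bound u v j hj
  set q := qS u v with hq
  set p := pS u with hp
  obtain ⟨K, hK⟩ := (sx_wsum q p i (sx_ricIter q p i ν 0) i).bdd
  have hR := fun n => ricRem_bdd q p i ν n
  have hW := fun n => (sx_ricIter q p i ν 0 n).bdd
  choose R hR using hR
  choose W hW using hW
  refine ⟨Real.exp (8 * K) * 4 * ∑ n, R n * B, fun k hk => ?_⟩
  obtain ⟨g, hg, hgB⟩ := hB k hk
  have hkn : 0 < ‖k‖ ^ ν := pow_pos (norm_pos_iff.2 (rayS_ne hk)) ν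
  have hB0 : 0 ≤ B := (norm_nonneg _).trans (hgB 0 0)
  set φ : Fin 3 → ℝ → ℂ := fun n x => colOf (lam k) j g x n with hφ
  set E : ℝ → ℂ := fun x => Complex.exp (((-x : ℝ) : ℂ) * (lam k i - lam k j)) with hE
  set w : Fin 3 → ℝ → ℂ := fun n => ricIter q p i ν n k with hw
  have hEn : ∀ x, ‖E x‖ = 1 := fun x => by
    rw [hE, Complex.norm_exp, Complex.re_ofReal_mul, hre k hk, mul_zero, Real.exp_zero]
  have hEd : ∀ x, HasDerivAt E (-(lam k i - lam k j) * E x) x := by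
    intro x
    have h1 : HasDerivAt (fun x : ℝ => (((-x : ℝ) : ℂ) * (lam k i - lam k j)))
        (-1 * (lam k i - lam k j)) x := by
      have := ((hasDerivAt_id x).neg.ofReal_comp).mul_const (lam k i - lam k j)
      simpa using this
    exact h1.cexp.congr_deriv (by simp only [hE]; ring)
  have hφd : ∀ n x, HasDerivAt (φ n) ((lam k n - lam k j) * φ n x + coef (lam k) n * g x) x :=
    fun n x => hasDerivAt_colOf hg.rightInt n (hj k hk n) x
  have hwd : ∀ n, Differentiable ℝ (w n) := fun n => (sx_ricIter q p i ν 1 n).2.1 k hk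
  have hwd2 : ∀ n, Differentiable ℝ (deriv (w n)) := fun n => (sx_ricIter q p i ν 2 n).2.2.2.1 k hk
  have hsd : ∀ n, Differentiable ℝ (wsum q p i (ricIter q p i ν) n k) := fun n =>
    (sx_wsum q p i (sx_ricIter q p i ν 1) n).2.1 k hk
  -- The approximate left eigenvector e_i + w is paired with the column. The result solves a scalar
  -- equation with forcing O(k^{-ν}), tends to δ_ij = 0 at plus infinity and to s_ij at minus
  -- infinity, since w vanishes at both ends.
  set f : ℝ → ℂ := fun x => E x * (φ i x + ∑ n, w n x * φ n x) with hf
  set ρ : ℝ → ℂ := fun x => E x * ∑ n, ricRem q p i ν n k x * φ n x with hρ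
  have hf' : f = fun x => intCol (lam k) j g i x + E x * ∑ n, w n x * φ n x := by
    ext x; rw [intCol_eq, hf]; simp only [mul_add, hφ, hE]
  have hEc : Continuous E := continuous_iff_continuousAt.2 fun x => (hEd x).continuousAt
  have hφc : ∀ n, Continuous (φ n) := fun n =>
    continuous_iff_continuousAt.2 fun x => (hφd n x).continuousAt
  have hrc : ∀ n, Continuous (ricRem q p i ν n k) := fun n => by
    have h1 := (hwd n).continuous
    have h2 := (hwd2 n).continuous
    have h3 := (hsd n).continuous
    have h4 := (hsd i).continuous
    unfold ricRem
    exact ((h2.add (continuous_const.mul h1)).add h3).sub (h4.mul (continuous_const.add h1))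
  have hρc : Continuous ρ := hEc.mul (continuous_finsetSum _ fun n _ => (hrc n).mul (hφc n))
  have hρb : ∀ x, ‖ρ x‖ ≤ ((∑ n, R n * B) / ‖k‖ ^ ν) * (1 + x ^ 2)⁻¹ := by
    intro x
    rw [hρ, norm_mul, hEn, one_mul]
    refine (norm_sum_le _ _).trans ?_
    rw [Finset.sum_div, Finset.sum_mul]
    refine Finset.sum_le_sum fun n _ => ?_
    have h1 := hR n k hk x
    rw [norm_mul]
    calc ‖ricRem q p i ν n k x‖ * ‖φ n x‖ ≤ ‖ricRem q p i ν n k x‖ * B := by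
          gcongr; exact hgB x n
      _ = (‖k‖ ^ ν * ‖ricRem q p i ν n k x‖) * B / ‖k‖ ^ ν := by field_simp
      _ ≤ (R n * (1 + x ^ 2)⁻¹) * B / ‖k‖ ^ ν := by gcongr
      _ = _ := by ring
  have hfd : ∀ x, HasDerivAt f (wsum q p i (ricIter q p i ν) i k x * f x + ρ x) x := by
    intro x
    have h1 : HasDerivAt f (-(lam k i - lam k j) * E x * (φ i x + ∑ n, w n x * φ n x) +
        E x * (((lam k i - lam k j) * φ i x + coef (lam k) i * g x) +
        ∑ n, (deriv (w n) x * φ n x +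
          w n x * ((lam k n - lam k j) * φ n x + coef (lam k) n * g x)))) x :=
      (hEd x).mul ((hφd i x).add (HasDerivAt.fun_sum fun n _ =>
        ((hwd n x).hasDerivAt).mul (hφd n x)))
    refine h1.congr_deriv ?_
    have hgx := sum_colOf hg x
    have hgx' : ∑ m, (q x + p x * lam k m) * φ m x = g x := hgx
    have e1 : (∑ n, wsum q p i (ricIter q p i ν) n k x * φ n x) =
        (coef (lam k) i + ∑ n, w n x * coef (lam k) n) * g x := by
      rw [← hgx']
      simp only [wsum, entry, Fin.sum_univ_three, hw]
      ring
    -- By the definition of the remainder, the derivative of the pairing is `wsum` times the pairing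
    -- plus the remainder paired with the column; the diagonal part l_i - l_j is removed by the
    -- factor E.
    have e2 : (∑ n, ricRem q p i ν n k x * φ n x) =
        (∑ n, deriv (w n) x * φ n x) + (∑ n, (lam k n - lam k i) * w n x * φ n x) +
        (∑ n, wsum q p i (ricIter q p i ν) n k x * φ n x) -
        wsum q p i (ricIter q p i ν) i k x * (φ i x + ∑ n, w n x * φ n x) := by
      have e3 : φ i x = ∑ n, (1 : Matrix (Fin 3) (Fin 3) ℂ) i n * φ n x := by
        simp [Matrix.one_apply]
      rw [e3]
      simp only [ricRem, Fin.sum_univ_three, hw]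
      ring
    simp only [hf, hρ]
    rw [e2, e1]
    simp only [Fin.sum_univ_three]
    ring
  have hsum0 : ∀ {l : Filter ℝ}, Tendsto (fun x : ℝ => x ^ 2) l atTop →
      Tendsto (fun x => E x * ∑ n, w n x * φ n x) l (𝓝 0) := by
    intro l hl
    refine tendsto_zero_of_le_inv_sq (C := ∑ n, W n * B) hl fun x => ?_
    rw [norm_mul, hEn, one_mul, Finset.sum_mul]
    refine (norm_sum_le _ _).trans (Finset.sum_le_sum fun n _ => ?_)
    have h1 := hW n k hk x
    rw [pow_zero, one_mul] at h1
    rw [norm_mul]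
    calc _ ≤ (W n * (1 + x ^ 2)⁻¹) * B :=
          mul_le_mul h1 (hgB x n) (norm_nonneg _) ((norm_nonneg _).trans h1)
      _ = _ := by ring
  have h0 : Tendsto f atTop (𝓝 0) := by
    rw [hf']
    have := (tendsto_intCol_atTop (lm := lam k) (j := j) (g := g) i).add
      (hsum0 (tendsto_pow_atTop two_ne_zero))
    rwa [Matrix.one_apply_ne hij, add_zero] at this
  have hbot : Tendsto f atBot (𝓝 (s u v k i j)) := by
    rw [hf']
    have := (tendsto_intCol_s hg (rayS_not_mem hk) (hj k hk) (hre k hk)).add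
      (hsum0 (((tendsto_pow_atTop (α := ℝ) two_ne_zero).comp tendsto_neg_atBot_atTop).congr
        fun x => by simp))
    rwa [add_zero] at this
  have hfinal := norm_le_of_linear_ode (hsd i).continuous hρc
    (fun x => by simpa using hK k hk x) hρb hfd h0
  have h2 : ‖s u v k i j‖ ≤ _ := le_of_tendsto hbot.norm (Eventually.of_forall hfinal)
  calc _ ≤ ‖k‖ ^ ν * (Real.exp (8 * K) * 4 * ((∑ n, R n * B) / ‖k‖ ^ ν)) := by gcongr
    _ = _ := by rw [mul_left_comm, mul_div_cancel₀ _ hkn.ne']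

end

/-! ### From rapid decrease on a ray to flatness at the origin -/

section

section Rapid
variable {c : ℂ} {F : ℂ → ℂ}

theorem wBdd_rapid {S : Set ℂ} : WBdd rapidW S F ↔ ∀ N : ℕ, ∃ C, ∀ k ∈ S, ‖k‖ ^ N * ‖F k‖ ≤ C := by
  constructor
  · intro h N
    obtain ⟨C, hC⟩ := h _ ⟨N, rfl⟩
    exact ⟨C, fun k hk => by simpa using hC k hk⟩
  · rintro h w ⟨N, rfl⟩
    obtain ⟨C, hC⟩ := h N
    exact ⟨C, fun k hk => by simpa using hC k hk⟩

theorem ray_ne (hc : ‖c‖ = 1) {k : ℂ} (hk : k ∈ ray c) : k ≠ 0 :=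
  norm_pos_iff.1 (zero_lt_one.trans_le (ray_norm hc hk))

theorem ne_zero_of_norm_one (hc : ‖c‖ = 1) : c ≠ 0 := norm_pos_iff.1 (by rw [hc]; exact one_pos)

theorem convex_ray (c : ℂ) : Convex ℝ (ray c) :=
  (convex_Ici (1 : ℝ)).is_linear_image
    ⟨fun x y => by push_cast; ring, fun x y => by simp only [smul_eq_mul, Complex.real_smul]; push_cast; ring⟩

theorem uniqueDiffOn_ray (hc : ‖c‖ = 1) : UniqueDiffOn ℂ (ray c) :=
  uniqueDiffOn_of_preconnected (isPreconnected_ray c) (nontrivial_ray (ne_zero_of_norm_one hc))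

theorem SD.derivWithin {W : Set (ℂ → ℝ)} {S : Set ℂ} (hS : UniqueDiffOn ℂ S) {m : ℕ}
    (h : SD W S (m + 1) F) : (∀ k ∈ S, HasDerivWithinAt F (derivWithin F S k) S k) ∧
      SD W S m (derivWithin F S) := by
  obtain ⟨-, f, hf, hf'⟩ := h
  exact ⟨fun k hk => (hf k hk).differentiableWithinAt.hasDerivWithinAt,
    hf'.congr fun k hk => (hf k hk).derivWithin (hS k hk)⟩

/-- Rapid decrease of a function passes to its derivative if the second derivative is bounded. -/
theorem rapid_derivWithin (hc : ‖c‖ = 1) (h : SD oneW (ray c) 2 F) (hF : WBdd rapidW (ray c) F) :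
    WBdd rapidW (ray c) (derivWithin F (ray c)) := by
  have hu := uniqueDiffOn_ray hc
  obtain ⟨h1, h2⟩ := h.derivWithin hu
  obtain ⟨h3, h4⟩ := h2.derivWithin hu
  obtain ⟨M, hM⟩ := wBdd_one.1 h4
  set f := derivWithin F (ray c) with hf
  rw [wBdd_rapid] at hF ⊢
  intro N
  obtain ⟨C, hC⟩ := hF (2 * N)
  refine ⟨2 * C + M, fun k hk => ?_⟩
  have hk1 := ray_norm hc hk
  -- Taylor's formula with step t gives t |F'(k)| ≤ |F(k)| + |F(k')| + M t². With t = |k|^{-N} and F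
  -- = O(|k|^{-2N}) all terms are O(t²), so F' = O(|k|^{-N}).
  set t : ℝ := (‖k‖ ^ N)⁻¹ with ht
  have hkN : 0 < ‖k‖ ^ N := by positivity
  have ht0 : 0 < t := by positivity
  obtain ⟨y, hy, rfl⟩ := id hk
  have hy : 1 ≤ y := hy
  have hny : ‖c * (y : ℂ)‖ = y := by
    rw [norm_mul, hc, one_mul, Complex.norm_real, Real.norm_of_nonneg (by linarith)]
  simp only at hk hk1 ht hkN ⊢
  set k : ℂ := c * y with hkd
  set k' : ℂ := c * ((y + t : ℝ) : ℂ) with hkd'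
  have hk' : k' ∈ ray c := ⟨y + t, by simp only [mem_Ici]; linarith, rfl⟩
  have hny' : ‖k'‖ = y + t := by
    rw [norm_mul, hc, one_mul, Complex.norm_real, Real.norm_of_nonneg (by linarith)]
  have hsub : k' - k = c * (t : ℂ) := by rw [hkd, hkd']; push_cast; ring
  have hnsub : ‖k' - k‖ = t := by
    rw [hsub, norm_mul, hc, one_mul, Complex.norm_real, Real.norm_of_nonneg ht0.le]
  have hseg : segment ℝ k k' ⊆ ray c := (convex_ray c).segment_subset hk hk'
  have hM0 : 0 ≤ M := (norm_nonneg _).trans (hM k hk)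
  have hderiv : ∀ z ∈ segment ℝ k k', ‖f z - f k‖ ≤ M * t := by
    intro z hz
    refine (Convex.norm_image_sub_le_of_norm_hasDerivWithin_le h3 hM (convex_ray c) hk
      (hseg hz)).trans ?_
    refine mul_le_mul_of_nonneg_left ?_ hM0
    have := norm_sub_le_of_mem_segment hz
    rwa [hnsub] at this
  have hrem : ‖(F k' - f k * k') - (F k - f k * k)‖ ≤ M * t * ‖k' - k‖ :=
    Convex.norm_image_sub_le_of_norm_hasDerivWithin_le (f := fun z => F z - f k * z)
      (f' := fun z => f z - f k)
      (fun z hz => (((h1 z (hseg hz)).mono hseg).sub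
        ((hasDerivWithinAt_id z _).const_mul (f k))).congr_deriv (by simp [hf])) hderiv
      (convex_segment k k') (left_mem_segment ℝ k k') (right_mem_segment ℝ k k')
  have hsq : t * t * ‖k‖ ^ (2 * N) = 1 := by
    rw [ht, pow_mul', pow_two]; field_simp
  have hFk : ‖F k‖ ≤ C * (t * t) := by
    calc ‖F k‖ = (‖k‖ ^ (2 * N) * ‖F k‖) * (t * t) := by linear_combination -‖F k‖ * hsq
      _ ≤ _ := by gcongr; exact hC k hk
  have hFk' : ‖F k'‖ ≤ C * (t * t) := by
    calc ‖F k'‖ = (‖k‖ ^ (2 * N) * ‖F k'‖) * (t * t) := by linear_combination -‖F k'‖ * hsq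
      _ ≤ (‖k'‖ ^ (2 * N) * ‖F k'‖) * (t * t) := by
        gcongr
        rw [hny, hny']; linarith
      _ ≤ _ := by gcongr; exact hC k' hk'
  have hmain : ‖f k‖ * t ≤ (2 * C + M) * (t * t) := by
    calc ‖f k‖ * t = ‖F k' - F k - ((F k' - f k * k') - (F k - f k * k))‖ := by
          rw [← hnsub, ← norm_mul]; congr 1; ring
      _ ≤ ‖F k'‖ + ‖F k‖ + M * t * ‖k' - k‖ :=
        (norm_sub_le _ _).trans (add_le_add (norm_sub_le _ _) hrem)
      _ ≤ _ := by rw [hnsub]; linarith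
  have h5 : ‖f k‖ ≤ (2 * C + M) * t := by
    refine le_of_mul_le_mul_right ?_ ht0
    linarith
  calc ‖k‖ ^ N * ‖f k‖ ≤ ‖k‖ ^ N * ((2 * C + M) * t) := by gcongr
    _ = _ := by rw [ht]; field_simp

theorem sd_rapid (hc : ‖c‖ = 1) (h : ∀ m, SD oneW (ray c) m F) (hF : WBdd rapidW (ray c) F) (m : ℕ) :
    SD rapidW (ray c) m F := by
  induction m generalizing F with
  | zero => exact hF
  | succ m ih =>
    have hu := uniqueDiffOn_ray hc
    exact ⟨hF, _, ((h 1).derivWithin hu).1,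
      ih (fun n => ((h (n + 1)).derivWithin hu).2) (rapid_derivWithin hc (h 2) hF)⟩

theorem SD.rapid_mul_id {S : Set ℂ} {m : ℕ} (h : SD rapidW S m F) :
    SD rapidW S m fun k => k * F k := by
  have hb : WBdd rapidW S fun k => k * F k := by
    have := wBdd_rapid.1 h.wBdd
    refine wBdd_rapid.2 fun N => ?_
    obtain ⟨C, hC⟩ := this (N + 1)
    exact ⟨C, fun k hk => le_trans (le_of_eq (by rw [norm_mul]; ring)) (hC k hk)⟩
  induction m generalizing F with
  | zero => exact hb
  | succ m ih =>
    have h0 := h.of_succ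
    obtain ⟨h1, f, hf, hf'⟩ := h
    refine ⟨hb, fun k => 1 * F k + k * f k, fun k hk => (hasDerivWithinAt_id k S).mul (hf k hk), ?_⟩
    refine (h0.congr fun k _ => one_mul _).add (ih hf' ?_)
    have := wBdd_rapid.1 hf'.wBdd
    refine wBdd_rapid.2 fun N => ?_
    obtain ⟨C, hC⟩ := this (N + 1)
    exact ⟨C, fun k hk => le_trans (le_of_eq (by rw [norm_mul]; ring)) (hC k hk)⟩

theorem seg_norm (hc : ‖c‖ = 1) {z : ℂ} (hz : z ∈ seg c) : ‖z‖ ≤ 1 := by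
  obtain ⟨y, hy, rfl⟩ := hz
  simp only
  rw [norm_mul, hc, one_mul, Complex.norm_real, Real.norm_of_nonneg hy.1]
  exact hy.2

theorem inv_mem_ray {z : ℂ} (hz : z ∈ seg c) (h0 : z ≠ 0) : z⁻¹ ∈ ray c⁻¹ := by
  obtain ⟨y, hy, rfl⟩ := hz
  have hy0 : 0 < y := lt_of_le_of_ne hy.1 fun h => h0 (by simp [← h])
  exact ⟨y⁻¹, (one_le_inv₀ hy0).2 hy.2, by simp [mul_comm]⟩

open Classical in
theorem flat_bound (h : WBdd rapidW (ray c⁻¹) F) (N : ℕ) :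
    ∃ C, ∀ z ∈ seg c, ‖if z = 0 then 0 else F z⁻¹‖ ≤ C * ‖z‖ ^ N := by
  obtain ⟨C, hC⟩ := wBdd_rapid.1 h N
  refine ⟨|C|, fun z hz => ?_⟩
  split_ifs with h0
  · rw [norm_zero]; positivity
  · have := (hC _ (inv_mem_ray hz h0)).trans (le_abs_self C)
    have hz0 : 0 < ‖z‖ ^ N := pow_pos (norm_pos_iff.2 h0) N
    generalize F z⁻¹ = w at this ⊢
    rwa [norm_inv, inv_pow, inv_mul_le_iff₀ hz0, mul_comm] at this

open Classical in
/-- A rapidly decreasing function of `z⁻¹` is flat at the origin. -/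
theorem sd_flat (hc : ‖c‖ = 1) (h : ∀ m, SD rapidW (ray c⁻¹) m F) (m : ℕ) :
    SD oneW (seg c) m fun z => if z = 0 then 0 else F z⁻¹ := by
  have hc' : ‖c⁻¹‖ = 1 := by rw [norm_inv, hc, inv_one]
  have hb0 : WBdd oneW (seg c) fun z => if z = 0 then 0 else F z⁻¹ := by
    obtain ⟨C, hC⟩ := flat_bound (h 0) 0
    exact wBdd_one.2 ⟨C, fun z hz => by simpa using hC z hz⟩
  induction m generalizing F with
  | zero => exact hb0
  | succ m ih =>
    have hu := uniqueDiffOn_ray hc'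
    set f := derivWithin F (ray c⁻¹) with hf
    have h1 := ((h 1).derivWithin hu).1
    -- Off zero the derivative of F(1/z) is -z⁻² f(1/z), a function of the same kind with F replaced
    -- by -k² f(k), which is again rapidly decreasing; so the induction closes.
    have h2 : ∀ n, SD rapidW (ray c⁻¹) n fun k => -(k * (k * f k)) := fun n =>
      ((((h (n + 1)).derivWithin hu).2).rapid_mul_id.rapid_mul_id).neg
    have h2b : WBdd oneW (seg c) fun z => if z = 0 then 0 else -(z⁻¹ * (z⁻¹ * f z⁻¹)) := by
      obtain ⟨C, hC⟩ := flat_bound (h2 0) 0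
      exact wBdd_one.2 ⟨C, fun z hz => by simpa using hC z hz⟩
    refine ⟨hb0, fun z => if z = 0 then 0 else -(z⁻¹ * (z⁻¹ * f z⁻¹)), fun z hz => ?_, ih h2 h2b⟩
    by_cases h0 : z = 0
    -- At the origin |F(1/z)| ≤ C |z|² gives the derivative 0, in agreement with the value assigned
    -- there.
    · subst h0
      obtain ⟨C, hC⟩ := flat_bound (h 0) 2
      refine hasDerivWithinAt_of_quadratic (C := C) fun b hb' => ?_
      simpa using hC b hb'
    · have h3 : HasDerivWithinAt (fun z => F z⁻¹) (f z⁻¹ * (-(z ^ 2)⁻¹)) (seg c \ {0}) z :=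
        (h1 z⁻¹ (inv_mem_ray hz h0)).comp z ((hasDerivAt_inv h0).hasDerivWithinAt)
          fun b hb' => inv_mem_ray hb'.1 hb'.2
      have h4 : HasDerivWithinAt (fun z => F z⁻¹) (f z⁻¹ * (-(z ^ 2)⁻¹)) (seg c) z :=
        h3.mono_of_mem_nhdsWithin
          (inter_mem_nhdsWithin _ (isOpen_compl_singleton.mem_nhds h0))
      refine (h4.congr_of_eventuallyEq ?_ (by simp [h0])).congr_deriv ?_
      · filter_upwards [nhdsWithin_le_nhds (isOpen_compl_singleton.mem_nhds h0)] with b hb'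
        exact if_neg hb'
      · simp only [h0, if_false]; rw [pow_two, mul_inv]; ring

end Rapid

theorem rapidlyDecreasingOn_of_sd {c : ℂ} (hc : ‖c‖ = 1) {f : ℂ → ℂ}
    (hu : UniqueDiffOn ℂ (seg c ∪ ray (-c)))
    (hf : ContDiffOn ℂ ∞ f (seg c ∪ ray (-c))) (h : ∀ m, SD rapidW (ray (-c)) m f) :
    RapidlyDecreasingOn f (seg c ∪ ray (-c)) := by
  have hc' : ‖-c‖ = 1 := by rw [norm_neg, hc]
  have hc0 := ne_zero_of_norm_one hc
  intro N
  have key : ∀ j, ∃ C, ∀ k ∈ seg c ∪ ray (-c),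
      (1 + ‖k‖) ^ N * ‖iteratedDerivWithin j f (seg c ∪ ray (-c)) k‖ ≤ C := by
    intro j
    have hcont : ContinuousOn (iteratedDerivWithin j f (seg c ∪ ray (-c))) (seg c) :=
      (hf.continuousOn_iteratedDerivWithin (by exact_mod_cast le_top) hu).mono subset_union_left
    obtain ⟨C, hC⟩ := (isCompact_Icc.image (by fun_prop) : IsCompact (seg c)).exists_bound_of_continuousOn
      hcont
    obtain ⟨D, hD⟩ := wBdd_rapid.1 ((h j).iteratedDerivWithin_bound (uniqueDiffOn_ray hc')) N
    refine ⟨max (2 ^ N * C) (2 ^ N * D), fun k hk => ?_⟩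
    by_cases hs : k ∈ seg c
    · refine le_trans ?_ (le_max_left _ _)
      have h1 := seg_norm hc hs
      have h2 : 1 + ‖k‖ ≤ 2 := by linarith
      exact mul_le_mul (by gcongr) (hC k hs) (norm_nonneg _) (by positivity)
    · refine le_trans ?_ (le_max_right _ _)
      have hr := hk.resolve_left hs
      have h1 := ray_norm hc' hr
      -- The segment is closed, so near a point outside it the contour coincides with the ray and
      -- the iterated derivatives agree.
      have e : (seg c ∪ ray (-c) : Set ℂ) =ᶠ[𝓝 k] ray (-c) := by
        filter_upwards [(isClosed_seg c).isOpen_compl.mem_nhds hs] with z hz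
        exact propext ⟨fun hz' => hz'.resolve_left hz, fun hz' => Or.inr hz'⟩
      rw [show iteratedDerivWithin j f (seg c ∪ ray (-c)) k = iteratedDerivWithin j f (ray (-c)) k by
        rw [iteratedDerivWithin, iteratedDerivWithin, iteratedFDerivWithin_congr_set e]]
      have h2 : 1 + ‖k‖ ≤ 2 * ‖k‖ := by linarith
      calc _ ≤ (2 * ‖k‖) ^ N * ‖iteratedDerivWithin j f (ray (-c)) k‖ := by gcongr
        _ = 2 ^ N * (‖k‖ ^ N * ‖iteratedDerivWithin j f (ray (-c)) k‖) := by rw [mul_pow]; ring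
        _ ≤ _ := by gcongr; exact hD k hr
  choose C hC using key
  refine ⟨∑ j ∈ Finset.range (N + 1), |C j|, fun j hj k hk => (hC j k hk).trans ?_⟩
  exact (le_abs_self _).trans (Finset.single_le_sum (f := fun j => |C j|)
    (fun _ _ => abs_nonneg _) (Finset.mem_range.2 (by omega)))

end

/-! ### Smoothness on the full contours and rapid decrease -/

section

variable {u v : SchwartzMap ℝ ℝ}

theorem sd_s_rapid {i j : Fin 3} (hij : i ≠ j) (hj : ∀ k ∈ rayS, Adm k j)
    (hre : ∀ k ∈ rayS, (lam k i - lam k j).re = 0) (m : ℕ) :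
    SD rapidW rayS m (fun k => s u v k i j) :=
  sd_rapid norm_neg_I (fun m => sd_s m hj hre) (wBdd_rapid.2 fun ν => s_rapid hij hj hre ν) m

/-- The denominator is bounded below and has bounded derivatives, so its inverse is an admissible
factor for the rapidly decreasing numerator. -/
theorem sd_s_ratio_rapid {i j : Fin 3} (hij : i ≠ j) (hi : ∀ k ∈ rayS, Adm k i)
    (hj : ∀ k ∈ rayS, Adm k j) (hre : ∀ k ∈ rayS, (lam k i - lam k j).re = 0)
    (hne : ∀ k ∈ rayS, s u v k i i ≠ 0) (m : ℕ) :
    SD rapidW rayS m (fun k => s u v k i j / s u v k i i) := by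
  obtain ⟨c, hc, hb⟩ := s_self_lower_bound hi hne
  exact (((sd_s m hi fun k _ => by simp).inv hc hb).mul (sd_s_rapid hij hj hre m)).congr
    fun k _ => by rw [div_eq_mul_inv, mul_comm]

theorem rayS_adm : (∀ k ∈ rayS, Adm k 0) ∧ (∀ k ∈ rayS, Adm k 1) ∧
    ∀ k ∈ rayS, (lam k 0 - lam k 1).re = 0 :=
  ⟨fun _ hk => (adm_of_Γhat₁ (rayS_subset hk)).1, fun _ hk => (adm_of_Γhat₁ (rayS_subset hk)).2.1,
    fun _ hk => (adm_of_Γhat₁ (rayS_subset hk)).2.2⟩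

theorem rayS_mem {k : ℂ} (hk : k ∈ rayS) : k ∈ Γhat₁ \ setQhat := ⟨rayS_subset hk, rayS_not_mem hk⟩

theorem rayS_inv_mem {k : ℂ} (hk : k ∈ rayS) : k⁻¹ ∈ Γhat₁ \ setQhat :=
  ⟨inv_mem_Γhat₁ (rayS_subset hk) (rayS_ne hk), fun h => rayS_not_mem hk (inv_setQhat.1 h)⟩

theorem s_inv_rayS {k : ℂ} (hk : k ∈ rayS) :
    s u v k⁻¹ 0 0 = s u v k 1 1 ∧ s u v k⁻¹ 0 1 = s u v k 1 0 := by
  have h0 := s_inv (u := u) (v := v) (rayS_not_mem hk) (j := 0) (by simpa using rayS_adm.2.1 k hk) 0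
  have h1 := s_inv (u := u) (v := v) (rayS_not_mem hk) (j := 1) (by simpa using rayS_adm.1 k hk) 0
  simp only [Equiv.swap_apply_left, Equiv.swap_apply_right] at h0 h1
  exact ⟨h0, h1⟩

theorem sd_extR₁_ray (h : Generic u v) (m : ℕ) : SD rapidW rayS m (extR₁ u v) := by
  obtain ⟨h0, h1, hre⟩ := rayS_adm
  exact (sd_s_ratio_rapid zero_ne_one h0 h1 hre (fun k hk => s_zero_zero_ne h.sol (rayS_mem hk)) m).congr
    fun k hk => extR₁_eq (rayS_mem hk)

/-- Inversion exchanges the first two indices: r_1(1/k) = s_21/s_22 on the ray, and the same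
estimates apply to this quotient. -/
theorem sd_extR₁_inv_ray (h : Generic u v) (m : ℕ) : SD rapidW rayS m (fun k => extR₁ u v k⁻¹) := by
  obtain ⟨h0, h1, hre⟩ := rayS_adm
  have hne : ∀ k ∈ rayS, s u v k 1 1 ≠ 0 := fun k hk => by
    rw [← (s_inv_rayS hk).1]; exact s_zero_zero_ne h.sol (rayS_inv_mem hk)
  refine (sd_s_ratio_rapid one_ne_zero h1 h0 (fun k hk => ?_) hne m).congr fun k hk => ?_
  · rw [← neg_sub, Complex.neg_re, hre k hk, neg_zero]
  · simp only
    rw [extR₁_eq (rayS_inv_mem hk), r₁, (s_inv_rayS hk).1, (s_inv_rayS hk).2]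

theorem extR₁_zero : extR₁ u v 0 = 0 := if_pos rfl

theorem sd_extR₁_seg (h : Generic u v) (m : ℕ) : SD oneW (seg Complex.I) m (extR₁ u v) := by
  have := sd_flat (c := Complex.I) (F := fun k => extR₁ u v k⁻¹) Complex.norm_I
    (fun m => by rw [Complex.inv_I]; exact sd_extR₁_inv_ray h m) m
  refine this.congr fun z _ => ?_
  by_cases h0 : z = 0
  · simp [h0, extR₁_zero]
  · simp [h0]

theorem conj_mem_rayS {k : ℂ} (hk : k ∈ ray Complex.I) : (starRingEnd ℂ) k ∈ rayS := by
  obtain ⟨y, hy, rfl⟩ := hk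
  exact ⟨y, hy, by simp⟩

theorem SD.conj_rapid {F : ℂ → ℂ} {m : ℕ} (h : SD rapidW rayS m F) :
    SD rapidW (ray Complex.I) m (fun k => (starRingEnd ℂ) (F ((starRingEnd ℂ) k))) :=
  SD.conj (by rintro w ⟨N, rfl⟩ z; simp) (fun _ hk => conj_mem_rayS hk) h

theorem sd_reflR₁_ray (h : Generic u v) (m : ℕ) : SD rapidW (ray Complex.I) m (reflR₁ u v) :=
  (sd_extR₁_inv_ray h m).conj_rapid

theorem sd_reflR₁_seg (h : Generic u v) (m : ℕ) : SD oneW (seg (-Complex.I)) m (reflR₁ u v) := by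
  have := sd_flat (c := -Complex.I) (F := fun k => (starRingEnd ℂ) (extR₁ u v ((starRingEnd ℂ) k)))
    norm_neg_I (fun m => by rw [inv_neg, Complex.inv_I, neg_neg]; exact (sd_extR₁_ray h m).conj_rapid) m
  refine this.congr fun z _ => ?_
  by_cases h0 : z = 0
  · simp [h0, reflR₁, refl, extR₁_zero]
  · simp [h0, reflR₁, refl]

/-- The ray and the circle stay at distance 1 from the origin, so near 0 the contour is only the
segment. -/
theorem contDiffOn_of_seg {c : ℂ} (hc : ‖c‖ = 1) {f : ℂ → ℂ} {S : Set ℂ}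
    (hS : S = seg c ∪ ray (-c) ∪ circ) (hf : ContDiffOn ℂ ∞ f (S \ {0}))
    (h : ∀ m, SD oneW (seg c) m f) : ContDiffOn ℂ ∞ f S := by
  have hc' : ‖-c‖ = 1 := by rw [norm_neg, hc]
  intro k hk
  by_cases h0 : k = 0
  · subst h0
    have hu : UniqueDiffOn ℂ (seg c) :=
      uniqueDiffOn_of_preconnected (isPreconnected_seg c) (nontrivial_seg (ne_zero_of_norm_one hc))
    have h1 : ContDiffOn ℂ ∞ f (seg c) := contDiffOn_infty.2 fun m => (h (m + 1)).contDiffOn hu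
    have h2 := h1 0 ⟨0, by simp, by simp⟩
    refine h2.mono_of_mem_nhdsWithin ?_
    filter_upwards [self_mem_nhdsWithin, mem_nhdsWithin_of_mem_nhds
      (Metric.ball_mem_nhds (0 : ℂ) one_pos)] with z hz hz'
    rw [mem_ball_zero_iff] at hz'
    rw [hS] at hz
    rcases hz with (hz | hz) | hz
    · exact hz
    · exact absurd (ray_norm hc' hz) (not_le.2 hz')
    · exact absurd (mem_sphere_zero_iff_norm.1 hz) hz'.ne
  · exact (hf k ⟨hk, h0⟩).mono_of_mem_nhdsWithin
      (inter_mem_nhdsWithin _ (isOpen_compl_singleton.mem_nhds h0))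

theorem smoothOn_extR₁ (h : Generic u v) : ContDiffOn ℂ ∞ (extR₁ u v) Γhat₁ :=
  contDiffOn_of_seg Complex.norm_I (by rw [Γhat₁, Γ₁_eq]) (contDiffOn_extR₁ h) (sd_extR₁_seg h)

theorem smoothOn_reflR₁ (h : Generic u v) : ContDiffOn ℂ ∞ (reflR₁ u v) Γhat₄ :=
  contDiffOn_of_seg norm_neg_I (by rw [Γhat₄, Γ₄_eq, neg_neg]) (contDiffOn_reflR₁ h)
    (sd_reflR₁_seg h)

theorem smoothOn_extR₂ (h : Generic u v) :
    ContDiffOn ℂ ∞ (extR₂ u v) (Γhat₄ \ {ω₃ ^ 2, -ω₃ ^ 2}) :=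
  (contDiffOn_rTilde.mono fun _ hk => hk.2).mul ((smoothOn_reflR₁ h).mono fun _ hk => hk.1)

theorem Γ₄_subset : Γ₄ ⊆ Γhat₄ \ {ω₃ ^ 2, -ω₃ ^ 2} := by
  intro k hk
  refine ⟨Or.inl hk, fun h => ?_⟩
  have h1 : k.re = 0 := by
    rcases hk with ⟨y, -, -, rfl⟩ | ⟨y, -, rfl⟩ <;> simp
  have h2 := omega_sq_re
  rcases h with rfl | h
  · rw [h1] at h2; norm_num at h2
  · rw [mem_singleton_iff.1 h, Complex.neg_re, h2] at h1; norm_num at h1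

/-- Numerator and denominator are divided by k² and become polynomials in 1/k; the denominator is
-ω² (1 + ω y⁻²) at k = iy, of modulus at least 1/2. -/
theorem sd_rTilde_ray (m : ℕ) : SD oneW (ray Complex.I) m rTilde := by
  have hi := sd_inv_ray Complex.norm_I m
  have hb : ∀ k ∈ ray Complex.I, 1 / 2 ≤ ‖k⁻¹ * k⁻¹ - ω₃ ^ 2‖ := by
    rintro k ⟨y, hy, rfl⟩
    have hy : 1 ≤ y := hy
    have h1 := inv_le_one_of_one_le₀ hy
    have h0 : 0 ≤ y⁻¹ := by positivity
    have e : (Complex.I * (y : ℂ))⁻¹ * (Complex.I * (y : ℂ))⁻¹ - ω₃ ^ 2 =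
        -ω₃ ^ 2 * (1 + ω₃ * ((y⁻¹ * y⁻¹ : ℝ) : ℂ)) := by
      simp only [mul_inv, Complex.inv_I, Complex.ofReal_mul, Complex.ofReal_inv]
      linear_combination ((y : ℂ)⁻¹ * (y : ℂ)⁻¹) * Complex.I_sq +
        ((y : ℂ)⁻¹ * (y : ℂ)⁻¹) * omega_cube
    simp only
    rw [e, norm_mul, norm_neg, norm_pow, norm_omega, one_pow, one_mul]
    exact half_le_norm omega_re (by nlinarith)
  have h2 : SD oneW (ray Complex.I) m fun k : ℂ => k⁻¹ * k⁻¹ - ω₃ ^ 2 := (hi.mul hi).sub (SD.const _)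
  refine ((((SD.const (ω₃ ^ 2)).mul (hi.mul hi)).sub (SD.const 1)).mul
    (h2.inv (by norm_num) hb)).congr fun k hk => ?_
  have h0 := ray_ne Complex.norm_I hk
  have h3 : k⁻¹ * k⁻¹ - ω₃ ^ 2 ≠ 0 := norm_pos_iff.1 (lt_of_lt_of_le (by norm_num) (hb k hk))
  have e1 : ω₃ ^ 2 - k ^ 2 = k ^ 2 * (ω₃ ^ 2 * (k⁻¹ * k⁻¹) - 1) := by field_simp
  have e2 : 1 - ω₃ ^ 2 * k ^ 2 = k ^ 2 * (k⁻¹ * k⁻¹ - ω₃ ^ 2) := by field_simp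
  rw [rTilde, e1, e2, mul_div_mul_left _ _ (pow_ne_zero 2 h0), div_eq_mul_inv]

theorem rapidlyDecreasingOn_extR₁ (h : Generic u v) : RapidlyDecreasingOn (extR₁ u v) Γ₁ := by
  have hu := uniqueDiffOn_Γ₁
  have hs : ContDiffOn ℂ ∞ (extR₁ u v) Γ₁ := (smoothOn_extR₁ h).mono subset_union_left
  rw [Γ₁_eq] at hu hs ⊢
  exact rapidlyDecreasingOn_of_sd Complex.norm_I hu hs (sd_extR₁_ray h)

theorem rapidlyDecreasingOn_extR₂ (h : Generic u v) : RapidlyDecreasingOn (extR₂ u v) Γ₄ := by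
  have hu := uniqueDiffOn_Γ₄
  have hs : ContDiffOn ℂ ∞ (extR₂ u v) Γ₄ := (smoothOn_extR₂ h).mono Γ₄_subset
  have hr : ∀ m, SD rapidW (ray (- -Complex.I)) m (extR₂ u v) := fun m => by
    rw [neg_neg]; exact (sd_rTilde_ray m).mul (sd_reflR₁_ray h m)
  rw [Γ₄_eq] at hu hs ⊢
  have := rapidlyDecreasingOn_of_sd norm_neg_I (by rwa [neg_neg]) (by rwa [neg_neg]) hr
  rwa [neg_neg] at this

end

end Boussinesq

open Boussinesq in
theorem theorem2p1 (u₀ v₀ : SchwartzMap ℝ ℝ) (hsol : NoSolitons u₀ v₀)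
    (hgen₁ : GenericAt u₀ v₀ 1) (hgen₂ : GenericAt u₀ v₀ (-1)) :
    -- the spectral functions are well defined
    (∀ k ∈ Γhat₁ \ setQhat, WellDefined₁ u₀ v₀ k) ∧
    (∀ k ∈ Γhat₄ \ setQhat, WellDefined₂ u₀ v₀ k) ∧
    -- they have extensions `R₁`, `R₂` with the following properties
    ∃ R₁ R₂ : ℂ → ℂ,
      Set.EqOn R₁ (r₁ u₀ v₀) (Γhat₁ \ setQhat) ∧
      Set.EqOn R₂ (r₂ u₀ v₀) (Γhat₄ \ setQhat) ∧
      -- (i)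
      SmoothOn R₁ Γhat₁ ∧
      SmoothOn R₂ (Γhat₄ \ {ω₃ ^ 2, -ω₃ ^ 2}) ∧
      -- (ii)
      (∃ C : ℝ, ∀ k ∈ circ, ‖R₁ k‖ ≤ C) ∧
      (∀ j ∈ Set.Icc 1 6, R₁ (κ j) ≠ 0) ∧
      HasSimplePole R₂ (κ 2) ∧ HasSimplePole R₂ (κ 5) ∧
      HasSimpleZero R₂ (κ 3) ∧ HasSimpleZero R₂ (κ 6) ∧
      R₁ 1 = 1 ∧ R₁ (-1) = 1 ∧ R₂ 1 = -1 ∧ R₂ (-1) = -1 ∧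
      -- (iii)
      RapidlyDecreasingOn R₁ Γ₁ ∧
      RapidlyDecreasingOn R₂ Γ₄ ∧
      -- (iv)
      (∀ k ∈ circ \ {-ω₃, ω₃}, CircleRelation R₁ R₂ k) ∧
      (∀ k ∈ circ \ {ω₃ ^ 2, -ω₃ ^ 2}, solvedDenom R₁ k ≠ 0 ∧ SolvedRelation R₁ R₂ k) ∧
      (∀ k ∈ circ \ setQ, solvedDenom R₂ k ≠ 0 ∧ SolvedRelation R₂ R₁ k) ∧
      (∀ ρ₁ ρ₂ : ℂ → ℂ, (∀ k ∈ circ \ setQ, solvedDenom ρ₁ k ≠ 0) →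
        ((∀ k ∈ circ \ setQ, CircleRelation ρ₁ ρ₂ k) ↔
          ∀ k ∈ circ \ setQ, SolvedRelation ρ₁ ρ₂ k)) ∧
      (∀ ρ₁ ρ₂ : ℂ → ℂ, (∀ k ∈ circ \ setQ, solvedDenom ρ₂ k ≠ 0) →
        ((∀ k ∈ circ \ setQ, CircleRelation ρ₁ ρ₂ k) ↔
          ∀ k ∈ circ \ setQ, SolvedRelation ρ₂ ρ₁ k)) ∧
      -- (v)
      (∀ k ∈ Γhat₄ \ {0, ω₃ ^ 2, -ω₃ ^ 2},
        R₂ k = rTilde k * (starRingEnd ℂ) (R₁ ((starRingEnd ℂ) k)⁻¹)) := by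
  have h : Generic u₀ v₀ := ⟨hsol, hgen₁, hgen₂⟩
  refine ⟨fun k hk => wellDefined₁ hsol hk, fun k hk => wellDefined₂ hsol hk, extR₁ u₀ v₀,
    extR₂ u₀ v₀, fun k hk => extR₁_eq hk, fun k hk => extR₂_eq hk, smoothOn_extR₁ h,
    smoothOn_extR₂ h, extR₁_bounded h, fun j hj => extR₁_ne h (kappa_mem hj), ?_, ?_, ?_, ?_,
    extR₁_pm_one h (Or.inl rfl), extR₁_pm_one h (Or.inr rfl), extR₂_pm_one h (Or.inl rfl),
    extR₂_pm_one h (Or.inr rfl), rapidlyDecreasingOn_extR₁ h, rapidlyDecreasingOn_extR₂ h,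
    fun k hk => circleRelation_ext h hk.1 hk.2,
    fun k hk => ⟨solvedDenom_extR₁ h hk.1 hk.2, solvedRelation_ext h hk.1 hk.2⟩,
    fun k hk => ⟨solvedDenom_extR₂ h hk, solvedRelation_ext' h hk⟩,
    fun _ _ hd => circleRelation_iff_solved hd, fun _ _ hd => circleRelation_iff_solved' hd,
    -- The extension of r_2 is defined by formula (v).
    fun k _ => rfl⟩
  · rw [kappa_two]; exact hasSimplePole_extR₂ h (Or.inr rfl)
  · rw [kappa_five]; exact hasSimplePole_extR₂ h (Or.inl rfl)
  · rw [kappa_three]; exact hasSimpleZero_extR₂ h (Or.inl rfl)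
  · rw [kappa_six]; exact hasSimpleZero_extR₂ h (Or.inr rfl)
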